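/- **Setting.** Let $V$ be a finite-dimensional $\mathbb{Q}$-vector space with a finite increasing filtration $W_\bullet$, non-degenerate $(-1)^k$-symmetric bilinear forms $Q_k$ on $\mathrm{Gr}^W_kV$, and a partition $\{h^{p,q}\}$ of $\dim V$. Let $\mathcal{M}$ be the classifying space of the $\mathbb{Q}$-mixed Hodge structures $(V,W_\bullet,F^\bullet)$ with Hodge numbers $h^{p,q}$ that are graded-polarized by the $Q_k$. For $x\in\mathcal{M}$ let $h_x\colon\mathbb{S}_{\mathbb{C}}\to \mathrm{GL}(V_{\mathbb{C}})$ be the homomorphism given by Deligne's bigrading $V_{\mathbb{C}}=\bigoplus I^{p,q}$ (where $(z,w)\in \mathbb{S}(\mathbb{C})=\mathbb{C}^*\times\mathbb{C}^*$ acts on $I^{p,q}$ as $z^{-p}w^{-q}$), and let $\mathrm{MT}(x)$ be the smallest $\mathbb{Q}$-algebraic subgroup of $\mathrm{GL}(V)$ whose complexification contains $h_x(\mathbb{S}_{\mathbb{C}})$. Let $\mathcal{D}\subseteq\mathcal{M}$ be a Mumford–Tate domain: $\mathcal{D}=P(\mathbb{R})^+W_{-1}(\mathbb{C})x_0$ with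 $x_0\in\mathcal{D}$, $P=\mathrm{MT}(x_0)$, $W_{-1}$ the unipotent radical of $P$, and $P(\mathbb{R})^+$ the identity component of $P(\mathbb{R})$. For $k\ge1$ let $W_{-k}\subseteq P$ be the connected normal unipotent subgroup with Lie algebra $W_{-k}(\mathrm{Lie}\,P)=\{X\in\mathrm{Lie}\,P: X(W_nV)\subseteq W_{n-k}V\ \forall n\}$, and let $m\ge 0$ be such that $W_{-(m+1)}=1$. The quotient $W_{-k}/W_{-(k+1)}$ is a vector group; it is identified with its Lie algebra. Let $\mathcal{X}$ be the $P(\mathbb{R})^+W_{-1}(\mathbb{C})$-conjugacy class of $h_{x_0}$, let $\varphi\colon\mathcal{X}\to\mathcal{D}$ send $h$ to the Hodge filtration it defines, and let $\mathcal{D}_{\mathbb{R}}=\varphi(\mathcal{X}_{\mathbb{R}})$, where $\mathcal{X}_{\mathbb{R}}$ is the set of $h\in\mathcal{X}$ defined over $\mathbb{R}$; this is the set of points of $\mathcal D$ whose mixed Hodge structure is split over $\mathbb{R}$. For $0\le k\le m$ let $p_k\colon\mathcal{D}\to\mathcal{D}_k=\mathcal{D}/W_{-(k+1)}$ be the quotient,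 whose fibres are the orbits of $W_{-(k+1)}(\mathbb{C})$, and let $\mathcal{D}_{k,\mathbb{R}}\subseteq \mathcal{D}_k$ be the set of the points $p_k(\varphi(h))$, $h\in\mathcal{X}$, such that $h$ modulo $W_{-(k+1)}$ is defined over $\mathbb{R}$. The sets $\mathcal{D}_{\mathbb{R}}$, $\mathcal{D}_{k,\mathbb{R}}$ and $\mathcal{D}_0$ carry the real algebraic structure of homogeneous spaces under $P(\mathbb{R})^+$. **Proposition.** There is a Levi decomposition $P=W_{-1}\rtimes G$ over $\mathbb{Q}$. Fix one. There are $G$-equivariant $\mathbb{Q}$-linear sections $s_k\colon W_{-k}/W_{-(k+1)}\to W_{-k}(\mathrm{Lie}\,P)$ of the projections ($k\ge1$). Fix such sections. Then each $g\in P(\mathbb{R})^+$ can be written uniquely as $$g=\exp\Bigl(\sum_{k=1}^m s_k(w_k)\Bigr)g_0,\qquad g_0\in G(\mathbb{R}),\ w_k\in(W_{-k}/W_{-(k+1)})(\mathbb{R});$$ write $g=(g_0,w_1,\dots,w_m)$. For $k\ge1$ there are polynomial maps over $\mathbb{Q}$, $$\mathrm{calb}_k\colon \prod_{j<k}(W_{-j}/W_{-(j+1)})\times\prod_{j<k}(W_{-j}/W_{-(j+1)})\to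 W_{-k}/W_{-(k+1)},$$ of degree at most $k-1$ in each of the two arguments and without constant term (so $\mathrm{calb}_1=0$), such that, with $\mathbf{w}_k=(w_1,\dots,w_k)$, the group law of $W_{-1}(\mathbb{R})$ is given by $$(w_k)_{k}\cdot(w'_k)_{k}=\bigl(w_k+w'_k+\mathrm{calb}_k(\mathbf{w}_{k-1},\mathbf{w}'_{k-1})\bigr)_{1\le k\le m},$$ and there is a real algebraic isomorphism $$\mathcal{D}_{\mathbb{R}}\;\cong\;\mathcal{D}_0\times(W_{-1}/W_{-2})(\mathbb{R})\times\cdots\times(W_{-(m-1)}/W_{-m})(\mathbb{R})\times W_{-m}(\mathbb{R})\qquad(*)$$ with the following properties. (i) For $g=(g_0,w_1,\dots,w_m)\in P(\mathbb{R})^+$ and $x=(x_0,x_1,\dots,x_m)\in\mathcal{D}_{\mathbb{R}}$, $$gx=\bigl(g_0x_0,\;w_1+g_0x_1,\;w_2+g_0x_2+\mathrm{calb}_2(w_1,g_0x_1),\;\dots,\;w_m+g_0x_m+\mathrm{calb}_m(\mathbf{w}_{m-1},g_0\mathbf{x}_{m-1})\bigr).$$ (ii) For each $k\in\{0,\dots,m-1\}$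 we have $p_k(\mathcal{D}_{\mathbb{R}})\subseteq\mathcal{D}_{k,\mathbb{R}}$, and there is a real algebraic isomorphism $$\mathcal{D}_{k,\mathbb{R}}\cong\mathcal{D}_0\times\prod_{i=1}^k(W_{-i}/W_{-(i+1)})(\mathbb{R})$$ under which $P(\mathbb{R})^+$ acts by the first $k+1$ entries of the formula in (i), and under which and $(*)$ the map $p_k\colon\mathcal{D}_{\mathbb{R}}\to\mathcal{D}_{k,\mathbb{R}}$ is the projection omitting the last $m-k$ factors. Moreover $\mathcal{D}_{0,\mathbb{R}}=\mathcal{D}_0$, and for $k=0$ the isomorphism is the identity. -/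

import Mathlib

noncomputable section

namespace MixedHodge

variable {V : Type*} [AddCommGroup V] [Module ℚ V]

/-! ### Complexification, complex conjugation, filtrations -/

/-- The complexification `V_ℂ = ℂ ⊗ V` of a rational vector space. -/
def Cx (V : Type*) [AddCommGroup V] [Module ℚ V] : Type _ :=
  @TensorProduct ℚ _ ℂ V _ _ Algebra.toModule _

instance : AddCommGroup (Cx V) :=
  @TensorProduct.addCommGroup ℚ _ ℂ V _ _ Algebra.toModule _

instance : Module ℂ (Cx V) :=
  @TensorProduct.leftModule ℚ ℂ _ _ ℂ V _ _ _ Algebra.toModule _ _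

instance : Module ℚ (Cx V) :=
  @TensorProduct.instModule ℚ _ ℂ V _ _ Algebra.toModule _

/-- The element `1 ⊗ v` of `V_ℂ`. -/
def toCx (v : V) : Cx V := @TensorProduct.mk ℚ _ ℂ V _ _ Algebra.toModule _ 1 v

/-- The complexification of a rational linear map. -/
def cxMap {V' : Type*} [AddCommGroup V'] [Module ℚ V'] (f : V →ₗ[ℚ] V') : Cx V →ₗ[ℂ] Cx V' :=
  f.baseChange ℂ

/-- The complexification of a rational subspace. -/
def cxSub (U : Submodule ℚ V) : Submodule ℂ (Cx V) := U.baseChange ℂ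

/-- The complexification of a rational bilinear form. -/
def cxForm (B : LinearMap.BilinForm ℚ V) : LinearMap.BilinForm ℂ (Cx V) := B.baseChange ℂ

/-- The complexification of a rational linear functional. -/
def cxDual (l : Module.Dual ℚ V) : Cx V →ₗ[ℂ] ℂ := Module.Dual.baseChange ℂ l

/-- Complex endomorphisms of the complexification. -/
abbrev EndC (V : Type*) [AddCommGroup V] [Module ℚ V] : Type _ := Module.End ℂ (Cx V)

/-- The group of complex points of `GL(V)`. -/
abbrev GLC (V : Type*) [AddCommGroup V] [Module ℚ V] : Type _ := (EndC V)ˣ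

/-- Families of complex subspaces of `V_ℂ` indexed by `ℤ` (the type in which Hodge filtrations
live). -/
abbrev Filt (V : Type*) [AddCommGroup V] [Module ℚ V] : Type _ := ℤ → Submodule ℂ (Cx V)

/-- Complex conjugation `a ⊗ v ↦ conj a ⊗ v` on `V_ℂ`. -/
def conjV (V : Type*) [AddCommGroup V] [Module ℚ V] : Cx V →ₛₗ[starRingEnd ℂ] Cx V where
  toFun := TensorProduct.map (starRingEnd ℂ).toRatAlgHom.toLinearMap LinearMap.id
  map_add' := map_add _
  map_smul' := by
    intro c x
    refine TensorProduct.induction_on x ?_ ?_ ?_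
    · exact (congrArg _ (smul_zero c)).trans ((map_zero _).trans (smul_zero _).symm)
    · intro a v
      change TensorProduct.map (starRingEnd ℂ).toRatAlgHom.toLinearMap LinearMap.id
        (TensorProduct.tmul ℚ (c * a) v) =
          TensorProduct.tmul ℚ ((starRingEnd ℂ) c * (starRingEnd ℂ) a) v
      rw [TensorProduct.map_tmul]
      simp
    · intro x y hx hy
      exact (congrArg _ (smul_add c x y)).trans ((map_add _ _ _).trans
        ((congrArg₂ _ hx hy).trans ((smul_add _ _ _).symm.trans
          (congrArg _ (map_add _ _ _).symm))))

/-- The complex conjugate of a complex subspace of `V_ℂ` (conjugation is an involution, so that the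
preimage is the image). -/
def conjSub (U : Submodule ℂ (Cx V)) : Submodule ℂ (Cx V) := U.comap (conjV V)

/-- The action of `GL(V_ℂ)` on filtrations. -/
def moveF (g : GLC V) (F : Filt V) : Filt V := fun p => (F p).map (g : EndC V)

/-! ### Classifying spaces of graded-polarized mixed Hodge structures -/

/-- The graded piece `W_k / W_{k-1}`. -/
abbrev Gr (W : ℤ → Submodule ℚ V) (k : ℤ) : Type _ := ↥(W k) ⧸ (W (k - 1)).submoduleOf (W k)

/-- The data defining a classifying space: a finite increasing filtration of `V`, non-degenerate
`(-1)^k`-symmetric forms on the graded pieces, a partition `h^{p,q}` of the dimension. -/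
structure HodgeData (V : Type*) [AddCommGroup V] [Module ℚ V] where
  W : ℤ → Submodule ℚ V
  mono : Monotone W
  exists_bot : ∃ a, W a = ⊥
  exists_top : ∃ b, W b = ⊤
  Q : ∀ k : ℤ, LinearMap.BilinForm ℚ (Gr W k)
  nondegenerate : ∀ k, (Q k).Nondegenerate
  symm : ∀ (k : ℤ) (x y : Gr W k), Q k x y = (-1 : ℚ) ^ k * Q k y x
  h : ℤ × ℤ →₀ ℕ
  h_sum : (h.sum fun _ n => n) = Module.finrank ℚ V

/-- The filtration induced by `F` on `(W_k / W_{k-1})_ℂ`. -/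
def grF (W : ℤ → Submodule ℚ V) (F : Filt V) (k : ℤ) : Filt (Gr W k) := fun p =>
  ((F p).comap (cxMap (W k).subtype)).map
    (cxMap ((W (k - 1)).submoduleOf (W k)).mkQ)

/-- `(V, W, F)` is a mixed Hodge structure. -/
structure IsMHS (W : ℤ → Submodule ℚ V) (F : Filt V) : Prop where
  anti : Antitone F
  exists_top : ∃ a, F a = ⊤
  exists_bot : ∃ b, F b = ⊥
  pure : ∀ k p : ℤ, IsCompl (grF W F k p) (conjSub (grF W F k (k + 1 - p)))

/-- The classifying space `ℳ`: mixed Hodge structures with weight filtration `W`, Hodge numbers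
`h^{p,q}` and graded-polarized by the forms `Q_k`.  In `polarized`, the vector `u` runs over the
`(p, k-p)`-part of the pure Hodge structure `Gr_k`, on which the Weil operator is `i^{p-(k-p)}`. -/
structure IsClassified (S : HodgeData V) (F : Filt V) : Prop where
  mhs : IsMHS S.W F
  hodgeNumbers : ∀ p q : ℤ, Module.finrank ℂ (grF S.W F (p + q) p) =
    S.h (p, q) + Module.finrank ℂ (grF S.W F (p + q) (p + 1))
  riemann : ∀ k p : ℤ, ∀ u ∈ grF S.W F k p, ∀ v ∈ grF S.W F k (k - p + 1),
    cxForm (S.Q k) u v = 0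
  polarized : ∀ k p : ℤ, ∀ u ∈ grF S.W F k p ⊓ conjSub (grF S.W F k (k - p)), u ≠ 0 →
    ∃ r : ℝ, 0 < r ∧
      Complex.I ^ (p - (k - p)) * cxForm (S.Q k) u (conjV _ u) = (r : ℂ)

/-- The classifying space as a set of filtrations. -/
def classifyingSpace (S : HodgeData V) : Set (Filt V) := {F | IsClassified S F}

/-! ### Homomorphisms from the Deligne torus

A homomorphism `𝕊_ℂ → GL(V_ℂ)` is given on points by `h : ℂˣ × ℂˣ →* GL(V_ℂ)`; it is algebraic
exactly if `V_ℂ` is the direct sum of the spaces on which `(z, w)` acts as `z^{-p} w^{-q}`. -/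

/-- The space on which `h (z, w)` is `z^{-p} w^{-q}` for all `z, w`. -/
def wtSpace (h : ℂˣ × ℂˣ →* GLC V) (p q : ℤ) : Submodule ℂ (Cx V) :=
  ⨅ zw : ℂˣ × ℂˣ, Module.End.eigenspace (h zw : EndC V)
    (((zw.1 ^ (-p) * zw.2 ^ (-q) : ℂˣ)) : ℂ)

/-- The Hodge filtration defined by `h`; this is the classifying map `φ`. -/
def hodgeFil (h : ℂˣ × ℂˣ →* GLC V) : Filt V := fun p =>
  ⨆ (r : ℤ) (q : ℤ) (_ : p ≤ r), wtSpace h r q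

/-- `h` is the homomorphism given by Deligne's bigrading `I^{p,q}` of the mixed Hodge structure
`(V, W, F)`. -/
structure IsDeligneHom (W : ℤ → Submodule ℚ V) (F : Filt V) (h : ℂˣ × ℂˣ →* GLC V) : Prop where
  internal : DirectSum.IsInternal fun pq : ℤ × ℤ => wtSpace h pq.1 pq.2
  weight : ∀ k : ℤ, cxSub (W k) = ⨆ (p : ℤ) (q : ℤ) (_ : p + q ≤ k), wtSpace h p q
  hodge : ∀ p : ℤ, F p = hodgeFil h p
  conj : ∀ p q : ℤ,
    wtSpace h p q ⊔ (⨆ (r : ℤ) (s : ℤ) (_ : r < p ∧ s < q), wtSpace h r s) =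
      conjSub (wtSpace h q p) ⊔ (⨆ (r : ℤ) (s : ℤ) (_ : r < p ∧ s < q), wtSpace h r s)

/-- Conjugation of a homomorphism by an element of `GL(V_ℂ)`. -/
def conjHom (g : GLC V) (h : ℂˣ × ℂˣ →* GLC V) : ℂˣ × ℂˣ →* GLC V :=
  (MulAut.conj g).toMonoidHom.comp h

/-! ### Algebraic groups over `ℚ`

A linear algebraic group over `ℚ` inside `GL(V)` is given by its group of complex points, a subgroup
of `GL(V_ℂ)` cut out by polynomials with rational coefficients in the matrix coefficients
`g ↦ ℓ (g v)`, `v ∈ V`, `ℓ ∈ V^∨`. -/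

/-- The matrix coefficient `ℓ_ℂ (T (1 ⊗ v))`. -/
def coef (T : EndC V) (vl : V × Module.Dual ℚ V) : ℂ :=
  cxDual vl.2 (T (toCx vl.1))

/-- `H` is (the group of complex points of) a `ℚ`-algebraic subgroup of `GL(V)`. -/
def IsQAlgebraic (H : Subgroup (GLC V)) : Prop :=
  ∃ E : Set (MvPolynomial (V × Module.Dual ℚ V) ℚ),
    ∀ g : GLC V, g ∈ H ↔ ∀ f ∈ E, MvPolynomial.aeval (coef (g : EndC V)) f = 0

/-- The Mumford–Tate group: the smallest `ℚ`-algebraic subgroup of `GL(V)` whose complexification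
contains the image of the homomorphism of the mixed Hodge structure `(V, W, F)`. -/
def mumfordTate (W : ℤ → Submodule ℚ V) (F : Filt V) : Subgroup (GLC V) :=
  sInf {H | IsQAlgebraic H ∧ ∀ h, IsDeligneHom W F h → h.range ≤ H}

/-- The real points: the elements that commute with complex conjugation. -/
def realPts (H : Subgroup (GLC V)) : Subgroup (GLC V) where
  carrier := {g | g ∈ H ∧ ∀ v, (g : EndC V) (conjV V v) = conjV V ((g : EndC V) v)}
  one_mem' := ⟨H.one_mem, fun _ => rfl⟩
  mul_mem' := by
    rintro a b ⟨ha, ha'⟩ ⟨hb, hb'⟩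
    refine ⟨H.mul_mem ha hb, fun v => ?_⟩
    simp [hb', ha']
  inv_mem' := by
    rintro a ⟨ha, ha'⟩
    refine ⟨H.inv_mem ha, fun v => ?_⟩
    have key : ∀ x, ((a⁻¹ : GLC V) : EndC V) ((a : EndC V) x) = x := fun x => by
      rw [← Module.End.mul_apply, ← Units.val_mul, inv_mul_cancel]; rfl
    have key' : ∀ x, (a : EndC V) (((a⁻¹ : GLC V) : EndC V) x) = x := fun x => by
      rw [← Module.End.mul_apply, ← Units.val_mul, mul_inv_cancel]; rfl
    conv_lhs => rw [← key' v]
    rw [← ha', key]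

/-- The usual topology of `GL(V_ℂ)`, induced by the matrix coefficients. -/
abbrev glTopology (V : Type*) [AddCommGroup V] [Module ℚ V] : TopologicalSpace (GLC V) :=
  TopologicalSpace.induced (fun g => coef (g : EndC V)) inferInstance

/-- `H(ℝ)⁺`, the identity component of the real Lie group `H(ℝ)`. -/
def realPlus (H : Subgroup (GLC V)) : Set (GLC V) :=
  @connectedComponentIn _ (glTopology V) (realPts H : Set (GLC V)) 1

/-- The unipotent radical: the largest normal unipotent subgroup (in characteristic zero a
unipotent algebraic group is automatically connected). -/
def unipotentRadical (H : Subgroup (GLC V)) : Subgroup (GLC V) :=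
  sSup {N | N ≤ H ∧ (∀ g ∈ H, ∀ n ∈ N, g * n * g⁻¹ ∈ N) ∧
    ∀ n ∈ N, IsNilpotent ((n : EndC V) - 1)}

/-- The set `H(ℝ)⁺ · R_u(H)(ℂ)`. -/
def orbitGroup (H : Subgroup (GLC V)) : Set (GLC V) :=
  {g | ∃ a ∈ realPlus H, ∃ u ∈ unipotentRadical H, g = a * u}

/-- `D` is the Mumford–Tate domain in the classifying space of `S` that is the orbit of `x₀ ∈ D`
under `P(ℝ)⁺ R_u(P)(ℂ)`, where `P` is the Mumford–Tate group of `x₀`. -/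
structure IsMumfordTateDomain (S : HodgeData V) (D : Set (Filt V)) (x₀ : Filt V) : Prop where
  mem : x₀ ∈ D
  subset : D ⊆ classifyingSpace S
  orbit : D = {x | ∃ g ∈ orbitGroup (mumfordTate S.W x₀), x = moveF g x₀}

/-! ### Lie algebra and weight filtration -/

/-- The derivative of a polynomial in the matrix coefficients at the identity in direction `X`. -/
def derivAtOne (X : Module.End ℚ V) (f : MvPolynomial (V × Module.Dual ℚ V) ℚ) : ℚ :=
  MvPolynomial.eval (fun vl : V × Module.Dual ℚ V => vl.2 vl.1)
    (MvPolynomial.mkDerivation ℚ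
      (fun vl : V × Module.Dual ℚ V => MvPolynomial.C (vl.2 (X vl.1))) f)

theorem derivAtOne_add (X Y : Module.End ℚ V) (f : MvPolynomial (V × Module.Dual ℚ V) ℚ) :
    derivAtOne (X + Y) f = derivAtOne X f + derivAtOne Y f := by
  have key : MvPolynomial.mkDerivation ℚ (fun vl : V × Module.Dual ℚ V =>
      (MvPolynomial.C (vl.2 ((X + Y) vl.1)) : MvPolynomial (V × Module.Dual ℚ V) ℚ)) =
      MvPolynomial.mkDerivation ℚ (fun vl => MvPolynomial.C (vl.2 (X vl.1))) +
      MvPolynomial.mkDerivation ℚ (fun vl => MvPolynomial.C (vl.2 (Y vl.1))) := by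
    apply MvPolynomial.derivation_ext
    intro vl
    simp [MvPolynomial.mkDerivation_X]
  unfold derivAtOne
  rw [key]
  simp

theorem derivAtOne_smul (c : ℚ) (X : Module.End ℚ V)
    (f : MvPolynomial (V × Module.Dual ℚ V) ℚ) :
    derivAtOne (c • X) f = c * derivAtOne X f := by
  have key : MvPolynomial.mkDerivation ℚ (fun vl : V × Module.Dual ℚ V =>
      (MvPolynomial.C (vl.2 ((c • X) vl.1)) : MvPolynomial (V × Module.Dual ℚ V) ℚ)) =
      c • MvPolynomial.mkDerivation ℚ (fun vl => MvPolynomial.C (vl.2 (X vl.1))) := by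
    apply MvPolynomial.derivation_ext
    intro vl
    simp [MvPolynomial.mkDerivation_X, MvPolynomial.smul_eq_C_mul]
  unfold derivAtOne
  rw [key]
  simp [MvPolynomial.smul_eq_C_mul]

/-- The Lie algebra of a `ℚ`-algebraic group, as its Zariski tangent space at the identity:
the `X` such that the derivative at `1` in direction `X` of every polynomial over `ℚ` that vanishes
on the group is zero. -/
def lieAlg (H : Subgroup (GLC V)) : Submodule ℚ (Module.End ℚ V) where
  carrier := {X | ∀ f : MvPolynomial (V × Module.Dual ℚ V) ℚ,
    (∀ g ∈ H, MvPolynomial.aeval (coef (g : EndC V)) f = 0) → derivAtOne X f = 0}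
  zero_mem' := by
    intro f _
    have h := derivAtOne_smul 0 (0 : Module.End ℚ V) f
    simpa using h
  add_mem' := by
    intro X Y hX hY f hf
    rw [derivAtOne_add, hX f hf, hY f hf, add_zero]
  smul_mem' := by
    intro c X hX f hf
    rw [derivAtOne_smul, hX f hf, mul_zero]

/-- `W_{-k}(Lie P)`, for the weight filtration on `Lie P ⊆ End(V)` deduced from the weight
filtration of `V`. -/
def lieW (S : HodgeData V) (P : Subgroup (GLC V)) (k : ℕ) : Submodule ℚ (Module.End ℚ V) :=
  lieAlg P ⊓
    { carrier := {X | ∀ n : ℤ, ∀ v ∈ S.W n, X v ∈ S.W (n - k)}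
      zero_mem' := fun _ _ _ => Submodule.zero_mem _
      add_mem' := fun hX hY n v hv => Submodule.add_mem _ (hX n v hv) (hY n v hv)
      smul_mem' := fun c _ hX n v hv => Submodule.smul_mem _ c (hX n v hv) }

/-- `W_{-k}(Lie P)_ℝ` inside `End(V_ℂ)`. -/
def lieWR (S : HodgeData V) (P : Subgroup (GLC V)) (k : ℕ) : Submodule ℝ (EndC V) :=
  Submodule.span ℝ ((fun X : Module.End ℚ V => (cxMap X : EndC V)) '' (lieW S P k : Set _))

/-- `W_{-k}(Lie P)_ℂ` inside `End(V_ℂ)`. -/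
def lieWC (S : HodgeData V) (P : Subgroup (GLC V)) (k : ℕ) : Submodule ℂ (EndC V) :=
  Submodule.span ℂ ((fun X : Module.End ℚ V => (cxMap X : EndC V)) '' (lieW S P k : Set _))

/-- For `k ≥ 1`, the complex points of `W_{-k} ⊆ P`, the connected (unipotent) subgroup with Lie
algebra `W_{-k}(Lie P)`. -/
def wGroup (S : HodgeData V) (P : Subgroup (GLC V)) (k : ℕ) : Subgroup (GLC V) :=
  Subgroup.closure {g | ∃ X ∈ lieWC S P k, (g : EndC V) = IsNilpotent.exp X}

/-- The vector group `(W_{-k} / W_{-(k+1)})(ℝ)`, identified with its Lie algebra. -/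
abbrev GrR (S : HodgeData V) (P : Subgroup (GLC V)) (k : ℕ) : Type _ :=
  ↥(lieWR S P k) ⧸ (lieWR S P (k + 1)).submoduleOf (lieWR S P k)

/-- The class of a rational element `X ∈ W_{-k}(Lie P)` in `(W_{-k} / W_{-(k+1)})(ℝ)`. -/
def ratClass (S : HodgeData V) (P : Subgroup (GLC V)) (k : ℕ) (X : lieW S P k) : GrR S P k :=
  Submodule.Quotient.mk
    ⟨(cxMap (X : Module.End ℚ V) : EndC V), Submodule.subset_span ⟨X, X.2, rfl⟩⟩

/-- Conjugation by `g` on `End(V_ℂ)`, as a real linear map. -/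
def adR (g : GLC V) : EndC V →ₗ[ℝ] EndC V where
  toFun X := (g : EndC V) * X * ((g⁻¹ : GLC V) : EndC V)
  map_add' X Y := by rw [mul_add, add_mul]
  map_smul' c X := by rw [mul_smul_comm, smul_mul_assoc]; rfl

open Classical in
/-- The action of `g` on `(W_{-k} / W_{-(k+1)})(ℝ)` induced by conjugation; the condition holds for
all `g ∈ P(ℝ)`, and the value `0` is used only when it fails. -/
def adGr (S : HodgeData V) (P : Subgroup (GLC V)) (g : GLC V) (k : ℕ) :
    GrR S P k →ₗ[ℝ] GrR S P k :=
  if h : (∀ X ∈ lieWR S P k, adR g X ∈ lieWR S P k) ∧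
      (∀ X ∈ lieWR S P (k + 1), adR g X ∈ lieWR S P (k + 1)) then
    Submodule.mapQ _ _ ((adR g).restrict h.1) (fun X hX => h.2 X hX)
  else 0

/-! ### The choices: Levi decomposition and splitting of the weight filtration -/

/-- `L` is a Levi subgroup of `P` over `ℚ`: `P = R_u(P) ⋊ L`. -/
structure IsLevi (P L : Subgroup (GLC V)) : Prop where
  algebraic : IsQAlgebraic L
  le : L ≤ P
  disjoint : unipotentRadical P ⊓ L = ⊥
  sup : unipotentRadical P ⊔ L = P

/-- A family of sections of the projections
`W_{-k}(Lie P)_ℝ → (W_{-k} / W_{-(k+1)})(ℝ)`, `k = j + 1 ≥ 1`. -/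
abbrev Sections (S : HodgeData V) (P : Subgroup (GLC V)) : Type _ :=
  ∀ j : ℕ, GrR S P (j + 1) →ₗ[ℝ] lieWR S P (j + 1)

/-- The sections `s` are defined over `ℚ` and `L`-equivariant, and thus give an `L`-equivariant
isomorphism over `ℚ` of `Lie W_{-1}` with the direct sum of the `W_{-k} / W_{-(k+1)}`. -/
structure IsSplitting (S : HodgeData V) (P L : Subgroup (GLC V)) (s : Sections S P) : Prop where
  isSection : ∀ j x, Submodule.Quotient.mk (s j x) = x
  rational : ∀ (j : ℕ) (X : lieW S P (j + 1)), ∃ Y : lieW S P (j + 1),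
    (s j (ratClass S P (j + 1) X) : EndC V) = cxMap (Y : Module.End ℚ V)
  equivariant : ∀ g ∈ realPts L, ∀ (j : ℕ) (x : GrR S P (j + 1)),
    (s j (adGr S P g (j + 1) x) : EndC V) = adR g (s j x)

/-- The element `exp (∑ s_k (w_k))` of `W_{-1}(ℝ)` with coordinates `(w_1, …, w_m)`. -/
def expSum {S : HodgeData V} {P : Subgroup (GLC V)} (s : Sections S P) {m : ℕ}
    (w : ∀ i : Fin m, GrR S P (i + 1)) : EndC V :=
  IsNilpotent.exp (∑ i : Fin m, (s i (w i) : EndC V))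

/-- The truncation `(w_1, …, w_k)` of `(w_1, …, w_m)`. -/
def trunc {S : HodgeData V} {P : Subgroup (GLC V)} {m k : ℕ} (hk : k ≤ m)
    (w : ∀ i : Fin m, GrR S P (i + 1)) : ∀ i : Fin k, GrR S P (i + 1) :=
  fun i => w ⟨i, i.2.trans_le hk⟩

/-! ### Polynomial maps over `ℚ` -/

/-- A real linear functional on `(W_{-k} / W_{-(k+1)})(ℝ)` that is defined over `ℚ`. -/
def IsRatFunctional (S : HodgeData V) (P : Subgroup (GLC V)) (k : ℕ)
    (l : GrR S P k →ₗ[ℝ] ℝ) : Prop :=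
  ∀ X : lieW S P k, ∃ q : ℚ, l (ratClass S P k X) = q

/-- Functions of `(w, w')` that are polynomials over `ℚ` of degree at most `1` in `w` alone. -/
def linLeft (S : HodgeData V) (P : Subgroup (GLC V)) (n : ℕ) :
    Submodule ℚ
      ((∀ j : Fin n, GrR S P (j + 1)) × (∀ j : Fin n, GrR S P (j + 1)) → ℝ) :=
  Submodule.span ℚ ({1} ∪ {f | ∃ (j : Fin n) (l : GrR S P (j + 1) →ₗ[ℝ] ℝ),
    IsRatFunctional S P (j + 1) l ∧ f = fun w => l (w.1 j)})

/-- Functions of `(w, w')` that are polynomials over `ℚ` of degree at most `1` in `w'` alone. -/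
def linRight (S : HodgeData V) (P : Subgroup (GLC V)) (n : ℕ) :
    Submodule ℚ
      ((∀ j : Fin n, GrR S P (j + 1)) × (∀ j : Fin n, GrR S P (j + 1)) → ℝ) :=
  Submodule.span ℚ ({1} ∪ {f | ∃ (j : Fin n) (l : GrR S P (j + 1) →ₗ[ℝ] ℝ),
    IsRatFunctional S P (j + 1) l ∧ f = fun w => l (w.2 j)})

/-- Families of maps `calb_k (𝐰_{k-1}, 𝐰'_{k-1})`, indexed by `n = k - 1 ≥ 0`. -/
abbrev Calb (S : HodgeData V) (P : Subgroup (GLC V)) : Type _ :=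
  ∀ n : ℕ, (∀ j : Fin n, GrR S P (j + 1)) → (∀ j : Fin n, GrR S P (j + 1)) → GrR S P (n + 1)

/-- The `calb_k` are polynomial maps over `ℚ`, of degree at most `k - 1` in each of the two
arguments, without constant term, and they describe the group law of `W_{-1}(ℝ)` in the
coordinates `(w_1, …, w_m)`.  (In particular `calb_1 = 0`.) -/
structure IsCalb (S : HodgeData V) (P : Subgroup (GLC V)) (s : Sections S P) (m : ℕ)
    (calb : Calb S P) : Prop where
  polynomial : ∀ (n : ℕ) (l : GrR S P (n + 1) →ₗ[ℝ] ℝ), IsRatFunctional S P (n + 1) l →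
    (fun w => l (calb n w.1 w.2)) ∈ linLeft S P n ^ n * linRight S P n ^ n
  zero : ∀ n, calb n 0 0 = 0
  groupLaw : ∀ w w' : ∀ i : Fin m, GrR S P (i + 1),
    expSum s w * expSum s w' =
      expSum s (fun i => w i + w' i + calb i (trunc i.2.le w) (trunc i.2.le w'))

/-! ### The domains `D_ℝ`, `D_k`, `D_{k,ℝ}` -/

/-- The conjugacy class `𝒳` of homomorphisms attached to the Mumford–Tate domain through `x₀`. -/
def homClass (S : HodgeData V) (x₀ : Filt V) : Set (ℂˣ × ℂˣ →* GLC V) :=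
  {h | ∃ g ∈ orbitGroup (mumfordTate S.W x₀), ∃ h₀, IsDeligneHom S.W x₀ h₀ ∧ h = conjHom g h₀}

/-- `h` is defined over `ℝ` modulo the subgroup `N`.  The real structure of `𝕊` acts on
`𝕊(ℂ) = ℂˣ × ℂˣ` by `(z, w) ↦ (conj w, conj z)`. -/
def IsRealMod (N : Subgroup (GLC V)) (h : ℂˣ × ℂˣ →* GLC V) : Prop :=
  ∀ z w : ℂˣ, ∃ n ∈ N, ∀ v : Cx V,
    conjV V ((h (z, w) : EndC V) (conjV V v)) = (h (star w, star z) * n : GLC V).1 v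

/-- `D_ℝ = φ(𝒳_ℝ)`: the points of `D` whose mixed Hodge structure is split over `ℝ`. -/
def splitPts (S : HodgeData V) (x₀ : Filt V) : Set (Filt V) :=
  {x | ∃ h ∈ homClass S x₀, IsRealMod ⊥ h ∧ x = hodgeFil h}

/-- The quotient map `p_k : D → D_k = D / W_{-(k+1)}`; a point of `D_k` is an orbit of
`W_{-(k+1)}(ℂ)` in `D`. -/
def proj (S : HodgeData V) (P : Subgroup (GLC V)) (k : ℕ) (x : Filt V) : Set (Filt V) :=
  {y | ∃ u ∈ wGroup S P (k + 1), y = moveF u x}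

/-- `D_k = D / W_{-(k+1)}`. -/
def quotDomain (S : HodgeData V) (P : Subgroup (GLC V)) (D : Set (Filt V)) (k : ℕ) :
    Set (Set (Filt V)) :=
  proj S P k '' D

/-- `D_{k,ℝ}`: the image of the homomorphisms `𝕊_ℂ → (P / W_{-(k+1)})_ℂ` in
`𝒳_k = 𝒳 / W_{-(k+1)}` that are defined over `ℝ`. -/
def quotSplitPts (S : HodgeData V) (x₀ : Filt V) (k : ℕ) : Set (Set (Filt V)) :=
  {y | ∃ h ∈ homClass S x₀, IsRealMod (wGroup S (mumfordTate S.W x₀) (k + 1)) h ∧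
    y = proj S (mumfordTate S.W x₀) k (hodgeFil h)}

/-! ### Real algebraic structure -/

/-- The regular functions on the real algebraic group `GL(V_ℝ)`: polynomials in the matrix
coefficients of `g` and `g⁻¹` (which are real for real `g`). -/
def regGL (V : Type*) [AddCommGroup V] [Module ℚ V] : Subalgebra ℝ (GLC V → ℝ) :=
  Algebra.adjoin ℝ
    (Set.range (fun (vl : V × Module.Dual ℚ V) (g : GLC V) => (coef (g : EndC V) vl).re) ∪
     Set.range (fun (vl : V × Module.Dual ℚ V) (g : GLC V) =>
      (coef ((g⁻¹ : GLC V) : EndC V) vl).re))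

/-- The real algebraic functions on a homogeneous space `Y` of `P(ℝ)⁺`: the functions whose
pullbacks under the orbit maps `P(ℝ)⁺ → Y` are restrictions of regular functions. -/
def regOn {α : Type*} (P : Subgroup (GLC V)) (act : GLC V → α → α) (Y : Set α) : Set (Y → ℝ) :=
  {f | ∀ y : Y, ∃ F ∈ regGL V, ∀ g ∈ realPlus P, ∀ hg : act g y ∈ Y, f ⟨act g y, hg⟩ = F g}

/-- The real algebraic functions on `Y × E` for a finite product `E` of real vector spaces:
generated by those on `Y` and by the linear functionals on the factors of `E`. -/
def regProd {α : Type*} (P : Subgroup (GLC V)) (act : GLC V → α → α) (Y : Set α) {k : ℕ}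
    (E : Fin k → Type*) [∀ i, AddCommGroup (E i)] [∀ i, Module ℝ (E i)] :
    Subalgebra ℝ (Y × (∀ i, E i) → ℝ) :=
  Algebra.adjoin ℝ
    ({f | ∃ a ∈ regOn P act Y, f = fun y => a y.1} ∪
     {f | ∃ (i : Fin k) (l : E i →ₗ[ℝ] ℝ), f = fun y => l (y.2 i)})

/-- The action of `GL(V_ℂ)` on sets of filtrations, and thereby on the quotients `D_k`. -/
def moveSet (g : GLC V) (A : Set (Filt V)) : Set (Filt V) := moveF g '' A

/-- `Φ : Y ≃ D_0 × ∏_{1 ≤ i ≤ k} (W_{-i} / W_{-(i+1)})(ℝ)` is an isomorphism of real algebraic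
spaces, and `P(ℝ)⁺` acts on `Y` by the formula
`g x = (g_0 x_0, …, w_i + g_0 x_i + calb_i (𝐰_{i-1}, g_0 𝐱_{i-1}), …)`
for `g = exp (∑ s_i (w_i)) · g_0` with `g_0 ∈ L(ℝ)`. -/
structure IsProductStructure {α : Type*} (S : HodgeData V) (P L : Subgroup (GLC V))
    (D : Set (Filt V)) {m : ℕ} (s : Sections S P) (calb : Calb S P)
    (act : GLC V → α → α) (Y : Set α) {k : ℕ} (hk : k ≤ m)
    (Φ : Y ≃ quotDomain S P D 0 × (∀ i : Fin k, GrR S P (i + 1))) : Prop where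
  algebraic : ∀ f : quotDomain S P D 0 × (∀ i : Fin k, GrR S P (i + 1)) → ℝ,
    f ∈ regProd P moveSet (quotDomain S P D 0) (fun i : Fin k => GrR S P (i + 1)) ↔
      (fun y => f (Φ y)) ∈ regOn P act Y
  action : ∀ g ∈ realPlus P, ∀ g₀ ∈ realPts L, ∀ w : ∀ i : Fin m, GrR S P (i + 1),
    (g : EndC V) = expSum s w * (g₀ : EndC V) → ∀ y : Y, ∃ hy : act g y ∈ Y,
      ((Φ ⟨act g y, hy⟩).1 : Set (Filt V)) = moveSet g₀ (Φ y).1 ∧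
      ∀ i : Fin k, (Φ ⟨act g y, hy⟩).2 i =
        trunc hk w i + adGr S P g₀ (i + 1) ((Φ y).2 i) +
          calb i (trunc i.2.le (trunc hk w))
            (fun j : Fin i => adGr S P g₀ (j + 1) (trunc i.2.le (Φ y).2 j))

end MixedHodge

end

/-! The proof rests on one element. Every mixed Hodge structure has Deligne's bigrading
(`HodgeRelations.exists_isDeligneHom`), so the Mumford–Tate group `P` contains the value of a
Deligne homomorphism at (1/2, 1/2), which acts on Gr^W_k as the scalar 2^k. Conjugation by such a
weight element acts on W_{-k} End / W_{-(k+1)} End as 2^{-k}, and 1 - 2^{-k} is invertible for k ≥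
1. Successive approximation along the weight filtration therefore shows that any two weight elements
of `P` are conjugate under the elements congruent to 1 modulo W_{-1} End
(`IsWeightGroup.exists_conj`). Combined with descent for the automorphisms of ℂ, it also shows that
`P` contains a rational weight element `a` (`IsWeightGroup.exists_rational_weightOp`). The
centralizer of `a` in `P` is a Levi subgroup, and every Levi subgroup over ℚ arises in this way
(`IsLevi.exists_isLeviWeight`).

That the elements acting trivially on Gr^W form the whole unipotent radical comes from the
polarizations. For a normal unipotent subgroup, the fixed part of Gr_k is `P`-stable. Were it
proper, the conjugate of its orthogonal would be stable and nonzero, so Kolchin's theorem would give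
a fixed vector in it, contradicting positivity (`IsClassified.sub_mem_of_normal_unipotent`).

The projectors to the eigenspaces of Ad `a` are rational polynomials in Ad `a` (`degPart`). They
give a multiplicative grading of the endomorphisms that preserve `W`, compatible with field
automorphisms and with conjugation by the Levi subgroup. An equivariant section has to take values
in the matching eigenspace (`section_eigen`), so all choices are expressed by `a`. The map calb_k is
the degree -k part of log(exp A exp B), where A and B have components in degrees -1, …, -(k-1). Only
mixed terms contribute to it. In a mixed term each side takes up at least one unit of degree, which
leaves at most k-1 for the other; this is the degree bound.

For the domain, an element u₀ of W_{-1}(ℂ) moves the weight element of the base point to `a`. The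
new bigrading is then split over ℝ (`exists_isSplitHom`); let F₀ be its Hodge filtration. Averaging
logarithms with their conjugates shows that the points of D_ℝ and D_{k,ℝ} come from the P(ℝ)⁺-orbit
of F₀ (`mem_splitPts`, `mem_quotSplitPts`). A real unipotent element that fixes F₀ modulo W_{-(k+1)}
has components of degree -1, …, -k that are real and preserve F₀. They send a vector of type (p, q)
into F^p ∩ conj F^q in weight below p + q, which is zero (`IsSplitHom.sub_one_mem`). Hence the class
in D_0 together with the first k logarithmic coordinates is a bijective chart (`exists_isChart`),
and the action formula is the group law applied to u g₀ · v r = u (g₀ v g₀⁻¹) · g₀ r.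

Algebraicity in one direction is checked on generators, since Levi part and logarithm are regular on
P(ℝ)⁺. In the other direction the function has the form F(exp(Σ s(w)) l); as `l` varies these
functions of `w` stay in a finite-dimensional space of polynomials, and interpolation at finitely
many `w` separates the variables (`IsChart.mem_regProd`). -/

/-! ### Automorphisms of ℂ and Galois descent to ℚ. -/

section ComplexAutomorphisms

open Cardinal

/-- Two embeddings of a countable domain into `ℂ` differ by an automorphism of `ℂ`. -/
theorem exists_ringEquiv_extending {R : Type} [CommRing R] [IsDomain R] [Countable R]
    (K L : Type) [Field K] [Field L] [IsAlgClosed K] [IsAlgClosed L]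
    [Algebra R K] [Algebra R L] [FaithfulSMul R K] [FaithfulSMul R L]
    (hK : ℵ₀ < #K) (hKL : #K = #L) :
    ∃ σ : K ≃+* L, ∀ r : R, σ (algebraMap R K r) = algebraMap R L r := by
  obtain ⟨s, hs⟩ := exists_isTranscendenceBasis R K
  obtain ⟨t, ht⟩ := exists_isTranscendenceBasis R L
  have hR : #R ≤ ℵ₀ := mk_le_aleph0
  have h1 := IsAlgClosed.cardinal_eq_cardinal_transcendence_basis_of_aleph0_lt' _ hs hR hK
  have h2 := IsAlgClosed.cardinal_eq_cardinal_transcendence_basis_of_aleph0_lt' _ ht hR (hKL ▸ hK)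
  obtain ⟨e⟩ := Cardinal.eq.1 (h1.symm.trans (hKL.trans h2))
  let := IsAlgClosed.isAlgClosure_of_transcendence_basis _ hs
  let := IsAlgClosed.isAlgClosure_of_transcendence_basis _ ht
  let e1 := (hs.1.aevalEquiv.symm.trans (MvPolynomial.renameEquiv R e)).trans ht.1.aevalEquiv
  refine ⟨IsAlgClosure.equivOfEquiv K L e1.toRingEquiv, fun r => ?_⟩
  have := IsAlgClosure.equivOfEquiv_algebraMap K L e1.toRingEquiv (algebraMap R _ r)
  rw [← IsScalarTower.algebraMap_apply] at this
  rw [this]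
  have h3 : e1.toRingEquiv (algebraMap R _ r) = algebraMap R _ r := e1.commutes r
  rw [h3, ← IsScalarTower.algebraMap_apply]

theorem exists_ringEquiv_complex_extending {R : Type} [CommRing R] [IsDomain R] [Countable R]
    (i j : R →+* ℂ) (hi : Function.Injective i) (hj : Function.Injective j) :
    ∃ σ : ℂ ≃+* ℂ, ∀ r : R, σ (i r) = j r := by
  have hc : ℵ₀ < #ℂ := by rw [mk_complex]; exact aleph0_lt_continuum
  exact @exists_ringEquiv_extending R _ _ _ ℂ ℂ _ _ _ _ i.toAlgebra j.toAlgebra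
    (by
      let := i.toAlgebra
      exact (faithfulSMul_iff_algebraMap_injective R ℂ).2 hi)
    (by
      let := j.toAlgebra
      exact (faithfulSMul_iff_algebraMap_injective R ℂ).2 hj) hc rfl

/-- The rational numbers are the fixed field of the automorphisms of `ℂ`. -/
theorem exists_rat_of_forall_ringEquiv_fixed (x : ℂ) (hx : ∀ σ : ℂ ≃+* ℂ, σ x = x) :
    ∃ q : ℚ, x = q := by
  by_contra hq
  -- A transcendental `x` can be moved to `-x`, which would force `x = 0`; an algebraic irrational
  -- `x` can be moved to another root of its minimal polynomial.
  by_cases hx' : Transcendental ℚ x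
  · have h1 : Function.Injective (Polynomial.aeval (R := ℚ) x) := transcendental_iff_injective.1 hx'
    have h2 : Function.Injective (Polynomial.aeval (R := ℚ) (-x)) := by
      refine transcendental_iff_injective.1 fun h => hx' ?_
      simpa using h.neg
    have : Countable (Polynomial ℚ) := by
      have : #(Polynomial ℚ) ≤ ℵ₀ := by
        refine Polynomial.cardinalMk_le_max.trans ?_
        simp
      exact Cardinal.mk_le_aleph0_iff.1 this
    obtain ⟨σ, hσ⟩ := exists_ringEquiv_complex_extending (R := Polynomial ℚ)
      (Polynomial.aeval (R := ℚ) x).toRingHom (Polynomial.aeval (R := ℚ) (-x)).toRingHom h1 h2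
    have h3 := hσ Polynomial.X
    simp [hx] at h3
    have h0 : x = 0 := by linear_combination h3 / 2
    exact hq ⟨0, by simp [h0]⟩
  · have hint : IsIntegral ℚ x := (not_not.1 hx' : IsAlgebraic ℚ x).isIntegral
    have hdeg : (minpoly ℚ x).natDegree ≠ 1 := by
      intro h
      have := minpoly.natDegree_eq_one_iff.1 h
      obtain ⟨q, rfl⟩ := this
      exact hq ⟨q, by simp⟩
    have hcard : ((minpoly ℚ x).rootSet ℂ).ncard = (minpoly ℚ x).natDegree := by
      rw [← Nat.card_coe_set_eq, Nat.card_eq_fintype_card]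
      exact Polynomial.card_rootSet_eq_natDegree (minpoly.irreducible hint).separable
        (IsAlgClosed.splits _)
    have hex : ∃ y ∈ (minpoly ℚ x).rootSet ℂ, y ≠ x := by
      by_contra hcon
      push Not at hcon
      have hsub : (minpoly ℚ x).rootSet ℂ ⊆ {x} := fun y hy => hcon y hy
      have := Set.ncard_le_ncard hsub
      rw [hcard, Set.ncard_singleton] at this
      have hpos := minpoly.natDegree_pos hint
      omega
    obtain ⟨y, hy, hyx⟩ := hex
    have : Countable (AdjoinRoot (minpoly ℚ x)) := by
      have hsurj := AdjoinRoot.mk_surjective (g := minpoly ℚ x)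
      have : Countable (Polynomial ℚ) := by
        have : #(Polynomial ℚ) ≤ ℵ₀ := by
          refine Polynomial.cardinalMk_le_max.trans ?_
          simp
        exact Cardinal.mk_le_aleph0_iff.1 this
      exact hsurj.countable
    have : Fact (Irreducible (minpoly ℚ x)) := ⟨minpoly.irreducible hint⟩
    have hx0 : Polynomial.eval₂ (algebraMap ℚ ℂ) x (minpoly ℚ x) = 0 := minpoly.aeval ℚ x
    have hy0 : Polynomial.eval₂ (algebraMap ℚ ℂ) y (minpoly ℚ x) = 0 :=
      (Polynomial.mem_rootSet.1 hy).2
    obtain ⟨σ, hσ⟩ := exists_ringEquiv_complex_extending (R := AdjoinRoot (minpoly ℚ x))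
      (AdjoinRoot.lift (algebraMap ℚ ℂ) x hx0)
      (AdjoinRoot.lift (algebraMap ℚ ℂ) y hy0) (RingHom.injective _) (RingHom.injective _)
    have h3 := hσ (AdjoinRoot.root _)
    rw [AdjoinRoot.lift_root, AdjoinRoot.lift_root, hx] at h3
    exact hyx h3.symm

/-- Galois descent: a subspace of a complex vector space with a basis that is stable under the
automorphisms of `ℂ` acting on the coordinates is spanned by its vectors with rational
coordinates. -/
theorem span_rational_of_stable {ι M : Type*} [AddCommGroup M] [Module ℂ M]
    (b : Module.Basis ι ℂ M) (N : Submodule ℂ M)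
    (hN : ∀ x ∈ N, ∀ σ : ℂ ≃+* ℂ, ∀ y, (∀ i, b.repr y i = σ (b.repr x i)) → y ∈ N) :
    N ≤ Submodule.span ℂ {x | x ∈ N ∧ ∀ i, ∃ q : ℚ, b.repr x i = q} := by
  set R := Submodule.span ℂ {x | x ∈ N ∧ ∀ i, ∃ q : ℚ, b.repr x i = q} with hR
  suffices h : ∀ n : ℕ, ∀ x ∈ N, (b.repr x).support.card ≤ n → x ∈ R from
    fun x hx => h _ x hx le_rfl
  intro n
  induction n using Nat.strong_induction_on with
  | _ n ih =>
  intro x hx hxn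
  by_cases hx0 : x = 0
  · rw [hx0]; exact R.zero_mem
  -- a nonzero element of minimal support inside the support of `x`
  have hne : ∃ k, ∃ g ∈ N, g ≠ 0 ∧ (b.repr g).support ⊆ (b.repr x).support ∧
      (b.repr g).support.card = k := ⟨_, x, hx, hx0, subset_rfl, rfl⟩
  classical
  obtain ⟨g, hg, hg0, hgs, hgk⟩ := Nat.find_spec hne
  have hmin := fun k hk => Nat.find_min hne (m := k) hk
  rw [← hgk] at hmin
  have hrepr0 : b.repr g ≠ 0 := by simpa using hg0
  obtain ⟨i₀, hi₀⟩ := Finsupp.support_nonempty_iff.2 hrepr0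
  have hgi : b.repr g i₀ ≠ 0 := by simpa using hi₀
  set g' := (b.repr g i₀)⁻¹ • g with hg'
  have hg'N : g' ∈ N := N.smul_mem _ hg
  have hg'i : b.repr g' i₀ = 1 := by simp [hg', hgi]
  have hg's : (b.repr g').support = (b.repr g).support := by
    ext i; simp [hg', hgi]
  -- With one coordinate normalised to 1, the difference of `g'` and its transform by `σ` has
  -- strictly smaller support, hence vanishes by minimality; so every coordinate of `g'` is fixed by
  -- every `σ`.
  have hrat : g' ∈ R := by
    refine Submodule.subset_span ⟨hg'N, fun i => ?_⟩
    apply exists_rat_of_forall_ringEquiv_fixed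
    intro σ
    set y := b.repr.symm (Finsupp.mapRange σ (map_zero σ) (b.repr g')) with hy
    have hyc : ∀ i, b.repr y i = σ (b.repr g' i) := fun i => by simp [hy]
    have hyN : y ∈ N := hN g' hg'N σ y hyc
    have hd : y - g' = 0 := by
      by_contra hd
      have hsub : (b.repr (y - g')).support ⊆ (b.repr g).support.erase i₀ := by
        intro i hi
        rw [Finset.mem_erase]
        refine ⟨?_, ?_⟩
        · rintro rfl
          rw [Finsupp.mem_support_iff] at hi
          apply hi
          rw [map_sub, Finsupp.sub_apply, hyc, hg'i]; simp
        · by_contra hi'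
          rw [← hg's, Finsupp.mem_support_iff, not_not] at hi'
          rw [Finsupp.mem_support_iff] at hi
          apply hi
          rw [map_sub, Finsupp.sub_apply, hyc, hi']; simp
      refine hmin _ ?_ ⟨y - g', N.sub_mem hyN hg'N, hd,
        (hsub.trans (Finset.erase_subset _ _)).trans hgs, rfl⟩
      exact (Finset.card_le_card hsub).trans_lt (Finset.card_erase_lt_of_mem hi₀)
    have := hyc i
    rw [sub_eq_zero.1 hd] at this
    exact this.symm
  -- Subtracting this multiple of `g'` removes `i₀` from the support and adds nothing to it, so the
  -- induction on the size of the support applies.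
  have hx' : x - (b.repr x i₀) • g' ∈ R := by
    have hsub : (b.repr (x - (b.repr x i₀) • g')).support ⊆ (b.repr x).support.erase i₀ := by
      intro i hi
      rw [Finset.mem_erase]
      rw [Finsupp.mem_support_iff] at hi
      refine ⟨?_, ?_⟩
      · rintro rfl
        apply hi
        simp [hg'i]
      · by_contra hi'
        have h1 : i ∉ (b.repr g').support := by rw [hg's]; exact fun h => hi' (hgs h)
        rw [Finsupp.mem_support_iff, not_not] at hi' h1
        apply hi
        simp [hi', h1]
    have hlt := (Finset.card_le_card hsub).trans_lt (Finset.card_erase_lt_of_mem (hgs hi₀))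
    exact ih _ (hlt.trans_le hxn) _ (N.sub_mem hx (N.smul_mem _ hg'N)) le_rfl
  have := R.add_mem hx' (R.smul_mem (b.repr x i₀) hrat)
  simpa using this

end ComplexAutomorphisms

/-! ### Burnside's and Kolchin's theorems. -/

section Kolchin

/-- A finite-dimensional complex representation without proper stable subspaces of a multiplicative
set of operators: the operators span all endomorphisms. -/
theorem span_eq_top_of_irreducible {M : Type*} [AddCommGroup M] [Module ℂ M]
    [FiniteDimensional ℂ M] [Nontrivial M] (N : Submonoid (Module.End ℂ M))
    (hirr : ∀ U : Submodule ℂ M, (∀ n ∈ N, ∀ u ∈ U, n u ∈ U) → U = ⊥ ∨ U = ⊤) :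
    Submodule.span ℂ (N : Set (Module.End ℂ M)) = ⊤ := by
  set A := Algebra.adjoin ℂ (N : Set (Module.End ℂ M)) with hA
  have hAs : Subalgebra.toSubmodule A = Submodule.span ℂ (N : Set (Module.End ℂ M)) := by
    rw [hA, Algebra.adjoin_eq_span, Submonoid.closure_eq]
  have hsimple : IsSimpleModule A M := by
    rw [isSimpleModule_iff]
    refine { exists_pair_ne := ⟨⊥, ⊤, bot_ne_top⟩, eq_bot_or_eq_top := fun U => ?_ }
    have h := hirr (U.restrictScalars ℂ) (fun n hn u hu =>
      U.smul_mem (⟨n, Algebra.subset_adjoin hn⟩ : A) hu)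
    refine h.imp (fun h => ?_) (fun h => ?_) <;>
    · ext x
      have := SetLike.ext_iff.1 h x
      simpa using this
  -- Schur's lemma over ℂ. Once the commutant is scalar, every ℂ-linear map is linear over it, and
  -- the density theorem realises that map on a basis by an element of the algebra.
  have hschur : ∀ φ : Module.End A M, ∃ c : ℂ, ∀ x, φ x = c • x := by
    intro φ
    let φ' : Module.End ℂ M := φ.restrictScalars ℂ
    obtain ⟨c, hc⟩ := Module.End.exists_eigenvalue φ'
    obtain ⟨v, hv⟩ := hc.exists_hasEigenvector
    let ψ : Module.End A M := φ - c • (1 : Module.End A M)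
    have hψv : ψ v = 0 := by
      have : φ v = c • v := hv.apply_eq_smul
      simp [ψ, this]
    refine ⟨c, fun x => ?_⟩
    rcases LinearMap.bijective_or_eq_zero ψ with h | h
    · exact absurd (h.1 (hψv.trans (map_zero ψ).symm)) hv.2
    · have := LinearMap.congr_fun h x
      simpa [ψ, sub_eq_zero] using this
  rw [eq_top_iff, ← hAs]
  intro g _
  let f : Module.End (Module.End A M) M :=
    { toFun := g
      map_add' := map_add g
      map_smul' := fun φ x => by
        obtain ⟨c, hc⟩ := hschur φ
        simp [Module.End.smul_def, hc] }
  let b := Module.finBasis ℂ M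
  classical
  obtain ⟨r, hr⟩ := jacobson_density f (Finset.univ.image b)
  have : g = r.1 := b.ext fun i => hr (b i) (Finset.mem_image_of_mem _ (Finset.mem_univ i))
  rw [this]
  exact r.2

/-- Kolchin's theorem: a monoid of unipotent operators has a common fixed vector. -/
theorem exists_common_fixed_vector (d : ℕ) : ∀ {M : Type*} [AddCommGroup M] [Module ℂ M]
    [FiniteDimensional ℂ M] [Nontrivial M] (_ : Module.finrank ℂ M = d)
    (N : Submonoid (Module.End ℂ M)) (_ : ∀ n ∈ N, IsNilpotent (n - 1)),
    ∃ v : M, v ≠ 0 ∧ ∀ n ∈ N, n v = v := by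
  induction d using Nat.strong_induction_on with
  | _ d ih =>
  intro M _ _ _ _ hd N hN
  by_cases hirr : ∀ U : Submodule ℂ M, (∀ n ∈ N, ∀ u ∈ U, n u ∈ U) → U = ⊥ ∨ U = ⊤
  · have hspan := span_eq_top_of_irreducible N hirr
    -- All elements of `N` have the trace of the identity, so tr((n - 1) x) = 0 for `x` in `N`, and
    -- then for all endomorphisms by Burnside. Rank-one endomorphisms afterwards detect `n - 1`.
    have htr : ∀ n ∈ N, ∀ a : Module.End ℂ M, LinearMap.trace ℂ M ((n - 1) * a) = 0 := by
      intro n hn a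
      have ha : a ∈ Submodule.span ℂ (N : Set (Module.End ℂ M)) := hspan ▸ Submodule.mem_top
      have key : ∀ n ∈ N, LinearMap.trace ℂ M n = LinearMap.trace ℂ M 1 := fun n hn => by
        have := (LinearMap.isNilpotent_trace_of_isNilpotent (hN n hn)).eq_zero
        rwa [map_sub, sub_eq_zero] at this
      refine Submodule.span_induction (p := fun a _ => LinearMap.trace ℂ M ((n - 1) * a) = 0)
        ?_ (by simp) ?_ ?_ ha
      · intro x hx
        rw [sub_mul, one_mul, map_sub, key _ (N.mul_mem hn hx), key _ hx, sub_self]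
      · intro x y _ _ hx hy; rw [mul_add, map_add, hx, hy, add_zero]
      · intro c x _ hx; rw [mul_smul_comm, map_smul, hx, smul_zero]
    obtain ⟨v, hv⟩ := exists_ne (0 : M)
    refine ⟨v, hv, fun n hn => ?_⟩
    by_contra hne
    have hne' : (n - 1) v ≠ 0 := by simpa [sub_eq_zero] using hne
    obtain ⟨f, hf⟩ := Module.Projective.exists_dual_ne_zero ℂ hne'
    have h1 := htr n hn (f.smulRight v)
    have h2 : (n - 1) * f.smulRight v = f.smulRight ((n - 1) v) := by
      ext x; simp
    rw [h2, LinearMap.trace_smulRight] at h1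
    exact hf h1
  · push Not at hirr
    obtain ⟨U, hU, hU0, hU1⟩ := hirr
    have : Nontrivial U := (Submodule.nontrivial_iff_ne_bot).2 hU0
    have hlt : Module.finrank ℂ U < d := hd ▸ Submodule.finrank_lt hU1
    let NU : Submonoid (Module.End ℂ U) :=
      { carrier := {T | ∃ n ∈ N, ∀ u : U, (T u : M) = n u}
        one_mem' := ⟨1, N.one_mem, fun _ => rfl⟩
        mul_mem' := by
          rintro S T ⟨n, hn, hS⟩ ⟨n', hn', hT⟩
          exact ⟨n * n', N.mul_mem hn hn', fun u => by simp [hS, hT]⟩ }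
    obtain ⟨v, hv, hfix⟩ := ih _ hlt (M := U) rfl NU (by
      rintro T ⟨n, hn, hT⟩
      obtain ⟨k, hk⟩ := hN n hn
      refine ⟨k, LinearMap.ext fun u => Subtype.ext ?_⟩
      have : ∀ j : ℕ, ∀ u : U, (((T - 1) ^ j) u : M) = ((n - 1) ^ j) u := by
        intro j
        induction j with
        | zero => intro u; simp
        | succ j ihj => intro u; rw [pow_succ, pow_succ, Module.End.mul_apply, ihj]; simp [hT]
      rw [this, hk]; simp)
    refine ⟨v, by simpa using hv, fun n hn => ?_⟩
    have := hfix ((n.restrict (p := U) (q := U) (hU n hn))) ⟨n, hn, fun u => rfl⟩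
    exact congrArg Subtype.val this

/-- Kolchin's theorem in a subquotient. -/
theorem exists_fixed_modulo {M : Type*} [AddCommGroup M] [Module ℂ M]
    [FiniteDimensional ℂ M] (N : Submonoid (Module.End ℂ M)) (hN : ∀ n ∈ N, IsNilpotent (n - 1))
    (A B : Submodule ℂ M) (hA : ∀ n ∈ N, ∀ u ∈ A, n u ∈ A) (hB : ∀ n ∈ N, ∀ u ∈ B, n u ∈ B)
    (hAB : ¬ B ≤ A) : ∃ v ∈ B, v ∉ A ∧ ∀ n ∈ N, n v - v ∈ A := by
  have hsub : Nontrivial (B ⧸ A.submoduleOf B) := by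
    rw [Submodule.Quotient.nontrivial_iff]
    rwa [Ne, Submodule.submoduleOf_eq_top]
  let NQ : Submonoid (Module.End ℂ (B ⧸ A.submoduleOf B)) :=
    { carrier := {T | ∃ n, ∃ hn : n ∈ N, ∀ u : B, T (Submodule.Quotient.mk u) =
        Submodule.Quotient.mk ⟨n u, hB n hn u u.2⟩}
      one_mem' := ⟨1, N.one_mem, fun _ => rfl⟩
      mul_mem' := by
        rintro S T ⟨n, hn, hS⟩ ⟨n', hn', hT⟩
        exact ⟨n * n', N.mul_mem hn hn', fun u => by rw [Module.End.mul_apply, hT, hS]; rfl⟩ }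
  obtain ⟨v, hv, hfix⟩ := exists_common_fixed_vector _ rfl NQ (by
    rintro T ⟨n, hn, hT⟩
    obtain ⟨k, hk⟩ := hN n hn
    refine ⟨k, LinearMap.ext fun u => ?_⟩
    have : ∀ j : ℕ, ∀ u : B, ∃ h : ((n - 1) ^ j) u ∈ B, ((T - 1) ^ j) (Submodule.Quotient.mk u) =
        Submodule.Quotient.mk ⟨((n - 1) ^ j) u, h⟩ := by
      intro j
      induction j with
      | zero => intro u; exact ⟨u.2, rfl⟩
      | succ j ihj =>
        intro u
        have hu : (n - 1) (u : M) ∈ B := B.sub_mem (hB n hn u u.2) u.2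
        obtain ⟨h, hj⟩ := ihj ⟨(n - 1) u, hu⟩
        refine ⟨by rw [pow_succ]; exact h, ?_⟩
        have h1 : (T - 1) (Submodule.Quotient.mk u) = Submodule.Quotient.mk ⟨(n - 1) u, hu⟩ := by
          rw [LinearMap.sub_apply, hT]; rfl
        rw [pow_succ, Module.End.mul_apply, h1, hj]
        congr 1
    obtain ⟨u, rfl⟩ := Submodule.Quotient.mk_surjective _ u
    obtain ⟨h, hj⟩ := this k u
    rw [hj, LinearMap.zero_apply, Submodule.Quotient.mk_eq_zero]
    change ((n - 1) ^ k) (u : M) ∈ A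
    rw [hk]; exact A.zero_mem)
  obtain ⟨u, rfl⟩ := Submodule.Quotient.mk_surjective _ v
  refine ⟨u, u.2, fun h => hv ((Submodule.Quotient.mk_eq_zero _).2 h), fun n hn => ?_⟩
  have h1 : ∀ x ∈ A.submoduleOf B, (n.restrict (hB n hn)) x ∈ A.submoduleOf B :=
    fun x hx => hA n hn x hx
  have h2 := hfix (Submodule.mapQ _ _ (n.restrict (hB n hn)) h1) ⟨n, hn, fun u => rfl⟩
  rw [Submodule.mapQ_apply] at h2
  exact (Submodule.Quotient.eq (A.submoduleOf B)).1 h2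

end Kolchin

/-! ### Exponential and logarithm of nilpotent and unipotent elements. -/

section ExpLog

open Polynomial Finset

theorem X_pow_dvd_of_coeff_eq {p : ℚ[X]} {N : ℕ} (h : ∀ n < N, p.coeff n = 0) : X ^ N ∣ p :=
  Polynomial.X_pow_dvd_iff.2 h

/-- The truncated exponential series without constant term. -/
noncomputable def expTrunc (N : ℕ) : ℚ[X] :=
  ∑ i ∈ range N, C (if i = 0 then 0 else (i.factorial : ℚ)⁻¹) * X ^ i

/-- The truncated series of `log (1 + X)`. -/
noncomputable def logTrunc (N : ℕ) : ℚ[X] :=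
  ∑ i ∈ range N, C ((-1 : ℚ) ^ (i + 1) / i) * X ^ i

theorem coeff_expTrunc (N n : ℕ) : (expTrunc N).coeff n =
    if n < N then (if n = 0 then 0 else (n.factorial : ℚ)⁻¹) else 0 := by
  simp [expTrunc, coeff_X_pow]

theorem coeff_logTrunc (N n : ℕ) : (logTrunc N).coeff n =
    if n < N then (-1 : ℚ) ^ (n + 1) / n else 0 := by
  simp only [logTrunc, finsetSum_coeff, coeff_C_mul, coeff_X_pow, mul_ite, mul_one, mul_zero,
    Finset.sum_ite_eq, Finset.mem_range]

theorem X_dvd_expTrunc (N : ℕ) : X ∣ expTrunc N := by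
  rw [X_dvd_iff, coeff_expTrunc]; simp

theorem X_dvd_logTrunc (N : ℕ) : X ∣ logTrunc N := by
  rw [X_dvd_iff, coeff_logTrunc]; simp

theorem X_pow_dvd_derivative_expTrunc (N : ℕ) :
    X ^ N ∣ derivative (expTrunc (N + 1)) - (1 + expTrunc (N + 1)) := by
  refine X_pow_dvd_of_coeff_eq fun n hn => ?_
  simp only [coeff_sub, coeff_derivative, coeff_add, coeff_expTrunc, coeff_one]
  rcases eq_or_ne n 0 with rfl | h0
  · simp [hn]
  · rw [if_pos (by omega), if_neg (by omega), if_neg h0, if_pos (by omega), if_neg h0,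
      Nat.factorial_succ]
    have : (n.factorial : ℚ) ≠ 0 := by positivity
    push_cast; field_simp; ring

theorem X_pow_dvd_derivative_logTrunc (N : ℕ) :
    X ^ N ∣ (1 + X) * derivative (logTrunc (N + 1)) - 1 := by
  refine X_pow_dvd_of_coeff_eq fun n hn => ?_
  have hc : ∀ n, n < N → (derivative (logTrunc (N + 1))).coeff n = (-1 : ℚ) ^ n := by
    intro n hn
    rw [coeff_derivative, coeff_logTrunc, if_pos (by omega)]
    have : ((n : ℚ) + 1) ≠ 0 := by positivity
    push_cast; field_simp; ring
  rw [add_mul, one_mul, coeff_sub, coeff_add]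
  cases n with
  | zero => simp [hc 0 hn]
  | succ n =>
    rw [coeff_X_mul, hc _ hn, hc n (by omega), coeff_one, if_neg (by omega)]
    ring

theorem X_pow_dvd_comp {N : ℕ} {p q : ℚ[X]} (hp : X ^ N ∣ p) (hq : X ∣ q) : X ^ N ∣ p.comp q := by
  obtain ⟨r, rfl⟩ := hp
  rw [mul_comp, pow_comp, X_comp]
  exact Dvd.dvd.mul_right (pow_dvd_pow_of_dvd hq N) _

/-- Differentiation turns the congruence into (1 + e) p' ≡ 0 modulo X^N. Since 1 + e is prime to X,
the derivative p' itself is divisible by X^N, and p has no constant term. -/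
theorem X_pow_dvd_comp_log_exp (N : ℕ) :
    X ^ (N + 1) ∣ (logTrunc (N + 1)).comp (expTrunc (N + 1)) - X := by
  set e := expTrunc (N + 1) with he
  set f := logTrunc (N + 1) with hf
  set p := f.comp e - X with hp
  have he0 : X ∣ e := X_dvd_expTrunc _
  have h1 : X ^ N ∣ (1 + e) * derivative p := by
    obtain ⟨r, hr⟩ := X_pow_dvd_derivative_expTrunc N
    have h2 := X_pow_dvd_comp (X_pow_dvd_derivative_logTrunc N) he0
    rw [← hf] at h2
    rw [← he] at hr
    simp only [sub_comp, mul_comp, add_comp, one_comp, X_comp] at h2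
    have : (1 + e) * derivative p =
        ((1 + e) * (derivative f).comp e - 1) * derivative e + X ^ N * r := by
      rw [← hr, hp, derivative_sub, derivative_comp, derivative_X]; ring
    rw [this]
    exact dvd_add (Dvd.dvd.mul_right h2 _) (Dvd.intro _ rfl)
  have hcop : IsCoprime (X ^ N : ℚ[X]) (1 + e) := by
    obtain ⟨r, hr⟩ := he0
    refine IsCoprime.pow_left ⟨-r, 1, ?_⟩
    rw [hr]; ring
  have h2 := hcop.dvd_of_dvd_mul_left h1
  rw [X_pow_dvd_iff] at h2
  refine X_pow_dvd_of_coeff_eq fun n hn => ?_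
  cases n with
  | zero =>
    have h3 : X ∣ p := dvd_sub (by
      have := X_pow_dvd_comp (N := 1) (p := f) (by simpa using X_dvd_logTrunc _) he0
      simpa using this) dvd_rfl
    exact X_dvd_iff.1 h3
  | succ n =>
    have := h2 n (by omega)
    rw [coeff_derivative] at this
    have hn0 : ((n : ℚ) + 1) ≠ 0 := by positivity
    exact (mul_eq_zero.1 this).resolve_right hn0

/-- Here differentiation gives the equation (1 + X) q' ≡ q modulo X^N. It is a recursion for the
coefficients, and with vanishing constant term its only solution below the truncation order is 0. -/
theorem X_pow_dvd_comp_exp_log (N : ℕ) :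
    X ^ (N + 1) ∣ (expTrunc (N + 1)).comp (logTrunc (N + 1)) - X := by
  set e := expTrunc (N + 1) with he
  set f := logTrunc (N + 1) with hf
  set q := e.comp f - X with hq
  have hf0 : X ∣ f := X_dvd_logTrunc _
  have h1 : X ^ N ∣ (1 + X) * derivative q - q := by
    obtain ⟨r, hr⟩ := X_pow_dvd_derivative_logTrunc N
    have h2 := X_pow_dvd_comp (X_pow_dvd_derivative_expTrunc N) hf0
    rw [← he] at h2
    rw [← hf] at hr
    simp only [sub_comp, add_comp, one_comp] at h2
    have : (1 + X) * derivative q - q =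
        ((derivative e).comp f - (1 + e.comp f)) + (derivative e).comp f * (X ^ N * r) := by
      rw [← hr, hq, derivative_sub, derivative_comp, derivative_X]; ring
    rw [this]
    exact dvd_add h2 (Dvd.dvd.mul_left (Dvd.intro _ rfl) _)
  rw [X_pow_dvd_iff] at h1
  have h0 : q.coeff 0 = 0 := by
    have h3 : X ∣ q := dvd_sub (by
      have := X_pow_dvd_comp (N := 1) (p := e) (by simpa using X_dvd_expTrunc _) hf0
      simpa using this) dvd_rfl
    exact X_dvd_iff.1 h3
  have hall : ∀ n, n < N + 1 → q.coeff n = 0 := by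
    intro n
    induction n with
    | zero => intro _; exact h0
    | succ n ih =>
      intro hn
      have h3 := h1 n (by omega)
      rw [add_mul, one_mul, coeff_sub, coeff_add, ih (by omega), coeff_derivative] at h3
      have h4 : (X * derivative q).coeff n = 0 := by
        cases n with
        | zero => simp
        | succ n => rw [coeff_X_mul, coeff_derivative, ih (by omega), zero_mul]
      rw [h4] at h3
      have hn0 : ((n : ℚ) + 1) ≠ 0 := by positivity
      have h5 : q.coeff (n + 1) * ((n : ℚ) + 1) = 0 := by linarith
      exact (mul_eq_zero.1 h5).resolve_right hn0
  exact X_pow_dvd_of_coeff_eq hall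

variable {A : Type*} [Ring A] [Algebra ℚ A]

/-- The logarithm of a unipotent element. -/
noncomputable def nilLog (u : A) : A :=
  ∑ i ∈ range (nilpotencyClass (u - 1)), ((-1 : ℚ) ^ (i + 1) / i) • (u - 1) ^ i

theorem nilLog_eq_sum {u : A} {N : ℕ} (h : (u - 1) ^ N = 0) :
    nilLog u = ∑ i ∈ range N, ((-1 : ℚ) ^ (i + 1) / i) • (u - 1) ^ i := by
  rw [nilLog]
  refine Finset.sum_subset (Finset.range_mono (csInf_le' h)) fun i _ hi => ?_
  rw [pow_eq_zero_of_le (by simpa using hi) (pow_nilpotencyClass ⟨N, h⟩), smul_zero]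

theorem nilLog_eq_aeval {u : A} {N : ℕ} (h : (u - 1) ^ N = 0) :
    nilLog u = aeval (u - 1) (logTrunc N) := by
  rw [nilLog_eq_sum h, logTrunc, map_sum]
  exact Finset.sum_congr rfl fun i _ => by simp [Algebra.smul_def]

theorem exp_eq_aeval {a : A} {N : ℕ} (h : a ^ (N + 1) = 0) :
    IsNilpotent.exp a = 1 + aeval a (expTrunc (N + 1)) := by
  rw [IsNilpotent.exp_eq_sum h, expTrunc, map_sum, Finset.sum_range_succ', Finset.sum_range_succ']
  simp [Algebra.smul_def, add_comm]

theorem aeval_eq_zero_of_X_pow_dvd {a : A} {N : ℕ} (h : a ^ N = 0) {p : ℚ[X]} (hp : X ^ N ∣ p) :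
    aeval a p = 0 := by
  obtain ⟨r, rfl⟩ := hp
  simp [h]

theorem aeval_pow_eq_zero {a : A} {N : ℕ} (h : a ^ N = 0) {p : ℚ[X]} (hp : X ∣ p) :
    (aeval a p) ^ N = 0 := by
  rw [← map_pow]
  exact aeval_eq_zero_of_X_pow_dvd h (pow_dvd_pow_of_dvd hp N)

/-- Both series are polynomials in the nilpotent element u - 1, so the identity follows from the
truncated polynomial congruence; the same holds for `nilLog_exp`. -/
theorem exp_nilLog {u : A} (h : IsNilpotent (u - 1)) : IsNilpotent.exp (nilLog u) = u := by
  obtain ⟨N, hN⟩ := h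
  have hN' : (u - 1) ^ (N + 1) = 0 := by rw [pow_succ, hN, zero_mul]
  rw [nilLog_eq_aeval hN', exp_eq_aeval (aeval_pow_eq_zero hN' (X_dvd_logTrunc _)), ← aeval_comp]
  have := aeval_eq_zero_of_X_pow_dvd hN' (X_pow_dvd_comp_exp_log N)
  rw [map_sub, aeval_X, sub_eq_zero] at this
  rw [this]; abel

theorem nilLog_exp {a : A} (h : IsNilpotent a) : nilLog (IsNilpotent.exp a) = a := by
  obtain ⟨N, hN⟩ := h
  have hN' : a ^ (N + 1) = 0 := by rw [pow_succ, hN, zero_mul]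
  have h1 : IsNilpotent.exp a - 1 = aeval a (expTrunc (N + 1)) := by
    rw [exp_eq_aeval hN']; abel
  have h2 : (IsNilpotent.exp a - 1) ^ (N + 1) = 0 := by
    rw [h1]; exact aeval_pow_eq_zero hN' (X_dvd_expTrunc _)
  rw [nilLog_eq_aeval h2, h1, ← aeval_comp]
  have := aeval_eq_zero_of_X_pow_dvd hN' (X_pow_dvd_comp_log_exp N)
  rwa [map_sub, aeval_X, sub_eq_zero] at this

theorem exp_nsmul {a : A} (h : IsNilpotent a) (n : ℕ) :
    IsNilpotent.exp (n • a) = IsNilpotent.exp a ^ n := by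
  induction n with
  | zero => simp [IsNilpotent.exp_zero]
  | succ n ih =>
    rw [succ_nsmul, IsNilpotent.exp_add_of_commute ((Commute.refl a).smul_left n)
      (h.smul n) h, ih, pow_succ]

end ExpLog

noncomputable section
namespace MixedHodge

/-! ### Complexification and its semilinear automorphisms. -/

section Complexification

variable {V V' : Type*} [AddCommGroup V] [Module ℚ V] [AddCommGroup V'] [Module ℚ V']

theorem toCx_add (v w : V) : toCx (v + w) = toCx v + toCx w :=
  TensorProduct.tmul_add _ _ _

theorem toCx_zero : toCx (0 : V) = 0 := TensorProduct.tmul_zero _ _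

theorem toCx_smul (q : ℚ) (v : V) : toCx (q • v) = (q : ℂ) • toCx v := by
  change TensorProduct.tmul ℚ (1 : ℂ) (q • v) = TensorProduct.tmul ℚ ((q : ℂ) * 1) v
  rw [TensorProduct.tmul_smul]
  change TensorProduct.tmul ℚ (q • (1 : ℂ)) v = _
  rw [Algebra.smul_def]; rfl

@[elab_as_elim]
theorem Cx.induction {p : Cx V → Prop} (zero : p 0) (smul : ∀ (a : ℂ) (v : V), p (a • toCx v))
    (add : ∀ x y, p x → p y → p (x + y)) (x : Cx V) : p x := by
  refine TensorProduct.induction_on x zero (fun a v => ?_) add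
  have := smul a v
  change p (TensorProduct.tmul ℚ (a * 1) v) at this
  rwa [mul_one] at this

@[simp] theorem cxMap_toCx (f : V →ₗ[ℚ] V') (v : V) : cxMap f (toCx v) = toCx (f v) := rfl

@[simp] theorem cxDual_toCx (l : Module.Dual ℚ V) (v : V) : cxDual l (toCx v) = (l v : ℂ) := by
  change Module.Dual.baseChange ℂ l (TensorProduct.tmul ℚ (1 : ℂ) v) = _
  rw [Module.Dual.baseChange_apply_tmul]
  simp

@[simp] theorem cxForm_toCx (B : LinearMap.BilinForm ℚ V) (v w : V) :
    cxForm B (toCx v) (toCx w) = (B v w : ℂ) := by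
  change LinearMap.BilinForm.baseChange ℂ B (TensorProduct.tmul ℚ (1 : ℂ) v)
    (TensorProduct.tmul ℚ (1 : ℂ) w) = _
  rw [LinearMap.BilinForm.baseChange_tmul]
  simp

theorem linearMap_ext {M : Type*} [AddCommGroup M] [Module ℂ M] {f g : Cx V →ₗ[ℂ] M}
    (h : ∀ v, f (toCx v) = g (toCx v)) : f = g := by
  ext x
  induction x using Cx.induction with
  | zero => simp
  | smul a v => simp [h]
  | add x y hx hy => simp [hx, hy]

/-- Complexification of rational endomorphisms as a homomorphism of rings. -/
def cxHom (V : Type*) [AddCommGroup V] [Module ℚ V] : Module.End ℚ V →+* EndC V where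
  toFun f := cxMap f
  map_one' := linearMap_ext fun v => rfl
  map_mul' f g := linearMap_ext fun v => rfl
  map_zero' := linearMap_ext fun v => by simp [toCx_zero]
  map_add' f g := linearMap_ext fun v => by simp [toCx_add]

theorem cxHom_apply (f : Module.End ℚ V) : cxHom V f = cxMap f := rfl

theorem cxMap_comp {V'' : Type*} [AddCommGroup V''] [Module ℚ V''] (f : V' →ₗ[ℚ] V'')
    (g : V →ₗ[ℚ] V') (x : Cx V) : cxMap (f ∘ₗ g) x = cxMap f (cxMap g x) := by
  have : cxMap (f ∘ₗ g) = (cxMap f) ∘ₗ (cxMap g) := linearMap_ext fun v => rfl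
  rw [this]; rfl

theorem cxHom_smul (q : ℚ) (f : Module.End ℚ V) : cxHom V (q • f) = (q : ℂ) • cxHom V f :=
  linearMap_ext fun v => by simp [cxHom_apply, toCx_smul]

/-! ### Automorphisms of the field of complex numbers -/

/-- The semilinear map `a ⊗ v ↦ σ a ⊗ v` of `V_ℂ`. -/
def galV (σ : ℂ →+* ℂ) : Cx V →ₛₗ[σ] Cx V where
  toFun := TensorProduct.map σ.toRatAlgHom.toLinearMap LinearMap.id
  map_add' := map_add _
  map_smul' := by
    intro c x
    refine TensorProduct.induction_on x ?_ ?_ ?_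
    · exact (congrArg _ (smul_zero c)).trans ((map_zero _).trans (smul_zero _).symm)
    · intro a v
      change TensorProduct.map σ.toRatAlgHom.toLinearMap LinearMap.id
        (TensorProduct.tmul ℚ (c * a) v) = TensorProduct.tmul ℚ (σ c * σ a) v
      rw [TensorProduct.map_tmul]
      simp
    · intro x y hx hy
      exact (congrArg _ (smul_add c x y)).trans ((map_add _ _ _).trans
        ((congrArg₂ _ hx hy).trans ((smul_add _ _ _).symm.trans
          (congrArg _ (map_add _ _ _).symm))))

@[simp] theorem galV_toCx (σ : ℂ →+* ℂ) (v : V) : galV σ (toCx v) = toCx v := by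
  change TensorProduct.map σ.toRatAlgHom.toLinearMap LinearMap.id
    (TensorProduct.tmul ℚ (1 : ℂ) v) = TensorProduct.tmul ℚ (1 : ℂ) v
  rw [TensorProduct.map_tmul]
  simp

@[simp] theorem conjV_toCx (v : V) : conjV V (toCx v) = toCx v := galV_toCx _ v

@[simp] theorem galV_galV_symm (σ : ℂ ≃+* ℂ) (x : Cx V) :
    galV (σ : ℂ →+* ℂ) (galV (σ.symm : ℂ →+* ℂ) x) = x := by
  induction x using Cx.induction with
  | zero => simp
  | smul a v => simp
  | add x y hx hy => simp [hx, hy]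

@[simp] theorem galV_symm_galV (σ : ℂ ≃+* ℂ) (x : Cx V) :
    galV (σ.symm : ℂ →+* ℂ) (galV (σ : ℂ →+* ℂ) x) = x := by
  induction x using Cx.induction with
  | zero => simp
  | smul a v => simp
  | add x y hx hy => simp [hx, hy]

@[simp] theorem conjV_conjV (x : Cx V) : conjV V (conjV V x) = x := by
  induction x using Cx.induction with
  | zero => simp
  | smul a v => simp
  | add x y hx hy => simp [hx, hy]

theorem galV_cxMap (σ : ℂ →+* ℂ) (f : V →ₗ[ℚ] V') (x : Cx V) :
    galV σ (cxMap f x) = cxMap f (galV σ x) := by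
  induction x using Cx.induction with
  | zero => simp
  | smul a v => simp
  | add x y hx hy => simp [hx, hy]

theorem conjV_cxMap (f : V →ₗ[ℚ] V') (x : Cx V) :
    conjV V' (cxMap f x) = cxMap f (conjV V x) := galV_cxMap _ f x

theorem cxDual_galV (σ : ℂ →+* ℂ) (l : Module.Dual ℚ V) (x : Cx V) :
    cxDual l (galV σ x) = σ (cxDual l x) := by
  induction x using Cx.induction with
  | zero => simp
  | smul a v => simp
  | add x y hx hy => simp [hx, hy]

theorem cxForm_conjV (B : LinearMap.BilinForm ℚ V) (x y : Cx V) :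
    cxForm B (conjV V x) (conjV V y) = (starRingEnd ℂ) (cxForm B x y) := by
  induction x using Cx.induction with
  | zero => simp
  | smul a v =>
    induction y using Cx.induction with
    | zero => simp
    | smul b w => simp
    | add x y hx hy => simp only [map_add, hx, hy]
  | add x y hx hy => simp only [map_add, LinearMap.add_apply, hx, hy]

theorem mem_conjSub {U : Submodule ℂ (Cx V)} {x : Cx V} : x ∈ conjSub U ↔ conjV V x ∈ U := Iff.rfl

theorem cxSub_eq_span (U : Submodule ℚ V) : cxSub U = Submodule.span ℂ (toCx '' (U : Set V)) :=
  Submodule.baseChange_eq_span _ _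

theorem toCx_mem_cxSub {U : Submodule ℚ V} {v : V} (hv : v ∈ U) : toCx v ∈ cxSub U := by
  rw [cxSub_eq_span]; exact Submodule.subset_span ⟨v, hv, rfl⟩

theorem cxSub_mono {U U' : Submodule ℚ V} (h : U ≤ U') : cxSub U ≤ cxSub U' :=
  by
  rw [cxSub_eq_span, cxSub_eq_span]
  exact Submodule.span_mono (Set.image_mono h)

theorem cxSub_bot : cxSub (⊥ : Submodule ℚ V) = ⊥ := Submodule.baseChange_bot _

theorem cxSub_top : cxSub (⊤ : Submodule ℚ V) = ⊤ := Submodule.baseChange_top _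

theorem cxSub_eq_range (U : Submodule ℚ V) : cxSub U = LinearMap.range (cxMap U.subtype) := rfl

theorem map_mem_of_mem_cxSub {σ : ℂ →+* ℂ} {M : Type*} [AddCommGroup M] [Module ℂ M]
    {f : Cx V →ₛₗ[σ] M} {U : Submodule ℚ V} {N : Submodule ℂ M}
    (h : ∀ v ∈ U, f (toCx v) ∈ N) {x : Cx V} (hx : x ∈ cxSub U) : f x ∈ N := by
  rw [cxSub_eq_span] at hx
  induction hx using Submodule.span_induction with
  | mem x hx => obtain ⟨v, hv, rfl⟩ := hx; exact h v hv
  | zero => simp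
  | add x y _ _ hx hy => rw [map_add]; exact N.add_mem hx hy
  | smul a x _ hx => rw [map_smulₛₗ]; exact N.smul_mem _ hx

theorem galV_mem_cxSub (σ : ℂ →+* ℂ) {U : Submodule ℚ V} {x : Cx V} (hx : x ∈ cxSub U) :
    galV σ x ∈ cxSub U :=
  map_mem_of_mem_cxSub (fun v hv => by rw [galV_toCx]; exact toCx_mem_cxSub hv) hx

theorem conjV_mem_cxSub {U : Submodule ℚ V} {x : Cx V} (hx : x ∈ cxSub U) :
    conjV V x ∈ cxSub U := galV_mem_cxSub _ hx

/-- The basis `1 ⊗ b i` of `V_ℂ`. -/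
def cxBasis {ι : Type*} (b : Module.Basis ι ℚ V) : Module.Basis ι ℂ (Cx V) := b.baseChange ℂ

@[simp] theorem cxBasis_apply {ι : Type*} (b : Module.Basis ι ℚ V) (i : ι) :
    cxBasis b i = toCx (b i) := Module.Basis.baseChange_apply ℂ b i

theorem cxBasis_repr {ι : Type*} (b : Module.Basis ι ℚ V) (x : Cx V) (i : ι) :
    (cxBasis b).repr x i = cxDual (b.coord i) x := by
  have : (cxBasis b).coord i = cxDual (b.coord i) := by
    refine linearMap_ext fun v => ?_
    have := Module.Basis.baseChange_repr_tmul ℂ b 1 v i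
    rw [cxDual_toCx]
    refine Eq.trans this ?_
    rw [Algebra.smul_def, mul_one]
    rfl
  rw [← this]; rfl

instance [Module.Finite ℚ V] : Module.Finite ℂ (Cx V) :=
  Module.Finite.of_basis (cxBasis (Module.finBasis ℚ V))

theorem cxDual_comp (l : Module.Dual ℚ V') (f : V →ₗ[ℚ] V') (x : Cx V) :
    cxDual (l ∘ₗ f) x = cxDual l (cxMap f x) := by
  have : cxDual (l ∘ₗ f) = (cxDual l) ∘ₗ (cxMap f) := linearMap_ext fun v => by simp
  rw [this]; rfl

theorem eq_zero_of_cxDual {x : Cx V} (h : ∀ l : Module.Dual ℚ V, cxDual l x = 0) : x = 0 := by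
  refine (cxBasis (Module.Basis.ofVectorSpace ℚ V)).ext_elem fun i => ?_
  rw [cxBasis_repr, h]; simp

/-- A rational vector outside `U` is separated from `U` by a rational functional, and the
complexified functional still separates them. -/
theorem toCx_mem_cxSub_iff {U : Submodule ℚ V} {v : V} : toCx v ∈ cxSub U ↔ v ∈ U := by
  refine ⟨fun h => ?_, toCx_mem_cxSub⟩
  by_contra hv
  obtain ⟨f, hf, hU⟩ := Submodule.exists_dual_map_eq_bot_of_notMem hv inferInstance
  have h1 : cxDual f (toCx v) ∈ (⊥ : Submodule ℂ ℂ) := by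
    refine map_mem_of_mem_cxSub (fun w hw => ?_) h
    have : f w ∈ (⊥ : Submodule ℚ ℚ) := hU ▸ Submodule.mem_map_of_mem hw
    rw [Submodule.mem_bot] at this
    simp [this]
  rw [cxDual_toCx, Submodule.mem_bot] at h1
  exact hf (by exact_mod_cast h1)

/-- A rational subspace is cut out, after complexification, by rational functionals. -/
theorem mem_cxSub_iff_dual {U : Submodule ℚ V} {x : Cx V} :
    x ∈ cxSub U ↔ ∀ l : Module.Dual ℚ V, (∀ u ∈ U, l u = 0) → cxDual l x = 0 := by
  constructor
  · intro hx l hl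
    have : cxDual l x ∈ (⊥ : Submodule ℂ ℂ) :=
      map_mem_of_mem_cxSub (fun v hv => by simp [hl v hv]) hx
    simpa using this
  · intro h
    obtain ⟨π, hπ⟩ := U.exists_isCompl
    set p : V →ₗ[ℚ] V := U.subtype ∘ₗ U.projectionOnto π hπ with hp
    have hpx : cxMap p x = x := by
      rw [← sub_eq_zero]
      refine eq_zero_of_cxDual fun l => ?_
      have h2 : cxDual (l ∘ₗ p - l) x = 0 := h _ fun u hu => by
        simp only [LinearMap.sub_apply, LinearMap.comp_apply, hp]
        have : U.projectionOnto π hπ u = ⟨u, hu⟩ :=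
          Submodule.projectionOnto_apply_left hπ ⟨u, hu⟩
        rw [this]; simp
      have h3 : cxDual (l ∘ₗ p - l) = cxDual (l ∘ₗ p) - cxDual l :=
        linearMap_ext fun v => by simp
      rw [h3, LinearMap.sub_apply, cxDual_comp] at h2
      rw [map_sub]; exact h2
    rw [← hpx, hp, cxMap_comp, cxSub_eq_range]
    exact ⟨_, rfl⟩

end Complexification

/-! ### Galois action and matrix coefficients on End(V_ℂ). -/

section Endomorphisms

variable {V : Type*} [AddCommGroup V] [Module ℚ V]

/-- The action of a field automorphism of `ℂ` on `End(V_ℂ)`. -/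
def galE (σ : ℂ ≃+* ℂ) : EndC V ≃+* EndC V where
  toFun T :=
    { toFun := fun x => galV (σ : ℂ →+* ℂ) (T (galV (σ.symm : ℂ →+* ℂ) x))
      map_add' := by simp
      map_smul' := by simp }
  invFun T :=
    { toFun := fun x => galV (σ.symm : ℂ →+* ℂ) (T (galV (σ : ℂ →+* ℂ) x))
      map_add' := by simp
      map_smul' := by simp }
  left_inv T := by ext x; simp
  right_inv T := by ext x; simp
  map_mul' S T := by ext x; simp
  map_add' S T := by ext x; simp

theorem galE_apply (σ : ℂ ≃+* ℂ) (T : EndC V) (x : Cx V) :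
    galE σ T x = galV (σ : ℂ →+* ℂ) (T (galV (σ.symm : ℂ →+* ℂ) x)) := rfl

theorem galE_smul (σ : ℂ ≃+* ℂ) (c : ℂ) (T : EndC V) : galE σ (c • T) = σ c • galE σ T := by
  ext x; simp [galE_apply]

theorem galE_cxHom (σ : ℂ ≃+* ℂ) (f : Module.End ℚ V) : galE σ (cxHom V f) = cxHom V f := by
  refine LinearMap.ext fun x => ?_
  rw [galE_apply, cxHom_apply, galV_cxMap, galV_galV_symm]

/-- The action of a field automorphism of `ℂ` on `GL(V_ℂ)`. -/
def galG (σ : ℂ ≃+* ℂ) : GLC V ≃* GLC V := Units.mapEquiv (galE σ).toMulEquiv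

@[simp] theorem coe_galG (σ : ℂ ≃+* ℂ) (g : GLC V) : (galG σ g : EndC V) = galE σ g := rfl

theorem coef_def (T : EndC V) (v : V) (l : Module.Dual ℚ V) :
    coef T (v, l) = cxDual l (T (toCx v)) := rfl

theorem coef_galE (σ : ℂ ≃+* ℂ) (T : EndC V) (vl : V × Module.Dual ℚ V) :
    coef (galE σ T) vl = σ (coef T vl) := by
  rw [coef, galE_apply, galV_toCx, cxDual_galV]; rfl

theorem coef_cxHom (f : Module.End ℚ V) (vl : V × Module.Dual ℚ V) :
    coef (cxHom V f) vl = (vl.2 (f vl.1) : ℂ) := by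
  rw [coef, cxHom_apply, cxMap_toCx, cxDual_toCx]

theorem coef_add (S T : EndC V) (vl : V × Module.Dual ℚ V) :
    coef (S + T) vl = coef S vl + coef T vl := by simp [coef]

theorem coef_smul (c : ℂ) (T : EndC V) (vl : V × Module.Dual ℚ V) :
    coef (c • T) vl = c * coef T vl := by simp [coef]

theorem coef_zero (vl : V × Module.Dual ℚ V) : coef (0 : EndC V) vl = 0 := by simp [coef]

theorem coef_sum {ι : Type*} (s : Finset ι) (T : ι → EndC V) (vl : V × Module.Dual ℚ V) :
    coef (∑ i ∈ s, T i) vl = ∑ i ∈ s, coef (T i) vl := by simp [coef, LinearMap.sum_apply]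

theorem end_ext {S T : EndC V} (h : ∀ vl, coef S vl = coef T vl) : S = T := by
  refine linearMap_ext fun v => ?_
  rw [← sub_eq_zero]
  refine eq_zero_of_cxDual fun l => ?_
  rw [map_sub, sub_eq_zero]
  exact h (v, l)

/-- Complex conjugation as a field automorphism. -/
def conjAut : ℂ ≃+* ℂ := starRingAut

theorem galE_conjAut_apply (T : EndC V) (x : Cx V) :
    galE conjAut T x = conjV V (T (conjV V x)) := rfl

theorem galE_conj_conj (T : EndC V) : galE conjAut (galE conjAut T) = T := by
  ext x; simp [galE_conjAut_apply]

theorem galE_conj_eq_iff (T : EndC V) :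
    galE conjAut T = T ↔ ∀ v, T (conjV V v) = conjV V (T v) := by
  constructor
  · intro h v
    conv_lhs => rw [← h]
    rw [galE_conjAut_apply, conjV_conjV]
  · intro h
    ext x
    rw [galE_conjAut_apply, h, conjV_conjV]

theorem mem_realPts {H : Subgroup (GLC V)} {g : GLC V} :
    g ∈ realPts H ↔ g ∈ H ∧ galE conjAut (g : EndC V) = g := by
  rw [galE_conj_eq_iff]; rfl

variable [Module.Finite ℚ V]

/-- A fixed rational basis. -/
abbrev ratBasis (V : Type*) [AddCommGroup V] [Module ℚ V] [Module.Finite ℚ V] :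
    Module.Basis (Fin (Module.finrank ℚ V)) ℚ V := Module.finBasis ℚ V

theorem coef_mul (S T : EndC V) (v : V) (l : Module.Dual ℚ V) :
    coef (S * T) (v, l) = ∑ i, coef S (ratBasis V i, l) * coef T (v, (ratBasis V).coord i) := by
  have h : T (toCx v) = ∑ i, coef T (v, (ratBasis V).coord i) • toCx (ratBasis V i) := by
    have := (cxBasis (ratBasis V)).sum_repr (T (toCx v))
    simp only [cxBasis_repr, cxBasis_apply] at this
    exact this.symm
  rw [coef_def, Module.End.mul_apply, h, map_sum, map_sum]
  refine Finset.sum_congr rfl fun i _ => ?_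
  rw [map_smul, map_smul, smul_eq_mul, mul_comm]
  rfl

/-- The basis of `End(V_ℂ)` deduced from a rational basis. -/
def endBasis (V : Type*) [AddCommGroup V] [Module ℚ V] [Module.Finite ℚ V] :
    Module.Basis (Fin (Module.finrank ℚ V) × Fin (Module.finrank ℚ V)) ℂ (EndC V) :=
  (cxBasis (ratBasis V)).end

theorem endBasis_repr (T : EndC V) (ij : Fin (Module.finrank ℚ V) × Fin (Module.finrank ℚ V)) :
    (endBasis V).repr T ij = coef T (ratBasis V ij.2, (ratBasis V).coord ij.1) := by
  have h : LinearMap.toMatrix (cxBasis (ratBasis V)) (cxBasis (ratBasis V)) T ij.1 ij.2 =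
      coef T (ratBasis V ij.2, (ratBasis V).coord ij.1) := by
    rw [LinearMap.toMatrix_apply, cxBasis_repr, cxBasis_apply]
    rfl
  rw [endBasis, Module.Basis.end_repr_apply]
  exact h

theorem exists_eq_cxHom_of_repr {T : EndC V} (h : ∀ i, ∃ q : ℚ, (endBasis V).repr T i = q) :
    ∃ f, T = cxHom V f := by
  choose q hq using h
  refine ⟨Matrix.toLin (ratBasis V) (ratBasis V) (Matrix.of fun i j => q (i, j)), ?_⟩
  refine (endBasis V).ext_elem fun ij => ?_
  rw [hq, endBasis_repr, coef_cxHom]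
  simp [Matrix.toLin_self, Finsupp.single_apply]

/-- Galois descent for endomorphisms. -/
theorem exists_eq_cxHom {T : EndC V} (h : ∀ σ, galE σ T = T) : ∃ f, T = cxHom V f := by
  refine exists_eq_cxHom_of_repr fun ij => ?_
  refine exists_rat_of_forall_ringEquiv_fixed _ fun σ => ?_
  rw [endBasis_repr, ← coef_galE, h]

/-- Galois descent for spaces of endomorphisms. -/
theorem span_cxHom_of_stable (N : Submodule ℂ (EndC V)) (hN : ∀ T ∈ N, ∀ σ, galE σ T ∈ N) :
    N = Submodule.span ℂ (cxHom V '' {f | cxHom V f ∈ N}) := by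
  refine le_antisymm ?_ (Submodule.span_le.2 ?_)
  · refine (span_rational_of_stable (endBasis V) N fun x hx σ y hy => ?_).trans
      (Submodule.span_mono ?_)
    · have : y = galE σ x := (endBasis V).ext_elem fun i => by
        rw [hy, endBasis_repr, endBasis_repr, coef_galE]
      rw [this]; exact hN x hx σ
    · rintro x ⟨hx, hr⟩
      obtain ⟨f, rfl⟩ := exists_eq_cxHom_of_repr hr
      exact ⟨f, hx, rfl⟩
  · rintro _ ⟨f, hf, rfl⟩
    exact hf

end Endomorphisms

/-! ### Tangent spaces and exponentials for ℚ-algebraic groups. -/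

section AlgebraicGroups

open MvPolynomial

variable {V : Type*} [AddCommGroup V] [Module ℚ V]

theorem aeval_coef_galE (σ : ℂ ≃+* ℂ) (T : EndC V) (f : MvPolynomial (V × Module.Dual ℚ V) ℚ) :
    aeval (coef (galE σ T)) f = σ (aeval (coef T) f) := by
  have : (aeval (coef (galE σ T)) : MvPolynomial (V × Module.Dual ℚ V) ℚ →ₐ[ℚ] ℂ) =
      ((σ : ℂ →+* ℂ).toRatAlgHom).comp (aeval (coef T)) := by
    ext vl; simp [coef_galE]
  rw [this]; rfl

theorem IsQAlgebraic.galG_mem {H : Subgroup (GLC V)} (hH : IsQAlgebraic H) (σ : ℂ ≃+* ℂ)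
    {g : GLC V} (hg : g ∈ H) : galG σ g ∈ H := by
  obtain ⟨E, hE⟩ := hH
  rw [hE] at hg ⊢
  intro f hf
  rw [coe_galG, aeval_coef_galE, hg f hf, map_zero]

theorem isQAlgebraic_sInf {C : Set (Subgroup (GLC V))} (hC : ∀ H ∈ C, IsQAlgebraic H) :
    IsQAlgebraic (sInf C) := by
  choose! E hE using hC
  refine ⟨⋃ H ∈ C, E H, fun g => ?_⟩
  rw [Subgroup.mem_sInf]
  constructor
  · intro h f hf
    simp only [Set.mem_iUnion] at hf
    obtain ⟨H, hH, hf⟩ := hf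
    exact (hE H hH g).1 (h H hH) f hf
  · intro h H hH
    exact (hE H hH g).2 fun f hf => h f (Set.mem_biUnion hH hf)

theorem IsQAlgebraic.inf {H K : Subgroup (GLC V)} (hH : IsQAlgebraic H) (hK : IsQAlgebraic K) :
    IsQAlgebraic (H ⊓ K) := by
  have := isQAlgebraic_sInf (C := {H, K}) (by
    rintro _ (rfl | rfl)
    · exact hH
    · exact hK)
  rwa [sInf_pair] at this

/-- The rational polynomials that vanish on `H`. -/
def vanishing (H : Subgroup (GLC V)) : Set (MvPolynomial (V × Module.Dual ℚ V) ℚ) :=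
  {f | ∀ g ∈ H, aeval (coef (g : EndC V)) f = 0}

theorem IsQAlgebraic.mem_iff {H : Subgroup (GLC V)} (hH : IsQAlgebraic H) {g : GLC V} :
    g ∈ H ↔ ∀ f ∈ vanishing H, aeval (coef (g : EndC V)) f = 0 := by
  obtain ⟨E, hE⟩ := hH
  refine ⟨fun hg f hf => hf g hg, fun h => (hE g).2 fun f hf => h f fun g' hg' => ?_⟩
  exact (hE g').1 hg' f hf

theorem eval_map_rat (x : V × Module.Dual ℚ V → ℂ) (p : MvPolynomial (V × Module.Dual ℚ V) ℚ) :
    eval x (map (algebraMap ℚ ℂ) p) = aeval x p := by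
  rw [eval_map]; rfl

/-- The complex polynomials that vanish on a `ℚ`-algebraic group are spanned by rational ones. -/
theorem IsQAlgebraic.mem_span_vanishing {H : Subgroup (GLC V)} (hH : IsQAlgebraic H)
    {f : MvPolynomial (V × Module.Dual ℚ V) ℂ} (hf : ∀ g ∈ H, eval (coef (g : EndC V)) f = 0) :
    f ∈ Submodule.span ℂ (map (algebraMap ℚ ℂ) '' vanishing H) := by
  set N : Submodule ℂ (MvPolynomial (V × Module.Dual ℚ V) ℂ) :=
    { carrier := {f | ∀ g ∈ H, eval (coef (g : EndC V)) f = 0}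
      zero_mem' := fun g _ => map_zero _
      add_mem' := fun ha hb g hg => by rw [map_add, ha g hg, hb g hg, add_zero]
      smul_mem' := fun c a ha g hg => by rw [smul_eval, ha g hg, mul_zero] } with hN
  have hrepr : ∀ (p : MvPolynomial (V × Module.Dual ℚ V) ℂ) i,
      (basisMonomials _ ℂ).repr p i = coeff i p := fun p i => rfl
  refine Submodule.span_mono ?_ (span_rational_of_stable (basisMonomials _ ℂ) N ?_ hf)
  · rintro x ⟨hx, hr⟩
    have : x ∈ Set.range (map (algebraMap ℚ ℂ) :
        MvPolynomial (V × Module.Dual ℚ V) ℚ → MvPolynomial (V × Module.Dual ℚ V) ℂ) := by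
      rw [mem_range_map_iff_coeffs_subset]
      intro c hc
      obtain ⟨i, hi, rfl⟩ := mem_coeffs_iff.1 hc
      obtain ⟨q, hq⟩ := hr i
      exact ⟨q, by rw [← hrepr, hq]; simp⟩
    obtain ⟨p, rfl⟩ := this
    refine ⟨p, fun g hg => ?_, rfl⟩
    rw [← eval_map_rat]
    exact hx g hg
  -- Applying `σ` to the coefficients of a polynomial and evaluating at `g` gives `σ` of the value
  -- of the original polynomial at the transform of `g` by the inverse of `σ`, which is again in
  -- `H`.
  · intro x hx σ y hy g hg
    have hy' : y = map (σ : ℂ →+* ℂ) x := by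
      ext i
      rw [coeff_map, ← hrepr, ← hrepr, hy]; rfl
    have hg' : g = galG σ ((galG σ).symm g) := by simp
    have h2 := hx ((galG σ).symm g) (by
      have := hH.galG_mem σ.symm hg
      exact this)
    rw [hy', eval_map]
    have h3 : coef (g : EndC V) = fun vl => (σ : ℂ →+* ℂ) (coef ((galG σ).symm g : EndC V) vl) := by
      funext vl
      conv_lhs => rw [hg', coe_galG, coef_galE]
      rfl
    rw [h3]
    have h4 := eval₂_comp_left (σ : ℂ →+* ℂ) (RingHom.id ℂ) (coef ((galG σ).symm g : EndC V)) x
    rw [RingHom.comp_id] at h4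
    refine h4.symm.trans ?_
    change σ (eval _ x) = 0
    rw [h2, map_zero]

/-- The derivative at `1` in a complex direction. -/
def derivC (X : EndC V) (f : MvPolynomial (V × Module.Dual ℚ V) ℂ) : ℂ :=
  eval (coef (1 : EndC V)) (mkDerivation ℂ (fun vl => C (coef X vl)) f)

theorem coef_one (vl : V × Module.Dual ℚ V) : coef (1 : EndC V) vl = (vl.2 vl.1 : ℂ) := by
  rw [← map_one (cxHom V), coef_cxHom]; rfl

theorem derivC_add_right (X : EndC V) (f g : MvPolynomial (V × Module.Dual ℚ V) ℂ) :
    derivC X (f + g) = derivC X f + derivC X g := by simp [derivC]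

theorem derivC_smul_right (X : EndC V) (c : ℂ) (f : MvPolynomial (V × Module.Dual ℚ V) ℂ) :
    derivC X (c • f) = c * derivC X f := by simp [derivC]

theorem derivC_mul_right (X : EndC V) (f g : MvPolynomial (V × Module.Dual ℚ V) ℂ) :
    derivC X (f * g) = eval (coef 1) f * derivC X g + eval (coef 1) g * derivC X f := by
  simp [derivC, Derivation.leibniz]

theorem derivC_X_right (X : EndC V) (vl : V × Module.Dual ℚ V) :
    derivC X (MvPolynomial.X vl) = coef X vl := by simp [derivC, mkDerivation_X]

theorem derivC_C_right (X : EndC V) (c : ℂ) :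
    derivC X (C c : MvPolynomial (V × Module.Dual ℚ V) ℂ) = 0 := by simp [derivC]

theorem derivC_add (X Y : EndC V) (f : MvPolynomial (V × Module.Dual ℚ V) ℂ) :
    derivC (X + Y) f = derivC X f + derivC Y f := by
  induction f using MvPolynomial.induction_on with
  | C a => simp [derivC_C_right]
  | add p q hp hq => simp only [derivC_add_right, hp, hq]; ring
  | mul_X p n hp => simp only [derivC_mul_right, hp, derivC_X_right, coef_add]; ring

theorem derivC_smul (c : ℂ) (X : EndC V) (f : MvPolynomial (V × Module.Dual ℚ V) ℂ) :
    derivC (c • X) f = c * derivC X f := by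
  induction f using MvPolynomial.induction_on with
  | C a => simp [derivC_C_right]
  | add p q hp hq => simp only [derivC_add_right, hp, hq]; ring
  | mul_X p n hp => simp only [derivC_mul_right, hp, derivC_X_right, coef_smul]; ring

theorem eval_coef_one (p : MvPolynomial (V × Module.Dual ℚ V) ℚ) :
    aeval (coef (1 : EndC V)) p = ((eval (fun vl => vl.2 vl.1) p : ℚ) : ℂ) := by
  have : (aeval (coef (1 : EndC V)) : MvPolynomial (V × Module.Dual ℚ V) ℚ →ₐ[ℚ] ℂ) =
      (Algebra.ofId ℚ ℂ).comp (aeval (fun vl => vl.2 vl.1)) := by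
    ext vl
    simp [coef_one]
  rw [this]
  rfl

theorem derivAtOne_mul (X : Module.End ℚ V) (f g : MvPolynomial (V × Module.Dual ℚ V) ℚ) :
    derivAtOne X (f * g) = eval (fun vl => vl.2 vl.1) f * derivAtOne X g +
      eval (fun vl => vl.2 vl.1) g * derivAtOne X f := by
  simp [derivAtOne, Derivation.leibniz]

theorem derivC_map (X : Module.End ℚ V) (p : MvPolynomial (V × Module.Dual ℚ V) ℚ) :
    derivC (cxHom V X) (map (algebraMap ℚ ℂ) p) = (derivAtOne X p : ℂ) := by
  induction p using MvPolynomial.induction_on with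
  | C a => simp [derivC_C_right, derivAtOne]
  | add p q hp hq =>
    rw [map_add, derivC_add_right, hp, hq]
    simp [derivAtOne]
  | mul_X p n hp =>
    rw [map_mul, derivC_mul_right, hp, map_X, derivC_X_right, derivAtOne_mul, eval_map_rat,
      eval_coef_one, coef_cxHom]
    simp [derivAtOne, mkDerivation_X, coef_one]

/-- The complex tangent space at `1` of a `ℚ`-algebraic group. -/
def lieAlgC (H : Subgroup (GLC V)) : Submodule ℂ (EndC V) where
  carrier := {X | ∀ f ∈ vanishing H, derivC X (map (algebraMap ℚ ℂ) f) = 0}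
  zero_mem' := fun f _ => by
    have := derivC_smul 0 (0 : EndC V) (map (algebraMap ℚ ℂ) f)
    simpa using this
  add_mem' := fun ha hb f hf => by rw [derivC_add, ha f hf, hb f hf, add_zero]
  smul_mem' := fun c X hX f hf => by rw [derivC_smul, hX f hf, mul_zero]

theorem cxHom_mem_lieAlgC {H : Subgroup (GLC V)} {X : Module.End ℚ V} :
    cxHom V X ∈ lieAlgC H ↔ X ∈ lieAlg H := by
  refine forall₂_congr fun f _ => ?_
  rw [derivC_map]
  exact Rat.cast_eq_zero

theorem derivC_galE (σ : ℂ ≃+* ℂ) (X : EndC V) (p : MvPolynomial (V × Module.Dual ℚ V) ℚ) :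
    derivC (galE σ X) (map (algebraMap ℚ ℂ) p) = σ (derivC X (map (algebraMap ℚ ℂ) p)) := by
  induction p using MvPolynomial.induction_on with
  | C a => simp [derivC_C_right]
  | add p q hp hq => simp only [map_add, derivC_add_right, hp, hq]
  | mul_X p n hp =>
    simp only [map_mul, derivC_mul_right, hp, map_X, derivC_X_right, coef_galE, eval_map_rat,
      eval_coef_one, map_add, map_ratCast, eval_X, coef_one]

theorem galE_mem_lieAlgC {H : Subgroup (GLC V)} (σ : ℂ ≃+* ℂ) {X : EndC V} (hX : X ∈ lieAlgC H) :
    galE σ X ∈ lieAlgC H := fun f hf => by rw [derivC_galE, hX f hf, map_zero]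

/-- The matrix coefficients of `t ↦ exp (t X)` as polynomials in `t`. -/
def expCurve (X : EndC V) (N : ℕ) (vl : V × Module.Dual ℚ V) : Polynomial ℂ :=
  ∑ i ∈ Finset.range N, Polynomial.C ((i.factorial : ℂ)⁻¹ * coef (X ^ i) vl) * Polynomial.X ^ i

theorem coeff_expCurve {X : EndC V} {N : ℕ} (hN : X ^ N = 0) (vl : V × Module.Dual ℚ V) (n : ℕ) :
    (expCurve X N vl).coeff n = (n.factorial : ℂ)⁻¹ * coef (X ^ n) vl := by
  rw [expCurve, Polynomial.finsetSum_coeff]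
  simp only [Polynomial.coeff_C_mul, Polynomial.coeff_X_pow, mul_ite, mul_one, mul_zero,
    Finset.sum_ite_eq, Finset.mem_range]
  split_ifs with h
  · rfl
  · rw [pow_eq_zero_of_le (not_lt.1 h) hN, coef_zero, mul_zero]

theorem exp_eq_sum_complex {X : EndC V} {N : ℕ} (hN : X ^ N = 0) :
    IsNilpotent.exp X = ∑ i ∈ Finset.range N, ((i.factorial : ℂ)⁻¹) • X ^ i := by
  rw [IsNilpotent.exp_eq_sum hN]
  refine Finset.sum_congr rfl fun i _ => ?_
  rw [← algebraMap_smul ℂ]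
  simp

theorem eval_expCurve {X : EndC V} {N : ℕ} (hN : X ^ N = 0) (vl : V × Module.Dual ℚ V) (t : ℂ) :
    (expCurve X N vl).eval t = coef (IsNilpotent.exp (t • X)) vl := by
  have h : (t • X) ^ N = 0 := by rw [smul_pow, hN, smul_zero]
  rw [exp_eq_sum_complex h, coef_sum, expCurve, Polynomial.eval_finsetSum]
  refine Finset.sum_congr rfl fun i _ => ?_
  simp only [Polynomial.eval_mul, Polynomial.eval_C, Polynomial.eval_pow, Polynomial.eval_X,
    coef_smul, smul_pow]
  ring

theorem eval_aeval_expCurve {X : EndC V} {N : ℕ} (hN : X ^ N = 0)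
    (f : MvPolynomial (V × Module.Dual ℚ V) ℂ) (t : ℂ) :
    (aeval (expCurve X N) f).eval t = eval (coef (IsNilpotent.exp (t • X))) f := by
  have : ((Polynomial.aeval t).comp ((aeval (expCurve X N)) :
      MvPolynomial (V × Module.Dual ℚ V) ℂ →ₐ[ℂ] Polynomial ℂ)) =
      aeval (coef (IsNilpotent.exp (t • X))) := by
    ext vl
    simp [eval_expCurve hN]
  exact DFunLike.congr_fun this f

variable [Module.Finite ℚ V]

/-- The left invariant vector field `g ↦ g X` on `GL(V_ℂ)`. -/
def invField (X : EndC V) : Derivation ℂ (MvPolynomial (V × Module.Dual ℚ V) ℂ)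
    (MvPolynomial (V × Module.Dual ℚ V) ℂ) :=
  mkDerivation ℂ fun vl => ∑ i, C (coef X (vl.1, (ratBasis V).coord i)) *
    MvPolynomial.X (ratBasis V i, vl.2)

theorem eval_invField_X (X T : EndC V) (vl : V × Module.Dual ℚ V) :
    eval (coef T) (invField X (MvPolynomial.X vl)) = coef (T * X) vl := by
  rw [invField, mkDerivation_X, map_sum, ← Prod.mk.eta (p := vl), coef_mul]
  refine Finset.sum_congr rfl fun i _ => ?_
  simp [mul_comm]

/-- Left translation by `T` on polynomials. -/
def leftTrans (T : EndC V) : MvPolynomial (V × Module.Dual ℚ V) ℂ →ₐ[ℂ]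
    MvPolynomial (V × Module.Dual ℚ V) ℂ :=
  aeval fun vl => ∑ i, C (coef T (ratBasis V i, vl.2)) *
    MvPolynomial.X (vl.1, (ratBasis V).coord i)

theorem eval_leftTrans (S T : EndC V) (f : MvPolynomial (V × Module.Dual ℚ V) ℂ) :
    eval (coef S) (leftTrans T f) = eval (coef (T * S)) f := by
  have : ((aeval (coef S) : MvPolynomial (V × Module.Dual ℚ V) ℂ →ₐ[ℂ] ℂ).comp (leftTrans T)) =
      aeval (coef (T * S)) := by
    ext vl
    rw [AlgHom.comp_apply, leftTrans, aeval_X, aeval_X, map_sum, ← Prod.mk.eta (p := vl), coef_mul]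
    refine Finset.sum_congr rfl fun i _ => ?_
    simp
  exact DFunLike.congr_fun this f

theorem derivC_leftTrans_X (T X : EndC V) (vl : V × Module.Dual ℚ V) :
    derivC X (leftTrans T (MvPolynomial.X vl)) = coef (T * X) vl := by
  rw [leftTrans, aeval_X, ← Prod.mk.eta (p := vl), coef_mul]
  have hs : ∀ (s : Finset (Fin (Module.finrank ℚ V))) (F : _ → MvPolynomial _ ℂ),
      derivC X (∑ i ∈ s, F i) = ∑ i ∈ s, derivC X (F i) := fun s F => by
    simp [derivC]
  rw [hs]
  refine Finset.sum_congr rfl fun i _ => ?_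
  rw [derivC_mul_right, derivC_C_right, derivC_X_right]
  simp

theorem derivC_leftTrans (T X : EndC V) (f : MvPolynomial (V × Module.Dual ℚ V) ℂ) :
    derivC X (leftTrans T f) = eval (coef T) (invField X f) := by
  induction f using MvPolynomial.induction_on with
  | C a => simp [derivC_C_right, leftTrans]
  | add p q hp hq => simp only [map_add, derivC_add_right, hp, hq]
  | mul_X p n hp =>
    have h1 : invField X (p * MvPolynomial.X n) =
        p * invField X (MvPolynomial.X n) + MvPolynomial.X n * invField X p :=
      Derivation.leibniz _ _ _
    rw [map_mul, derivC_mul_right, hp, derivC_leftTrans_X, h1, map_add, map_mul, map_mul,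
      eval_invField_X, eval_leftTrans, eval_leftTrans, mul_one]

theorem eval_one_invField (X : EndC V) (f : MvPolynomial (V × Module.Dual ℚ V) ℂ) :
    eval (coef 1) (invField X f) = derivC X f := by
  induction f using MvPolynomial.induction_on with
  | C a => simp [derivC_C_right]
  | add p q hp hq => simp only [map_add, derivC_add_right, hp, hq]
  | mul_X p n hp =>
    have h1 : invField X (p * MvPolynomial.X n) =
        p * invField X (MvPolynomial.X n) + MvPolynomial.X n * invField X p :=
      Derivation.leibniz _ _ _
    rw [h1, derivC_mul_right, map_add, map_mul, map_mul, eval_invField_X, derivC_X_right, hp,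
      one_mul]

/-- The value at `g` of the invariant field applied to `f` is the derivative at 1 of the left
translate of `f` by `g`. That translate vanishes on `H` as well, so it is a complex combination of
rational polynomials vanishing on `H`, which `X` annihilates by definition. -/
theorem IsQAlgebraic.invField_vanish {H : Subgroup (GLC V)} (hH : IsQAlgebraic H) {X : EndC V}
    (hX : X ∈ lieAlgC H) {f : MvPolynomial (V × Module.Dual ℚ V) ℂ}
    (hf : ∀ g ∈ H, eval (coef (g : EndC V)) f = 0) :
    ∀ g ∈ H, eval (coef (g : EndC V)) (invField X f) = 0 := by
  intro g hg
  rw [← derivC_leftTrans]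
  have h1 : leftTrans (g : EndC V) f ∈
      Submodule.span ℂ (map (algebraMap ℚ ℂ) '' vanishing H) :=
    hH.mem_span_vanishing fun g' hg' => by
      rw [eval_leftTrans, ← Units.val_mul]
      exact hf _ (H.mul_mem hg hg')
  generalize leftTrans (g : EndC V) f = F at h1
  induction h1 using Submodule.span_induction with
  | mem x hx => obtain ⟨p, hp, rfl⟩ := hx; exact hX p hp
  | zero => simp [derivC]
  | add x y _ _ hx hy => rw [derivC_add_right, hx, hy, add_zero]
  | smul c x _ hx => rw [derivC_smul_right, hx, mul_zero]

/-- This is the chain rule for the differential equation (exp tX)' = exp(tX) · X: differentiation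
along the curve is the left invariant field. It keeps the argument inside polynomials in `t`. -/
theorem derivative_aeval_expCurve {X : EndC V} {N : ℕ} (hN : X ^ N = 0)
    (f : MvPolynomial (V × Module.Dual ℚ V) ℂ) :
    Polynomial.derivative (aeval (expCurve X N) f) = aeval (expCurve X N) (invField X f) := by
  induction f using MvPolynomial.induction_on with
  | C a => simp
  | add p q hp hq => simp only [map_add, hp, hq]
  | mul_X p vl hp =>
    rw [map_mul, Polynomial.derivative_mul, hp, Derivation.leibniz, smul_eq_mul, smul_eq_mul,
      map_add, map_mul, map_mul, aeval_X, add_comm]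
    congr 1
    · congr 1
      ext n
      rw [Polynomial.coeff_derivative, coeff_expCurve hN, invField, mkDerivation_X, map_sum,
        Polynomial.finsetSum_coeff, pow_succ, ← Prod.mk.eta (p := vl), coef_mul,
        Nat.factorial_succ, Finset.mul_sum, Finset.sum_mul]
      refine Finset.sum_congr rfl fun i _ => ?_
      rw [map_mul, aeval_X, aeval_C]
      change _ = (Polynomial.C _ * _ : Polynomial ℂ).coeff n
      rw [Polynomial.coeff_C_mul, coeff_expCurve hN]
      have h1 : (n.factorial : ℂ) ≠ 0 := by exact_mod_cast n.factorial_ne_zero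
      have h2 : (n : ℂ) + 1 ≠ 0 := by exact_mod_cast n.succ_ne_zero
      push_cast
      field_simp
    · rw [mul_comm]

theorem polynomial_eq_zero_of_iterate_derivative {p : Polynomial ℂ}
    (h : ∀ n, (Polynomial.derivative^[n] p).eval 0 = 0) : p = 0 := by
  ext n
  have h1 := h n
  rw [← Polynomial.coeff_zero_eq_eval_zero, Polynomial.coeff_iterate_derivative, zero_add,
    Nat.descFactorial_self, nsmul_eq_mul, mul_eq_zero] at h1
  exact h1.resolve_left (by exact_mod_cast n.factorial_ne_zero)

/-- Nilpotent elements of the complexified Lie algebra of a `ℚ`-algebraic group exponentiate into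
the group. -/
theorem IsQAlgebraic.exp_mem {H : Subgroup (GLC V)} (hH : IsQAlgebraic H) {X : EndC V}
    (hX : X ∈ lieAlgC H) (hn : IsNilpotent X) {g : GLC V} (hg : (g : EndC V) = IsNilpotent.exp X) :
    g ∈ H := by
  obtain ⟨N, hN⟩ := hn
  rw [hH.mem_iff]
  intro f hf
  -- Each derivative in `t` replaces the function by another one that vanishes on `H`, and at t = 0
  -- the curve is at 1 ∈ H; so the polynomial has zero Taylor coefficients.
  have hall : ∀ n, ∀ F : MvPolynomial (V × Module.Dual ℚ V) ℂ,
      (∀ g ∈ H, eval (coef (g : EndC V)) F = 0) →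
      (Polynomial.derivative^[n] (aeval (expCurve X N) F)).eval 0 = 0 := by
    intro n
    induction n with
    | zero =>
      intro F hF
      rw [Function.iterate_zero, id, eval_aeval_expCurve hN, zero_smul, IsNilpotent.exp_zero]
      exact hF 1 H.one_mem
    | succ n ih =>
      intro F hF
      rw [Function.iterate_succ_apply, derivative_aeval_expCurve hN]
      exact ih _ (hH.invField_vanish hX hF)
  have h0 := polynomial_eq_zero_of_iterate_derivative (p := aeval (expCurve X N)
    (map (algebraMap ℚ ℂ) f)) fun n => hall n _ fun g hg => by rw [eval_map_rat]; exact hf g hg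
  have h1 := eval_aeval_expCurve hN (map (algebraMap ℚ ℂ) f) 1
  rw [h0, one_smul, ← hg, eval_map_rat] at h1
  rw [← h1]; simp

/-- The logarithm of a unipotent element of an algebraic group is in the Lie algebra. -/
theorem IsQAlgebraic.mem_lieAlgC_of_exp_mem {H : Subgroup (GLC V)} {X : EndC V}
    (hn : IsNilpotent X) {g : GLC V} (hg : (g : EndC V) = IsNilpotent.exp X) (hgH : g ∈ H) :
    X ∈ lieAlgC H := by
  intro f hf
  have hnil := hn
  obtain ⟨N, hN⟩ := hn
  set p := aeval (expCurve X N) (map (algebraMap ℚ ℂ) f) with hp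
  -- The polynomial t ↦ f(exp tX) vanishes at every natural number n, because exp(nX) = g^n lies in
  -- `H`.
  have h0 : p = 0 := by
    refine Polynomial.eq_zero_of_infinite_isRoot p ?_
    refine Set.infinite_of_injective_forall_mem (f := fun n : ℕ => (n : ℂ)) Nat.cast_injective
      fun n => ?_
    change p.eval (n : ℂ) = 0
    rw [hp, eval_aeval_expCurve hN, Nat.cast_smul_eq_nsmul, exp_nsmul hnil, ← hg,
      ← Units.val_pow_eq_pow_val, eval_map_rat]
    exact hf _ (H.pow_mem hgH n)
  have h1 := derivative_aeval_expCurve hN (map (algebraMap ℚ ℂ) f)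
  rw [← hp, h0] at h1
  have h2 := eval_aeval_expCurve hN (invField X (map (algebraMap ℚ ℂ) f)) 0
  rw [← h1, zero_smul, IsNilpotent.exp_zero, eval_one_invField] at h2
  rw [← h2]; simp

end AlgebraicGroups

/-! ### Opposed filtrations expressed inside V_ℂ. -/

section Subquotients

variable {V : Type*} [AddCommGroup V] [Module ℚ V]

theorem mem_cxSub_iff_exists {U : Submodule ℚ V} {x : Cx V} :
    x ∈ cxSub U ↔ ∃ y : Cx U, cxMap U.subtype y = x := Iff.rfl

/-- Exactness of complexification, tested on rational functionals: functionals of the quotient come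
from functionals vanishing on the smaller subspace, and conversely those extend to all of V. -/
theorem cxMap_mkQ_eq_zero {U' U : Submodule ℚ V} (h : U' ≤ U) {x : Cx U} :
    cxMap (U'.submoduleOf U).mkQ x = 0 ↔ cxMap U.subtype x ∈ cxSub U' := by
  constructor
  · intro hx
    rw [mem_cxSub_iff_dual]
    intro l hl
    have h1 : U'.submoduleOf U ≤ LinearMap.ker (l ∘ₗ U.subtype) := fun u hu => hl u hu
    have h2 : l ∘ₗ U.subtype = ((U'.submoduleOf U).liftQ _ h1) ∘ₗ (U'.submoduleOf U).mkQ :=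
      (Submodule.liftQ_mkQ _ _ _).symm
    rw [← cxDual_comp, h2, cxDual_comp, hx, map_zero]
  · intro hx
    refine eq_zero_of_cxDual fun l => ?_
    obtain ⟨l', hl'⟩ := LinearMap.exists_extend (l ∘ₗ (U'.submoduleOf U).mkQ)
    rw [← cxDual_comp, ← hl', cxDual_comp]
    refine mem_cxSub_iff_dual.1 hx l' fun u hu => ?_
    have h3 := LinearMap.congr_fun hl' ⟨u, h hu⟩
    have h4 : (U'.submoduleOf U).mkQ ⟨u, h hu⟩ = 0 := by
      rw [Submodule.mkQ_apply, Submodule.Quotient.mk_eq_zero]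
      exact hu
    rw [LinearMap.comp_apply, LinearMap.comp_apply, h4, map_zero] at h3
    exact h3

/-- The properties of a mixed Hodge structure, expressed inside `V_ℂ`. -/
structure HodgeRelations (W : ℤ → Submodule ℚ V) (F : Filt V) : Prop where
  mono : Monotone W
  W_bot : ∃ a, W a = ⊥
  W_top : ∃ b, W b = ⊤
  anti : Antitone F
  F_top : ∃ a, F a = ⊤
  F_bot : ∃ b, F b = ⊥
  split : ∀ k p : ℤ, ∀ v ∈ cxSub (W k), ∃ a ∈ F p ⊓ cxSub (W k),
    ∃ b ∈ conjSub (F (k + 1 - p)) ⊓ cxSub (W k), v - a - b ∈ cxSub (W (k - 1))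
  meet : ∀ k p : ℤ, ∀ a ∈ F p ⊓ cxSub (W k), ∀ b ∈ conjSub (F (k + 1 - p)) ⊓ cxSub (W k),
    a - b ∈ cxSub (W (k - 1)) → a ∈ cxSub (W (k - 1))

/-- The two halves of complementarity on Gr_k, existence and uniqueness of a decomposition, are
lifted to vectors of W_k modulo W_{k-1}. The construction of the bigrading can then avoid quotients.
-/
theorem IsMHS.hodgeRelations {W : ℤ → Submodule ℚ V} {F : Filt V} (h : IsMHS W F)
    (mono : Monotone W) (W_bot : ∃ a, W a = ⊥) (W_top : ∃ b, W b = ⊤) : HodgeRelations W F := by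
  refine ⟨mono, W_bot, W_top, h.anti, h.exists_top, h.exists_bot, fun k p v hv => ?_,
    fun k p a ha b hb hab => ?_⟩
  · have hle : W (k - 1) ≤ W k := mono (by omega)
    rw [cxSub_eq_range] at hv
    obtain ⟨x, rfl⟩ := hv
    have hx : cxMap ((W (k - 1)).submoduleOf (W k)).mkQ x ∈
        grF W F k p ⊔ conjSub (grF W F k (k + 1 - p)) := by
      rw [(h.pure k p).sup_eq_top]; trivial
    obtain ⟨y, ⟨a, ha, rfl⟩, z, ⟨b, hb, hbz⟩, hyz⟩ := Submodule.mem_sup.1 hx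
    refine ⟨cxMap (W k).subtype a, ⟨ha, ⟨a, rfl⟩⟩, cxMap (W k).subtype (conjV _ b),
      ⟨?_, ⟨_, rfl⟩⟩, ?_⟩
    · rw [SetLike.mem_coe, mem_conjSub, conjV_cxMap, conjV_conjV]; exact hb
    · rw [← map_sub, ← map_sub, ← cxMap_mkQ_eq_zero hle, map_sub, map_sub, ← hyz,
        ← conjV_cxMap, hbz, conjV_conjV]
      abel
  · have hle : W (k - 1) ≤ W k := mono (by omega)
    obtain ⟨haF, hx⟩ := ha
    obtain ⟨x, rfl⟩ := mem_cxSub_iff_exists.1 hx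
    obtain ⟨hbF, hy⟩ := hb
    obtain ⟨y, rfl⟩ := mem_cxSub_iff_exists.1 hy
    rw [← map_sub, ← cxMap_mkQ_eq_zero hle, map_sub, sub_eq_zero] at hab
    rw [← cxMap_mkQ_eq_zero hle]
    have h1 : cxMap ((W (k - 1)).submoduleOf (W k)).mkQ x ∈
        grF W F k p ⊓ conjSub (grF W F k (k + 1 - p)) := by
      refine ⟨⟨x, haF, rfl⟩, ?_⟩
      rw [hab, SetLike.mem_coe, mem_conjSub, conjV_cxMap]
      exact ⟨conjV _ y, by
        rw [SetLike.mem_coe, mem_conjSub, conjV_cxMap] at hbF; exact hbF, rfl⟩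
    rw [(h.pure k p).inf_eq_bot] at h1
    exact h1

end Subquotients

/-! ### Existence of Deligne's bigrading. -/

section DeligneSplitting

variable {V : Type*} [AddCommGroup V] [Module ℚ V]

/-- The second term in the definition of Deligne's bigrading. -/
def deligneAux (W : ℤ → Submodule ℚ V) (F : Filt V) (p q : ℤ) : Submodule ℂ (Cx V) :=
  (conjSub (F q) ⊓ cxSub (W (p + q))) ⊔
    ⨆ (j : ℤ) (_ : 2 ≤ j), conjSub (F (q - j + 1)) ⊓ cxSub (W (p + q - j))

/-- Deligne's bigrading `I^{p,q}`. -/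
def deligneI (W : ℤ → Submodule ℚ V) (F : Filt V) (p q : ℤ) : Submodule ℂ (Cx V) :=
  (F p ⊓ cxSub (W (p + q))) ⊓ deligneAux W F p q

variable {W : ℤ → Submodule ℚ V} {F : Filt V}

theorem conjSub_mono {A B : Submodule ℂ (Cx V)} (h : A ≤ B) : conjSub A ≤ conjSub B :=
  fun _ hx => h hx

namespace HodgeRelations

variable (h : HodgeRelations W F)
include h

theorem Wc_mono : Monotone fun k => cxSub (W k) := fun _ _ hab => cxSub_mono (h.mono hab)

/-- The missing index j = 1 costs nothing: conj F^q ∩ W_{p+q-1} already lies in the first summand.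
This keeps the later inductions uniform in `j`. -/
theorem mem_deligneAux_of_le {p q j : ℤ} (hj : 1 ≤ j) {x : Cx V}
    (hx : x ∈ conjSub (F (q - j + 1)) ⊓ cxSub (W (p + q - j))) : x ∈ deligneAux W F p q := by
  rcases eq_or_lt_of_le hj with rfl | hj
  · refine Submodule.mem_sup_left ⟨?_, h.Wc_mono (by omega) hx.2⟩
    have := hx.1
    rwa [show q - 1 + 1 = q by ring] at this
  · refine Submodule.mem_sup_right ?_
    exact (le_iSup₂_of_le (f := fun (j : ℤ) (_ : 2 ≤ j) =>
      conjSub (F (q - j + 1)) ⊓ cxSub (W (p + q - j))) j hj le_rfl) hx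

/-- Successive approximation. The discrepancy between an element of F^p and an element of the
auxiliary space, lying in W_{p+q-n-1}, splits along F^p and conj F^{q-n} up to the next lower
weight. The first part corrects the element of F^p, and the second is absorbed by the auxiliary
space. The process stops when W becomes zero. -/
theorem exists_deligneI {p q : ℤ} {v v' : Cx V} (hv : v ∈ F p ⊓ cxSub (W (p + q)))
    (hv' : v' ∈ conjSub (F q) ⊓ cxSub (W (p + q))) (hvv : v - v' ∈ cxSub (W (p + q - 1))) :
    ∃ a ∈ deligneI W F p q, v - a ∈ cxSub (W (p + q - 1)) := by
  have key : ∀ n : ℕ, ∃ a ∈ F p ⊓ cxSub (W (p + q)), ∃ c ∈ deligneAux W F p q,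
      a - c ∈ cxSub (W (p + q - (n + 1))) ∧ v - a ∈ cxSub (W (p + q - 1)) := by
    intro n
    induction n with
    | zero => exact ⟨v, hv, v', Submodule.mem_sup_left hv', by simpa using hvv, by simp⟩
    | succ n ih =>
      obtain ⟨a, ha, c, hc, hac, hva⟩ := ih
      obtain ⟨α, hα, β, hβ, hδ⟩ := h.split (p + q - (n + 1)) p _ hac
      refine ⟨a - α, ⟨(F p).sub_mem ha.1 hα.1, Submodule.sub_mem _ ha.2
        (h.Wc_mono (by omega) hα.2)⟩, c + β, Submodule.add_mem _ hc
        (h.mem_deligneAux_of_le (j := n + 1) (by omega) ⟨?_, hβ.2⟩), ?_, ?_⟩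
      · have := hβ.1
        rwa [show p + q - ((n : ℤ) + 1) + 1 - p = q - (n + 1) + 1 by ring] at this
      · have e : a - α - (c + β) = a - c - α - β := by abel
        rw [e]
        exact h.Wc_mono (by push_cast; omega) hδ
      · have e : v - (a - α) = (v - a) + α := by abel
        rw [e]
        exact Submodule.add_mem _ hva (h.Wc_mono (by omega) hα.2)
  obtain ⟨b, hb⟩ := h.W_bot
  obtain ⟨a, ha, c, hc, hac, hva⟩ := key (p + q - b).toNat
  have h0 : a - c ∈ cxSub (W b) := h.Wc_mono (by omega) hac
  rw [hb, cxSub_bot, Submodule.mem_bot, sub_eq_zero] at h0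
  exact ⟨a, ⟨ha, h0 ▸ hc⟩, hva⟩

/-- For a cutoff `n`, the terms with j ≤ n lie in the conjugate filtration step and those with j > n
in the lower weight step. -/
theorem deligneAux_le (p q n : ℤ) (hn : 1 ≤ n) :
    deligneAux W F p q ≤ conjSub (F (q - n + 1)) ⊔ cxSub (W (p + q - n - 1)) := by
  refine sup_le (inf_le_left.trans (le_sup_of_le_left (conjSub_mono (h.anti (by omega))))) ?_
  refine iSup₂_le fun j hj => ?_
  by_cases hjn : j ≤ n
  · exact inf_le_left.trans (le_sup_of_le_left (conjSub_mono (h.anti (by omega))))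
  · exact inf_le_right.trans (le_sup_of_le_right (h.Wc_mono (by omega)))

/-- On each lower graded piece the class of `v` belongs both to the Hodge filtration and, by
`deligneAux_le`, to the opposite conjugate filtration. So it is zero, and `v` descends one weight at
a time. -/
theorem deligneI_disjoint {p q : ℤ} {v : Cx V} (hv : v ∈ deligneI W F p q)
    (hv' : v ∈ cxSub (W (p + q - 1))) : v = 0 := by
  have key : ∀ n : ℕ, v ∈ cxSub (W (p + q - (n + 1))) := by
    intro n
    induction n with
    | zero => simpa using hv'
    | succ n ih =>
      obtain ⟨c, hc, d, hd, hcd⟩ := Submodule.mem_sup.1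
        (h.deligneAux_le p q (n + 1) (by omega) hv.2)
      have hd' : d ∈ cxSub (W (p + q - (n + 1) - 1)) := hd
      have := h.meet (p + q - (n + 1)) p v ⟨hv.1.1, ih⟩ c ⟨by
          rwa [show p + q - ((n : ℤ) + 1) + 1 - p = q - (n + 1) + 1 by ring], by
          rw [show c = v - d by rw [← hcd]; abel]
          exact Submodule.sub_mem _ ih (h.Wc_mono (by omega) hd')⟩
        (by rw [← hcd]; simpa using hd')
      exact h.Wc_mono (by push_cast; omega) this
  obtain ⟨b, hb⟩ := h.W_bot
  have h0 : v ∈ cxSub (W b) := h.Wc_mono (by omega) (key (p + q - b).toNat)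
  rwa [hb, cxSub_bot, Submodule.mem_bot] at h0

omit h in
theorem deligneI_le_W (p q : ℤ) : deligneI W F p q ≤ cxSub (W (p + q)) :=
  inf_le_left.trans inf_le_right

omit h in
theorem deligneI_le_F (p q : ℤ) : deligneI W F p q ≤ F p :=
  inf_le_left.trans inf_le_left

/-- On Gr_k, removing the component in F^{p+1} leaves a class in F^p ∩ conj F^{k-p}, which lifts to
I^{p,k-p}. The two remainders have larger Hodge index or smaller weight, and this is the step of the
double induction in `F_inf_W_eq`. -/
theorem F_inf_W_step {p k : ℤ} {v : Cx V} (hv : v ∈ F p ⊓ cxSub (W k)) :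
    ∃ i ∈ deligneI W F p (k - p), ∃ a ∈ F (p + 1) ⊓ cxSub (W k),
      v - i - a ∈ F p ⊓ cxSub (W (k - 1)) := by
  obtain ⟨a, ha, b, hb, hw⟩ := h.split k (p + 1) v hv.2
  have hk : p + (k - p) = k := by ring
  have hap : a ∈ F p := h.anti (by omega) ha.1
  obtain ⟨i, hi, hvi⟩ := h.exists_deligneI (p := p) (q := k - p) (v := v - a) (v' := b)
    ⟨(F p).sub_mem hv.1 hap, by rw [hk]; exact Submodule.sub_mem _ hv.2 ha.2⟩
    ⟨by have := hb.1; rwa [show k + 1 - (p + 1) = k - p by ring] at this, by rw [hk]; exact hb.2⟩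
    (by rw [hk]; exact hw)
  rw [hk] at hvi
  have e : v - i - a = v - a - i := by abel
  refine ⟨i, hi, a, ha, ⟨?_, by rw [e]; exact hvi⟩⟩
  exact (F p).sub_mem ((F p).sub_mem hv.1 (deligneI_le_F _ _ hi)) hap

theorem F_inf_W_eq (p k : ℤ) : F p ⊓ cxSub (W k) =
    ⨆ (r : ℤ) (s : ℤ) (_ : p ≤ r ∧ r + s ≤ k), deligneI W F r s := by
  have le_T : ∀ {p k r s : ℤ}, p ≤ r ∧ r + s ≤ k → deligneI W F r s ≤
      ⨆ (r : ℤ) (s : ℤ) (_ : p ≤ r ∧ r + s ≤ k), deligneI W F r s := fun {p k r s} hrs =>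
    le_iSup_of_le r (le_iSup_of_le s (le_iSup_of_le hrs le_rfl))
  have T_mono : ∀ {p k p' k' : ℤ}, p' ≤ p → k ≤ k' →
      (⨆ (r : ℤ) (s : ℤ) (_ : p ≤ r ∧ r + s ≤ k), deligneI W F r s) ≤
      ⨆ (r : ℤ) (s : ℤ) (_ : p' ≤ r ∧ r + s ≤ k'), deligneI W F r s := fun {p k p' k'} hp hk =>
    iSup_le fun r => iSup_le fun s => iSup_le fun hrs => le_T ⟨hp.trans hrs.1, hrs.2.trans hk⟩
  apply le_antisymm
  · obtain ⟨a, ha⟩ := h.W_bot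
    obtain ⟨b, hb⟩ := h.F_bot
    have key : ∀ n m : ℕ, ∀ p k : ℤ, k ≤ a + n → b ≤ p + m → F p ⊓ cxSub (W k) ≤
        ⨆ (r : ℤ) (s : ℤ) (_ : p ≤ r ∧ r + s ≤ k), deligneI W F r s := by
      intro n
      induction n with
      | zero =>
        intro m p k hk _
        have : cxSub (W k) ≤ ⊥ := by
          rw [← cxSub_bot, ← ha]; exact h.Wc_mono (by simpa using hk)
        exact inf_le_right.trans (this.trans bot_le)
      | succ n ihn =>
        intro m
        induction m with
        | zero =>
          intro p k _ hp
          have : F p ≤ ⊥ := hb ▸ h.anti (by simpa using hp)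
          exact inf_le_left.trans (this.trans bot_le)
        | succ m ihm =>
          intro p k hk hp v hv
          obtain ⟨i, hi, c, hc, hw⟩ := h.F_inf_W_step hv
          have h1 := ihm (p + 1) k hk (by push_cast at hp; omega) hc
          have h2 := ihn (m + 1) p (k - 1) (by push_cast at hk; omega) hp hw
          have e : v = i + c + (v - i - c) := by abel
          rw [e]
          exact Submodule.add_mem _ (Submodule.add_mem _ (le_T ⟨le_rfl, by omega⟩ hi)
            (T_mono (by omega) le_rfl h1)) (T_mono le_rfl (by omega) h2)
    exact key (k - a).toNat (b - p).toNat p k (by omega) (by omega)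
  · exact iSup_le fun r => iSup_le fun s => iSup_le fun hrs => le_inf
      ((deligneI_le_F _ _).trans (h.anti hrs.1)) ((deligneI_le_W _ _).trans (h.Wc_mono hrs.2))

theorem W_eq (k : ℤ) : cxSub (W k) =
    ⨆ (r : ℤ) (s : ℤ) (_ : r + s ≤ k), deligneI W F r s := by
  apply le_antisymm
  · obtain ⟨a, ha⟩ := h.F_top
    have := h.F_inf_W_eq a k
    rw [ha, top_inf_eq] at this
    rw [this]
    exact iSup_mono fun r => iSup_mono fun s => iSup_le fun hrs => le_iSup_of_le hrs.2 le_rfl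
  · exact iSup_le fun r => iSup_le fun s => iSup_le fun hrs =>
      (deligneI_le_W _ _).trans (h.Wc_mono hrs)

theorem F_eq (p : ℤ) : F p = ⨆ (r : ℤ) (s : ℤ) (_ : p ≤ r), deligneI W F r s := by
  apply le_antisymm
  · obtain ⟨a, ha⟩ := h.W_top
    have := h.F_inf_W_eq p a
    rw [ha, cxSub_top, inf_top_eq] at this
    rw [this]
    exact iSup_mono fun r => iSup_mono fun s => iSup_le fun hrs => le_iSup_of_le hrs.1 le_rfl
  · exact iSup_le fun r => iSup_le fun s => iSup_le fun hrs =>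
      (deligneI_le_F _ _).trans (h.anti hrs)

theorem iSup_deligneI : ⨆ pq : ℤ × ℤ, deligneI W F pq.1 pq.2 = ⊤ := by
  obtain ⟨a, ha⟩ := h.F_top
  rw [eq_top_iff, ← ha, h.F_eq a]
  exact iSup_le fun r => iSup_le fun s => iSup_le fun _ =>
    le_iSup (fun pq : ℤ × ℤ => deligneI W F pq.1 pq.2) (r, s)

/-- Modulo W_{p+q-1} the vector `v` lies in conj F^q, which is opposite to F^{p+1} in weight p + q.
So `a`, and with it `v`, drops in weight, and `deligneI_disjoint` applies. -/
theorem deligneI_disjoint_later {p q : ℤ} {v a w : Cx V} (hv : v ∈ deligneI W F p q)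
    (ha : a ∈ F (p + 1) ⊓ cxSub (W (p + q))) (hw : w ∈ cxSub (W (p + q - 1)))
    (hsum : v + a + w = 0) : v = 0 := by
  obtain ⟨c, hc, d, hd, hcd⟩ := Submodule.mem_sup.1 hv.2
  have hd' : d ∈ cxSub (W (p + q - 1)) := by
    have : (⨆ (j : ℤ) (_ : 2 ≤ j), conjSub (F (q - j + 1)) ⊓ cxSub (W (p + q - j))) ≤
        cxSub (W (p + q - 1)) := iSup₂_le fun j hj => inf_le_right.trans (h.Wc_mono (by omega))
    exact this hd
  have h1 := h.meet (p + q) (p + 1) a ha (-c) ⟨by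
      rw [show p + q + 1 - (p + 1) = q by ring]; exact Submodule.neg_mem _ hc.1,
      Submodule.neg_mem _ hc.2⟩ (by
    have e : a - -c = -(d + w) := by
      rw [eq_neg_iff_add_eq_zero, ← hsum, ← hcd]; abel
    rw [e]
    exact Submodule.neg_mem _ (Submodule.add_mem _ hd' hw))
  refine h.deligneI_disjoint hv ?_
  have e : v = -(a + w) := by rw [eq_neg_iff_add_eq_zero, ← hsum]; abel
  rw [e]
  exact Submodule.neg_mem _ (Submodule.add_mem _ h1 hw)

theorem deligneAux_mono {p q r s : ℤ} (hr : r < p) (hs : s < q) :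
    deligneAux W F r s ≤ deligneAux W F p q := by
  refine sup_le (fun x hx => h.mem_deligneAux_of_le (j := p + q - r - s) (by omega)
    ⟨conjSub_mono (h.anti (by omega)) hx.1, h.Wc_mono (by omega) hx.2⟩) ?_
  exact iSup₂_le fun i hi x hx => h.mem_deligneAux_of_le (j := p + q - r - s + i) (by omega)
    ⟨conjSub_mono (h.anti (by omega)) hx.1, h.Wc_mono (by omega) hx.2⟩

/-- Conjugating the auxiliary condition writes the conjugate vector as an element of F^p ∩ W_{p+q}
plus terms of strictly smaller bidegree. Those terms lie in the auxiliary space for (p, q) by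
`deligneAux_mono`, so the first summand does too and belongs to I^{p,q}. -/
theorem conjV_mem {p q : ℤ} {v : Cx V} (hv : v ∈ deligneI W F q p) :
    conjV V v ∈ deligneI W F p q ⊔
      ⨆ (r : ℤ) (s : ℤ) (_ : r < p ∧ s < q), deligneI W F r s := by
  set R := ⨆ (r : ℤ) (s : ℤ) (_ : r < p ∧ s < q), deligneI W F r s with hR
  have hRaux : R ≤ deligneAux W F p q := iSup_le fun r => iSup_le fun s => iSup_le fun hrs =>
    inf_le_right.trans (h.deligneAux_mono hrs.1 hrs.2)
  have h1 : conjV V v ∈ conjSub (F q) ⊓ cxSub (W (p + q)) := by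
    refine ⟨?_, ?_⟩
    · rw [SetLike.mem_coe, mem_conjSub, conjV_conjV]; exact hv.1.1
    · have := conjV_mem_cxSub hv.1.2
      rwa [add_comm] at this
  have h2 : deligneAux W F q p ≤ conjSub ((F p ⊓ cxSub (W (p + q))) ⊔ R) := by
    refine sup_le (fun x hx => ?_) (iSup₂_le fun j hj x hx => ?_)
    · refine Submodule.mem_sup_left ⟨hx.1, ?_⟩
      have := conjV_mem_cxSub hx.2
      rwa [add_comm] at this
    · have hx' : conjV V x ∈ F (p - j + 1) ⊓ cxSub (W (p + q - j)) := by
        refine ⟨hx.1, ?_⟩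
        have := conjV_mem_cxSub hx.2
        rwa [add_comm q p] at this
      rw [h.F_inf_W_eq] at hx'
      rw [mem_conjSub]
      refine (iSup_le fun r => iSup_le fun s => iSup_le fun hrs => ?_ :
        (⨆ (r : ℤ) (s : ℤ) (_ : p - j + 1 ≤ r ∧ r + s ≤ p + q - j), deligneI W F r s) ≤ _) hx'
      by_cases hr : p ≤ r
      · exact le_sup_of_le_left (le_inf ((deligneI_le_F _ _).trans (h.anti hr))
          ((deligneI_le_W _ _).trans (h.Wc_mono (by omega))))
      · exact le_sup_of_le_right (le_iSup_of_le r (le_iSup_of_le s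
          (le_iSup_of_le ⟨by omega, by omega⟩ le_rfl)))
  obtain ⟨a, ha, b, hb, hab⟩ := Submodule.mem_sup.1 (h2 hv.2)
  rw [← hab]
  refine Submodule.add_mem_sup ⟨ha, ?_⟩ hb
  have e : a = conjV V v - b := by rw [← hab]; abel
  rw [e]
  exact Submodule.sub_mem _ (Submodule.mem_sup_left h1) (hRaux hb)

/-- One inclusion is `conjV_mem`. The other applies it twice, using that the strictly lower terms
for (q, p) are conjugated into those for (p, q). -/
theorem deligneI_conj (p q : ℤ) :
    deligneI W F p q ⊔ (⨆ (r : ℤ) (s : ℤ) (_ : r < p ∧ s < q), deligneI W F r s) =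
      conjSub (deligneI W F q p) ⊔
        (⨆ (r : ℤ) (s : ℤ) (_ : r < p ∧ s < q), deligneI W F r s) := by
  apply le_antisymm
  · refine sup_le (fun x hx => ?_) le_sup_right
    obtain ⟨a, ha, b, hb, hab⟩ := Submodule.mem_sup.1 (h.conjV_mem hx)
    have e : x = conjV V a + conjV V b := by rw [← map_add, hab, conjV_conjV]
    rw [e]
    refine Submodule.add_mem_sup (by rw [mem_conjSub, conjV_conjV]; exact ha) ?_
    have : (⨆ (r : ℤ) (s : ℤ) (_ : r < q ∧ s < p), deligneI W F r s) ≤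
        conjSub (⨆ (r : ℤ) (s : ℤ) (_ : r < p ∧ s < q), deligneI W F r s) := by
      refine iSup_le fun r => iSup_le fun s => iSup_le fun hrs y hy => ?_
      rw [mem_conjSub]
      have hle : deligneI W F s r ⊔ (⨆ (r' : ℤ) (s' : ℤ) (_ : r' < s ∧ s' < r),
          deligneI W F r' s') ≤ ⨆ (r : ℤ) (s : ℤ) (_ : r < p ∧ s < q), deligneI W F r s := by
        refine sup_le ?_ ?_
        · exact le_iSup_of_le s (le_iSup_of_le r (le_iSup_of_le ⟨hrs.2, hrs.1⟩ le_rfl))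
        · exact iSup_le fun r' => iSup_le fun s' => iSup_le fun hrs' => le_iSup_of_le r'
            (le_iSup_of_le s' (le_iSup_of_le ⟨by omega, by omega⟩ le_rfl))
      exact hle (h.conjV_mem hy)
    exact this hb
  · refine sup_le (fun x hx => ?_) le_sup_right
    have := h.conjV_mem (p := p) (q := q) hx
    rwa [conjV_conjV] at this

theorem iSupIndep_deligneI : iSupIndep fun pq : ℤ × ℤ => deligneI W F pq.1 pq.2 := by
  rw [iSupIndep_iff_finsetSum_eq_zero_imp_eq_zero]
  intro s v hv hsum
  by_contra hcon
  push Not at hcon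
  obtain ⟨i₀, hi₀, hvi₀⟩ := hcon
  classical
  set t := s.filter fun i => v i ≠ 0 with ht
  have htne : t.Nonempty := ⟨i₀, by simp [ht, hi₀, hvi₀]⟩
  -- The leading term has the highest weight and, among those, the smallest first index. Every other
  -- term then lies in F^{p+1} ∩ W_{p+q} or in W_{p+q-1}, as `deligneI_disjoint_later` requires.
  obtain ⟨a, ha, hamin⟩ := Finset.exists_min_image t
    (fun i : ℤ × ℤ => toLex (-(i.1 + i.2), i.1)) htne
  have hat := Finset.mem_filter.1 ha
  obtain ⟨p, q⟩ := a
  have hsum' : ∑ i ∈ t, v i = 0 := by rw [ht, Finset.sum_filter_ne_zero]; exact hsum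
  rw [← Finset.add_sum_erase t v ha] at hsum'
  have hrest : ∑ i ∈ t.erase (p, q), v i ∈
      (F (p + 1) ⊓ cxSub (W (p + q))) ⊔ cxSub (W (p + q - 1)) := by
    refine Submodule.sum_mem _ fun i hi => ?_
    obtain ⟨hne, hit⟩ := Finset.mem_erase.1 hi
    have hle := hamin i hit
    have hvi := hv i (Finset.mem_filter.1 hit).1
    rw [Prod.Lex.toLex_le_toLex] at hle
    rcases hle with hlt | ⟨heq, hle⟩
    · refine Submodule.mem_sup_right (h.Wc_mono ?_ (deligneI_le_W _ _ hvi))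
      simp only at hlt
      omega
    · simp only at heq hle
      have hlt : p < i.1 := by
        refine lt_of_le_of_ne hle fun hp => hne ?_
        exact Prod.ext hp.symm (by simp only; omega)
      refine Submodule.mem_sup_left ⟨h.anti (by omega) (deligneI_le_F _ _ hvi),
        h.Wc_mono (by omega) (deligneI_le_W _ _ hvi)⟩
  obtain ⟨b, hb, w, hw, hbw⟩ := Submodule.mem_sup.1 hrest
  refine hat.2 (h.deligneI_disjoint_later (hv _ hat.1) hb hw ?_)
  rw [add_assoc, hbw, hsum']

theorem isInternal_deligneI : DirectSum.IsInternal fun pq : ℤ × ℤ => deligneI W F pq.1 pq.2 :=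
  DirectSum.isInternal_submodule_of_iSupIndep_of_iSup_eq_top h.iSupIndep_deligneI h.iSup_deligneI

end HodgeRelations

/-! ### Bigradings as homomorphisms from the Deligne torus. -/

section Torus

variable (I : ℤ × ℤ → Submodule ℂ (Cx V)) (hI : DirectSum.IsInternal I)

/-- The equivalence of `V_ℂ` with the direct sum of the pieces of a bigrading. -/
def bigradingEquiv : (DirectSum (ℤ × ℤ) fun i => I i) ≃ₗ[ℂ] Cx V :=
  LinearEquiv.ofBijective (DirectSum.coeLinearMap I) hI

/-- The operator that acts on the `i`-th piece of a bigrading as the scalar `c i`. -/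
def bigradingScalar (c : ℤ × ℤ → ℂ) : EndC V :=
  (bigradingEquiv I hI).conj (DirectSum.lmap fun i => c i • LinearMap.id)

theorem bigradingScalar_apply (c : ℤ × ℤ → ℂ) (i : ℤ × ℤ) {x : Cx V} (hx : x ∈ I i) :
    bigradingScalar I hI c x = c i • x := by
  have h1 : x = bigradingEquiv I hI (DirectSum.lof ℂ _ (fun i => I i) i ⟨x, hx⟩) :=
    (DirectSum.coeLinearMap_lof I i ⟨x, hx⟩).symm
  conv_lhs => rw [h1]
  rw [bigradingScalar, LinearEquiv.conj_apply_apply, LinearEquiv.symm_apply_apply,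
    DirectSum.lmap_lof, LinearMap.smul_apply, map_smul, map_smul, LinearMap.id_apply, ← h1]

include hI in
theorem bigrading_end_ext {M : Type*} [AddCommGroup M] [Module ℂ M] {f g : Cx V →ₗ[ℂ] M}
    (h : ∀ i, ∀ x ∈ I i, f x = g x) : f = g := by
  have : f ∘ₗ (bigradingEquiv I hI).toLinearMap = g ∘ₗ (bigradingEquiv I hI).toLinearMap := by
    refine DirectSum.linearMap_ext ℂ fun i => LinearMap.ext fun x => ?_
    change f (bigradingEquiv I hI (DirectSum.lof ℂ _ (fun i => I i) i x)) =
      g (bigradingEquiv I hI (DirectSum.lof ℂ _ (fun i => I i) i x))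
    have h1 : bigradingEquiv I hI (DirectSum.lof ℂ _ (fun i => I i) i x) = x :=
      DirectSum.coeLinearMap_lof I i x
    rw [h1]
    exact h i x x.2
  refine LinearMap.ext fun x => ?_
  obtain ⟨y, rfl⟩ := (bigradingEquiv I hI).surjective x
  exact LinearMap.congr_fun this y

theorem bigradingScalar_mul (c d : ℤ × ℤ → ℂ) :
    bigradingScalar I hI (c * d) = bigradingScalar I hI c * bigradingScalar I hI d := by
  refine bigrading_end_ext I hI fun i x hx => ?_
  rw [Module.End.mul_apply, bigradingScalar_apply I hI _ i hx, bigradingScalar_apply I hI _ i hx,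
    map_smul, bigradingScalar_apply I hI _ i hx, smul_smul, mul_comm]
  rfl

theorem bigradingScalar_one : bigradingScalar I hI 1 = 1 := by
  refine bigrading_end_ext I hI fun i x hx => ?_
  rw [bigradingScalar_apply I hI _ i hx]
  simp

/-- The characters `(z, w) ↦ z^{-p} w^{-q}` of the Deligne torus. -/
def torusChar : ℂˣ × ℂˣ →* (ℤ × ℤ → ℂˣ) where
  toFun zw i := zw.1 ^ (-i.1) * zw.2 ^ (-i.2)
  map_one' := by ext i; simp
  map_mul' a b := by
    funext i
    simp only [Prod.fst_mul, Prod.snd_mul, mul_zpow, Pi.mul_apply]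
    rw [mul_mul_mul_comm]

/-- The homomorphism from the Deligne torus defined by a bigrading. -/
def bigradingHom : ℂˣ × ℂˣ →* GLC V :=
  (Units.map (M := ℤ × ℤ → ℂ) (N := EndC V) ⟨⟨bigradingScalar I hI, bigradingScalar_one I hI⟩,
    bigradingScalar_mul I hI⟩).comp (MulEquiv.piUnits.symm.toMonoidHom.comp torusChar)

theorem bigradingHom_apply (zw : ℂˣ × ℂˣ) (i : ℤ × ℤ) {x : Cx V} (hx : x ∈ I i) :
    (bigradingHom I hI zw : EndC V) x = ((zw.1 ^ (-i.1) * zw.2 ^ (-i.2) : ℂˣ) : ℂ) • x :=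
  bigradingScalar_apply I hI _ i hx

theorem mem_wtSpace {h : ℂˣ × ℂˣ →* GLC V} {p q : ℤ} {x : Cx V} : x ∈ wtSpace h p q ↔
    ∀ zw : ℂˣ × ℂˣ, (h zw : EndC V) x = ((zw.1 ^ (-p) * zw.2 ^ (-q) : ℂˣ) : ℂ) • x := by
  simp only [wtSpace, Submodule.mem_iInf, Module.End.mem_eigenspace_iff]

theorem wtSpace_bigradingHom (p q : ℤ) : wtSpace (bigradingHom I hI) p q = I (p, q) := by
  apply le_antisymm
  · intro x hx
    rw [mem_wtSpace] at hx
    obtain ⟨y, rfl⟩ := (bigradingEquiv I hI).surjective x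
    have key : ∀ zw : ℂˣ × ℂˣ, ∀ i : ℤ × ℤ, ((zw.1 ^ (-i.1) * zw.2 ^ (-i.2) : ℂˣ) : ℂ) • y i =
        ((zw.1 ^ (-p) * zw.2 ^ (-q) : ℂˣ) : ℂ) • y i := by
      intro zw i
      have h1 := hx zw
      change bigradingScalar I hI _ _ = _ at h1
      rw [bigradingScalar, LinearEquiv.conj_apply_apply, LinearEquiv.symm_apply_apply,
        ← map_smul] at h1
      have h2 := DFunLike.congr_fun ((bigradingEquiv I hI).injective h1) i
      exact h2
    -- The two points (2, 1) and (1, 2) of the torus suffice to separate the characters, since the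
    -- integral powers of 2 are distinct.
    have two : (2 : ℂ) ≠ 0 := two_ne_zero
    have hinj : ∀ a b : ℤ, ((Units.mk0 (2 : ℂ) two ^ (-a) : ℂˣ) : ℂ) =
        ((Units.mk0 (2 : ℂ) two ^ (-b) : ℂˣ) : ℂ) → a = b := by
      intro a b hab
      rw [Units.val_zpow_eq_zpow_val, Units.val_zpow_eq_zpow_val, Units.val_mk0] at hab
      have h3 : ((2 : ℝ) ^ (-a)) = (2 : ℝ) ^ (-b) := by
        apply Complex.ofReal_injective
        push_cast
        exact hab
      have := zpow_right_injective₀ (a := (2 : ℝ)) (by norm_num) (by norm_num) h3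
      omega
    have hy0 : ∀ i, i ≠ (p, q) → y i = 0 := by
      intro i hi
      by_contra hne
      apply hi
      have e1 := sub_eq_zero.2 (key (Units.mk0 2 two, 1) i)
      have e2 := sub_eq_zero.2 (key (1, Units.mk0 2 two) i)
      rw [← sub_smul, smul_eq_zero, or_iff_left hne, sub_eq_zero] at e1 e2
      simp only [one_zpow, mul_one, one_mul] at e1 e2
      exact Prod.ext (hinj _ _ e1) (hinj _ _ e2)
    have hy : y = DirectSum.lof ℂ _ (fun i => I i) (p, q) (y (p, q)) := by
      refine DFinsupp.ext fun i => ?_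
      by_cases hi : i = (p, q)
      · subst hi
        exact (DirectSum.of_eq_same (β := fun i => I i) (p, q) (y (p, q))).symm
      · rw [hy0 i hi]
        exact (DirectSum.of_eq_of_ne (β := fun i => I i) (p, q) i (y (p, q)) hi).symm
    have h4 : bigradingEquiv I hI y = y (p, q) := by
      conv_lhs => rw [hy]
      exact DirectSum.coeLinearMap_lof I (p, q) (y (p, q))
    rw [h4]
    exact (y (p, q)).2
  · intro x hx
    rw [mem_wtSpace]
    exact fun zw => bigradingHom_apply I hI zw (p, q) hx

end Torus

/-- Existence of Deligne's bigrading. -/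
theorem HodgeRelations.exists_isDeligneHom (h : HodgeRelations W F) :
    ∃ h₀, IsDeligneHom W F h₀ := by
  refine ⟨bigradingHom _ h.isInternal_deligneI, ?_, fun k => ?_, fun p => ?_, fun p q => ?_⟩
  · simp only [wtSpace_bigradingHom]
    exact h.isInternal_deligneI
  · simp only [wtSpace_bigradingHom]
    exact h.W_eq k
  · simp only [hodgeFil, wtSpace_bigradingHom]
    exact h.F_eq p
  · simp only [wtSpace_bigradingHom]
    exact h.deligneI_conj p q

end DeligneSplitting

/-! ### The weight filtration on End(V_ℂ). -/

section WeightFiltration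

variable {V : Type*} [AddCommGroup V] [Module ℚ V] {S : HodgeData V}

/-- `W_{-k} End(V_ℂ)`. -/
def wEnd (S : HodgeData V) (k : ℕ) : Submodule ℂ (EndC V) where
  carrier := {X | ∀ n : ℤ, ∀ v ∈ cxSub (S.W n), X v ∈ cxSub (S.W (n - k))}
  zero_mem' := fun _ _ _ => Submodule.zero_mem _
  add_mem' := fun hX hY n v hv => Submodule.add_mem _ (hX n v hv) (hY n v hv)
  smul_mem' := fun c _ hX n v hv => Submodule.smul_mem _ c (hX n v hv)

theorem wEnd_anti {k l : ℕ} (h : k ≤ l) : wEnd S l ≤ wEnd S k := fun _ hX n v hv =>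
  cxSub_mono (S.mono (by omega)) (hX n v hv)

theorem mul_mem_wEnd {k l : ℕ} {X Y : EndC V} (hX : X ∈ wEnd S k) (hY : Y ∈ wEnd S l) :
    X * Y ∈ wEnd S (k + l) := fun n v hv => by
  have := hX _ _ (hY n v hv)
  rwa [show n - (l : ℤ) - k = n - ((k + l : ℕ) : ℤ) by push_cast; ring] at this

theorem mul_mem_wEnd_left {k : ℕ} {X Y : EndC V} (hX : X ∈ wEnd S 0) (hY : Y ∈ wEnd S k) :
    X * Y ∈ wEnd S k := by simpa using mul_mem_wEnd hX hY

theorem mul_mem_wEnd_right {k : ℕ} {X Y : EndC V} (hX : X ∈ wEnd S k) (hY : Y ∈ wEnd S 0) :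
    X * Y ∈ wEnd S k := by simpa using mul_mem_wEnd hX hY

theorem one_mem_wEnd : (1 : EndC V) ∈ wEnd S 0 := fun n v hv => by simpa using hv

theorem mem_wEnd_zero {k : ℕ} {X : EndC V} (hX : X ∈ wEnd S k) : X ∈ wEnd S 0 :=
  wEnd_anti (Nat.zero_le _) hX

theorem pow_mem_wEnd {k : ℕ} {X : EndC V} (hX : X ∈ wEnd S k) (n : ℕ) :
    X ^ n ∈ wEnd S (n * k) := by
  induction n with
  | zero => simpa using one_mem_wEnd
  | succ n ih => rw [pow_succ, Nat.succ_mul]; exact mul_mem_wEnd ih hX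

/-- The length of the weight filtration. -/
theorem exists_wEnd_eq_bot (S : HodgeData V) : ∃ N, ∀ k, N ≤ k → wEnd S k = ⊥ := by
  obtain ⟨a, ha⟩ := S.exists_bot
  obtain ⟨b, hb⟩ := S.exists_top
  refine ⟨(b - a).toNat, fun k hk => ?_⟩
  rw [eq_bot_iff]
  intro X hX
  refine LinearMap.ext fun v => ?_
  have h1 := hX b v (by rw [hb, cxSub_top]; trivial)
  have h2 : X v ∈ cxSub (S.W a) := cxSub_mono (S.mono (by omega)) h1
  rwa [ha, cxSub_bot, Submodule.mem_bot] at h2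

theorem isNilpotent_of_mem_wEnd {X : EndC V} {k : ℕ} (hk : 1 ≤ k) (hX : X ∈ wEnd S k) :
    IsNilpotent X := by
  obtain ⟨N, hN⟩ := exists_wEnd_eq_bot S
  refine ⟨N, ?_⟩
  have := pow_mem_wEnd hX N
  rwa [hN _ (Nat.le_mul_of_pos_right N hk), Submodule.mem_bot] at this

theorem galE_mem_wEnd {k : ℕ} {X : EndC V} (hX : X ∈ wEnd S k) (σ : ℂ ≃+* ℂ) :
    galE σ X ∈ wEnd S k := fun n _ hv => galV_mem_cxSub _ (hX n _ (galV_mem_cxSub _ hv))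

theorem cxHom_mem_wEnd {k : ℕ} {X : Module.End ℚ V} :
    cxHom V X ∈ wEnd S k ↔ ∀ n : ℤ, ∀ v ∈ S.W n, X v ∈ S.W (n - k) := by
  constructor
  · intro h n v hv
    exact toCx_mem_cxSub_iff.1 (h n (toCx v) (toCx_mem_cxSub hv))
  · exact fun h n v hv => map_mem_of_mem_cxSub (fun w hw => toCx_mem_cxSub (h n w hw)) hv

theorem pow_sub_pow_mem_wEnd {k : ℕ} {X Y : EndC V} (hX : X ∈ wEnd S 0) (hY : Y ∈ wEnd S 0)
    (h : X - Y ∈ wEnd S k) (n : ℕ) : X ^ n - Y ^ n ∈ wEnd S k := by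
  induction n with
  | zero => simp
  | succ n ih =>
    have e : X ^ (n + 1) - Y ^ (n + 1) = (X ^ n - Y ^ n) * X + Y ^ n * (X - Y) := by
      rw [pow_succ, pow_succ]; noncomm_ring
    rw [e]
    have hYn : Y ^ n ∈ wEnd S 0 := by simpa using pow_mem_wEnd hY n
    exact Submodule.add_mem _ (mul_mem_wEnd_right ih hX) (mul_mem_wEnd_left hYn h)

theorem rat_smul_mem {N : Submodule ℂ (EndC V)} (q : ℚ) {X : EndC V} (hX : X ∈ N) : q • X ∈ N := by
  have : q • X = (q : ℂ) • X := by
    rw [← algebraMap_smul ℂ]; simp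
  rw [this]; exact N.smul_mem _ hX

theorem exp_sub_exp_mem_wEnd {k : ℕ} {X Y : EndC V} (hX : X ∈ wEnd S 1) (hY : Y ∈ wEnd S 1)
    (h : X - Y ∈ wEnd S k) : IsNilpotent.exp X - IsNilpotent.exp Y ∈ wEnd S k := by
  obtain ⟨N, hN⟩ := isNilpotent_of_mem_wEnd le_rfl hX
  obtain ⟨M, hM⟩ := isNilpotent_of_mem_wEnd le_rfl hY
  rw [IsNilpotent.exp_eq_sum (pow_eq_zero_of_le (le_max_left N M) hN),
    IsNilpotent.exp_eq_sum (pow_eq_zero_of_le (le_max_right N M) hM), ← Finset.sum_sub_distrib]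
  refine Submodule.sum_mem _ fun i _ => ?_
  rw [← smul_sub]
  exact rat_smul_mem _ (pow_sub_pow_mem_wEnd (mem_wEnd_zero hX) (mem_wEnd_zero hY) h i)

theorem exp_sub_one_mem_wEnd {k : ℕ} (hk : 1 ≤ k) {X : EndC V} (hX : X ∈ wEnd S k) :
    IsNilpotent.exp X - 1 ∈ wEnd S k := by
  rw [← IsNilpotent.exp_zero]
  exact exp_sub_exp_mem_wEnd (wEnd_anti hk hX) (Submodule.zero_mem _) (by simpa using hX)

/-- The terms of order at least two lie in W_{-2k}, hence in W_{-(k+1)} because k ≥ 1. This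
linearises the group W_{-k} modulo W_{-(k+1)} in all approximation arguments. -/
theorem exp_sub_one_sub_mem_wEnd {k : ℕ} (hk : 1 ≤ k) {X : EndC V} (hX : X ∈ wEnd S k) :
    IsNilpotent.exp X - 1 - X ∈ wEnd S (k + 1) := by
  obtain ⟨N, hN⟩ := isNilpotent_of_mem_wEnd hk hX
  have hN2 : X ^ (N + 2) = 0 := pow_eq_zero_of_le (by omega) hN
  rw [IsNilpotent.exp_eq_sum hN2, Finset.sum_range_succ', Finset.sum_range_succ']
  have e : ∀ A : EndC V, A + ((0 + 1).factorial : ℚ)⁻¹ • X ^ (0 + 1) +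
      ((0).factorial : ℚ)⁻¹ • X ^ 0 - 1 - X = A := fun A => by simp
  rw [e]
  refine Submodule.sum_mem _ fun i _ => rat_smul_mem _ ?_
  refine wEnd_anti ?_ (pow_mem_wEnd hX (i + 1 + 1))
  nlinarith

theorem nilLog_sub_nilLog_mem_wEnd {k : ℕ} {u v : EndC V} (hu : u - 1 ∈ wEnd S 1)
    (hv : v - 1 ∈ wEnd S 1) (h : u - v ∈ wEnd S k) : nilLog u - nilLog v ∈ wEnd S k := by
  obtain ⟨N, hN⟩ := isNilpotent_of_mem_wEnd le_rfl hu
  obtain ⟨M, hM⟩ := isNilpotent_of_mem_wEnd le_rfl hv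
  rw [nilLog_eq_sum (pow_eq_zero_of_le (le_max_left N M) hN),
    nilLog_eq_sum (pow_eq_zero_of_le (le_max_right N M) hM), ← Finset.sum_sub_distrib]
  refine Submodule.sum_mem _ fun i _ => ?_
  rw [← smul_sub]
  refine rat_smul_mem _ (pow_sub_pow_mem_wEnd (mem_wEnd_zero hu) (mem_wEnd_zero hv) ?_ i)
  simpa using h

theorem nilLog_one : nilLog (1 : EndC V) = 0 := by
  have := nilLog_exp (IsNilpotent.zero (R := EndC V))
  rwa [IsNilpotent.exp_zero] at this

theorem nilLog_mem_wEnd {k : ℕ} (hk : 1 ≤ k) {u : EndC V} (hu : u - 1 ∈ wEnd S k) :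
    nilLog u ∈ wEnd S k := by
  have := nilLog_sub_nilLog_mem_wEnd (S := S) (u := u) (v := 1) (wEnd_anti hk hu) (by simp) hu
  rwa [nilLog_one, sub_zero] at this

theorem exp_nilLog_of_mem {k : ℕ} (hk : 1 ≤ k) {u : EndC V} (hu : u - 1 ∈ wEnd S k) :
    IsNilpotent.exp (nilLog u) = u := exp_nilLog (isNilpotent_of_mem_wEnd hk hu)

theorem nilLog_exp_of_mem {k : ℕ} (hk : 1 ≤ k) {X : EndC V} (hX : X ∈ wEnd S k) :
    nilLog (IsNilpotent.exp X) = X := nilLog_exp (isNilpotent_of_mem_wEnd hk hX)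

theorem galE_exp (σ : ℂ ≃+* ℂ) {X : EndC V} (hX : IsNilpotent X) :
    galE σ (IsNilpotent.exp X) = IsNilpotent.exp (galE σ X) := IsNilpotent.map_exp hX (galE σ)

/-- Conjugation by a unit, as a ring automorphism. -/
def conjE (g : GLC V) : EndC V ≃+* EndC V where
  toFun X := g * X * (g⁻¹ : GLC V)
  invFun X := (g⁻¹ : GLC V) * X * g
  left_inv X := by simp [mul_assoc]
  right_inv X := by simp [mul_assoc]
  map_mul' X Y := by simp [mul_assoc]
  map_add' X Y := by rw [mul_add, add_mul]

theorem conjE_apply (g : GLC V) (X : EndC V) :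
    conjE g X = (g : EndC V) * X * ((g⁻¹ : GLC V) : EndC V) := rfl

theorem conjE_smul (g : GLC V) (c : ℂ) (X : EndC V) : conjE g (c • X) = c • conjE g X := by
  simp [conjE_apply]

theorem conjE_exp (g : GLC V) {X : EndC V} (hX : IsNilpotent X) :
    conjE g (IsNilpotent.exp X) = IsNilpotent.exp (conjE g X) := IsNilpotent.map_exp hX (conjE g)

theorem conjE_mem_wEnd {g : GLC V} (hg : (g : EndC V) ∈ wEnd S 0)
    (hg' : ((g⁻¹ : GLC V) : EndC V) ∈ wEnd S 0) {k : ℕ} {X : EndC V} (hX : X ∈ wEnd S k) :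
    conjE g X ∈ wEnd S k := mul_mem_wEnd_right (mul_mem_wEnd_left hg hX) hg'

/-- The exponential of a nilpotent endomorphism, as a unit. -/
def expUnit (X : EndC V) (hX : IsNilpotent X) : GLC V where
  val := IsNilpotent.exp X
  inv := IsNilpotent.exp (-X)
  val_inv := IsNilpotent.exp_mul_exp_neg_self hX
  inv_val := IsNilpotent.exp_neg_mul_exp_self hX

@[simp] theorem coe_expUnit (X : EndC V) (hX : IsNilpotent X) :
    (expUnit X hX : EndC V) = IsNilpotent.exp X := rfl

end WeightFiltration

/-! ### The unipotent groups W_{-k} and their Lie algebras. -/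

section WeightGroups

variable {V : Type*} [AddCommGroup V] [Module ℚ V] {S : HodgeData V} {P : Subgroup (GLC V)}

/-- A `ℚ`-algebraic group that preserves the weight filtration. -/
structure IsWeightGroup (S : HodgeData V) (P : Subgroup (GLC V)) : Prop where
  alg : IsQAlgebraic P
  mem_wEnd : ∀ g ∈ P, (g : EndC V) ∈ wEnd S 0

/-- The subgroup of the elements of `P` that are congruent to `1` modulo `W_{-k} End(V_ℂ)`. -/
def unipSub (S : HodgeData V) (P : Subgroup (GLC V)) (k : ℕ) : Subgroup (GLC V) where
  carrier := {g | g ∈ P ∧ (g : EndC V) ∈ wEnd S 0 ∧ ((g⁻¹ : GLC V) : EndC V) ∈ wEnd S 0 ∧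
    (g : EndC V) - 1 ∈ wEnd S k}
  one_mem' := ⟨P.one_mem, one_mem_wEnd, by simpa using one_mem_wEnd, by simp⟩
  mul_mem' := by
    rintro a b ⟨ha, ha0, hai, ha1⟩ ⟨hb, hb0, hbi, hb1⟩
    refine ⟨P.mul_mem ha hb, mul_mem_wEnd_left ha0 hb0, ?_, ?_⟩
    · rw [mul_inv_rev]; exact mul_mem_wEnd_left hbi hai
    · have e : ((a * b : GLC V) : EndC V) - 1 = ((a : EndC V) - 1) * b + ((b : EndC V) - 1) := by
        rw [Units.val_mul]; noncomm_ring
      rw [e]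
      exact Submodule.add_mem _ (mul_mem_wEnd_right ha1 hb0) hb1
  inv_mem' := by
    rintro a ⟨ha, ha0, hai, ha1⟩
    refine ⟨P.inv_mem ha, hai, by simpa using ha0, ?_⟩
    have e : ((a⁻¹ : GLC V) : EndC V) - 1 = -(((a⁻¹ : GLC V) : EndC V) * ((a : EndC V) - 1)) := by
      rw [mul_sub, Units.inv_mul]; noncomm_ring
    rw [e]
    exact Submodule.neg_mem _ (mul_mem_wEnd_left hai ha1)

theorem unipSub_le (k : ℕ) : unipSub S P k ≤ P := fun _ h => h.1

theorem unipSub_anti {k l : ℕ} (h : k ≤ l) : unipSub S P l ≤ unipSub S P k :=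
  fun _ hg => ⟨hg.1, hg.2.1, hg.2.2.1, wEnd_anti h hg.2.2.2⟩

theorem IsWeightGroup.mem_unipSub (hP : IsWeightGroup S P) {k : ℕ} {g : GLC V} :
    g ∈ unipSub S P k ↔ g ∈ P ∧ (g : EndC V) - 1 ∈ wEnd S k :=
  ⟨fun h => ⟨h.1, h.2.2.2⟩, fun h => ⟨h.1, hP.mem_wEnd _ h.1, hP.mem_wEnd _ (P.inv_mem h.1), h.2⟩⟩

theorem IsWeightGroup.conjE_mem_wEnd (hP : IsWeightGroup S P) {g : GLC V} (hg : g ∈ P) {k : ℕ}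
    {X : EndC V} (hX : X ∈ wEnd S k) : conjE g X ∈ wEnd S k :=
  MixedHodge.conjE_mem_wEnd (hP.mem_wEnd _ hg) (hP.mem_wEnd _ (P.inv_mem hg)) hX

theorem IsWeightGroup.conj_mem_unipSub (hP : IsWeightGroup S P) {g u : GLC V} (hg : g ∈ P) {k : ℕ}
    (hu : u ∈ unipSub S P k) : g * u * g⁻¹ ∈ unipSub S P k := by
  rw [hP.mem_unipSub] at hu ⊢
  refine ⟨P.mul_mem (P.mul_mem hg hu.1) (P.inv_mem hg), ?_⟩
  have := hP.conjE_mem_wEnd hg hu.2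
  rwa [map_sub, map_one] at this

theorem IsWeightGroup.galG_mem_unipSub (hP : IsWeightGroup S P) {u : GLC V} {k : ℕ}
    (hu : u ∈ unipSub S P k) (σ : ℂ ≃+* ℂ) : galG σ u ∈ unipSub S P k := by
  rw [hP.mem_unipSub] at hu ⊢
  refine ⟨hP.alg.galG_mem σ hu.1, ?_⟩
  have := galE_mem_wEnd hu.2 σ
  rwa [map_sub, map_one] at this

variable [Module.Finite ℚ V]

/-- Both spaces in the intersection are stable under automorphisms of ℂ, so their intersection is
spanned by rational endomorphisms, and the rational ones are exactly W_{-k}(Lie P). -/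
theorem lieWC_eq (S : HodgeData V) (P : Subgroup (GLC V)) (k : ℕ) :
    lieWC S P k = lieAlgC P ⊓ wEnd S k := by
  rw [span_cxHom_of_stable (lieAlgC P ⊓ wEnd S k) fun T hT σ =>
    ⟨galE_mem_lieAlgC σ hT.1, galE_mem_wEnd hT.2 σ⟩]
  rw [lieWC]
  congr 1
  ext T
  constructor
  · rintro ⟨X, hX, rfl⟩
    exact ⟨X, ⟨cxHom_mem_lieAlgC.2 hX.1, cxHom_mem_wEnd.2 hX.2⟩, rfl⟩
  · rintro ⟨X, hX, rfl⟩
    exact ⟨X, ⟨cxHom_mem_lieAlgC.1 hX.1, cxHom_mem_wEnd.1 hX.2⟩, rfl⟩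

theorem lieWC_le_wEnd (k : ℕ) : lieWC S P k ≤ wEnd S k := by
  rw [lieWC_eq]; exact inf_le_right

theorem galE_mem_lieWC {k : ℕ} {X : EndC V} (hX : X ∈ lieWC S P k) (σ : ℂ ≃+* ℂ) :
    galE σ X ∈ lieWC S P k := by
  rw [lieWC_eq] at hX ⊢
  exact ⟨galE_mem_lieAlgC σ hX.1, galE_mem_wEnd hX.2 σ⟩

theorem isNilpotent_of_mem_lieWC {k : ℕ} (hk : 1 ≤ k) {X : EndC V} (hX : X ∈ lieWC S P k) :
    IsNilpotent X := isNilpotent_of_mem_wEnd hk (lieWC_le_wEnd k hX)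

theorem mem_lieWC_of_exp {k : ℕ} (hk : 1 ≤ k) {X : EndC V} (hX : X ∈ wEnd S k) {g : GLC V}
    (hg : (g : EndC V) = IsNilpotent.exp X) (hgP : g ∈ P) : X ∈ lieWC S P k := by
  rw [lieWC_eq]
  exact ⟨IsQAlgebraic.mem_lieAlgC_of_exp_mem (isNilpotent_of_mem_wEnd hk hX) hg hgP, hX⟩

theorem nilLog_mem_lieWC {k : ℕ} (hk : 1 ≤ k) {u : GLC V} (hu : u ∈ unipSub S P k) :
    nilLog (u : EndC V) ∈ lieWC S P k :=
  mem_lieWC_of_exp hk (nilLog_mem_wEnd hk hu.2.2.2) (exp_nilLog_of_mem hk hu.2.2.2).symm hu.1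

namespace IsWeightGroup

variable (hP : IsWeightGroup S P)
include hP

theorem exp_mem {k : ℕ} (hk : 1 ≤ k) {X : EndC V} (hX : X ∈ lieWC S P k) {g : GLC V}
    (hg : (g : EndC V) = IsNilpotent.exp X) : g ∈ unipSub S P k := by
  rw [hP.mem_unipSub]
  refine ⟨?_, ?_⟩
  · have h1 := hX
    rw [lieWC_eq] at h1
    exact hP.alg.exp_mem h1.1 (isNilpotent_of_mem_lieWC hk hX) hg
  · rw [hg]; exact exp_sub_one_mem_wEnd hk (lieWC_le_wEnd _ hX)

theorem expUnit_mem {k : ℕ} (hk : 1 ≤ k) {X : EndC V} (hX : X ∈ lieWC S P k) :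
    expUnit X (isNilpotent_of_mem_lieWC hk hX) ∈ unipSub S P k := hP.exp_mem hk hX rfl

/-- The generated group is no larger than the set of exponentials: an element of `P` congruent to 1
has a nilpotent logarithm, which is tangent to `P`, and nilpotent tangent vectors exponentiate into
`P`. So W_{-k} becomes a congruence subgroup. -/
theorem wGroup_eq {k : ℕ} (hk : 1 ≤ k) : wGroup S P k = unipSub S P k := by
  apply le_antisymm
  · rw [wGroup, Subgroup.closure_le]
    rintro g ⟨X, hX, hg⟩
    exact hP.exp_mem hk hX hg
  · intro g hg
    exact Subgroup.subset_closure
      ⟨nilLog (g : EndC V), nilLog_mem_lieWC hk hg, (exp_nilLog_of_mem hk hg.2.2.2).symm⟩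

/-- Stability of the Lie algebra is read off from the group: conjugation commutes with the
exponential, and the logarithm of an element of `P` is tangent to `P`. -/
theorem conjE_mem_lieWC {k : ℕ} (hk : 1 ≤ k) {g : GLC V} (hg : g ∈ P) {X : EndC V}
    (hX : X ∈ lieWC S P k) : conjE g X ∈ lieWC S P k := by
  refine mem_lieWC_of_exp hk (hP.conjE_mem_wEnd hg (lieWC_le_wEnd _ hX))
    (g := g * expUnit X (isNilpotent_of_mem_lieWC hk hX) * g⁻¹) ?_
    (P.mul_mem (P.mul_mem hg (hP.expUnit_mem hk hX).1) (P.inv_mem hg))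
  rw [← conjE_exp g (isNilpotent_of_mem_lieWC hk hX)]
  rfl

end IsWeightGroup

end WeightGroups

/-! ### Weight elements: conjugacy and rationality. -/

section WeightOperators

variable {V : Type*} [AddCommGroup V] [Module ℚ V] {S : HodgeData V} {P : Subgroup (GLC V)}

/-- An operator that acts on the graded pieces of weight `k` as the scalar `2 ^ k`. -/
def IsWeightOp (S : HodgeData V) (a : EndC V) : Prop :=
  ∀ k : ℤ, ∀ v ∈ cxSub (S.W k), a v - (2 : ℂ) ^ k • v ∈ cxSub (S.W (k - 1))

theorem IsWeightOp.sub_mem {a b : EndC V} (ha : IsWeightOp S a) (hb : IsWeightOp S b) :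
    a - b ∈ wEnd S 1 := fun n v hv => by
  have e : (a - b) v = (a v - (2 : ℂ) ^ n • v) - (b v - (2 : ℂ) ^ n • v) := by
    rw [LinearMap.sub_apply]; abel
  rw [e]
  exact Submodule.sub_mem _ (ha n v hv) (hb n v hv)

theorem IsWeightOp.of_sub_mem {a b : EndC V} (ha : IsWeightOp S a) (hb : b - a ∈ wEnd S 1) :
    IsWeightOp S b := fun n v hv => by
  have e : b v - (2 : ℂ) ^ n • v = (a v - (2 : ℂ) ^ n • v) + (b - a) v := by
    rw [LinearMap.sub_apply]; abel
  rw [e]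
  exact Submodule.add_mem _ (ha n v hv) (hb n v hv)

theorem IsWeightOp.galE {a : EndC V} (ha : IsWeightOp S a) (σ : ℂ ≃+* ℂ) :
    IsWeightOp S (galE σ a) := fun n v hv => by
  have h1 := galV_mem_cxSub (σ : ℂ →+* ℂ) (ha n _ (galV_mem_cxSub (σ.symm : ℂ →+* ℂ) hv))
  rw [map_sub, map_smulₛₗ, galV_galV_symm] at h1
  have h2 : (σ : ℂ →+* ℂ) ((2 : ℂ) ^ n) = (2 : ℂ) ^ n := by
    rw [map_zpow₀, map_ofNat]
  rwa [h2] at h1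

theorem IsWeightOp.mul_sub_mem {a X : EndC V} (ha : IsWeightOp S a) {k : ℕ} (hX : X ∈ wEnd S k) :
    a * X - ((2 : ℂ) ^ (-(k : ℤ))) • (X * a) ∈ wEnd S (k + 1) := fun n v hv => by
  have h1 := ha _ _ (hX n v hv)
  have h2 := Submodule.smul_mem _ ((2 : ℂ) ^ (-(k : ℤ))) (hX _ _ (ha n v hv))
  have e : (a * X - ((2 : ℂ) ^ (-(k : ℤ))) • (X * a)) v =
      (a (X v) - (2 : ℂ) ^ (n - k : ℤ) • X v) -
        (2 : ℂ) ^ (-(k : ℤ)) • X (a v - (2 : ℂ) ^ n • v) := by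
    rw [map_sub, map_smul, smul_sub, smul_smul, ← zpow_add₀ two_ne_zero,
      show -(k : ℤ) + n = n - k by ring]
    simp only [LinearMap.sub_apply, LinearMap.smul_apply, Module.End.mul_apply]
    abel
  rw [e]
  refine Submodule.sub_mem _ ?_ ?_
  · rwa [show n - ((k + 1 : ℕ) : ℤ) = n - k - 1 by push_cast; ring]
  · rwa [show n - ((k + 1 : ℕ) : ℤ) = n - 1 - k by push_cast; ring]

/-- An endomorphism in W_{-k} maps Gr_n to Gr_{n-k}, so conjugation multiplies its symbol by 2^{n-k}
/ 2^n. This scalar, different from 1 for k ≥ 1, drives the rest of the proof. -/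
theorem IsWeightOp.conjE_sub_mem (hP : IsWeightGroup S P) {a : GLC V} (haP : a ∈ P)
    (ha : IsWeightOp S (a : EndC V)) {k : ℕ} {X : EndC V} (hX : X ∈ wEnd S k) :
    conjE a X - ((2 : ℂ) ^ (-(k : ℤ))) • X ∈ wEnd S (k + 1) := by
  have e : conjE a X - ((2 : ℂ) ^ (-(k : ℤ))) • X =
      ((a : EndC V) * X - ((2 : ℂ) ^ (-(k : ℤ))) • (X * (a : EndC V))) *
        ((a⁻¹ : GLC V) : EndC V) := by
    rw [sub_mul, smul_mul_assoc, mul_assoc X, Units.mul_inv, mul_one, conjE_apply]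
  rw [e]
  exact mul_mem_wEnd_right (ha.mul_sub_mem hX) (hP.mem_wEnd _ (P.inv_mem haP))

theorem two_zpow_neg_ne_one {k : ℕ} (hk : 1 ≤ k) : (1 : ℂ) - (2 : ℂ) ^ (-(k : ℤ)) ≠ 0 := by
  rw [zpow_neg, zpow_natCast, sub_ne_zero]
  intro h
  have h1 : (2 : ℂ) ^ k = 1 := by rw [← inv_inj, ← h, inv_one]
  have h2 : (2 : ℕ) ^ k = 1 := by exact_mod_cast h1
  have h3 : 2 ^ 1 ≤ 2 ^ k := Nat.pow_le_pow_right (by norm_num) hk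
  omega

variable [Module.Finite ℚ V]

/-- Two elements of `P` that act on the graded pieces of weight `k` as `2 ^ k` are conjugate under
the unipotent part. -/
theorem IsWeightGroup.exists_conj (hP : IsWeightGroup S P) {a b : GLC V} (ha : a ∈ P) (hb : b ∈ P)
    (haw : IsWeightOp S (a : EndC V)) (hbw : IsWeightOp S (b : EndC V)) :
    ∃ u ∈ unipSub S P 1, b = u * a * u⁻¹ := by
  have key : ∀ k : ℕ, ∃ u ∈ unipSub S P 1, b * (u * a * u⁻¹)⁻¹ ∈ unipSub S P (k + 1) := by
    intro k
    induction k with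
    | zero =>
      refine ⟨1, one_mem _, ?_⟩
      rw [one_mul, inv_one, mul_one, hP.mem_unipSub]
      refine ⟨P.mul_mem hb (P.inv_mem ha), ?_⟩
      have e : ((b * a⁻¹ : GLC V) : EndC V) - 1 =
          ((b : EndC V) - a) * ((a⁻¹ : GLC V) : EndC V) := by
        rw [sub_mul, Units.mul_inv, Units.val_mul]
      rw [e]
      exact mul_mem_wEnd_right (hbw.sub_mem haw) (hP.mem_wEnd _ (P.inv_mem ha))
    | succ k ih =>
      obtain ⟨u, hu, hn⟩ := ih
      have hk : 1 ≤ k + 1 := by omega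
      set a' := u * a * u⁻¹ with ha'
      have ha'P : a' ∈ P := P.mul_mem (P.mul_mem hu.1 ha) (P.inv_mem hu.1)
      have ha'w : IsWeightOp S (a' : EndC V) := by
        refine hbw.of_sub_mem ?_
        have h1 := wEnd_anti hk hn.2.2.2
        have e : (a' : EndC V) - b = -((((b * a'⁻¹ : GLC V) : EndC V) - 1) * a') := by
          have e0 : ((b * a'⁻¹ : GLC V) : EndC V) * (a' : EndC V) = b := by
            rw [← Units.val_mul, inv_mul_cancel_right]
          rw [sub_mul, one_mul, e0]; abel
        rw [e]
        exact Submodule.neg_mem _ (mul_mem_wEnd_right h1 (hP.mem_wEnd _ ha'P))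
      have hZm := nilLog_mem_lieWC hk hn
      have hexpZ := exp_nilLog_of_mem hk hn.2.2.2
      generalize nilLog ((b * a'⁻¹ : GLC V) : EndC V) = Z at hZm hexpZ
      -- The constant solves Z + 2^{-(k+1)} c Z - c Z = 0: conjugating by exp(c Z) changes the
      -- discrepancy exp(Z) to first order by the last two terms, so it cancels up to W_{-(k+2)}.
      set c := ((1 : ℂ) - (2 : ℂ) ^ (-((k + 1 : ℕ) : ℤ)))⁻¹ with hc
      have hXm : c • Z ∈ lieWC S P (k + 1) := Submodule.smul_mem _ _ hZm
      set v := expUnit (c • Z) (isNilpotent_of_mem_lieWC hk hXm) with hv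
      have hvm : v ∈ unipSub S P (k + 1) := hP.expUnit_mem hk hXm
      refine ⟨v * u, mul_mem (unipSub_anti hk hvm) hu, ?_⟩
      have e1 : b * (v * u * a * (v * u)⁻¹)⁻¹ = b * a'⁻¹ * (a' * v * a'⁻¹) * v⁻¹ := by
        rw [ha']; group
      rw [e1, hP.mem_unipSub]
      refine ⟨P.mul_mem (P.mul_mem hn.1 (P.mul_mem (P.mul_mem ha'P hvm.1) (P.inv_mem ha'P)))
        (P.inv_mem hvm.1), ?_⟩
      have e2 : ((b * a'⁻¹ * (a' * v * a'⁻¹) * v⁻¹ : GLC V) : EndC V) - 1 =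
          (((b * a'⁻¹ : GLC V) : EndC V) * conjE a' v - v) * ((v⁻¹ : GLC V) : EndC V) := by
        rw [sub_mul, Units.mul_inv]; rfl
      rw [e2]
      refine mul_mem_wEnd_right ?_ (hP.mem_wEnd _ (P.inv_mem hvm.1))
      have hZw := lieWC_le_wEnd _ hZm
      have hXw := lieWC_le_wEnd _ hXm
      have m1 := exp_sub_one_sub_mem_wEnd hk hZw
      rw [hexpZ] at m1
      have m2 := exp_sub_one_sub_mem_wEnd hk hXw
      have hXw' := hP.conjE_mem_wEnd ha'P hXw
      have m3 := exp_sub_one_sub_mem_wEnd hk hXw'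
      rw [← conjE_exp a' (isNilpotent_of_mem_lieWC hk hXm)] at m3
      have m4 := IsWeightOp.conjE_sub_mem hP ha'P ha'w hXw
      set n := ((b * a'⁻¹ : GLC V) : EndC V)
      have ev : (v : EndC V) = IsNilpotent.exp (c • Z) := rfl
      rw [← ev] at m2 m3
      have hn1 : n - 1 ∈ wEnd S (k + 1) := hn.2.2.2
      have hcv1 : conjE a' v - 1 ∈ wEnd S (k + 1) := by
        have := hP.conjE_mem_wEnd ha'P hvm.2.2.2
        rwa [map_sub, map_one] at this
      have m5 : (n - 1) * (conjE a' v - 1) ∈ wEnd S (k + 1 + 1) :=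
        wEnd_anti (by omega) (mul_mem_wEnd hn1 hcv1)
      have hcc : Z + (2 : ℂ) ^ (-((k + 1 : ℕ) : ℤ)) • (c • Z) - c • Z = 0 := by
        have h0 := two_zpow_neg_ne_one hk
        have h1 : (1 : ℂ) + (2 : ℂ) ^ (-((k + 1 : ℕ) : ℤ)) * c - c = 0 := by
          rw [hc]; field_simp; ring
        have h2 : Z + (2 : ℂ) ^ (-((k + 1 : ℕ) : ℤ)) • (c • Z) - c • Z =
            ((1 : ℂ) + (2 : ℂ) ^ (-((k + 1 : ℕ) : ℤ)) * c - c) • Z := by module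
        rw [h2, h1, zero_smul]
      have e3 : n * conjE a' v - v = (n - 1) * (conjE a' v - 1) + (n - 1 - Z) +
          (conjE a' v - 1 - conjE a' (c • Z)) - ((v : EndC V) - 1 - c • Z) +
          (conjE a' (c • Z) - (2 : ℂ) ^ (-((k + 1 : ℕ) : ℤ)) • (c • Z)) +
          (Z + (2 : ℂ) ^ (-((k + 1 : ℕ) : ℤ)) • (c • Z) - c • Z) := by noncomm_ring
      rw [e3, hcc, add_zero]
      exact Submodule.add_mem _ (Submodule.sub_mem _ (Submodule.add_mem _
        (Submodule.add_mem _ m5 m1) m3) m2) m4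
  obtain ⟨N, hN⟩ := exists_wEnd_eq_bot S
  obtain ⟨u, hu, hn⟩ := key N
  refine ⟨u, hu, ?_⟩
  have h1 := hn.2.2.2
  rw [hN _ (by omega), Submodule.mem_bot, sub_eq_zero] at h1
  have h2 : b * (u * a * u⁻¹)⁻¹ = 1 := Units.ext h1
  rwa [mul_inv_eq_one] at h2

/-- An endomorphism whose class modulo a Galois-stable subspace is invariant is congruent to a
rational one. -/
theorem exists_cxHom_sub_mem (N : Submodule ℂ (EndC V)) (hN : ∀ T ∈ N, ∀ σ, galE σ T ∈ N)
    (x : EndC V) (hx : ∀ σ, galE σ x - x ∈ N) : ∃ r, cxHom V r - x ∈ N := by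
  by_cases hxN : x ∈ N
  · exact ⟨0, by rw [map_zero, zero_sub]; exact N.neg_mem hxN⟩
  set N₁ := N ⊔ Submodule.span ℂ {x} with hN₁
  have hstab : ∀ T ∈ N₁, ∀ σ, galE σ T ∈ N₁ := by
    intro T hT σ
    obtain ⟨n, hn, y, hy, rfl⟩ := Submodule.mem_sup.1 hT
    obtain ⟨c, rfl⟩ := Submodule.mem_span_singleton.1 hy
    have e : galE σ (n + c • x) = (galE σ n + σ c • (galE σ x - x)) + σ c • x := by
      rw [map_add, galE_smul]; module
    rw [e]
    exact Submodule.add_mem_sup (N.add_mem (hN n hn σ) (N.smul_mem _ (hx σ)))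
      (Submodule.smul_mem _ _ (Submodule.mem_span_singleton_self x))
  have hspan := span_cxHom_of_stable N₁ hstab
  have hex : ∃ r, cxHom V r ∈ N₁ ∧ cxHom V r ∉ N := by
    by_contra hcon
    push Not at hcon
    have : N₁ ≤ N := by
      rw [hspan, Submodule.span_le]
      rintro _ ⟨f, hf, rfl⟩
      exact hcon f hf
    exact hxN (this (Submodule.mem_sup_right (Submodule.mem_span_singleton_self x)))
  obtain ⟨r, hr, hrN⟩ := hex
  obtain ⟨n, hn, y, hy, hny⟩ := Submodule.mem_sup.1 hr
  obtain ⟨c, rfl⟩ := Submodule.mem_span_singleton.1 hy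
  have hc0 : c ≠ 0 := by
    rintro rfl
    rw [zero_smul, add_zero] at hny
    exact hrN (hny ▸ hn)
  -- If some `σ` moved `c`, invariance of the rational vector n + c x would put a nonzero multiple
  -- of `x` into `N`. Hence `c` is fixed by all automorphisms.
  obtain ⟨q, rfl⟩ : ∃ q : ℚ, c = q := by
    refine exists_rat_of_forall_ringEquiv_fixed c fun σ => ?_
    have h1 := galE_cxHom σ r
    rw [← hny, map_add, galE_smul] at h1
    have h2 : (σ c - c) • x ∈ N := by
      have e : (σ c - c) • x = n - galE σ n - σ c • (galE σ x - x) := by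
        have h3 : galE σ n = n + c • x - σ c • galE σ x := by rw [← h1]; abel
        rw [h3]; module
      rw [e]
      exact N.sub_mem (N.sub_mem hn (hN n hn σ)) (N.smul_mem _ (hx σ))
    by_contra hne
    have h3 := N.smul_mem (σ c - c)⁻¹ h2
    rw [smul_smul, inv_mul_cancel₀ (sub_ne_zero.2 hne), one_smul] at h3
    exact hxN h3
  refine ⟨q⁻¹ • r, ?_⟩
  have e : cxHom V (q⁻¹ • r) - x = (q : ℂ)⁻¹ • n := by
    rw [cxHom_smul, ← hny, smul_add, smul_smul, Rat.cast_inv, inv_mul_cancel₀ hc0]; module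
  rw [e]
  exact N.smul_mem _ hn

/-- If `P` contains a weight operator, it contains a rational one. -/
theorem IsWeightGroup.exists_rational_weightOp (hP : IsWeightGroup S P) {a : GLC V} (ha : a ∈ P)
    (haw : IsWeightOp S (a : EndC V)) :
    ∃ b ∈ P, IsWeightOp S (b : EndC V) ∧ ∀ σ, galE σ (b : EndC V) = b := by
  have key : ∀ k : ℕ, ∃ b ∈ P, IsWeightOp S (b : EndC V) ∧
      ∀ σ, galE σ (b : EndC V) - b ∈ wEnd S (k + 1) := by
    intro k
    induction k with
    | zero => exact ⟨a, ha, haw, fun σ => (haw.galE σ).sub_mem haw⟩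
    | succ k ih =>
      obtain ⟨b, hb, hbw, hσ⟩ := ih
      have hk : 1 ≤ k + 1 := by omega
      have hb0 := hP.mem_wEnd _ hb
      -- Modulo W_{-(k+2)} the conjugates of `b` differ from `b` by Z b with Z in the Lie algebra.
      -- So `b` is Galois-invariant modulo `N`, and descent gives a rational endomorphism congruent
      -- to it.
      set N := (lieWC S P (k + 1)).map (LinearMap.mulRight ℂ (b : EndC V)) ⊔ wEnd S (k + 1 + 1)
        with hN
      have hsub : ∀ σ, ∃ Z ∈ lieWC S P (k + 1), galE σ (b : EndC V) - b - Z * b ∈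
          wEnd S (k + 1 + 1) := by
        intro σ
        have h1 : galG σ b * b⁻¹ ∈ unipSub S P (k + 1) := by
          rw [hP.mem_unipSub]
          refine ⟨P.mul_mem (hP.alg.galG_mem σ hb) (P.inv_mem hb), ?_⟩
          have e : ((galG σ b * b⁻¹ : GLC V) : EndC V) - 1 =
              (galE σ (b : EndC V) - b) * ((b⁻¹ : GLC V) : EndC V) := by
            rw [sub_mul, Units.mul_inv]; rfl
          rw [e]
          exact mul_mem_wEnd_right (hσ σ) (hP.mem_wEnd _ (P.inv_mem hb))
        refine ⟨_, nilLog_mem_lieWC hk h1, ?_⟩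
        have h2 := exp_sub_one_sub_mem_wEnd hk (nilLog_mem_wEnd hk h1.2.2.2)
        rw [exp_nilLog_of_mem hk h1.2.2.2] at h2
        have h3 := mul_mem_wEnd_right h2 hb0
        have e : ∀ Z : EndC V, (((galG σ b * b⁻¹ : GLC V) : EndC V) - 1 - Z) * (b : EndC V) =
            galE σ (b : EndC V) - b - Z * b := by
          intro Z
          rw [sub_mul, sub_mul, one_mul, Units.val_mul, mul_assoc, Units.inv_mul, mul_one]
          rfl
        rwa [e] at h3
      have hNst : ∀ T ∈ N, ∀ σ, galE σ T ∈ N := by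
        intro T hT σ
        obtain ⟨_, ⟨X, hX, rfl⟩, Y, hY, rfl⟩ := Submodule.mem_sup.1 hT
        have e : galE σ (LinearMap.mulRight ℂ (b : EndC V) X + Y) = galE σ X * b +
            (galE σ X * (galE σ (b : EndC V) - b) + galE σ Y) := by
          rw [map_add, LinearMap.mulRight_apply, map_mul]; noncomm_ring
        rw [e]
        refine Submodule.add_mem_sup ⟨galE σ X, galE_mem_lieWC hX σ, rfl⟩
          (Submodule.add_mem _ ?_ (galE_mem_wEnd hY σ))
        exact wEnd_anti (by omega)
          (mul_mem_wEnd (lieWC_le_wEnd _ (galE_mem_lieWC hX σ)) (hσ σ))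
      obtain ⟨r, hr⟩ := exists_cxHom_sub_mem N hNst (b : EndC V) fun σ => by
        obtain ⟨Z, hZ, hZ'⟩ := hsub σ
        have e : galE σ (b : EndC V) - b = Z * b + (galE σ (b : EndC V) - b - Z * b) := by abel
        rw [e]
        exact Submodule.add_mem_sup ⟨Z, hZ, rfl⟩ hZ'
      obtain ⟨_, ⟨X, hX, rfl⟩, Y, hY, hXY⟩ := Submodule.mem_sup.1 hr
      rw [LinearMap.mulRight_apply] at hXY
      -- Multiplying by exp X realises the correction X b inside the group `P`; the result agrees
      -- with the rational endomorphism one step further, so its conjugates agree with it one step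
      -- further.
      set v := expUnit X (isNilpotent_of_mem_lieWC hk hX) with hv
      have hvm : v ∈ unipSub S P (k + 1) := hP.expUnit_mem hk hX
      have hdiff : ((v * b : GLC V) : EndC V) - cxHom V r ∈ wEnd S (k + 1 + 1) := by
        have h1 := mul_mem_wEnd_right (exp_sub_one_sub_mem_wEnd hk (lieWC_le_wEnd _ hX)) hb0
        have e : ((v * b : GLC V) : EndC V) - cxHom V r = (IsNilpotent.exp X - 1 - X) * b - Y := by
          have h2 : cxHom V r = X * b + Y + b := by rw [hXY]; abel
          rw [h2, Units.val_mul, hv, coe_expUnit]; noncomm_ring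
        rw [e]
        exact Submodule.sub_mem _ h1 hY
      refine ⟨v * b, P.mul_mem hvm.1 hb, hbw.of_sub_mem ?_, fun σ => ?_⟩
      · have e : ((v * b : GLC V) : EndC V) - b = ((v : EndC V) - 1) * b := by
          rw [sub_mul, one_mul]; rfl
        rw [e]
        exact mul_mem_wEnd_right (wEnd_anti hk hvm.2.2.2) hb0
      · have h1 := galE_mem_wEnd hdiff σ
        rw [map_sub, galE_cxHom] at h1
        have h2 := Submodule.sub_mem _ h1 hdiff
        rwa [sub_sub_sub_cancel_right] at h2
  obtain ⟨N, hN⟩ := exists_wEnd_eq_bot S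
  obtain ⟨b, hb, hbw, hσ⟩ := key N
  refine ⟨b, hb, hbw, fun σ => ?_⟩
  have := hσ σ
  rwa [hN _ (by omega), Submodule.mem_bot, sub_eq_zero] at this

end WeightOperators

/-! ### The grading of End(V_ℂ) defined by a weight element. -/

section DegreeParts

open Polynomial

variable {V : Type*} [AddCommGroup V] [Module ℚ V] {S : HodgeData V} {P : Subgroup (GLC V)}

/-- Conjugation by a unit, as a complex linear map. -/
def adC (g : GLC V) : Module.End ℂ (EndC V) where
  toFun := conjE g
  map_add' := map_add _
  map_smul' := conjE_smul g

theorem adC_apply (g : GLC V) (X : EndC V) : adC g X = conjE g X := rfl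

/-- A number `N ≥ 1` such that `W_{-N} End(V_ℂ) = 0`. -/
def wLen (S : HodgeData V) : ℕ := (exists_wEnd_eq_bot S).choose + 1

theorem wEnd_eq_bot {k : ℕ} (hk : wLen S ≤ k) : wEnd S k = ⊥ :=
  (exists_wEnd_eq_bot S).choose_spec k (by rw [wLen] at hk; omega)

theorem eq_zero_of_mem_wEnd {k : ℕ} (hk : wLen S ≤ k) {X : EndC V} (hX : X ∈ wEnd S k) : X = 0 := by
  rwa [wEnd_eq_bot hk, Submodule.mem_bot] at hX

/-- The eigenvalue of a weight operator on `End(V)` in degree `-i`. -/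
def adNode (i : ℕ) : ℚ := (2 ^ i)⁻¹

theorem adNode_injective : Function.Injective adNode := fun i j h => by
  have h1 : (2 : ℚ) ^ i = 2 ^ j := inv_injective h
  exact Nat.pow_right_injective le_rfl (by exact_mod_cast h1)

theorem adNode_cast (i : ℕ) : ((adNode i : ℚ) : ℂ) = (2 : ℂ) ^ (-(i : ℤ)) := by
  rw [adNode, zpow_neg, zpow_natCast]; push_cast; rfl

theorem adNode_mul (i j : ℕ) : adNode i * adNode j = adNode (i + j) := by
  rw [adNode, adNode, adNode, pow_add, mul_inv]

/-- The polynomial that separates the eigenvalue in degree `-k`. -/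
def degPoly (S : HodgeData V) (k : ℕ) : ℚ[X] :=
  if k < wLen S then Lagrange.basis (Finset.range (wLen S)) adNode k else 0

/-- The component of degree `-k` of an endomorphism with respect to the weight operator `a`. -/
def degPart (S : HodgeData V) (a : GLC V) (k : ℕ) : Module.End ℂ (EndC V) :=
  aeval (adC a) (degPoly S k)

/-- The map `φ` is only additive, because the intended maps include the semilinear Galois actions;
rational coefficients of the polynomial are what makes it commute. -/
theorem map_aeval_of_commute {M : Type*} [AddCommGroup M] [Module ℂ M] [Module ℚ M]
    [IsScalarTower ℚ ℂ M]
    (A : Module.End ℂ M) (φ : M →+ M) (h : ∀ x, φ (A x) = A (φ x)) (p : ℚ[X]) (x : M) :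
    φ (aeval A p x) = aeval A p (φ x) := by
  induction p using Polynomial.induction_on' generalizing x with
  | add p q hp hq => simp only [map_add, LinearMap.add_apply, hp, hq]
  | monomial n c =>
    rw [aeval_monomial, Algebra.algebraMap_eq_smul_one, smul_one_mul]
    have hpow : ∀ n : ℕ, ∀ x, φ ((A ^ n) x) = (A ^ n) (φ x) := by
      intro n
      induction n with
      | zero => intro x; rfl
      | succ n ih => intro x; rw [pow_succ, Module.End.mul_apply, Module.End.mul_apply, ih, h]
    rw [LinearMap.smul_apply, LinearMap.smul_apply, map_rat_smul, hpow]

theorem degPart_mem {a : GLC V} {N : Submodule ℂ (EndC V)} (hN : ∀ X ∈ N, conjE a X ∈ N)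
    {X : EndC V} (hX : X ∈ N) (k : ℕ) : degPart S a k X ∈ N := by
  rw [degPart]
  generalize degPoly S k = p
  induction p using Polynomial.induction_on' with
  | add p q hp hq => rw [map_add, LinearMap.add_apply]; exact N.add_mem hp hq
  | monomial n c =>
    rw [aeval_monomial, Algebra.algebraMap_eq_smul_one, smul_one_mul, LinearMap.smul_apply]
    refine rat_smul_mem _ ?_
    induction n with
    | zero => exact hX
    | succ n ih => rw [pow_succ', Module.End.mul_apply]; exact hN _ ih

theorem degPart_galE {a : GLC V} {σ : ℂ ≃+* ℂ} (ha : galE σ (a : EndC V) = a) (k : ℕ) (X : EndC V) :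
    degPart S a k (galE σ X) = galE σ (degPart S a k X) := by
  refine (map_aeval_of_commute (adC a) ((galE σ : EndC V ≃+* EndC V) : EndC V →+ EndC V) (fun x => ?_) _ _).symm
  have ha' : galG σ a = a := Units.ext ha
  have h2 : galE σ ((a⁻¹ : GLC V) : EndC V) = ((a⁻¹ : GLC V) : EndC V) := by
    rw [← coe_galG, map_inv, ha']
  change galE σ ((a : EndC V) * x * ((a⁻¹ : GLC V) : EndC V)) = (a : EndC V) * galE σ x * ((a⁻¹ : GLC V) : EndC V)
  rw [map_mul, map_mul, ha, h2]

theorem degPart_conjE {a g : GLC V} (hg : g * a = a * g) (k : ℕ) (X : EndC V) :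
    degPart S a k (conjE g X) = conjE g (degPart S a k X) := by
  refine (map_aeval_of_commute (adC a) (conjE g : EndC V →+ EndC V) (fun x => ?_) _ _).symm
  have h1 : ∀ b c : GLC V, ∀ x, conjE b (conjE c x) = conjE (b * c) x := fun b c x => by
    simp [conjE_apply, mul_assoc]
  change conjE g (conjE a x) = conjE a (conjE g x)
  rw [h1, h1, hg]

/-- An element of `P` that acts on the graded pieces of weight `k` as `2 ^ k`. -/
structure IsWeightElt (S : HodgeData V) (P : Subgroup (GLC V)) (a : GLC V) : Prop where
  group : IsWeightGroup S P
  mem : a ∈ P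
  op : IsWeightOp S (a : EndC V)

namespace IsWeightElt

variable {a : GLC V} (ha : IsWeightElt S P a)
include ha

theorem adC_sub_mem {k : ℕ} {X : EndC V} (hX : X ∈ wEnd S k) :
    aeval (adC a) (Polynomial.X - C (adNode k)) X ∈ wEnd S (k + 1) := by
  have h := IsWeightOp.conjE_sub_mem ha.group ha.mem ha.op hX
  rw [← adNode_cast] at h
  rw [map_sub, aeval_X, aeval_C, LinearMap.sub_apply, Module.algebraMap_end_apply]
  rw [← algebraMap_smul ℂ (adNode k) X]
  simpa [adC_apply] using h

/-- Each factor X - 2^{-j} moves W_{-j} into W_{-(j+1)}; the product of the factors up to the length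
of the filtration kills W_{-k}. -/
theorem aeval_nodal_mem (k l : ℕ) {X : EndC V} (hX : X ∈ wEnd S k) :
    aeval (adC a) (Lagrange.nodal (Finset.Ico k l) adNode) X ∈ wEnd S l := by
  rcases le_total l k with h | h
  · rw [Finset.Ico_eq_empty_of_le h, Lagrange.nodal_empty, map_one]; exact wEnd_anti h hX
  induction l, h using Nat.le_induction with
  | base => rw [Finset.Ico_self, Lagrange.nodal_empty, map_one]; exact hX
  | succ l hl ih =>
    rw [Lagrange.nodal, ← Finset.prod_Ico_mul_eq_prod_Ico_add_one hl, mul_comm, map_mul,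
      Module.End.mul_apply]
    exact ha.adC_sub_mem ih

theorem aeval_apply_eq_zero {k : ℕ} {X : EndC V} (hX : X ∈ wEnd S k) {p : ℚ[X]}
    (hp : Lagrange.nodal (Finset.Ico k (wLen S)) adNode ∣ p) : aeval (adC a) p X = 0 := by
  obtain ⟨q, rfl⟩ := hp
  rw [mul_comm, map_mul, Module.End.mul_apply,
    eq_zero_of_mem_wEnd le_rfl (ha.aeval_nodal_mem k _ hX), map_zero]

omit ha in
theorem aeval_eigen {c : ℚ} {X : EndC V} (hX : conjE a X = c • X) (p : ℚ[X]) :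
    aeval (adC a) p X = p.eval c • X := by
  induction p using Polynomial.induction_on' with
  | add p q hp hq => rw [map_add, LinearMap.add_apply, hp, hq, eval_add, add_smul]
  | monomial n r =>
    rw [aeval_monomial, Algebra.algebraMap_eq_smul_one, smul_one_mul, LinearMap.smul_apply,
      eval_monomial, mul_smul]
    congr 1
    induction n with
    | zero => simp
    | succ n ih =>
      rw [pow_succ', Module.End.mul_apply, ih, adC_apply, map_rat_smul, hX, pow_succ, mul_smul]

-- The Lagrange polynomial for the node `i` contains, up to nonzero constants, the factors of all
-- other nodes, in particular of all those in degree at least k > i.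
omit ha in
theorem nodal_dvd_degPoly {k i : ℕ} (hik : i < k) :
    Lagrange.nodal (Finset.Ico k (wLen S)) adNode ∣ degPoly S i := by
  rw [degPoly]
  split_ifs with h
  · have hsub : Finset.Ico k (wLen S) ⊆ (Finset.range (wLen S)).erase i := fun j hj => by
      simp only [Finset.mem_Ico, Finset.mem_erase, Finset.mem_range] at hj ⊢
      omega
    rw [Lagrange.basis, Lagrange.nodal]
    refine (Finset.prod_dvd_prod_of_subset _ _ _ hsub).trans (Finset.prod_dvd_prod_of_dvd _ _ ?_)
    intro j _
    exact Dvd.intro_left _ rfl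
  · exact dvd_zero _

theorem degPart_eq_zero {k i : ℕ} (hik : i < k) {X : EndC V} (hX : X ∈ wEnd S k) :
    degPart S a i X = 0 := ha.aeval_apply_eq_zero hX (nodal_dvd_degPoly hik)

/-- The remaining factor X - 2^{-k} completes the Lagrange polynomial to a constant multiple of the
nodal polynomial, which annihilates W_0 End. -/
theorem conjE_degPart (k : ℕ) {X : EndC V} (hX : X ∈ wEnd S 0) :
    conjE a (degPart S a k X) = adNode k • degPart S a k X := by
  have h : aeval (adC a) ((Polynomial.X - C (adNode k)) * degPoly S k) X = 0 := by
    refine ha.aeval_apply_eq_zero hX ?_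
    rw [degPoly]
    split_ifs with h
    · have e : (Polynomial.X - C (adNode k)) * Lagrange.basis (Finset.range (wLen S)) adNode k =
        Lagrange.nodal (Finset.range (wLen S)) adNode *
          C (Lagrange.nodalWeight (Finset.range (wLen S)) adNode k) := by
        rw [Lagrange.basis_eq_prod_sub_inv_mul_nodal_div (Finset.mem_range.2 h),
          Lagrange.nodal_eq_mul_nodal_erase (Finset.mem_range.2 h),
          mul_div_cancel_left₀ _ (X_sub_C_ne_zero _)]
        ring
      rw [e, ← Finset.range_eq_Ico]
      exact Dvd.intro _ rfl
    · rw [mul_zero]; exact dvd_zero _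
  rw [map_mul, Module.End.mul_apply, map_sub, aeval_X, aeval_C, LinearMap.sub_apply,
    Module.algebraMap_end_apply, sub_eq_zero] at h
  exact h

/-- As long as `X` is known to lie in W_{-j} with j < k, the operator acts on its class as 2^{-j} ≠
2^{-k}, so the class vanishes and `X` lies one step deeper. -/
theorem mem_wEnd_of_eigen {k : ℕ} {X : EndC V} (hX : X ∈ wEnd S 0)
    (hk : conjE a X = adNode k • X) : X ∈ wEnd S k := by
  have key : ∀ j ≤ k, X ∈ wEnd S j := by
    intro j
    induction j with
    | zero => exact fun _ => hX
    | succ j ih =>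
      intro hj
      have h := ha.adC_sub_mem (ih (by omega))
      rw [aeval_eigen hk] at h
      simp only [eval_sub, eval_X, eval_C] at h
      have h2 := rat_smul_mem (adNode k - adNode j)⁻¹ h
      rwa [smul_smul, inv_mul_cancel₀, one_smul] at h2
      rw [sub_ne_zero]
      exact fun e => by have := adNode_injective e; omega
  exact key k le_rfl

theorem degPart_mem_wEnd (k : ℕ) {X : EndC V} (hX : X ∈ wEnd S 0) : degPart S a k X ∈ wEnd S k :=
  ha.mem_wEnd_of_eigen
    (degPart_mem (fun _ h => ha.group.conjE_mem_wEnd ha.mem h) hX k) (ha.conjE_degPart k hX)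

omit ha in
theorem sum_degPart (a : GLC V) (X : EndC V) :
    ∑ k ∈ Finset.range (wLen S), degPart S a k X = X := by
  simp only [degPart]
  rw [← LinearMap.sum_apply, ← map_sum]
  have e : ∑ k ∈ Finset.range (wLen S), degPoly S k = 1 := by
    rw [← Lagrange.sum_basis (s := Finset.range (wLen S)) adNode_injective.injOn ⟨0, by
      simp [wLen]⟩]
    refine Finset.sum_congr rfl fun k hk => ?_
    rw [degPoly, if_pos (Finset.mem_range.1 hk)]
  rw [e, map_one, Module.End.one_apply]

theorem degPart_of_eigen {k : ℕ} {X : EndC V} (hX : X ∈ wEnd S 0)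
    (hk : conjE a X = adNode k • X) (i : ℕ) : degPart S a i X = if i = k then X else 0 := by
  rcases lt_or_ge k (wLen S) with hlt | hge
  · rw [degPart, aeval_eigen hk, degPoly]
    split_ifs with h1 h2 h2
    · rw [h2, Lagrange.eval_basis_self adNode_injective.injOn (Finset.mem_range.2 hlt), one_smul]
    · rw [Lagrange.eval_basis_of_ne h2 (Finset.mem_range.2 hlt), zero_smul]
    · omega
    · simp
  · rw [eq_zero_of_mem_wEnd hge (ha.mem_wEnd_of_eigen hX hk), map_zero, ite_self]

theorem sub_sum_mem_wEnd (k : ℕ) {X : EndC V} (hX : X ∈ wEnd S 0) :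
    X - ∑ i ∈ Finset.range k, degPart S a i X ∈ wEnd S k := by
  have h0 : ∀ i, wLen S ≤ i → degPart S a i X = 0 := fun i hi => by
    rw [degPart, degPoly, if_neg (by omega), map_zero, LinearMap.zero_apply]
  rcases le_total k (wLen S) with h | h
  · have e := sum_degPart (S := S) a X
    rw [← Finset.sum_range_add_sum_Ico _ h] at e
    nth_rw 1 [← e]
    rw [add_sub_cancel_left]
    refine Submodule.sum_mem _ fun i hi => ?_
    exact wEnd_anti (Finset.mem_Ico.1 hi).1 (ha.degPart_mem_wEnd i hX)
  · have e := sum_degPart (S := S) a X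
    rw [← Finset.sum_subset (Finset.range_mono h) (fun i _ hi => h0 i (by simpa using hi)), e,
      sub_self]
    exact Submodule.zero_mem _

/-- Conjugation is multiplicative and 2^{-i} 2^{-j} = 2^{-(i+j)}, so products of components are
again eigenvectors. This multiplicativity underlies the degree bound for the group law. -/
theorem degPart_mul (k : ℕ) {X Y : EndC V} (hX : X ∈ wEnd S 0) (hY : Y ∈ wEnd S 0) :
    degPart S a k (X * Y) =
      ∑ p ∈ Finset.HasAntidiagonal.antidiagonal k, degPart S a p.1 X * degPart S a p.2 Y := by
  have h0 : ∀ Z i, wLen S ≤ i → degPart S a i Z = 0 := fun Z i hi => by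
    rw [degPart, degPoly, if_neg (by omega), map_zero, LinearMap.zero_apply]
  have hXY : ∀ i j, degPart S a k (degPart S a i X * degPart S a j Y) =
      if k = i + j then degPart S a i X * degPart S a j Y else 0 := fun i j =>
    ha.degPart_of_eigen (mul_mem_wEnd_left (mem_wEnd_zero (ha.degPart_mem_wEnd i hX))
      (mem_wEnd_zero (ha.degPart_mem_wEnd j hY))) (by
        rw [map_mul, ha.conjE_degPart i hX, ha.conjE_degPart j hY, smul_mul_smul_comm, adNode_mul]) k
  conv_lhs => rw [← sum_degPart (S := S) a X, ← sum_degPart (S := S) a Y]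
  rw [Finset.sum_mul_sum, map_sum]
  simp only [map_sum, hXY]
  rw [← Finset.sum_product', ← Finset.sum_filter]
  refine Finset.sum_subset_zero_on_sdiff (fun p hp => ?_) (fun p hp => ?_) (fun _ _ => rfl)
  · simp only [Finset.mem_filter] at hp
    exact Finset.HasAntidiagonal.mem_antidiagonal.2 hp.2.symm
  · simp only [Finset.mem_sdiff, Finset.HasAntidiagonal.mem_antidiagonal, Finset.mem_filter, Finset.mem_product,
      Finset.mem_range, not_and] at hp
    by_cases h1 : p.1 < wLen S
    · by_cases h2 : p.2 < wLen S
      · exact absurd hp.1.symm (hp.2 ⟨h1, h2⟩)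
      · rw [h0 Y p.2 (by omega), mul_zero]
    · rw [h0 X p.1 (by omega), zero_mul]

end IsWeightElt

end DegreeParts

/-! ### The group of similitudes of the graded polarizations. -/

section Similitudes

open MvPolynomial

variable {V : Type*} [AddCommGroup V] [Module ℚ V]

/-- The stabilizer of the weight filtration. -/
def weightStab (S : HodgeData V) : Subgroup (GLC V) where
  carrier := {g | (g : EndC V) ∈ wEnd S 0 ∧ ((g⁻¹ : GLC V) : EndC V) ∈ wEnd S 0}
  one_mem' := ⟨one_mem_wEnd, by simpa using one_mem_wEnd⟩
  mul_mem' := fun ha hb => ⟨mul_mem_wEnd_left ha.1 hb.1, by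
    rw [mul_inv_rev]; exact mul_mem_wEnd_left hb.2 ha.2⟩
  inv_mem' := fun ha => ⟨ha.2, by simpa using ha.1⟩

/-- A rational linear map `V → W_k / W_{k-1}` that is the projection on `W_k`. -/
def grProj (S : HodgeData V) (k : ℤ) : V →ₗ[ℚ] Gr S.W k :=
  ((S.W (k - 1)).submoduleOf (S.W k)).mkQ ∘ₗ
    ((S.W k).subtype.exists_leftInverse_of_injective (Submodule.ker_subtype _)).choose

theorem grProj_comp (S : HodgeData V) (k : ℤ) : grProj S k ∘ₗ (S.W k).subtype =
    ((S.W (k - 1)).submoduleOf (S.W k)).mkQ := by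
  rw [grProj, LinearMap.comp_assoc, ((S.W k).subtype.exists_leftInverse_of_injective
    (Submodule.ker_subtype _)).choose_spec, LinearMap.comp_id]

theorem cxMap_grProj (S : HodgeData V) (k : ℤ) (x : Cx (S.W k)) :
    cxMap (grProj S k) (cxMap (S.W k).subtype x) =
      cxMap ((S.W (k - 1)).submoduleOf (S.W k)).mkQ x := by
  rw [← cxMap_comp, grProj_comp]

theorem cxMap_grProj_eq_zero {S : HodgeData V} {k : ℤ} {x : Cx V} (hx : x ∈ cxSub (S.W k)) :
    cxMap (grProj S k) x = 0 ↔ x ∈ cxSub (S.W (k - 1)) := by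
  obtain ⟨y, rfl⟩ := mem_cxSub_iff_exists.1 hx
  rw [cxMap_grProj, cxMap_mkQ_eq_zero (S.mono (by omega))]

theorem cxMap_grProj_mem_grF {S : HodgeData V} {F : Filt V} {k p : ℤ} {x : Cx V}
    (hx : x ∈ cxSub (S.W k)) (hF : x ∈ F p) : cxMap (grProj S k) x ∈ grF S.W F k p := by
  obtain ⟨y, rfl⟩ := mem_cxSub_iff_exists.1 hx
  rw [cxMap_grProj]
  exact ⟨y, hF, rfl⟩

/-- A form on `V` that induces `Q_k` on `W_k / W_{k-1}`. -/
def grForm (S : HodgeData V) (k : ℤ) : LinearMap.BilinForm ℚ V :=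
  (S.Q k).comp (grProj S k) (grProj S k)

theorem cxForm_grForm (S : HodgeData V) (k : ℤ) (x y : Cx V) :
    cxForm (grForm S k) x y = cxForm (S.Q k) (cxMap (grProj S k) x) (cxMap (grProj S k) y) := by
  induction x using Cx.induction with
  | zero => simp
  | smul a v =>
    induction y using Cx.induction with
    | zero => simp
    | smul b w => simp [grForm]
    | add x y hx hy => simp only [map_add, hx, hy]
  | add x y hx hy => simp only [map_add, LinearMap.add_apply, hx, hy]

/-- The group of the automorphisms of `(V, W)` that preserve the forms `Q_k` up to scalars. -/
def simGroup (S : HodgeData V) : Subgroup (GLC V) where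
  carrier := {g | g ∈ weightStab S ∧ ∀ k : ℤ, ∃ c : ℂ, c ≠ 0 ∧ ∀ u ∈ cxSub (S.W k),
    ∀ v ∈ cxSub (S.W k), cxForm (grForm S k) ((g : EndC V) u) ((g : EndC V) v) =
      c * cxForm (grForm S k) u v}
  one_mem' := ⟨one_mem _, fun k => ⟨1, one_ne_zero, fun u _ v _ => by simp⟩⟩
  mul_mem' := by
    rintro a b ⟨ha, ha'⟩ ⟨hb, hb'⟩
    refine ⟨mul_mem ha hb, fun k => ?_⟩
    obtain ⟨c, hc, hca⟩ := ha' k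
    obtain ⟨d, hd, hdb⟩ := hb' k
    refine ⟨c * d, mul_ne_zero hc hd, fun u hu v hv => ?_⟩
    have h1 := hb.1 k u hu
    have h2 := hb.1 k v hv
    rw [Nat.cast_zero, sub_zero] at h1 h2
    rw [Units.val_mul, Module.End.mul_apply, Module.End.mul_apply, hca _ h1 _ h2, hdb u hu v hv,
      mul_assoc]
  inv_mem' := by
    rintro a ⟨ha, ha'⟩
    refine ⟨inv_mem ha, fun k => ?_⟩
    obtain ⟨c, hc, hca⟩ := ha' k
    refine ⟨c⁻¹, inv_ne_zero hc, fun u hu v hv => ?_⟩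
    have h1 := ha.2 k u hu
    have h2 := ha.2 k v hv
    rw [Nat.cast_zero, sub_zero] at h1 h2
    have h3 := hca _ h1 _ h2
    have key : ∀ x, (a : EndC V) (((a⁻¹ : GLC V) : EndC V) x) = x := fun x => by
      rw [← Module.End.mul_apply, Units.mul_inv]; rfl
    rw [key, key] at h3
    rw [h3, inv_mul_cancel_left₀ hc]

variable [Module.Finite ℚ V] {S : HodgeData V}

/-- An injective map of W_n into itself is onto by dimension. So the inverse preserves the
filtration automatically, and the stabilizer is cut out by conditions on `g` alone. -/
theorem map_cxSub_eq {g : GLC V} (hg : (g : EndC V) ∈ wEnd S 0) (n : ℤ) :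
    (cxSub (S.W n)).map (g : EndC V) = cxSub (S.W n) := by
  have hle : (cxSub (S.W n)).map (g : EndC V) ≤ cxSub (S.W n) := by
    rintro _ ⟨x, hx, rfl⟩
    simpa using hg n x hx
  refine Submodule.eq_of_le_of_finrank_eq hle ?_
  exact (Submodule.equivMapOfInjective (g : EndC V) ((Module.End.isUnit_iff _).1 g.isUnit).1
    (cxSub (S.W n))).finrank_eq.symm

theorem mem_weightStab {g : GLC V} : g ∈ weightStab S ↔ (g : EndC V) ∈ wEnd S 0 := by
  refine ⟨fun h => h.1, fun h => ⟨h, fun n v hv => ?_⟩⟩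
  rw [← map_cxSub_eq h n] at hv
  obtain ⟨x, hx, rfl⟩ := hv
  rw [← Module.End.mul_apply, Units.inv_mul, Module.End.one_apply, Nat.cast_zero, sub_zero]
  exact hx

theorem isQAlgebraic_weightStab (S : HodgeData V) : IsQAlgebraic (weightStab S) := by
  refine ⟨{f | ∃ n : ℤ, ∃ v ∈ S.W n, ∃ l : Module.Dual ℚ V, (∀ u ∈ S.W n, l u = 0) ∧
    f = X (v, l)}, fun g => ?_⟩
  rw [mem_weightStab]
  constructor
  · rintro hg _ ⟨n, v, hv, l, hl, rfl⟩
    rw [aeval_X, coef_def]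
    have := hg n _ (toCx_mem_cxSub hv)
    rw [Nat.cast_zero, sub_zero] at this
    exact mem_cxSub_iff_dual.1 this l hl
  · intro h n v hv
    rw [Nat.cast_zero, sub_zero]
    refine map_mem_of_mem_cxSub (fun w hw => ?_) hv
    rw [mem_cxSub_iff_dual]
    intro l hl
    have := h _ ⟨n, w, hw, l, hl, rfl⟩
    rwa [aeval_X, coef_def] at this

/-- The polynomial `B (g u, g v)` in the matrix coefficients of `g`. -/
def formPoly (B : LinearMap.BilinForm ℚ V) (u v : V) : MvPolynomial (V × Module.Dual ℚ V) ℚ :=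
  ∑ i, ∑ j, C (B (ratBasis V i) (ratBasis V j)) *
    (X (u, (ratBasis V).coord i) * X (v, (ratBasis V).coord j))

theorem apply_toCx_eq_sum (T : EndC V) (v : V) :
    T (toCx v) = ∑ i, coef T (v, (ratBasis V).coord i) • toCx (ratBasis V i) := by
  have := (cxBasis (ratBasis V)).sum_repr (T (toCx v))
  simp only [cxBasis_repr, cxBasis_apply] at this
  exact this.symm

theorem aeval_formPoly (B : LinearMap.BilinForm ℚ V) (u v : V) (T : EndC V) :
    aeval (coef T) (formPoly B u v) = cxForm B (T (toCx u)) (T (toCx v)) := by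
  rw [apply_toCx_eq_sum T u, apply_toCx_eq_sum T v]
  simp only [formPoly, map_sum, map_mul, aeval_C, aeval_X, LinearMap.sum_apply, map_smul,
    LinearMap.smul_apply, cxForm_toCx, smul_eq_mul]
  rw [Finset.sum_comm]
  refine Finset.sum_congr rfl fun i _ => ?_
  rw [Finset.mul_sum]
  refine Finset.sum_congr rfl fun j _ => ?_
  rw [eq_ratCast]; ring

omit [Module.Finite ℚ V] in
theorem bilin_eq_on_cxSub {U : Submodule ℚ V} {β γ : Cx V →ₗ[ℂ] Cx V →ₗ[ℂ] ℂ}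
    (h : ∀ u ∈ U, ∀ v ∈ U, β (toCx u) (toCx v) = γ (toCx u) (toCx v)) {x y : Cx V}
    (hx : x ∈ cxSub U) (hy : y ∈ cxSub U) : β x y = γ x y := by
  have h1 : ∀ u ∈ U, β (toCx u) y = γ (toCx u) y := by
    intro u hu
    rw [← sub_eq_zero, ← LinearMap.sub_apply, ← Submodule.mem_bot ℂ]
    refine map_mem_of_mem_cxSub (fun v hv => ?_) hy
    rw [Submodule.mem_bot, LinearMap.sub_apply, h u hu v hv, sub_self]
  rw [← sub_eq_zero, ← LinearMap.flip_apply, ← LinearMap.flip_apply γ, ← LinearMap.sub_apply,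
    ← Submodule.mem_bot ℂ]
  refine map_mem_of_mem_cxSub (fun v hv => ?_) hx
  rw [Submodule.mem_bot, LinearMap.sub_apply, LinearMap.flip_apply, LinearMap.flip_apply, h1 v hv,
    sub_self]

omit [Module.Finite ℚ V] in
theorem cxForm_map_eq_mul {U : Submodule ℚ V} {B : LinearMap.BilinForm ℚ V} {T : EndC V} {c : ℂ}
    (h : ∀ u ∈ U, ∀ v ∈ U, cxForm B (T (toCx u)) (T (toCx v)) = c * B u v) {x y : Cx V}
    (hx : x ∈ cxSub U) (hy : y ∈ cxSub U) : cxForm B (T x) (T y) = c * cxForm B x y := by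
  have := bilin_eq_on_cxSub (U := U) (β := LinearMap.BilinForm.comp (cxForm B) T T)
    (γ := c • cxForm B) (fun u hu v hv => ?_) hx hy
  · exact this
  · rw [LinearMap.BilinForm.comp_apply, h u hu v hv, LinearMap.smul_apply, LinearMap.smul_apply,
      cxForm_toCx, smul_eq_mul]

/-- The multiplier is not a matrix coefficient, so it is eliminated by cross-multiplication: Q(gu,
gv) Q(u', v') = Q(gu', gv') Q(u, v) for all rational vectors of W_k. -/
theorem isQAlgebraic_simGroup (S : HodgeData V) : IsQAlgebraic (simGroup S) := by
  obtain ⟨E, hE⟩ := isQAlgebraic_weightStab S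
  refine ⟨E ∪ {f | ∃ k : ℤ, ∃ u ∈ S.W k, ∃ v ∈ S.W k, ∃ u' ∈ S.W k, ∃ v' ∈ S.W k,
    f = formPoly (grForm S k) u v * C (grForm S k u' v') -
      formPoly (grForm S k) u' v' * C (grForm S k u v)}, fun g => ?_⟩
  constructor
  · rintro ⟨hg, hg'⟩ f (hf | ⟨k, u, hu, v, hv, u', hu', v', hv', rfl⟩)
    · exact (hE g).1 hg f hf
    · obtain ⟨c, -, hc⟩ := hg' k
      simp only [map_sub, map_mul, aeval_formPoly, aeval_C]
      rw [hc _ (toCx_mem_cxSub hu) _ (toCx_mem_cxSub hv),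
        hc _ (toCx_mem_cxSub hu') _ (toCx_mem_cxSub hv'), cxForm_toCx, cxForm_toCx]
      simp only [eq_ratCast]
      ring
  · intro h
    have hg : g ∈ weightStab S := (hE g).2 fun f hf => h f (Or.inl hf)
    refine ⟨hg, fun k => ?_⟩
    have hcross : ∀ u ∈ S.W k, ∀ v ∈ S.W k, ∀ u' ∈ S.W k, ∀ v' ∈ S.W k,
        cxForm (grForm S k) ((g : EndC V) (toCx u)) ((g : EndC V) (toCx v)) *
          (grForm S k u' v' : ℂ) =
        cxForm (grForm S k) ((g : EndC V) (toCx u')) ((g : EndC V) (toCx v')) *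
          (grForm S k u v : ℂ) := by
      intro u hu v hv u' hu' v' hv'
      have := h _ (Or.inr ⟨k, u, hu, v, hv, u', hu', v', hv', rfl⟩)
      simp only [map_sub, map_mul, aeval_formPoly, aeval_C, eq_ratCast] at this
      exact sub_eq_zero.1 this
    by_cases h0 : ∃ u' ∈ S.W k, ∃ v' ∈ S.W k, grForm S k u' v' ≠ 0
    · obtain ⟨u', hu', v', hv', hne⟩ := h0
      have hne' : ((grForm S k u' v' : ℚ) : ℂ) ≠ 0 := by exact_mod_cast hne
      set c := cxForm (grForm S k) ((g : EndC V) (toCx u')) ((g : EndC V) (toCx v')) /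
        ((grForm S k u' v' : ℚ) : ℂ) with hc
      have hall : ∀ u ∈ cxSub (S.W k), ∀ v ∈ cxSub (S.W k),
          cxForm (grForm S k) ((g : EndC V) u) ((g : EndC V) v) =
            c * cxForm (grForm S k) u v := by
        intro u hu v hv
        refine cxForm_map_eq_mul (fun u hu v hv => ?_) hu hv
        rw [hc]
        have := hcross u hu v hv u' hu' v' hv'
        field_simp
        linear_combination this
      -- The multiplier is nonzero because `g` is onto W_k: preimages of u' and v' would otherwise
      -- show Q(u', v') = 0.
      refine ⟨c, fun hc0 => hne' ?_, hall⟩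
      have hsurj : ∀ u ∈ cxSub (S.W k), ∃ x ∈ cxSub (S.W k), (g : EndC V) x = u := by
        intro u hu
        rw [← map_cxSub_eq hg.1 k] at hu
        exact hu
      obtain ⟨x, hx, hxu⟩ := hsurj _ (toCx_mem_cxSub hu')
      obtain ⟨y, hy, hyv⟩ := hsurj _ (toCx_mem_cxSub hv')
      have := hall x hx y hy
      rwa [hxu, hyv, cxForm_toCx, hc0, zero_mul] at this
    · push Not at h0
      refine ⟨1, one_ne_zero, fun u hu v hv => ?_⟩
      have hz : ∀ u ∈ cxSub (S.W k), ∀ v ∈ cxSub (S.W k), cxForm (grForm S k) u v = 0 := by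
        intro u hu v hv
        refine bilin_eq_on_cxSub (β := cxForm (grForm S k)) (γ := 0) (fun u hu v hv => ?_) hu hv
        rw [cxForm_toCx, h0 u hu v hv]; simp
      have h1 := hg.1 k u hu
      have h2 := hg.1 k v hv
      rw [Nat.cast_zero, sub_zero] at h1 h2
      rw [hz _ h1 _ h2, hz _ hu _ hv, mul_zero]

end Similitudes

/-! ### Hodge types and positivity on the graded pieces. -/

section Polarization

variable {V : Type*} [AddCommGroup V] [Module ℚ V] {S : HodgeData V} {F : Filt V}
  {h : ℂˣ × ℂˣ →* GLC V}

namespace IsDeligneHom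

variable (hh : IsDeligneHom S.W F h)
include hh

theorem wtSpace_le_weight (p q : ℤ) : wtSpace h p q ≤ cxSub (S.W (p + q)) := by
  rw [hh.weight]
  exact le_iSup_of_le p (le_iSup_of_le q (le_iSup_of_le le_rfl le_rfl))

theorem wtSpace_le_hodge (p q : ℤ) : wtSpace h p q ≤ F p := by
  rw [hh.hodge]
  exact le_iSup_of_le p (le_iSup_of_le q (le_iSup_of_le le_rfl le_rfl))

/-- Statements about Gr_k that are additive can be checked on W_{k-1} and on the Deligne pieces of
total weight exactly k, since the bigrading splits the weight filtration. -/
theorem weight_induction {k : ℤ} {motive : Cx V → Prop}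
    (lower : ∀ u ∈ cxSub (S.W (k - 1)), motive u)
    (wt : ∀ p, ∀ u ∈ wtSpace h p (k - p), motive u)
    (add : ∀ u v, motive u → motive v → motive (u + v)) {u : Cx V} (hu : u ∈ cxSub (S.W k)) :
    motive u := by
  have hle : cxSub (S.W k) ≤ cxSub (S.W (k - 1)) ⊔ ⨆ p, wtSpace h p (k - p) := by
    rw [hh.weight k]
    refine iSup_le fun p => iSup_le fun q => iSup_le fun hpq => ?_
    rcases eq_or_lt_of_le hpq with h1 | h1
    · rw [show q = k - p by omega]
      exact le_sup_of_le_right (le_iSup (fun p => wtSpace h p (k - p)) p)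
    · exact le_sup_of_le_left ((hh.wtSpace_le_weight p q).trans
        (cxSub_mono (S.mono (by omega))))
  obtain ⟨a, ha, b, hb, rfl⟩ := Submodule.mem_sup.1 (hle hu)
  exact add _ _ (lower a ha)
    (Submodule.iSup_induction _ (motive := motive) hb (fun p x hx => wt p x hx) (lower 0 (Submodule.zero_mem _)) add)

theorem exists_weight_decomp {k : ℤ} {u : Cx V} (hu : u ∈ cxSub (S.W k)) :
    ∃ f : ℤ →₀ Cx V, (∀ p, f p ∈ wtSpace h p (k - p)) ∧
      u - f.sum (fun _ x => x) ∈ cxSub (S.W (k - 1)) := by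
  refine hh.weight_induction (k := k) (motive := fun u => ∃ f : ℤ →₀ Cx V,
    (∀ p, f p ∈ wtSpace h p (k - p)) ∧ u - f.sum (fun _ x => x) ∈ cxSub (S.W (k - 1)))
    (fun u hu => ⟨0, fun p => Submodule.zero_mem _, ?_⟩)
    (fun p u hu => ⟨Finsupp.single p u, fun q => ?_, ?_⟩) (fun u v hu hv => ?_) hu
  · simpa using hu
  · rw [Finsupp.single_apply]
    split_ifs with h
    · exact h ▸ hu
    · exact Submodule.zero_mem _
  · rw [Finsupp.sum_single_index rfl, sub_self]; exact Submodule.zero_mem _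
  · obtain ⟨f, hf, hfu⟩ := hu
    obtain ⟨g, hg, hgv⟩ := hv
    refine ⟨f + g, fun p => Submodule.add_mem _ (hf p) (hg p), ?_⟩
    rw [Finsupp.sum_add_index' (fun _ => rfl) (fun _ _ _ => rfl), add_sub_add_comm]
    exact Submodule.add_mem _ hfu hgv

/-- The conjugation rule for the bigrading has an error of strictly smaller bidegree, hence of lower
weight. It disappears in Gr_k, where the piece acquires an honest Hodge type. -/
theorem grProj_mem {k p : ℤ} {u : Cx V} (hu : u ∈ wtSpace h p (k - p)) :
    cxMap (grProj S k) u ∈ grF S.W F k p ⊓ conjSub (grF S.W F k (k - p)) := by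
  have hW : u ∈ cxSub (S.W k) := by
    have := hh.wtSpace_le_weight p (k - p) hu
    rwa [show p + (k - p) = k by ring] at this
  refine ⟨cxMap_grProj_mem_grF hW (hh.wtSpace_le_hodge _ _ hu), ?_⟩
  have h1 : u ∈ wtSpace h p (k - p) ⊔
      (⨆ (r : ℤ) (s : ℤ) (_ : r < p ∧ s < k - p), wtSpace h r s) := Submodule.mem_sup_left hu
  rw [hh.conj] at h1
  obtain ⟨a, ha, b, hb, rfl⟩ := Submodule.mem_sup.1 h1
  have hbW : b ∈ cxSub (S.W (k - 1)) := by
    refine (iSup_le fun r => iSup_le fun s => iSup_le fun hrs => ?_ :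
      (⨆ (r : ℤ) (s : ℤ) (_ : r < p ∧ s < k - p), wtSpace h r s) ≤ cxSub (S.W (k - 1))) hb
    exact (hh.wtSpace_le_weight r s).trans (cxSub_mono (S.mono (by omega)))
  have hbW' : b ∈ cxSub (S.W k) := cxSub_mono (S.mono (by omega)) hbW
  have haW : a ∈ cxSub (S.W k) := by
    have := Submodule.sub_mem _ hW hbW'
    rwa [add_sub_cancel_right] at this
  rw [map_add, (cxMap_grProj_eq_zero hbW').2 hbW, add_zero, SetLike.mem_coe, mem_conjSub, conjV_cxMap]
  exact cxMap_grProj_mem_grF (conjV_mem_cxSub haW) (hh.wtSpace_le_hodge _ _ ha)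

end IsDeligneHom

theorem grF_anti {W : ℤ → Submodule ℚ V} (hF : Antitone F) (k : ℤ) : Antitone (grF W F k) :=
  fun _ _ hpq => Submodule.map_mono (Submodule.comap_mono (hF hpq))

/-- If p + p' > k this is the first Riemann relation; if p + p' < k it is the same relation for the
conjugate vectors. -/
theorem IsClassified.form_eq_zero (hF : IsClassified S F) {k p p' : ℤ} (hpp : p + p' ≠ k)
    {x y : Cx (Gr S.W k)} (hx : x ∈ grF S.W F k p ⊓ conjSub (grF S.W F k (k - p)))
    (hy : y ∈ grF S.W F k p' ⊓ conjSub (grF S.W F k (k - p'))) : cxForm (S.Q k) x y = 0 := by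
  rcases lt_or_gt_of_ne hpp with h1 | h1
  · have h2 := hF.riemann k (k - p) _ hx.2 (conjV _ y)
      (grF_anti hF.mhs.anti k (by omega) hy.2)
    rw [cxForm_conjV] at h2
    simpa using h2
  · exact hF.riemann k p _ hx.1 y (grF_anti hF.mhs.anti k (by omega) hy.1)

theorem cxForm_grForm_eq_zero_left {k : ℤ} {x : Cx V} (hx : x ∈ cxSub (S.W (k - 1))) (y : Cx V) :
    cxForm (grForm S k) x y = 0 := by
  rw [cxForm_grForm, (cxMap_grProj_eq_zero (cxSub_mono (S.mono (by omega)) hx)).2 hx, map_zero,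
    LinearMap.zero_apply]

theorem cxForm_grForm_eq_zero_right {k : ℤ} {y : Cx V} (hy : y ∈ cxSub (S.W (k - 1))) (x : Cx V) :
    cxForm (grForm S k) x y = 0 := by
  rw [cxForm_grForm, (cxMap_grProj_eq_zero (cxSub_mono (S.mono (by omega)) hy)).2 hy, map_zero]

theorem IsDeligneHom.mem_wEnd (hh : IsDeligneHom S.W F h) (zw : ℂˣ × ℂˣ) :
    (h zw : EndC V) ∈ wEnd S 0 := fun n v hv => by
  rw [Nat.cast_zero, sub_zero]
  refine (?_ : (cxSub (S.W n)).map (h zw : EndC V) ≤ cxSub (S.W n)) ⟨v, hv, rfl⟩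
  rw [hh.weight]
  simp only [Submodule.map_iSup]
  refine iSup_mono fun p => iSup_mono fun q => iSup_mono fun _ => ?_
  rintro _ ⟨x, hx, rfl⟩
  rw [mem_wtSpace.1 hx zw]
  exact Submodule.smul_mem _ _ hx

/-- Only the types (p, k-p) and (k-p, p) pair nontrivially, and on such a pair the characters
multiply to z^{-k} w^{-k}, independently of p. That is the multiplier on Gr_k. -/
theorem IsDeligneHom.range_le_simGroup [Module.Finite ℚ V] (hF : IsClassified S F)
    (hh : IsDeligneHom S.W F h) : h.range ≤ simGroup S := by
  rintro _ ⟨⟨z, w⟩, rfl⟩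
  have hW := hh.mem_wEnd (z, w)
  refine ⟨mem_weightStab.2 hW, fun k => ⟨((z ^ (-k) * w ^ (-k) : ℂˣ) : ℂ), Units.ne_zero _, ?_⟩⟩
  have hlow : ∀ u ∈ cxSub (S.W (k - 1)), (h (z, w) : EndC V) u ∈ cxSub (S.W (k - 1)) :=
    fun u hu => by simpa using hW _ u hu
  intro u hu v hv
  refine hh.weight_induction (k := k) (motive := fun u => cxForm (grForm S k)
    ((h (z, w) : EndC V) u) ((h (z, w) : EndC V) v) =
      ((z ^ (-k) * w ^ (-k) : ℂˣ) : ℂ) * cxForm (grForm S k) u v)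
    (fun u hu => ?_) (fun p u hu => ?_) (fun u u' hu hu' => ?_) hu
  · rw [cxForm_grForm_eq_zero_left (hlow u hu), cxForm_grForm_eq_zero_left hu, mul_zero]
  · refine hh.weight_induction (k := k) (motive := fun v => cxForm (grForm S k)
      ((h (z, w) : EndC V) u) ((h (z, w) : EndC V) v) =
        ((z ^ (-k) * w ^ (-k) : ℂˣ) : ℂ) * cxForm (grForm S k) u v) (fun v hv => ?_) (fun p' v hv => ?_)
      (fun v v' hv hv' => ?_) hv
    · rw [cxForm_grForm_eq_zero_right (hlow v hv), cxForm_grForm_eq_zero_right hv, mul_zero]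
    · rw [mem_wtSpace.1 hu, mem_wtSpace.1 hv]
      simp only [map_smul, LinearMap.smul_apply, smul_eq_mul]
      by_cases hpp : p + p' = k
      · rw [← mul_assoc, ← Units.val_mul]
        congr 2
        subst hpp
        rw [show -(p + p' - p') = -p by ring, show -(p + p' - p) = -p' by ring, neg_add, zpow_add,
          zpow_add, mul_mul_mul_comm, mul_comm (w ^ (-p)), mul_comm (z ^ (-p'))]
      · rw [cxForm_grForm, hF.form_eq_zero hpp (hh.grProj_mem hu) (hh.grProj_mem hv)]
        simp
    · rw [map_add, map_add, map_add, hv, hv', mul_add]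
  · rw [map_add, map_add, map_add, LinearMap.add_apply, LinearMap.add_apply, hu, hu', mul_add]

/-- The Weil operator. -/
def weilOp (h : ℂˣ × ℂˣ →* GLC V) : GLC V :=
  h ((Units.mk0 Complex.I Complex.I_ne_zero)⁻¹, Units.mk0 Complex.I Complex.I_ne_zero)

theorem weilOp_apply {p q : ℤ} {u : Cx V} (hu : u ∈ wtSpace h p q) :
    (weilOp h : EndC V) u = Complex.I ^ (p - q) • u := by
  rw [weilOp, mem_wtSpace.1 hu]
  congr 1
  simp only [inv_zpow', neg_neg, Units.val_mul, Units.val_zpow_eq_zpow_val, Units.val_mk0]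
  rw [← zpow_add₀ Complex.I_ne_zero, sub_eq_add_neg]

/-- The polarizations are positive definite on the graded pieces. -/
theorem IsDeligneHom.mem_of_polarization_eq_zero (hF : IsClassified S F)
    (hh : IsDeligneHom S.W F h) {k : ℤ} {u : Cx V} (hu : u ∈ cxSub (S.W k))
    (h0 : cxForm (grForm S k) ((weilOp h : EndC V) u) (conjV V u) = 0) :
    u ∈ cxSub (S.W (k - 1)) := by
  obtain ⟨f, hf, hr⟩ := hh.exists_weight_decomp hu
  set x : ℤ → Cx (Gr S.W k) := fun p => cxMap (grProj S k) (f p) with hx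
  have hxm : ∀ p, x p ∈ grF S.W F k p ⊓ conjSub (grF S.W F k (k - p)) := fun p =>
    hh.grProj_mem (hf p)
  obtain ⟨r, hru⟩ : ∃ r, r = u - f.sum fun _ x => x := ⟨_, rfl⟩
  rw [← hru] at hr
  have hu' : u = (∑ p ∈ f.support, f p) + r := by rw [hru, Finsupp.sum]; abel
  have hCr : (weilOp h : EndC V) r ∈ cxSub (S.W (k - 1)) := by
    have := hh.mem_wEnd ((Units.mk0 Complex.I Complex.I_ne_zero)⁻¹,
      Units.mk0 Complex.I Complex.I_ne_zero) _ _ hr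
    rwa [Nat.cast_zero, sub_zero] at this
  have hconjr := conjV_mem_cxSub hr
  have hconjx : ∀ p, conjV _ (x p) ∈ grF S.W F k (k - p) ⊓ conjSub (grF S.W F k (k - (k - p))) := by
    intro p
    refine ⟨(hxm p).2, ?_⟩
    rw [SetLike.mem_coe, mem_conjSub, conjV_conjV, sub_sub_cancel]
    exact (hxm p).1
  -- Orthogonality of different Hodge types leaves the diagonal terms, each of which is a
  -- nonnegative real number by the polarization; a vanishing sum makes each vanish.
  have hsum : ∑ p ∈ f.support, Complex.I ^ (p - (k - p)) * cxForm (S.Q k) (x p) (conjV _ (x p)) =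
      0 := by
    rw [← h0, hu']
    simp only [map_add, LinearMap.add_apply]
    rw [cxForm_grForm_eq_zero_left hCr, cxForm_grForm_eq_zero_left hCr,
      cxForm_grForm_eq_zero_right hconjr, add_zero, add_zero, add_zero, map_sum, map_sum, map_sum, LinearMap.sum_apply]
    refine Finset.sum_congr rfl fun p hp => ?_
    rw [map_sum, Finset.sum_eq_single p, weilOp_apply (hf p), map_smul, LinearMap.smul_apply,
      cxForm_grForm, ← conjV_cxMap, smul_eq_mul]
    · intro p' _ hne
      rw [weilOp_apply (hf p), map_smul, LinearMap.smul_apply, cxForm_grForm, ← conjV_cxMap,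
        hF.form_eq_zero (p' := k - p') (by omega) (hxm p) (hconjx p'), smul_zero]
    · exact fun hp' => absurd hp hp'
  have hpos : ∀ p, ∃ r : ℝ, 0 ≤ r ∧ (r = 0 → x p = 0) ∧
      Complex.I ^ (p - (k - p)) * cxForm (S.Q k) (x p) (conjV _ (x p)) = (r : ℂ) := by
    intro p
    by_cases hp : x p = 0
    · exact ⟨0, le_rfl, fun _ => hp, by simp [hp]⟩
    · obtain ⟨r, hr, hr'⟩ := hF.polarized k p (x p) (hxm p) hp
      exact ⟨r, hr.le, fun h => absurd h hr.ne', hr'⟩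
  choose ρ hρ hρ0 hρe using hpos
  rw [Finset.sum_congr rfl fun p _ => hρe p, ← Complex.ofReal_sum, Complex.ofReal_eq_zero,
    Finset.sum_eq_zero_iff_of_nonneg fun p _ => hρ p] at hsum
  rw [← cxMap_grProj_eq_zero hu, hu', map_add, map_sum,
    (cxMap_grProj_eq_zero (cxSub_mono (S.mono (by omega)) hr)).2 hr, add_zero]
  exact Finset.sum_eq_zero fun p hp => hρ0 p (hsum p hp)

end Polarization

/-! ### The unipotent radical of the Mumford–Tate group. -/

section Reductivity

/-- The pairing sends W to the functionals on X that vanish on A, a space of dimension dim X - dim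
A. As X is proper in W, the kernel has dimension greater than dim A, so it is not contained in A. -/
theorem exists_mem_orthogonal {M : Type*} [AddCommGroup M] [Module ℂ M] [Module.Finite ℂ M]
    (B : LinearMap.BilinForm ℂ M) {A X W : Submodule ℂ M} (hAX : A ≤ X) (hXW : X ≤ W)
    (hA : ∀ a ∈ A, ∀ w ∈ W, B a w = 0) (hne : ¬ W ≤ X) :
    ∃ v ∈ W, v ∉ A ∧ ∀ x ∈ X, B x v = 0 := by
  by_contra hcon
  push Not at hcon
  let T : W →ₗ[ℂ] Module.Dual ℂ X :=
    (LinearMap.lcomp ℂ ℂ X.subtype) ∘ₗ (LinearMap.flip B) ∘ₗ W.subtype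
  have hT : ∀ (w : W) (x : X), T w x = B x w := fun _ _ => rfl
  have hker : LinearMap.ker T ≤ A.submoduleOf W := by
    intro w hw
    by_contra hwA
    obtain ⟨x, hx, hxw⟩ := hcon w w.2 hwA
    exact hxw (LinearMap.congr_fun (LinearMap.mem_ker.1 hw) ⟨x, hx⟩)
  have hran : LinearMap.range T ≤ (A.submoduleOf X).dualAnnihilator := by
    rintro _ ⟨w, rfl⟩
    rw [Submodule.mem_dualAnnihilator]
    exact fun x hx => hA _ hx _ w.2
  have h1 := T.finrank_range_add_finrank_ker
  have h2 := Submodule.finrank_mono hker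
  have h3 := Submodule.finrank_mono hran
  have h4 := Subspace.finrank_add_finrank_dualAnnihilator_eq (A.submoduleOf X)
  have h5 := (Submodule.submoduleOfEquivOfLe hAX).finrank_eq
  have h6 := (Submodule.submoduleOfEquivOfLe (hAX.trans hXW)).finrank_eq
  exact hne (Submodule.eq_of_le_of_finrank_le hXW (by omega)).ge

variable {V : Type*} [AddCommGroup V] [Module ℚ V] [Module.Finite ℚ V] {S : HodgeData V}
  {F : Filt V} {h : ℂˣ × ℂˣ →* GLC V}

omit [Module.Finite ℚ V] in
theorem isQAlgebraic_mumfordTate (W : ℤ → Submodule ℚ V) (F : Filt V) :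
    IsQAlgebraic (mumfordTate W F) := isQAlgebraic_sInf fun _ hH => hH.1

omit [Module.Finite ℚ V] in
theorem IsDeligneHom.range_le_mumfordTate {W : ℤ → Submodule ℚ V} (hh : IsDeligneHom W F h) :
    h.range ≤ mumfordTate W F := le_sInf fun _ hH => hH.2 h hh

theorem IsClassified.mumfordTate_le_simGroup (hF : IsClassified S F) :
    mumfordTate S.W F ≤ simGroup S :=
  sInf_le ⟨isQAlgebraic_simGroup S, fun _ hh => hh.range_le_simGroup hF⟩

theorem IsClassified.isWeightGroup (hF : IsClassified S F) :
    IsWeightGroup S (mumfordTate S.W F) :=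
  ⟨isQAlgebraic_mumfordTate _ _, fun _ hg => (hF.mumfordTate_le_simGroup hg).1.1⟩

/-- A normal unipotent subgroup of the Mumford–Tate group acts trivially on the graded pieces. -/
theorem IsClassified.sub_mem_of_normal_unipotent (hF : IsClassified S F) {N : Subgroup (GLC V)}
    (hNP : N ≤ mumfordTate S.W F)
    (hN : ∀ g ∈ mumfordTate S.W F, ∀ n ∈ N, g * n * g⁻¹ ∈ N)
    (hu : ∀ n ∈ N, IsNilpotent ((n : EndC V) - 1)) {n : GLC V} (hn : n ∈ N) :
    (n : EndC V) - 1 ∈ wEnd S 1 := by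
  obtain ⟨h, hh⟩ := (hF.mhs.hodgeRelations S.mono S.exists_bot S.exists_top).exists_isDeligneHom
  set P := mumfordTate S.W F with hP
  have hPW : ∀ g ∈ P, ∀ k, ∀ v ∈ cxSub (S.W k), (g : EndC V) v ∈ cxSub (S.W k) := fun g hg k v hv =>
    by simpa using hF.isWeightGroup.mem_wEnd g hg k v hv
  have hmul : ∀ (a b : GLC V) (v : Cx V), ((a * b : GLC V) : EndC V) v =
      (a : EndC V) ((b : EndC V) v) := fun _ _ _ => rfl
  intro k
  -- The vectors of W_k fixed by `N` modulo W_{k-1}; normality of `N` makes this subspace stable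
  -- under `P`.
  let X : Submodule ℂ (Cx V) :=
    { carrier := {x | x ∈ cxSub (S.W k) ∧ ∀ n ∈ N, (n : EndC V) x - x ∈ cxSub (S.W (k - 1))}
      zero_mem' := ⟨Submodule.zero_mem _, fun n _ => by simp⟩
      add_mem' := fun {a b} ha hb => ⟨Submodule.add_mem _ ha.1 hb.1, fun n hn => by
        rw [map_add, add_sub_add_comm]
        exact Submodule.add_mem _ (ha.2 n hn) (hb.2 n hn)⟩
      smul_mem' := fun c x hx => ⟨Submodule.smul_mem _ c hx.1, fun n hn => by
        rw [map_smul, ← smul_sub]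
        exact Submodule.smul_mem _ c (hx.2 n hn)⟩ }
  have hXP : ∀ g ∈ P, ∀ x ∈ X, (g : EndC V) x ∈ X := by
    intro g hg x hx
    refine ⟨hPW g hg k x hx.1, fun n hn => ?_⟩
    have h1 := hx.2 _ (hN g⁻¹ (P.inv_mem hg) n hn)
    have h2 := hPW g hg _ _ h1
    rw [map_sub, ← hmul] at h2
    rwa [show g * (g⁻¹ * n * g⁻¹⁻¹) = n * g by group, hmul] at h2
  suffices hX : cxSub (S.W k) ≤ X by
    intro v hv
    have := (hX hv).2 n hn
    simpa using this
  by_contra hne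
  have hAX : cxSub (S.W (k - 1)) ≤ X := fun x hx =>
    ⟨cxSub_mono (S.mono (by omega)) hx, fun n hn =>
      Submodule.sub_mem _ (hPW n (hNP hn) _ x hx) hx⟩
  obtain ⟨y, hyW, hyA, hyX⟩ := exists_mem_orthogonal (cxForm (grForm S k)) hAX
    (W := cxSub (S.W k)) (fun x hx => hx.1)
    (fun a ha w _ => cxForm_grForm_eq_zero_left ha w) hne
  -- The orthogonal of X has to be conjugated to bring in the Hermitian form. It stays `P`-stable
  -- because `P` acts by similitudes and, being defined over ℚ, is stable under complex conjugation.
  let Y : Submodule ℂ (Cx V) := cxSub (S.W k) ⊓ conjSub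
    { carrier := {v | ∀ x ∈ X, cxForm (grForm S k) x v = 0}
      zero_mem' := fun x _ => map_zero _
      add_mem' := fun {a b} ha hb x hx => by rw [map_add, ha x hx, hb x hx, add_zero]
      smul_mem' := fun c v hv x hx => by rw [map_smul, hv x hx, smul_zero] }
  have hYP : ∀ g ∈ P, ∀ v ∈ Y, (g : EndC V) v ∈ Y := by
    rintro g hg v ⟨hvW, hv⟩
    refine ⟨hPW g hg k v hvW, fun x hx => ?_⟩
    have hg' : galG conjAut g ∈ P := hF.isWeightGroup.alg.galG_mem conjAut hg
    have h1 : conjV V ((g : EndC V) v) = (galG conjAut g : EndC V) (conjV V v) := by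
      rw [coe_galG, galE_conjAut_apply, conjV_conjV]
    obtain ⟨c, -, hc⟩ := (hF.mumfordTate_le_simGroup hg').2 k
    have h2 := hXP _ (P.inv_mem hg') x hx
    have h3 := hc _ h2.1 _ (conjV_mem_cxSub hvW)
    rw [hv _ h2, mul_zero, ← h1, ← hmul, mul_inv_cancel] at h3
    exact h3
  have hYA : ¬ Y ≤ cxSub (S.W (k - 1)) := by
    intro hle
    have h1 : conjV V y ∈ Y := ⟨conjV_mem_cxSub hyW, by
      rw [SetLike.mem_coe, mem_conjSub, conjV_conjV]; exact hyX⟩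
    have h2 := conjV_mem_cxSub (hle h1)
    rw [conjV_conjV] at h2
    exact hyA h2
  -- Kolchin's theorem in Y / W_{k-1} gives a vector lying in both X and Y. The Weil operator
  -- belongs to `P` and preserves X, so Q(Cv, conj v) = 0, against positivity.
  obtain ⟨v, hvY, hvA, hv⟩ := exists_fixed_modulo (N.toSubmonoid.map (Units.coeHom (EndC V)))
    (by rintro _ ⟨n, hn, rfl⟩; exact hu n hn) (cxSub (S.W (k - 1))) Y
    (by rintro _ ⟨n, hn, rfl⟩ u hu; exact hPW n (hNP hn) _ u hu)
    (by rintro _ ⟨n, hn, rfl⟩ u hu; exact hYP n (hNP hn) u hu) hYA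
  have hvX : v ∈ X := ⟨hvY.1, fun n hn => hv _ ⟨n, hn, rfl⟩⟩
  refine hvA (hh.mem_of_polarization_eq_zero hF hvY.1 ?_)
  exact hvY.2 _ (hXP _ (hh.range_le_mumfordTate ⟨_, rfl⟩) v hvX)

/-- The unipotent radical of the Mumford–Tate group consists of the elements that act trivially on
the graded pieces of the weight filtration. -/
theorem IsClassified.unipotentRadical_eq (hF : IsClassified S F) :
    unipotentRadical (mumfordTate S.W F) = unipSub S (mumfordTate S.W F) 1 := by
  have hP := hF.isWeightGroup
  apply le_antisymm
  · refine sSup_le ?_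
    rintro N ⟨hNP, hN, hu⟩ n hn
    exact hP.mem_unipSub.2 ⟨hNP hn, hF.sub_mem_of_normal_unipotent hNP hN hu hn⟩
  · exact le_sSup ⟨unipSub_le 1, fun g hg n hn => hP.conj_mem_unipSub hg hn,
      fun n hn => isNilpotent_of_mem_wEnd le_rfl hn.2.2.2⟩

/-- The value of a Deligne homomorphism at `(1/2, 1/2)`. -/
theorem IsDeligneHom.isWeightElt (hF : IsClassified S F) (hh : IsDeligneHom S.W F h) :
    IsWeightElt S (mumfordTate S.W F) (h ((Units.mk0 2 two_ne_zero)⁻¹, (Units.mk0 2 two_ne_zero)⁻¹))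
      where
  group := hF.isWeightGroup
  mem := hh.range_le_mumfordTate ⟨_, rfl⟩
  op := fun k v hv => by
    refine hh.weight_induction (k := k) (motive := fun v =>
      (h ((Units.mk0 2 two_ne_zero)⁻¹, (Units.mk0 2 two_ne_zero)⁻¹) : EndC V) v -
        (2 : ℂ) ^ k • v ∈ cxSub (S.W (k - 1))) (fun u hu => ?_) (fun p u hu => ?_)
      (fun u u' hu hu' => ?_) hv
    · refine Submodule.sub_mem _ ?_ (Submodule.smul_mem _ _ hu)
      simpa using hh.mem_wEnd _ _ _ hu
    · rw [mem_wtSpace.1 hu]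
      simp only [inv_zpow', neg_neg, Units.val_mul, Units.val_zpow_eq_zpow_val, Units.val_mk0]
      rw [← zpow_add₀ two_ne_zero, add_sub_cancel, sub_self]
      exact Submodule.zero_mem _
    · rw [map_add, smul_add, add_sub_add_comm]
      exact Submodule.add_mem _ hu hu'

end Reductivity

/-! ### Levi subgroups as centralizers of rational weight elements. -/

section Levi

variable {V : Type*} [AddCommGroup V] [Module ℚ V] {S : HodgeData V} {P L : Subgroup (GLC V)}
  {a : GLC V}

namespace IsWeightElt

variable (ha : IsWeightElt S P a)
include ha

/-- If `g` commutes with `a`, then g - 1 is homogeneous of degree 0; but it also lies in W_{-1},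
which has no component of degree 0. -/
theorem eq_one_of_commute {g : GLC V} (hg : g ∈ unipSub S P 1) (hga : g * a = a * g) : g = 1 := by
  have h1 : conjE a ((g : EndC V) - 1) = adNode 0 • ((g : EndC V) - 1) := by
    have h2 : a * g * a⁻¹ = g := by rw [← hga, mul_inv_cancel_right]
    have h3 : conjE a (g : EndC V) = g := congrArg Units.val h2
    rw [map_sub, map_one, h3, adNode, pow_zero, inv_one, one_smul]
  have h4 := ha.degPart_of_eigen (mem_wEnd_zero hg.2.2.2) h1 0
  rw [if_pos rfl, ha.degPart_eq_zero one_pos hg.2.2.2] at h4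
  exact Units.ext (sub_eq_zero.1 h4.symm)

theorem isWeightOp_conj {g : GLC V} (hg : g ∈ P) :
    IsWeightOp S ((g * a * g⁻¹ : GLC V) : EndC V) := fun k v hv => by
  have hgi := ha.group.mem_wEnd _ (P.inv_mem hg) k v hv
  rw [Nat.cast_zero, sub_zero] at hgi
  have h1 := ha.group.mem_wEnd _ hg _ _ (ha.op k _ hgi)
  rw [Nat.cast_zero, sub_zero, map_sub, map_smul] at h1
  have h2 : (g : EndC V) (((g⁻¹ : GLC V) : EndC V) v) = v := by
    rw [← Module.End.mul_apply, Units.mul_inv]; rfl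
  rw [h2] at h1
  exact h1

theorem isWeightOp_mul {u : GLC V} (hu : u ∈ unipSub S P 1) :
    IsWeightOp S ((a * u : GLC V) : EndC V) := by
  refine ha.op.of_sub_mem ?_
  rw [Units.val_mul, ← mul_sub_one]
  exact mul_mem_wEnd_left (ha.group.mem_wEnd _ ha.mem) hu.2.2.2

end IsWeightElt

theorem IsWeightGroup.le_normalizer (hP : IsWeightGroup S P) (k : ℕ) :
    P ≤ Subgroup.normalizer (unipSub S P k : Set (GLC V)) := by
  intro g hg
  rw [Subgroup.mem_normalizer_iff]
  refine fun n => ⟨fun hn => hP.conj_mem_unipSub hg hn, fun hn => ?_⟩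
  have := hP.conj_mem_unipSub (P.inv_mem hg) hn
  rwa [show g⁻¹ * (g * n * g⁻¹) * g⁻¹⁻¹ = n by group] at this

/-- `a` is the rational weight element of the Levi subgroup `L`, and `L` is its centralizer. -/
structure IsLeviWeight (S : HodgeData V) (P L : Subgroup (GLC V)) (a : GLC V) : Prop where
  elt : IsWeightElt S P a
  rational : ∀ σ : ℂ ≃+* ℂ, galE σ (a : EndC V) = a
  mem_iff : ∀ g : GLC V, g ∈ L ↔ g ∈ P ∧ g * a = a * g

variable [Module.Finite ℚ V]

theorem isQAlgebraic_centralizer (hP : IsQAlgebraic P) (ha : ∀ σ, galE σ (a : EndC V) = a) :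
    IsQAlgebraic (P ⊓ Subgroup.centralizer {a}) := by
  refine hP.inf ?_
  obtain ⟨α, hα⟩ := exists_eq_cxHom ha
  refine ⟨{f | ∃ (v : V) (l : Module.Dual ℚ V),
    f = MvPolynomial.X (α v, l) - MvPolynomial.X (v, l ∘ₗ α)}, fun g => ?_⟩
  have h1 : ∀ v l, coef ((g : EndC V) * (a : EndC V)) (v, l) = coef (g : EndC V) (α v, l) := fun v l => by
    rw [coef_def, hα, coef_def, Module.End.mul_apply, cxHom_apply, cxMap_toCx]
  have h2 : ∀ v l, coef ((a : EndC V) * (g : EndC V)) (v, l) = coef (g : EndC V) (v, l ∘ₗ α) := fun v l => by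
    rw [coef_def, hα, coef_def, Module.End.mul_apply, cxHom_apply, cxDual_comp]
  rw [Subgroup.mem_centralizer_singleton_iff]
  constructor
  · rintro hg _ ⟨v, l, rfl⟩
    rw [map_sub, MvPolynomial.aeval_X, MvPolynomial.aeval_X, ← h1, ← h2, ← Units.val_mul, hg,
      Units.val_mul, sub_self]
  · intro h
    refine Units.ext (end_ext fun vl => ?_)
    have := h _ ⟨vl.1, vl.2, rfl⟩
    rw [map_sub, MvPolynomial.aeval_X, MvPolynomial.aeval_X, ← h1, ← h2, sub_eq_zero] at this
    exact this

theorem exists_isLeviWeight_of_isWeightElt (ha : IsWeightElt S P a) :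
    ∃ L b, IsLeviWeight S P L b := by
  obtain ⟨b, hb, hbw, hbσ⟩ := ha.group.exists_rational_weightOp ha.mem ha.op
  refine ⟨P ⊓ Subgroup.centralizer {b}, b, ⟨ha.group, hb, hbw⟩, hbσ, fun g => ?_⟩
  rw [Subgroup.mem_inf, Subgroup.mem_centralizer_singleton_iff]

/-- The conjugate of `a` by `g` is a second weight element, so some unipotent `u` carries `a` to it
as well; then u⁻¹ g centralizes `a`. -/
theorem IsLeviWeight.exists_mul (hL : IsLeviWeight S P L a) {g : GLC V} (hg : g ∈ P) :
    ∃ u ∈ unipSub S P 1, ∃ l ∈ L, g = u * l := by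
  obtain ⟨u, hu, he⟩ := hL.elt.group.exists_conj hL.elt.mem
    (P.mul_mem (P.mul_mem hg hL.elt.mem) (P.inv_mem hg)) hL.elt.op (hL.elt.isWeightOp_conj hg)
  refine ⟨u, hu, u⁻¹ * g, (hL.mem_iff _).2 ⟨P.mul_mem (P.inv_mem hu.1) hg, ?_⟩, by group⟩
  have h1 : g * a = u * a * u⁻¹ * g := by rw [← he]; group
  rw [mul_assoc, h1]; group

theorem IsLeviWeight.isLevi (hL : IsLeviWeight S P L a)
    (hR : unipotentRadical P = unipSub S P 1) : IsLevi P L where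
  algebraic := by
    have : L = P ⊓ Subgroup.centralizer {a} := by
      ext g
      rw [hL.mem_iff, Subgroup.mem_inf, Subgroup.mem_centralizer_singleton_iff]
    rw [this]
    exact isQAlgebraic_centralizer hL.elt.group.alg hL.rational
  le := fun g hg => ((hL.mem_iff g).1 hg).1
  disjoint := by
    rw [hR, eq_bot_iff]
    rintro g ⟨hg, hgL⟩
    exact hL.elt.eq_one_of_commute hg ((hL.mem_iff g).1 hgL).2
  sup := by
    rw [hR]
    refine le_antisymm (sup_le (unipSub_le 1) fun g hg => ((hL.mem_iff g).1 hg).1) fun g hg => ?_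
    obtain ⟨u, hu, l, hl, rfl⟩ := hL.exists_mul hg
    exact Subgroup.mul_mem_sup hu hl

-- The Levi factor of any weight element is again a weight element. Two weight elements of `L`
-- differ by an element of the unipotent radical, so `L` contains only one.
omit [Module.Finite ℚ V] in
theorem IsLevi.exists_isLeviWeight (hL : IsLevi P L)
    (hR : unipotentRadical P = unipSub S P 1) (ha : IsWeightElt S P a) :
    ∃ b, IsLeviWeight S P L b := by
  have hP := ha.group
  have hmul : ∀ g ∈ P, ∃ l ∈ L, ∃ u ∈ unipSub S P 1, l * u = g := by
    intro g hg
    rw [← hL.sup, hR, sup_comm] at hg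
    have h1 := Subgroup.coe_mul_of_left_le_normalizer_right L (unipSub S P 1)
      (hL.le.trans (hP.le_normalizer 1))
    have h2 : g ∈ ((L ⊔ unipSub S P 1 : Subgroup (GLC V)) : Set (GLC V)) := hg
    rw [h1] at h2
    exact h2
  have huniq : ∀ b ∈ L, ∀ c ∈ L, IsWeightOp S (b : EndC V) → IsWeightOp S (c : EndC V) →
      b = c := by
    intro b hb c hc hbw hcw
    have h1 : b * c⁻¹ ∈ unipSub S P 1 ⊓ L := by
      refine ⟨hP.mem_unipSub.2 ⟨P.mul_mem (hL.le hb) (P.inv_mem (hL.le hc)), ?_⟩,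
        L.mul_mem hb (L.inv_mem hc)⟩
      have e : ((b * c⁻¹ : GLC V) : EndC V) - 1 =
          ((b : EndC V) - c) * ((c⁻¹ : GLC V) : EndC V) := by
        rw [sub_mul, Units.mul_inv, Units.val_mul]
      rw [e]
      exact mul_mem_wEnd_right (hbw.sub_mem hcw) (hP.mem_wEnd _ (P.inv_mem (hL.le hc)))
    rw [← hR, hL.disjoint, Subgroup.mem_bot] at h1
    exact mul_inv_eq_one.1 h1
  obtain ⟨b, hb, u, hu, hbu⟩ := hmul a ha.mem
  have hbw : IsWeightOp S (b : EndC V) := by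
    have h1 := ha.isWeightOp_mul (inv_mem hu)
    rwa [← hbu, mul_inv_cancel_right] at h1
  have hbe : IsWeightElt S P b := ⟨hP, hL.le hb, hbw⟩
  -- Uniqueness gives everything: the Galois conjugates of `b` and its conjugates under `L` are
  -- weight elements of `L`, so they equal `b`. A unipotent factor commuting with `b` is trivial, so
  -- the centralizer is not larger than `L`.
  refine ⟨b, hbe, fun σ => ?_, fun g => ⟨fun hg => ⟨hL.le hg, ?_⟩, ?_⟩⟩
  · exact congrArg Units.val
      (huniq (galG σ b) (hL.algebraic.galG_mem σ hb) b hb (hbw.galE σ) hbw)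
  · have h1 := huniq (g * b * g⁻¹) (L.mul_mem (L.mul_mem hg hb) (L.inv_mem hg)) b hb
      (hbe.isWeightOp_conj (hL.le hg)) hbw
    rwa [mul_inv_eq_iff_eq_mul] at h1
  · rintro ⟨hg, hgb⟩
    obtain ⟨l, hl, u, hu, rfl⟩ := hmul g hg
    have hlb : l * b * l⁻¹ = b :=
      huniq (l * b * l⁻¹) (L.mul_mem (L.mul_mem hl hb) (L.inv_mem hl)) b hb
        (hbe.isWeightOp_conj (hL.le hl)) hbw
    rw [mul_inv_eq_iff_eq_mul] at hlb
    have h1 : u * b = b * u := by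
      rw [← mul_right_inj l, ← mul_assoc, hgb, ← mul_assoc, ← mul_assoc, hlb]
    rw [hbe.eq_one_of_commute hu h1, mul_one]
    exact hl

end Levi

/-! ### Real structure, graded pieces and equivariant sections. -/

section RealLieAlgebra

variable {V : Type*} [AddCommGroup V] [Module ℚ V] {S : HodgeData V} {P L : Subgroup (GLC V)}
  {a : GLC V}

namespace IsLeviWeight

variable (hL : IsLeviWeight S P L a)
include hL

theorem mem : a ∈ realPts L := by
  rw [mem_realPts, hL.mem_iff]
  exact ⟨⟨hL.elt.mem, rfl⟩, hL.rational _⟩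

theorem le : L ≤ P := fun g hg => ((hL.mem_iff g).1 hg).1

theorem degPart_sub_mem {k : ℕ} {X : EndC V} (hX : X ∈ wEnd S k) :
    X - degPart S a k X ∈ wEnd S (k + 1) := by
  have h := hL.elt.sub_sum_mem_wEnd (k + 1) (mem_wEnd_zero hX)
  rwa [Finset.sum_range_succ, Finset.sum_eq_zero (fun i hi =>
    hL.elt.degPart_eq_zero (Finset.mem_range.1 hi) hX), zero_add] at h

end IsLeviWeight

theorem real_smul_eq (r : ℝ) (X : EndC V) : r • X = (r : ℂ) • X := rfl

theorem rat_smul_eq (q : ℚ) (X : EndC V) : q • X = (q : ℂ) • X := by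
  rw [← algebraMap_smul ℂ]; simp

theorem lieWR_le_lieWC (k : ℕ) {X : EndC V} (hX : X ∈ lieWR S P k) :
    X ∈ lieWC S P k ∧ galE conjAut X = X := by
  induction hX using Submodule.span_induction with
  | mem X hX =>
    obtain ⟨Y, hY, rfl⟩ := hX
    exact ⟨Submodule.subset_span ⟨Y, hY, rfl⟩, galE_cxHom _ _⟩
  | zero => exact ⟨Submodule.zero_mem _, map_zero _⟩
  | add X Y _ _ hX hY => exact ⟨Submodule.add_mem _ hX.1 hY.1, by rw [map_add, hX.2, hY.2]⟩
  | smul r X _ hX =>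
    refine ⟨Submodule.smul_mem _ (r : ℂ) hX.1, ?_⟩
    rw [real_smul_eq, galE_smul, hX.2]
    congr 1
    exact Complex.conj_ofReal r

theorem mem_lieWR {k : ℕ} {X : EndC V} :
    X ∈ lieWR S P k ↔ X ∈ lieWC S P k ∧ galE conjAut X = X := by
  refine ⟨lieWR_le_lieWC k, fun ⟨hX, hc⟩ => ?_⟩
  -- The sum of a complex vector and its conjugate is a real combination of rational vectors; a real
  -- vector is half of such a sum. The scalar `c` is carried along to make the induction over the
  -- complex span work.
  have key : ∀ X ∈ lieWC S P k, ∀ c : ℂ, c • X + galE conjAut (c • X) ∈ lieWR S P k := by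
    intro X hX
    induction hX using Submodule.span_induction with
    | mem X hX =>
      obtain ⟨Y, hY, rfl⟩ := hX
      intro c
      have h1 : galE conjAut (c • (cxMap Y : EndC V)) = (starRingEnd ℂ) c • (cxMap Y : EndC V) := by
        rw [galE_smul, ← cxHom_apply, galE_cxHom]; rfl
      have h2 : c • (cxMap Y : EndC V) + galE conjAut (c • (cxMap Y : EndC V)) =
          (2 * c.re) • (cxMap Y : EndC V) := by
        rw [h1, ← add_smul, Complex.add_conj, real_smul_eq]
      rw [h2]
      exact Submodule.smul_mem _ _ (Submodule.subset_span ⟨Y, hY, rfl⟩)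
    | zero => intro c; rw [smul_zero, map_zero, add_zero]; exact Submodule.zero_mem _
    | add X Y _ _ hX hY =>
      intro c
      rw [smul_add, map_add, add_add_add_comm]
      exact Submodule.add_mem _ (hX c) (hY c)
    | smul d X _ hX => intro c; rw [smul_smul]; exact hX _
  have h1 := key X hX 1
  rw [one_smul, hc] at h1
  have h2 := Submodule.smul_mem _ (1 / 2 : ℝ) h1
  rwa [← two_smul ℝ X, smul_smul, show (1 / 2 : ℝ) * 2 = 1 by norm_num, one_smul] at h2

variable [Module.Finite ℚ V]

theorem mem_lieWR_of_mem {k l : ℕ} {X : EndC V} (hX : X ∈ lieWR S P k) (hX' : X ∈ wEnd S l) :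
    X ∈ lieWR S P l := by
  rw [mem_lieWR, lieWC_eq] at hX ⊢
  exact ⟨⟨hX.1.1, hX'⟩, hX.2⟩

theorem lieWR_le_wEnd {k : ℕ} {X : EndC V} (hX : X ∈ lieWR S P k) : X ∈ wEnd S k :=
  lieWC_le_wEnd k (mem_lieWR.1 hX).1

theorem lieWR_anti {k l : ℕ} (h : k ≤ l) : lieWR S P l ≤ lieWR S P k := fun _ hX =>
  mem_lieWR_of_mem hX (wEnd_anti h (lieWR_le_wEnd hX))

theorem IsWeightGroup.adR_mem (hP : IsWeightGroup S P) {k : ℕ} (hk : 1 ≤ k) {g : GLC V}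
    (hg : g ∈ realPts P) {X : EndC V} (hX : X ∈ lieWR S P k) : adR g X ∈ lieWR S P k := by
  rw [mem_lieWR] at hX ⊢
  rw [mem_realPts] at hg
  refine ⟨hP.conjE_mem_lieWC hk hg.1 hX.1, ?_⟩
  have h1 : galG conjAut g = g := Units.ext hg.2
  have h2 : galE conjAut ((g⁻¹ : GLC V) : EndC V) = ((g⁻¹ : GLC V) : EndC V) := by
    rw [← coe_galG, map_inv, h1]
  change galE conjAut ((g : EndC V) * X * ((g⁻¹ : GLC V) : EndC V)) =
    (g : EndC V) * X * ((g⁻¹ : GLC V) : EndC V)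
  rw [map_mul, map_mul, hg.2, h2, hX.2]

/-- The class in `GrR` of an element of `W_{-k}(Lie P)_ℝ`. -/
abbrev grMk {k : ℕ} (X : EndC V) (hX : X ∈ lieWR S P k) : GrR S P k :=
  Submodule.Quotient.mk ⟨X, hX⟩

theorem grMk_eq_iff {k : ℕ} {X Y : EndC V} (hX : X ∈ lieWR S P k) (hY : Y ∈ lieWR S P k) :
    grMk X hX = grMk Y hY ↔ X - Y ∈ wEnd S (k + 1) := by
  rw [grMk, grMk, Submodule.Quotient.eq]
  exact ⟨fun h => lieWR_le_wEnd h, fun h => mem_lieWR_of_mem (Submodule.sub_mem _ hX hY) h⟩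

theorem IsWeightGroup.adGr_grMk (hP : IsWeightGroup S P) {k : ℕ} (hk : 1 ≤ k) {g : GLC V}
    (hg : g ∈ realPts P) {X : EndC V} (hX : X ∈ lieWR S P k) :
    adGr S P g k (grMk X hX) = grMk (adR g X) (hP.adR_mem hk hg hX) := by
  have h : (∀ X ∈ lieWR S P k, adR g X ∈ lieWR S P k) ∧
      (∀ X ∈ lieWR S P (k + 1), adR g X ∈ lieWR S P (k + 1)) :=
    ⟨fun X hX => hP.adR_mem hk hg hX, fun X hX => hP.adR_mem (by omega) hg hX⟩
  rw [adGr, dif_pos h]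
  rfl

namespace IsLeviWeight

variable (hL : IsLeviWeight S P L a)
include hL

omit [Module.Finite ℚ V] in
theorem realPts_le : realPts L ≤ realPts P := fun g hg => by
  rw [mem_realPts] at hg ⊢
  exact ⟨hL.le hg.1, hg.2⟩

theorem degPart_lieWC {k : ℕ} (hk : 1 ≤ k) {X : EndC V} (hX : X ∈ lieWC S P k) (i : ℕ) :
    degPart S a i X ∈ lieWC S P k :=
  degPart_mem (fun _ h => hL.elt.group.conjE_mem_lieWC hk hL.elt.mem h) hX i

theorem degPart_lieWR {X : EndC V} (hX : X ∈ lieWR S P 1) (i : ℕ) :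
    degPart S a i X ∈ lieWR S P i := by
  have h0 := mem_wEnd_zero (lieWR_le_wEnd hX)
  rw [mem_lieWR] at hX
  refine mem_lieWR_of_mem (mem_lieWR.2 ⟨hL.degPart_lieWC le_rfl hX.1 i, ?_⟩)
    (hL.elt.degPart_mem_wEnd i h0)
  rw [← degPart_galE (hL.rational _), hX.2]

/-- The section picks the component of degree -k of a representative. It kills W_{-(k+1)}, is
rational because `a` is, and is equivariant because the Levi subgroup commutes with `a`. -/
theorem exists_isSplitting : ∃ s : Sections S P, IsSplitting S P L s := by
  have hmem : ∀ j, ∀ X ∈ lieWR S P (j + 1), degPart S a (j + 1) X ∈ lieWR S P (j + 1) :=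
    fun j X hX => hL.degPart_lieWR (lieWR_anti (by omega) hX) _
  let s : Sections S P := fun j => Submodule.liftQ _
    (((degPart S a (j + 1)).restrictScalars ℝ).restrict (hmem j)) (fun X hX => by
      rw [LinearMap.mem_ker]
      exact Subtype.ext (hL.elt.degPart_eq_zero (by omega) (lieWR_le_wEnd hX)))
  have hs : ∀ j (X : EndC V) (hX : X ∈ lieWR S P (j + 1)),
      (s j (grMk X hX) : EndC V) = degPart S a (j + 1) X := fun _ _ _ => rfl
  refine ⟨s, fun j x => ?_, fun j X => ?_, fun g hg j x => ?_⟩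
  · obtain ⟨⟨X, hX⟩, rfl⟩ := Submodule.Quotient.mk_surjective _ x
    refine ((grMk_eq_iff hX (hmem j X hX)).2 (hL.degPart_sub_mem (lieWR_le_wEnd hX))).symm
  · have hX : (cxMap (X : Module.End ℚ V) : EndC V) ∈ lieWR S P (j + 1) :=
      Submodule.subset_span ⟨X, X.2, rfl⟩
    obtain ⟨Y, hY⟩ := exists_eq_cxHom (T := degPart S a (j + 1) (cxHom V X)) fun σ => by
      rw [← degPart_galE (hL.rational σ), galE_cxHom]
    have h1 := (mem_lieWR.1 (hmem j _ hX)).1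
    rw [← cxHom_apply, hY, lieWC_eq] at h1
    exact ⟨⟨Y, cxHom_mem_lieAlgC.1 h1.1, cxHom_mem_wEnd.1 h1.2⟩, hY⟩
  · obtain ⟨⟨X, hX⟩, rfl⟩ := Submodule.Quotient.mk_surjective _ x
    have hgP := hL.realPts_le hg
    change (s j (adGr S P g (j + 1) (grMk X hX)) : EndC V) = adR g (s j (grMk X hX))
    rw [hL.elt.group.adGr_grMk (by omega) hgP hX, hs, hs]
    exact degPart_conjE ((hL.mem_iff g).1 (mem_realPts.1 hg).1).2 _ _

variable {s : Sections S P} (hs : IsSplitting S P L s)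
include hs

/-- The sections are the splittings by the weight element. -/
theorem section_eigen (j : ℕ) (x : GrR S P (j + 1)) :
    conjE a (s j x : EndC V) = adNode (j + 1) • (s j x : EndC V) := by
  have h1 := hs.equivariant a hL.mem j x
  -- Since `a` itself lies in L(ℝ), equivariance can be applied to it; on the graded piece it acts
  -- as a scalar, so the image of the section consists of eigenvectors.
  have h2 : adGr S P a (j + 1) x = ((adNode (j + 1) : ℚ) : ℝ) • x := by
    obtain ⟨⟨X, hX⟩, rfl⟩ := Submodule.Quotient.mk_surjective _ x
    have h3 := hL.elt.group.adGr_grMk (by omega) (hL.realPts_le hL.mem) hX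
    refine h3.trans ((grMk_eq_iff _ (Submodule.smul_mem _ _ hX)).2 ?_)
    have h4 := IsWeightOp.conjE_sub_mem hL.elt.group hL.elt.mem hL.elt.op (lieWR_le_wEnd hX)
    rwa [← adNode_cast] at h4
  rw [h2, map_smul] at h1
  refine h1.symm.trans ?_
  rw [rat_smul_eq, Submodule.coe_smul, real_smul_eq]
  norm_cast

theorem degPart_section (j : ℕ) (x : GrR S P (j + 1)) (i : ℕ) :
    degPart S a i (s j x) = if i = j + 1 then (s j x : EndC V) else 0 :=
  hL.elt.degPart_of_eigen (mem_wEnd_zero (lieWR_le_wEnd (s j x).2)) (hL.section_eigen hs j x) i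

theorem degPart_sum_section {n : ℕ} (w : ∀ i : Fin n, GrR S P (i + 1)) (i : Fin n) :
    degPart S a (i + 1) (∑ j : Fin n, (s j (w j) : EndC V)) = s i (w i) := by
  rw [map_sum, Finset.sum_eq_single i, hL.degPart_section hs, if_pos rfl]
  · intro j _ hj
    rw [hL.degPart_section hs, if_neg]
    intro h
    exact hj (Fin.ext (by omega))
  · exact fun h => absurd (Finset.mem_univ i) h

omit hL hs in
theorem sum_section_mem {n : ℕ} (w : ∀ i : Fin n, GrR S P (i + 1)) :
    ∑ j : Fin n, (s j (w j) : EndC V) ∈ lieWR S P 1 :=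
  Submodule.sum_mem _ fun j _ => lieWR_anti (by omega) (s j (w j)).2

end IsLeviWeight

end RealLieAlgebra

/-! ### Logarithmic coordinates and the group law of W_{-1}(ℝ). -/

section GroupLaw

variable {V : Type*} [AddCommGroup V] [Module ℚ V] {S : HodgeData V} {P L : Subgroup (GLC V)}
  {a : GLC V}

theorem pow_sub_pow_mem_wEnd_succ {k : ℕ} {X Y : EndC V} (hX : X ∈ wEnd S 1) (hY : Y ∈ wEnd S 1)
    (h : X - Y ∈ wEnd S k) (n : ℕ) : X ^ (n + 2) - Y ^ (n + 2) ∈ wEnd S (k + 1) := by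
  have e : X ^ (n + 2) - Y ^ (n + 2) =
      (X ^ (n + 1) - Y ^ (n + 1)) * X + Y ^ (n + 1) * (X - Y) := by
    rw [pow_succ X (n + 1), pow_succ Y (n + 1)]; noncomm_ring
  rw [e]
  refine Submodule.add_mem _ (mul_mem_wEnd
    (pow_sub_pow_mem_wEnd (mem_wEnd_zero hX) (mem_wEnd_zero hY) h _) hX) ?_
  have h1 : Y ^ (n + 1) ∈ wEnd S 1 := wEnd_anti (by omega) (pow_mem_wEnd hY (n + 1))
  rw [add_comm]
  exact mul_mem_wEnd h1 h

/-- In a difference of powers of order at least two, each term has one factor X - Y and at least one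
more factor in W_{-1}, which gains a step. -/
theorem exp_sub_exp_sub_mem_wEnd {k : ℕ} {X Y : EndC V} (hX : X ∈ wEnd S 1) (hY : Y ∈ wEnd S 1)
    (h : X - Y ∈ wEnd S k) :
    IsNilpotent.exp X - IsNilpotent.exp Y - (X - Y) ∈ wEnd S (k + 1) := by
  obtain ⟨N, hN⟩ := isNilpotent_of_mem_wEnd le_rfl hX
  obtain ⟨M, hM⟩ := isNilpotent_of_mem_wEnd le_rfl hY
  rw [IsNilpotent.exp_eq_sum (pow_eq_zero_of_le (show N ≤ max N M + 2 by omega) hN),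
    IsNilpotent.exp_eq_sum (pow_eq_zero_of_le (show M ≤ max N M + 2 by omega) hM),
    ← Finset.sum_sub_distrib, Finset.sum_range_succ', Finset.sum_range_succ']
  have e : ∀ T : EndC V, T + ((((0 + 1).factorial : ℚ)⁻¹ • X ^ (0 + 1)) -
      (((0 + 1).factorial : ℚ)⁻¹ • Y ^ (0 + 1))) + ((((0).factorial : ℚ)⁻¹ • X ^ 0) -
      (((0).factorial : ℚ)⁻¹ • Y ^ 0)) - (X - Y) = T := fun T => by simp
  rw [e]
  refine Submodule.sum_mem _ fun i _ => ?_
  rw [← smul_sub]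
  exact rat_smul_mem _ (pow_sub_pow_mem_wEnd_succ hX hY h i)

theorem nilLog_sub_nilLog_sub_mem_wEnd {k : ℕ} {u v : EndC V} (hu : u - 1 ∈ wEnd S 1)
    (hv : v - 1 ∈ wEnd S 1) (h : u - v ∈ wEnd S k) :
    nilLog u - nilLog v - (u - v) ∈ wEnd S (k + 1) := by
  obtain ⟨N, hN⟩ := isNilpotent_of_mem_wEnd le_rfl hu
  obtain ⟨M, hM⟩ := isNilpotent_of_mem_wEnd le_rfl hv
  rw [nilLog_eq_sum (pow_eq_zero_of_le (show N ≤ max N M + 2 by omega) hN),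
    nilLog_eq_sum (pow_eq_zero_of_le (show M ≤ max N M + 2 by omega) hM),
    ← Finset.sum_sub_distrib, Finset.sum_range_succ', Finset.sum_range_succ']
  have e : ∀ T : EndC V,
      T + ((((-1 : ℚ) ^ (0 + 1 + 1) / ((0 + 1 : ℕ) : ℚ)) • (u - 1) ^ (0 + 1)) -
      (((-1 : ℚ) ^ (0 + 1 + 1) / ((0 + 1 : ℕ) : ℚ)) • (v - 1) ^ (0 + 1))) +
      ((((-1 : ℚ) ^ (0 + 1) / ((0 : ℕ) : ℚ)) • (u - 1) ^ 0) -
      (((-1 : ℚ) ^ (0 + 1) / ((0 : ℕ) : ℚ)) • (v - 1) ^ 0)) - (u - v) = T := fun T => by simp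
  rw [e]
  refine Submodule.sum_mem _ fun i _ => ?_
  rw [← smul_sub]
  exact rat_smul_mem _ (pow_sub_pow_mem_wEnd_succ hu hv (by simpa using h) i)

theorem exp_mul_exp_sub_one_mem {A B : EndC V} (hA : A ∈ wEnd S 1) (hB : B ∈ wEnd S 1) :
    IsNilpotent.exp A * IsNilpotent.exp B - 1 ∈ wEnd S 1 := by
  have hA1 := exp_sub_one_mem_wEnd le_rfl hA
  have hB1 := exp_sub_one_mem_wEnd le_rfl hB
  have e : IsNilpotent.exp A * IsNilpotent.exp B - 1 = (IsNilpotent.exp A - 1) +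
      (IsNilpotent.exp A - 1) * (IsNilpotent.exp B - 1) + (IsNilpotent.exp B - 1) := by
    noncomm_ring
  rw [e]
  exact Submodule.add_mem _ (Submodule.add_mem _ hA1
    (wEnd_anti (by omega) (mul_mem_wEnd hA1 hB1))) hB1

/-- `log (exp A exp B)` in the leading degree of a perturbation. -/
theorem nilLog_exp_mul_exp_sub_mem {k : ℕ} {A B A' B' : EndC V} (hA : A ∈ wEnd S 1)
    (hB : B ∈ wEnd S 1) (hA' : A' ∈ wEnd S 1) (hB' : B' ∈ wEnd S 1) (h : A - A' ∈ wEnd S k)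
    (h' : B - B' ∈ wEnd S k) :
    nilLog (IsNilpotent.exp A * IsNilpotent.exp B) -
      nilLog (IsNilpotent.exp A' * IsNilpotent.exp B') - ((A - A') + (B - B')) ∈
        wEnd S (k + 1) := by
  have h1 := exp_sub_exp_sub_mem_wEnd hA hA' h
  have h2 := exp_sub_exp_sub_mem_wEnd hB hB' h'
  have hd := exp_sub_exp_mem_wEnd hA hA' h
  have hd' := exp_sub_exp_mem_wEnd hB hB' h'
  have hB1 := exp_sub_one_mem_wEnd le_rfl hB
  have hA1' := exp_sub_one_mem_wEnd le_rfl hA'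
  have h3 : IsNilpotent.exp A * IsNilpotent.exp B - IsNilpotent.exp A' * IsNilpotent.exp B' -
      ((A - A') + (B - B')) ∈ wEnd S (k + 1) := by
    have e : IsNilpotent.exp A * IsNilpotent.exp B - IsNilpotent.exp A' * IsNilpotent.exp B' -
        ((A - A') + (B - B')) =
        (IsNilpotent.exp A - IsNilpotent.exp A' - (A - A')) +
        (IsNilpotent.exp B - IsNilpotent.exp B' - (B - B')) +
        (IsNilpotent.exp A - IsNilpotent.exp A') * (IsNilpotent.exp B - 1) +
        (IsNilpotent.exp A' - 1) * (IsNilpotent.exp B - IsNilpotent.exp B') := by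
      noncomm_ring
    rw [e]
    refine Submodule.add_mem _ (Submodule.add_mem _ (Submodule.add_mem _ h1 h2)
      (mul_mem_wEnd hd hB1)) ?_
    rw [add_comm k]
    exact mul_mem_wEnd hA1' hd'
  have h4 : IsNilpotent.exp A * IsNilpotent.exp B - IsNilpotent.exp A' * IsNilpotent.exp B' ∈
      wEnd S k := by
    have := Submodule.add_mem _ (wEnd_anti (Nat.le_succ k) h3) (Submodule.add_mem _ h h')
    rwa [sub_add_cancel] at this
  have h5 := nilLog_sub_nilLog_sub_mem_wEnd (exp_mul_exp_sub_one_mem hA hB)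
    (exp_mul_exp_sub_one_mem hA' hB') h4
  have := Submodule.add_mem _ h5 h3
  rwa [sub_add_sub_cancel] at this

variable [Module.Finite ℚ V]

omit [Module.Finite ℚ V] in
theorem galE_nilLog {u : EndC V} (hu : u - 1 ∈ wEnd S 1) (σ : ℂ ≃+* ℂ) :
    galE σ (nilLog u) = nilLog (galE σ u) := by
  have h1 := exp_nilLog_of_mem le_rfl hu
  conv_rhs => rw [← h1, galE_exp σ (isNilpotent_of_mem_wEnd le_rfl (nilLog_mem_wEnd le_rfl hu))]
  rw [nilLog_exp_of_mem le_rfl (galE_mem_wEnd (nilLog_mem_wEnd le_rfl hu) σ)]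

theorem IsWeightGroup.nilLog_exp_mul_exp_mem (hP : IsWeightGroup S P) {A B : EndC V}
    (hA : A ∈ lieWR S P 1) (hB : B ∈ lieWR S P 1) :
    nilLog (IsNilpotent.exp A * IsNilpotent.exp B) ∈ lieWR S P 1 := by
  rw [mem_lieWR] at hA hB ⊢
  have hA' := lieWC_le_wEnd _ hA.1
  have hB' := lieWC_le_wEnd _ hB.1
  have h1 := nilLog_mem_lieWC le_rfl
    (mul_mem (hP.expUnit_mem le_rfl hA.1) (hP.expUnit_mem le_rfl hB.1))
  rw [Units.val_mul, coe_expUnit, coe_expUnit] at h1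
  refine ⟨h1, ?_⟩
  rw [galE_nilLog (exp_mul_exp_sub_one_mem hA' hB'), map_mul,
    galE_exp _ (isNilpotent_of_mem_wEnd le_rfl hA'), hA.2,
    galE_exp _ (isNilpotent_of_mem_wEnd le_rfl hB'), hB.2]

namespace IsLeviWeight

variable (hL : IsLeviWeight S P L a)

section
include hL

/-- The quotient of the two unipotent parts is a quotient of Levi elements, so it commutes with `a`
and is 1; logarithms then recover the exponents. -/
theorem exp_mul_injective {A A' : EndC V} {l l' : GLC V} (hA : A ∈ lieWC S P 1)
    (hA' : A' ∈ lieWC S P 1) (hl : l ∈ L) (hl' : l' ∈ L)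
    (h : IsNilpotent.exp A * (l : EndC V) = IsNilpotent.exp A' * (l' : EndC V)) :
    A = A' ∧ l = l' := by
  set u := expUnit A (isNilpotent_of_mem_lieWC le_rfl hA) with hu
  set u' := expUnit A' (isNilpotent_of_mem_lieWC le_rfl hA') with hu'
  have hum : u ∈ unipSub S P 1 := hL.elt.group.expUnit_mem le_rfl hA
  have hum' : u' ∈ unipSub S P 1 := hL.elt.group.expUnit_mem le_rfl hA'
  have h1 : u * l = u' * l' := Units.ext h
  have h2 : u'⁻¹ * u = l' * l⁻¹ := by
    rw [eq_mul_inv_iff_mul_eq, mul_assoc, h1, inv_mul_cancel_left]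
  have h3 : u'⁻¹ * u = 1 := by
    refine hL.elt.eq_one_of_commute (mul_mem (inv_mem hum') hum) ?_
    rw [h2]
    exact ((hL.mem_iff _).1 (L.mul_mem hl' (L.inv_mem hl))).2
  have h4 : u = u' := (inv_mul_eq_one.1 h3).symm
  refine ⟨?_, ?_⟩
  · have h5 : IsNilpotent.exp A = IsNilpotent.exp A' := congrArg Units.val h4
    rw [← nilLog_exp (isNilpotent_of_mem_lieWC le_rfl hA), h5,
      nilLog_exp (isNilpotent_of_mem_lieWC le_rfl hA')]
  · rw [h4] at h1
    exact mul_left_cancel h1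

/-- The conjugate of a decomposition of a real element is another decomposition of it, so by
uniqueness both factors are real. -/
theorem exists_exp_mul {g : GLC V} (hg : g ∈ realPts P) :
    ∃ A ∈ lieWR S P 1, ∃ l ∈ realPts L, (g : EndC V) = IsNilpotent.exp A * (l : EndC V) := by
  rw [mem_realPts] at hg
  obtain ⟨u, hu, l, hl, rfl⟩ := hL.exists_mul hg.1
  have hA := nilLog_mem_lieWC le_rfl hu
  have he := exp_nilLog_of_mem le_rfl hu.2.2.2
  generalize nilLog (u : EndC V) = A at hA he
  have hlσ : galG conjAut l ∈ L := by
    rw [hL.mem_iff] at hl ⊢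
    refine ⟨hL.elt.group.alg.galG_mem _ hl.1, ?_⟩
    have ha : galG conjAut a = a := Units.ext (hL.rational _)
    have h1 := congrArg (galG conjAut) hl.2
    rwa [map_mul, map_mul, ha] at h1
  have h1 : IsNilpotent.exp (galE conjAut A) * (galG conjAut l : EndC V) =
      IsNilpotent.exp A * (l : EndC V) := by
    rw [he, ← galE_exp _ (isNilpotent_of_mem_lieWC le_rfl hA), he, coe_galG, ← map_mul,
      ← Units.val_mul, hg.2]
  obtain ⟨h2, h3⟩ := hL.exp_mul_injective (galE_mem_lieWC hA _) hA hlσ hl h1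
  refine ⟨A, mem_lieWR.2 ⟨hA, h2⟩, l, mem_realPts.2 ⟨hl, congrArg Units.val h3⟩, ?_⟩
  rw [he, Units.val_mul]

end

/-- The coordinates of an element of `W_{-1}(Lie P)_ℝ` in the graded pieces. -/
def coord (hL : IsLeviWeight S P L a) (i : ℕ) (A : EndC V) (hA : A ∈ lieWR S P 1) :
    GrR S P (i + 1) := grMk (degPart S a (i + 1) A) (hL.degPart_lieWR hA (i + 1))

theorem coord_congr (i : ℕ) {A B : EndC V} (hA : A ∈ lieWR S P 1) (hB : B ∈ lieWR S P 1)
    (h : A = B) : hL.coord i A hA = hL.coord i B hB := by subst h; rfl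

theorem coord_zero (i : ℕ) (h : (0 : EndC V) ∈ lieWR S P 1) : hL.coord i 0 h = 0 := by
  refine (grMk_eq_iff _ (Submodule.zero_mem _)).2 ?_
  rw [map_zero, sub_zero]
  exact Submodule.zero_mem _

theorem eq_of_coord_eq {i : ℕ} {A B : EndC V} (hA : A ∈ lieWR S P 1) (hB : B ∈ lieWR S P 1)
    (h : hL.coord i A hA = hL.coord i B hB) :
    degPart S a (i + 1) A = degPart S a (i + 1) B := by
  have h1 := (grMk_eq_iff _ _).1 h
  rw [← map_sub] at h1
  have hAB := mem_wEnd_zero (lieWR_le_wEnd (Submodule.sub_mem _ hA hB))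
  have h2 := hL.elt.degPart_eq_zero (i := i + 1) (by omega) h1
  rw [hL.elt.degPart_of_eigen (mem_wEnd_zero (hL.elt.degPart_mem_wEnd _ hAB))
    (hL.elt.conjE_degPart _ hAB), if_pos rfl, map_sub, sub_eq_zero] at h2
  exact h2

theorem adGr_coord (i : ℕ) {A : EndC V} (hA : A ∈ lieWR S P 1) {g : GLC V} (hg : g ∈ realPts L) :
    adGr S P g (i + 1) (hL.coord i A hA) =
      hL.coord i (adR g A) (hL.elt.group.adR_mem le_rfl (hL.realPts_le hg) hA) := by
  rw [coord, hL.elt.group.adGr_grMk (by omega) (hL.realPts_le hg)]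
  refine (grMk_eq_iff _ _).2 ?_
  have h1 : degPart S a (i + 1) (adR g A) = adR g (degPart S a (i + 1) A) :=
    degPart_conjE ((hL.mem_iff g).1 (mem_realPts.1 hg).1).2 _ _
  rw [h1, sub_self]
  exact Submodule.zero_mem _

/-- The coordinates of `A` determine it modulo `W_{-(n+1)}`. -/
theorem sub_mem_of_coord_eq {n : ℕ} {A B : EndC V} (hA : A ∈ lieWR S P 1) (hB : B ∈ lieWR S P 1)
    (h : ∀ i < n, hL.coord i A hA = hL.coord i B hB) : A - B ∈ wEnd S (n + 1) := by
  have hAB := lieWR_le_wEnd (Submodule.sub_mem _ hA hB)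
  have h1 := hL.elt.sub_sum_mem_wEnd (n + 1) (mem_wEnd_zero hAB)
  rw [Finset.sum_eq_zero, sub_zero] at h1
  · exact h1
  · intro i hi
    rcases i with _ | i
    · exact hL.elt.degPart_eq_zero one_pos hAB
    · rw [map_sub, hL.eq_of_coord_eq hA hB (h i (by simpa using hi)), sub_self]

theorem coord_eq_of_sub_mem {n : ℕ} {A B : EndC V} (hA : A ∈ lieWR S P 1) (hB : B ∈ lieWR S P 1)
    (h : A - B ∈ wEnd S (n + 1)) {i : ℕ} (hi : i < n) : hL.coord i A hA = hL.coord i B hB := by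
  refine (grMk_eq_iff _ _).2 ?_
  rw [← map_sub, hL.elt.degPart_eq_zero (by omega) h]
  exact Submodule.zero_mem _

variable {s : Sections S P} (hs : IsSplitting S P L s)

section
include hs

theorem coord_sum_section {n : ℕ} (w : ∀ i : Fin n, GrR S P (i + 1)) (i : Fin n) :
    hL.coord i (∑ j : Fin n, (s j (w j) : EndC V)) (sum_section_mem w) = w i := by
  conv_rhs => rw [← hs.isSection i (w i)]
  refine (grMk_eq_iff _ (s i (w i)).2).2 ?_
  rw [hL.degPart_sum_section hs, sub_self]
  exact Submodule.zero_mem _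

theorem sub_sum_section_mem (n : ℕ) {A : EndC V} (hA : A ∈ lieWR S P 1) :
    A - ∑ j : Fin n, (s j (hL.coord j A hA) : EndC V) ∈ wEnd S (n + 1) :=
  hL.sub_mem_of_coord_eq hA (sum_section_mem _) fun i hi =>
    (hL.coord_sum_section hs (fun j : Fin n => hL.coord j A hA) ⟨i, hi⟩).symm

end

/-- The polynomial maps that describe the group law of `W_{-1}(ℝ)`. -/
def calb (hL : IsLeviWeight S P L a) (s : Sections S P) : Calb S P := fun n w w' =>
  hL.coord n (nilLog (IsNilpotent.exp (∑ j : Fin n, (s j (w j) : EndC V)) *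
      IsNilpotent.exp (∑ j : Fin n, (s j (w' j) : EndC V))))
    (hL.elt.group.nilLog_exp_mul_exp_mem (sum_section_mem w) (sum_section_mem w'))

theorem calb_zero (s : Sections S P) (n : ℕ) : hL.calb s n 0 0 = 0 := by
  have h : nilLog (IsNilpotent.exp (∑ j : Fin n,
      (s j ((0 : ∀ j : Fin n, GrR S P (j + 1)) j) : EndC V)) *
      IsNilpotent.exp (∑ j : Fin n, (s j ((0 : ∀ j : Fin n, GrR S P (j + 1)) j) : EndC V))) =
      0 := by
    simp only [Pi.zero_apply, map_zero, ZeroMemClass.coe_zero, Finset.sum_const_zero,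
      IsNilpotent.exp_zero, mul_one, nilLog_one]
  exact (hL.coord_congr n _ (Submodule.zero_mem _) h).trans (hL.coord_zero n _)

/-- Truncating A and B to their first `n` coordinates changes them by elements of W_{-(n+1)}. Modulo
W_{-(n+2)} the logarithm of the product changes by the sum of these elements. The truncations have
no component of degree -(n+1) themselves, so the coordinate is the sum of the two coordinates and a
function of the earlier ones. -/
theorem coord_nilLog_mul (hs : IsSplitting S P L s) (n : ℕ) {A B : EndC V}
    (hA : A ∈ lieWR S P 1) (hB : B ∈ lieWR S P 1) :
    hL.coord n (nilLog (IsNilpotent.exp A * IsNilpotent.exp B))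
        (hL.elt.group.nilLog_exp_mul_exp_mem hA hB) =
      hL.coord n A hA + hL.coord n B hB +
        hL.calb s n (fun j => hL.coord j A hA) (fun j => hL.coord j B hB) := by
  have hX := hL.sub_sum_section_mem hs n hA
  have hY := hL.sub_sum_section_mem hs n hB
  have hA0 := sum_section_mem (s := s) (fun j : Fin n => hL.coord j A hA)
  have hB0 := sum_section_mem (s := s) (fun j : Fin n => hL.coord j B hB)
  have h1 := nilLog_exp_mul_exp_sub_mem (lieWR_le_wEnd hA) (lieWR_le_wEnd hB)
    (lieWR_le_wEnd hA0) (lieWR_le_wEnd hB0) hX hY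
  have h2 : ∀ w : ∀ j : Fin n, GrR S P (j + 1),
      degPart S a (n + 1) (∑ j : Fin n, (s j (w j) : EndC V)) = 0 := by
    intro w
    rw [map_sum]
    refine Finset.sum_eq_zero fun j _ => ?_
    rw [hL.degPart_section hs, if_neg (by have := j.2; omega)]
  refine (grMk_eq_iff _ (Submodule.add_mem _ (Submodule.add_mem _ (hL.degPart_lieWR hA _)
    (hL.degPart_lieWR hB _)) (hL.degPart_lieWR
      (hL.elt.group.nilLog_exp_mul_exp_mem hA0 hB0) _))).2 ?_
  have h3 := hL.elt.degPart_eq_zero (i := n + 1) (by omega) h1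
  simp only [map_sub, map_add, h2, sub_zero] at h3
  have e : ∀ x y z t : EndC V, x - y - (z + t) = x - (z + t + y) := fun x y z t => by abel
  rw [e] at h3
  rw [h3]
  exact Submodule.zero_mem _

include hs in
theorem exp_eq_expSum {m : ℕ} (hm : lieW S P (m + 1) = ⊥) {A : EndC V} (hA : A ∈ lieWR S P 1) :
    IsNilpotent.exp A = expSum s (fun i : Fin m => hL.coord i A hA) := by
  have h1 : lieWR S P (m + 1) = ⊥ := by
    rw [lieWR, hm, eq_bot_iff, Submodule.span_le]
    rintro _ ⟨X, hX, rfl⟩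
    rw [SetLike.mem_coe, Submodule.mem_bot] at hX
    subst hX
    exact map_zero (cxHom V)
  have h2 := mem_lieWR_of_mem (Submodule.sub_mem _ hA (sum_section_mem (s := s)
    (fun i : Fin m => hL.coord i A hA))) (hL.sub_sum_section_mem hs m hA)
  rw [h1, Submodule.mem_bot, sub_eq_zero] at h2
  rw [expSum, ← h2]

theorem expSum_mul_expSum (hs : IsSplitting S P L s) {m : ℕ} (hm : lieW S P (m + 1) = ⊥)
    (w w' : ∀ i : Fin m, GrR S P (i + 1)) : expSum s w * expSum s w' =
      expSum s (fun i => w i + w' i + hL.calb s i (trunc i.2.le w) (trunc i.2.le w')) := by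
  have hA := sum_section_mem (s := s) w
  have hB := sum_section_mem (s := s) w'
  have hC := hL.elt.group.nilLog_exp_mul_exp_mem hA hB
  have h1 : expSum s w * expSum s w' = IsNilpotent.exp (nilLog (expSum s w * expSum s w')) :=
    (exp_nilLog_of_mem le_rfl
      (exp_mul_exp_sub_one_mem (lieWR_le_wEnd hA) (lieWR_le_wEnd hB))).symm
  rw [h1]
  -- The hypothesis on `m` makes the first `m` coordinates determine the logarithm completely, so
  -- the identity can be checked coordinate by coordinate.
  refine (hL.exp_eq_expSum hs hm hC).trans (congrArg _ (funext fun i => ?_))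
  rw [hL.coord_nilLog_mul hs i hA hB, hL.coord_sum_section hs w i, hL.coord_sum_section hs w' i]
  congr 2
  · funext j
    exact hL.coord_sum_section hs w ⟨j, j.2.trans i.2⟩
  · funext j
    exact hL.coord_sum_section hs w' ⟨j, j.2.trans i.2⟩

include hL in
/-- The decomposition `g = exp (∑ s_k w_k) g₀`. -/
theorem existsUnique_decomp (hs : IsSplitting S P L s) {m : ℕ} (hm : lieW S P (m + 1) = ⊥)
    {g : GLC V} (hg : g ∈ realPts P) :
    ∃! b : GLC V × (∀ i : Fin m, GrR S P (i + 1)),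
      b.1 ∈ realPts L ∧ (g : EndC V) = expSum s b.2 * (b.1 : EndC V) := by
  obtain ⟨A, hA, l, hl, hgl⟩ := hL.exists_exp_mul hg
  refine ⟨(l, fun i => hL.coord i A hA), ⟨hl, by rw [hgl, ← hL.exp_eq_expSum hs hm hA]⟩, ?_⟩
  rintro ⟨l', w⟩ ⟨hl', hw⟩
  have hw0 := sum_section_mem (s := s) w
  obtain ⟨h1, h2⟩ := hL.exp_mul_injective (mem_lieWR.1 hw0).1 (mem_lieWR.1 hA).1
    (mem_realPts.1 hl').1 (mem_realPts.1 hl).1 (hw.symm.trans hgl)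
  refine Prod.ext h2 (funext fun i => ?_)
  exact (hL.coord_sum_section hs w i).symm.trans (hL.coord_congr i hw0 hA h1)

end IsLeviWeight

end GroupLaw

/-! ### Endomorphism-valued functions with coefficients in a given space. -/

section MatrixCoefficients

variable {V : Type*} [AddCommGroup V] [Module ℚ V] {X : Type*} {M N K : Submodule ℚ (X → ℝ)}
  {F G : X → EndC V}

/-- The matrix coefficients of `F x` are real, and as functions of `x` they lie in `M`. -/
def CoefIn (M : Submodule ℚ (X → ℝ)) (F : X → EndC V) : Prop :=
  ∀ vl, ∃ f ∈ M, ∀ x, coef (F x) vl = (f x : ℂ)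

namespace CoefIn

theorem mono (hF : CoefIn M F) (h : M ≤ N) : CoefIn N F := fun vl => by
  obtain ⟨f, hf, e⟩ := hF vl
  exact ⟨f, h hf, e⟩

theorem zero : CoefIn M (fun _ => (0 : EndC V)) :=
  fun vl => ⟨0, Submodule.zero_mem _, fun x => by rw [coef_zero]; simp⟩

theorem add (hF : CoefIn M F) (hG : CoefIn M G) : CoefIn M (fun x => F x + G x) := fun vl => by
  obtain ⟨f, hf, h⟩ := hF vl
  obtain ⟨g, hg, h'⟩ := hG vl
  exact ⟨f + g, Submodule.add_mem _ hf hg, fun x => by rw [coef_add, h, h']; simp⟩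

theorem smul (hF : CoefIn M F) (c : ℚ) : CoefIn M (fun x => c • F x) := fun vl => by
  obtain ⟨f, hf, h⟩ := hF vl
  refine ⟨c • f, Submodule.smul_mem _ c hf, fun x => ?_⟩
  change coef (c • F x) vl = _
  rw [rat_smul_eq, coef_smul, h, Pi.smul_apply, Rat.smul_def]
  push_cast
  rfl

theorem sum {ι : Type*} (t : Finset ι) {F : ι → X → EndC V} (hF : ∀ i ∈ t, CoefIn M (F i)) :
    CoefIn M (fun x => ∑ i ∈ t, F i x) := by
  classical
  induction t using Finset.induction_on with
  | empty => simpa using CoefIn.zero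
  | insert i t hi ih =>
    simp only [Finset.sum_insert hi]
    exact (hF i (Finset.mem_insert_self i t)).add
      (ih fun j hj => hF j (Finset.mem_insert_of_mem hj))

variable [Module.Finite ℚ V]

theorem mul (hF : CoefIn M F) (hG : CoefIn N G) (h : ∀ f ∈ M, ∀ g ∈ N, f * g ∈ K) :
    CoefIn K (fun x => F x * G x) := by
  rintro ⟨v, l⟩
  choose f hf hf' using fun i => hF (ratBasis V i, l)
  choose g hg hg' using fun i => hG (v, (ratBasis V).coord i)
  refine ⟨∑ i, f i * g i, Submodule.sum_mem _ fun i _ => h _ (hf i) _ (hg i), fun x => ?_⟩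
  rw [coef_mul]
  simp [hf', hg']

end CoefIn

variable [Module.Finite ℚ V]

theorem endBasis_eq_cxHom (i : Fin (Module.finrank ℚ V) × Fin (Module.finrank ℚ V)) :
    ∃ f, endBasis V i = cxHom V f := by
  refine exists_eq_cxHom_of_repr fun j => ?_
  rw [Module.Basis.repr_self, Finsupp.single_apply]
  split_ifs
  · exact ⟨1, by simp⟩
  · exact ⟨0, by simp⟩

theorem CoefIn.apply (hF : CoefIn M F) (Λ : EndC V →ₗ[ℂ] ℂ) (hΛ : ∀ f, ∃ c : ℚ, Λ (cxHom V f) = c) :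
    ∃ f ∈ M, ∀ x, Λ (F x) = (f x : ℂ) := by
  choose e he using endBasis_eq_cxHom (V := V)
  choose c hc using fun i => hΛ (e i)
  choose f hf hf' using fun i : Fin (Module.finrank ℚ V) × Fin (Module.finrank ℚ V) =>
    hF (ratBasis V i.2, (ratBasis V).coord i.1)
  refine ⟨∑ i, c i • f i, Submodule.sum_mem _ fun i _ => Submodule.smul_mem _ _ (hf i),
    fun x => ?_⟩
  rw [← (endBasis V).sum_repr (F x), map_sum, Finset.sum_apply, Complex.ofReal_sum]
  refine Finset.sum_congr rfl fun i _ => ?_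
  rw [map_smul, endBasis_repr, hf', he, hc, Pi.smul_apply, Rat.smul_def, smul_eq_mul, mul_comm]
  push_cast
  rfl

/-- The matrix coefficient as a linear functional. -/
def coefLin (vl : V × Module.Dual ℚ V) : EndC V →ₗ[ℂ] ℂ where
  toFun T := coef T vl
  map_add' S T := coef_add S T vl
  map_smul' c T := coef_smul c T vl

variable {S : HodgeData V} {P L : Subgroup (GLC V)} {a : GLC V}

theorem IsLeviWeight.degPart_cxHom (hL : IsLeviWeight S P L a) (k : ℕ) (f : Module.End ℚ V) :
    ∃ f', degPart S a k (cxHom V f) = cxHom V f' :=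
  exists_eq_cxHom fun σ => by rw [← degPart_galE (hL.rational σ), galE_cxHom]

theorem IsLeviWeight.coefIn_degPart (hL : IsLeviWeight S P L a) (hF : CoefIn M F) (k : ℕ) :
    CoefIn M (fun x => degPart S a k (F x)) := fun vl => by
  refine hF.apply (coefLin vl ∘ₗ degPart S a k) fun f => ?_
  obtain ⟨f', hf'⟩ := hL.degPart_cxHom k f
  exact ⟨vl.2 (f' vl.1), (congrArg (fun T => coef T vl) hf').trans (coef_cxHom f' vl)⟩

omit [Module.Finite ℚ V] in
theorem coef_eq_re {T : EndC V} (hT : galE conjAut T = T) (vl : V × Module.Dual ℚ V) :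
    coef T vl = ((coef T vl).re : ℂ) := by
  have h := coef_galE conjAut T vl
  rw [hT] at h
  exact (Complex.conj_eq_iff_re.1 h.symm).symm

end MatrixCoefficients

/-! ### Polynomiality and degree bounds for `calb`. -/

section PolynomialMaps

variable {V : Type*} [AddCommGroup V] [Module ℚ V] {S : HodgeData V} {P L : Subgroup (GLC V)}
  {a : GLC V} {n : ℕ}

/-- The pairs of coordinate vectors of length `n`. -/
abbrev CoordPair (S : HodgeData V) (P : Subgroup (GLC V)) (n : ℕ) : Type _ :=
  (∀ j : Fin n, GrR S P (j + 1)) × (∀ j : Fin n, GrR S P (j + 1))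

/-- The polynomials over `ℚ` of degree at most `p` in the first and `q` in the second argument. -/
abbrev polPair (S : HodgeData V) (P : Subgroup (GLC V)) (n p q : ℕ) :
    Submodule ℚ (CoordPair S P n → ℝ) := linLeft S P n ^ p * linRight S P n ^ q

theorem one_mem_linLeft : (1 : CoordPair S P n → ℝ) ∈ linLeft S P n :=
  Submodule.subset_span (Or.inl rfl)

theorem one_mem_linRight : (1 : CoordPair S P n → ℝ) ∈ linRight S P n :=
  Submodule.subset_span (Or.inl rfl)

theorem pow_le_pow_of_one_mem {A : Type*} [CommRing A] [Algebra ℚ A] {M : Submodule ℚ A}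
    (hM : 1 ∈ M) {i j : ℕ} (hij : i ≤ j) : M ^ i ≤ M ^ j := by
  induction j, hij using Nat.le_induction with
  | base => exact le_rfl
  | succ j _ ih =>
    refine ih.trans fun x hx => ?_
    rw [Submodule.pow_succ, ← mul_one x]
    exact Submodule.mul_mem_mul hx hM

theorem polPair_mono {p q p' q' : ℕ} (hp : p ≤ p') (hq : q ≤ q') :
    polPair S P n p q ≤ polPair S P n p' q' :=
  Submodule.mul_le.2 fun _ hf _ hg => Submodule.mul_mem_mul
    (pow_le_pow_of_one_mem one_mem_linLeft hp hf) (pow_le_pow_of_one_mem one_mem_linRight hq hg)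

theorem mul_mem_polPair {p q p' q' : ℕ} {f g : CoordPair S P n → ℝ} (hf : f ∈ polPair S P n p q)
    (hg : g ∈ polPair S P n p' q') : f * g ∈ polPair S P n (p + p') (q + q') := by
  have h := Submodule.mul_mem_mul hf hg
  have e : (linLeft S P n ^ p * linRight S P n ^ q) * (linLeft S P n ^ p' * linRight S P n ^ q') =
      (linLeft S P n ^ p * linLeft S P n ^ p') * (linRight S P n ^ q * linRight S P n ^ q') :=
    mul_mul_mul_comm (linLeft S P n ^ p) (linRight S P n ^ q) (linLeft S P n ^ p')
      (linRight S P n ^ q')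
  have e₁ : linLeft S P n ^ (p + p') = linLeft S P n ^ p * linLeft S P n ^ p' :=
    pow_add (linLeft S P n) p p'
  have e₂ : linRight S P n ^ (q + q') = linRight S P n ^ q * linRight S P n ^ q' :=
    pow_add (linRight S P n) q q'
  rw [polPair, e₁, e₂, ← e]
  exact h

/-- The endomorphism `F w` has matrix coefficients that are polynomials over `ℚ` in `w` of degree at
most `p` and `q` in the two arguments. -/
abbrev IsPol (S : HodgeData V) (P : Subgroup (GLC V)) (p q : ℕ) (F : CoordPair S P n → EndC V) :
    Prop := CoefIn (polPair S P n p q) F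

theorem IsPol.mono {p q p' q' : ℕ} {F : CoordPair S P n → EndC V} (hF : IsPol S P p q F)
    (hp : p ≤ p') (hq : q ≤ q') : IsPol S P p' q' F := CoefIn.mono hF (polPair_mono hp hq)

variable [Module.Finite ℚ V]

theorem IsPol.mul {p q p' q' : ℕ} {F G : CoordPair S P n → EndC V} (hF : IsPol S P p q F)
    (hG : IsPol S P p' q' G) : IsPol S P (p + p') (q + q') (fun w => F w * G w) :=
  CoefIn.mul hF hG fun _ hf _ hg => mul_mem_polPair hf hg

/-- The component of degree `-d` of `F w` is polynomial of degree at most `p d` and `q d`. -/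
structure IsGradedPol (S : HodgeData V) (P : Subgroup (GLC V)) (a : GLC V) (p q : ℕ → ℕ)
    (F : CoordPair S P n → EndC V) : Prop where
  mem : ∀ w, F w ∈ wEnd S 1
  pol : ∀ d, IsPol S P (p d) (q d) (fun w => degPart S a d (F w))

namespace IsGradedPol

variable {p q p' q' p'' q'' : ℕ → ℕ} {F G : CoordPair S P n → EndC V}

omit [Module.Finite ℚ V] in
theorem mono (hF : IsGradedPol S P a p q F) (hp : ∀ d, p d ≤ p' d) (hq : ∀ d, q d ≤ q' d) :
    IsGradedPol S P a p' q' F := ⟨hF.mem, fun d => (hF.pol d).mono (hp d) (hq d)⟩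

omit [Module.Finite ℚ V] in
theorem add (hF : IsGradedPol S P a p q F) (hG : IsGradedPol S P a p q G) :
    IsGradedPol S P a p q (fun w => F w + G w) :=
  ⟨fun w => Submodule.add_mem _ (hF.mem w) (hG.mem w), fun d => by
    simp only [map_add]; exact (hF.pol d).add (hG.pol d)⟩

omit [Module.Finite ℚ V] in
theorem smul (hF : IsGradedPol S P a p q F) (c : ℚ) :
    IsGradedPol S P a p q (fun w => c • F w) :=
  ⟨fun w => rat_smul_mem c (hF.mem w), fun d => by
    simp only [map_rat_smul]; exact (hF.pol d).smul c⟩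

omit [Module.Finite ℚ V] in
theorem sum {ι : Type*} (t : Finset ι) {F : ι → CoordPair S P n → EndC V}
    (hF : ∀ i ∈ t, IsGradedPol S P a p q (F i)) :
    IsGradedPol S P a p q (fun w => ∑ i ∈ t, F i w) :=
  ⟨fun w => Submodule.sum_mem _ fun i hi => (hF i hi).mem w, fun d => by
    simp only [map_sum]; exact CoefIn.sum t fun i hi => (hF i hi).pol d⟩

/-- Because both factors lie in W_{-1}, only splittings d = i + j with i, j ≥ 1 occur. The
hypotheses on the bounds are needed only for such pairs, and this makes the bound d - 1 possible. -/
theorem mul (ha : IsWeightElt S P a) (hF : IsGradedPol S P a p q F)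
    (hG : IsGradedPol S P a p' q' G)
    (hp : ∀ i j, 1 ≤ i → 1 ≤ j → p i + p' j ≤ p'' (i + j))
    (hq : ∀ i j, 1 ≤ i → 1 ≤ j → q i + q' j ≤ q'' (i + j)) :
    IsGradedPol S P a p'' q'' (fun w => F w * G w) := by
  refine ⟨fun w => wEnd_anti (by omega) (mul_mem_wEnd (hF.mem w) (hG.mem w)), fun d => ?_⟩
  simp only [ha.degPart_mul d (mem_wEnd_zero (hF.mem _)) (mem_wEnd_zero (hG.mem _))]
  refine CoefIn.sum _ fun ij hij => ?_
  rw [Finset.HasAntidiagonal.mem_antidiagonal] at hij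
  subst hij
  rcases Nat.eq_zero_or_pos ij.1 with h1 | h1
  · simp only [h1, ha.degPart_eq_zero one_pos (hF.mem _), zero_mul]
    exact CoefIn.zero
  rcases Nat.eq_zero_or_pos ij.2 with h2 | h2
  · simp only [h2, ha.degPart_eq_zero one_pos (hG.mem _), mul_zero]
    exact CoefIn.zero
  exact ((hF.pol _).mul (hG.pol _)).mono (hp _ _ h1 h2) (hq _ _ h1 h2)

theorem pow_succ (ha : IsWeightElt S P a) (hF : IsGradedPol S P a p q F)
    (hp : ∀ i j, p i + p j ≤ p (i + j)) (hq : ∀ i j, q i + q j ≤ q (i + j)) (r : ℕ) :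
    IsGradedPol S P a p q (fun w => F w ^ (r + 1)) := by
  induction r with
  | zero => simpa using hF
  | succ r ih =>
    simp only [_root_.pow_succ _ (r + 1)]
    exact ih.mul ha hF (fun i j _ _ => hp i j) (fun i j _ _ => hq i j)

theorem exp_sub_one (ha : IsWeightElt S P a) (hF : IsGradedPol S P a p q F)
    (hp : ∀ i j, p i + p j ≤ p (i + j)) (hq : ∀ i j, q i + q j ≤ q (i + j)) :
    IsGradedPol S P a p q (fun w => IsNilpotent.exp (F w) - 1) := by
  have e : ∀ w, IsNilpotent.exp (F w) - 1 =
      ∑ r ∈ Finset.range (wLen S), ((r + 1).factorial : ℚ)⁻¹ • F w ^ (r + 1) := by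
    intro w
    have hN : F w ^ (wLen S + 1) = 0 := by
      have h1 := pow_mem_wEnd (hF.mem w) (wLen S + 1)
      rw [mul_one] at h1
      exact eq_zero_of_mem_wEnd (by omega) h1
    rw [IsNilpotent.exp_eq_sum hN, Finset.sum_range_succ']
    simp
  simp only [e]
  exact IsGradedPol.sum _ fun r _ => (hF.pow_succ ha hp hq r).smul _

/-- The mixed terms of the powers of `x + y + x y`. -/
theorem mixed (ha : IsWeightElt S P a) {x y : CoordPair S P n → EndC V}
    (hx : IsGradedPol S P a id (fun _ => 0) x) (hy : IsGradedPol S P a (fun _ => 0) id y) (r : ℕ) :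
    IsGradedPol S P a (· - 1) (· - 1)
      (fun w => (x w + y w + x w * y w) ^ (r + 1) - x w ^ (r + 1) - y w ^ (r + 1)) := by
  have hxG : IsGradedPol S P a id id x := hx.mono (fun d => le_rfl) (fun d => Nat.zero_le _)
  have hyG : IsGradedPol S P a id id y := hy.mono (fun d => Nat.zero_le _) (fun d => le_rfl)
  -- In degree d = i + j the product has degree at most i in the first and j in the second argument;
  -- since both are at least 1, neither exceeds d - 1.
  have hxy : IsGradedPol S P a (· - 1) (· - 1) (fun w => x w * y w) :=
    hx.mul ha hy (fun i j hi hj => by simp only [id]; omega)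
      (fun i j hi hj => by simp only [id]; omega)
  have hz : IsGradedPol S P a id id (fun w => x w + y w + x w * y w) :=
    (hxG.add hyG).add (hxy.mono (fun d => Nat.sub_le _ _) (fun d => Nat.sub_le _ _))
  induction r with
  | zero =>
    have e : ∀ w, (x w + y w + x w * y w) ^ (0 + 1) - x w ^ (0 + 1) - y w ^ (0 + 1) =
        x w * y w := fun w => by rw [zero_add, pow_one, pow_one, pow_one]; abel
    simp only [e]
    exact hxy
  | succ r ih =>
    have e : ∀ w, (x w + y w + x w * y w) ^ (r + 1 + 1) - x w ^ (r + 1 + 1) - y w ^ (r + 1 + 1) =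
        ((x w + y w + x w * y w) ^ (r + 1) - x w ^ (r + 1) - y w ^ (r + 1)) *
          (x w + y w + x w * y w) + x w ^ (r + 1) * y w + x w ^ (r + 1) * (x w * y w) +
          y w ^ (r + 1) * x w + y w ^ (r + 1) * (x w * y w) := fun w => by
      rw [_root_.pow_succ _ (r + 1), _root_.pow_succ (x w) (r + 1), _root_.pow_succ (y w) (r + 1)]
      noncomm_ring
    simp only [e]
    have hxr := hx.pow_succ ha (fun i j => le_rfl) (fun i j => le_rfl) r
    have hyr := hy.pow_succ ha (fun i j => le_rfl) (fun i j => le_rfl) r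
    refine ((((ih.mul ha hz ?_ ?_).add (hxr.mul ha hy ?_ ?_)).add
      ((hxr.mono (q' := id) (fun d => le_rfl) (fun d => Nat.zero_le _)).mul ha hxy ?_ ?_)).add
      (hyr.mul ha hx ?_ ?_)).add
      ((hyr.mono (p' := id) (fun d => Nat.zero_le _) (fun d => le_rfl)).mul ha hxy ?_ ?_)
    all_goals intro i j hi hj; simp only [id]; omega

end IsGradedPol

omit [Module.Finite ℚ V] in
theorem IsSplitting.exists_coef (s : Sections S P) (hs : IsSplitting S P L s) (j : ℕ)
    (vl : V × Module.Dual ℚ V) : ∃ l : GrR S P (j + 1) →ₗ[ℝ] ℝ, IsRatFunctional S P (j + 1) l ∧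
      ∀ x, coef (s j x : EndC V) vl = (l x : ℂ) := by
  refine ⟨Complex.reLm ∘ₗ ((coefLin vl).restrictScalars ℝ) ∘ₗ (lieWR S P (j + 1)).subtype ∘ₗ s j,
    fun X => ?_, fun x => coef_eq_re (mem_lieWR.1 (s j x).2).2 vl⟩
  obtain ⟨Y, hY⟩ := hs.rational j X
  refine ⟨vl.2 ((Y : Module.End ℚ V) vl.1), ?_⟩
  change (coef (s j (ratClass S P (j + 1) X) : EndC V) vl).re = _
  rw [hY, ← cxHom_apply, coef_cxHom]
  exact Complex.ratCast_re _

omit [Module.Finite ℚ V] in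
theorem IsSplitting.isPol_left {s : Sections S P} (hs : IsSplitting S P L s) (j : Fin n) :
    IsPol S P 1 0 (fun w : CoordPair S P n => (s j (w.1 j) : EndC V)) := fun vl => by
  obtain ⟨l, hl, h⟩ := hs.exists_coef s j vl
  refine ⟨fun w => l (w.1 j), ?_, fun w => h _⟩
  rw [polPair, Submodule.pow_one, Submodule.pow_zero,
    ← mul_one (fun w : CoordPair S P n => l (w.1 j))]
  exact Submodule.mul_mem_mul (Submodule.subset_span (Or.inr ⟨j, l, hl, rfl⟩))
    (Submodule.one_le.1 le_rfl)

omit [Module.Finite ℚ V] in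
theorem IsSplitting.isPol_right {s : Sections S P} (hs : IsSplitting S P L s) (j : Fin n) :
    IsPol S P 0 1 (fun w : CoordPair S P n => (s j (w.2 j) : EndC V)) := fun vl => by
  obtain ⟨l, hl, h⟩ := hs.exists_coef s j vl
  refine ⟨fun w => l (w.2 j), ?_, fun w => h _⟩
  rw [polPair, Submodule.pow_one, Submodule.pow_zero,
    ← one_mul (fun w : CoordPair S P n => l (w.2 j))]
  exact Submodule.mul_mem_mul (Submodule.one_le.1 le_rfl)
    (Submodule.subset_span (Or.inr ⟨j, l, hl, rfl⟩))

omit [Module.Finite ℚ V] in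
theorem ratClass_add (k : ℕ) (X Y : lieW S P k) :
    ratClass S P k (X + Y) = ratClass S P k X + ratClass S P k Y :=
  congrArg Submodule.Quotient.mk (Subtype.ext (map_add (cxHom V) (X : Module.End ℚ V) Y))

omit [Module.Finite ℚ V] in
theorem ratClass_smul (k : ℕ) (c : ℚ) (X : lieW S P k) :
    ratClass S P k (c • X) = (c : ℝ) • ratClass S P k X := by
  refine congrArg Submodule.Quotient.mk (Subtype.ext ?_)
  refine (cxHom_smul c (X : Module.End ℚ V)).trans ?_
  rw [Submodule.coe_smul, real_smul_eq]
  norm_cast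

/-- A rational functional on `GrR` is given by rational matrix coefficients. -/
theorem IsRatFunctional.exists_linear {k : ℕ} {l : GrR S P k →ₗ[ℝ] ℝ}
    (hl : IsRatFunctional S P k l) : ∃ Λ : EndC V →ₗ[ℂ] ℂ,
      (∀ f, ∃ c : ℚ, Λ (cxHom V f) = c) ∧
      ∀ (X : EndC V) (hX : X ∈ lieWR S P k), Λ X = (l (grMk X hX) : ℂ) := by
  choose q hq using hl
  let μ : lieW S P k →ₗ[ℚ] ℚ :=
    { toFun := q
      map_add' := fun X Y => by
        have : ((q (X + Y) : ℚ) : ℝ) = ((q X + q Y : ℚ) : ℝ) := by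
          rw [← hq, ratClass_add, map_add, hq, hq, Rat.cast_add]
        exact_mod_cast this
      map_smul' := fun c X => by
        have : ((q (c • X) : ℚ) : ℝ) = ((c * q X : ℚ) : ℝ) := by
          rw [← hq, ratClass_smul, map_smul, hq, Rat.cast_mul, smul_eq_mul]
        exact_mod_cast this }
  -- Extending the rational functional from W_{-k}(Lie P) to all of End(V) lets it be written as a
  -- combination of matrix coefficients with rational weights.
  obtain ⟨ν, hν⟩ := LinearMap.exists_extend μ
  let E := (ratBasis V).end
  let Λ : EndC V →ₗ[ℂ] ℂ :=
    ∑ ij, (ν (E ij) : ℂ) • coefLin (ratBasis V ij.2, (ratBasis V).coord ij.1)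
  have hΛ : ∀ f, Λ (cxHom V f) = (ν f : ℂ) := by
    intro f
    have h1 : ∀ ij, E.repr f ij = (ratBasis V).coord ij.1 (f (ratBasis V ij.2)) := fun ij =>
      LinearMap.toMatrix_apply (ratBasis V) (ratBasis V) f ij.1 ij.2
    conv_rhs => rw [← E.sum_repr f]
    rw [map_sum, Rat.cast_sum, LinearMap.sum_apply]
    refine Finset.sum_congr rfl fun ij _ => ?_
    rw [map_smul, h1, LinearMap.smul_apply]
    change (ν (E ij) : ℂ) * coef (cxHom V f) _ = _
    rw [coef_cxHom, smul_eq_mul, Rat.cast_mul, mul_comm]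
  refine ⟨Λ, fun f => ⟨_, hΛ f⟩, fun X hX => ?_⟩
  induction hX using Submodule.span_induction with
  | mem X hX =>
    obtain ⟨Y, hY, rfl⟩ := hX
    have h1 : ν Y = q ⟨Y, hY⟩ := LinearMap.congr_fun hν ⟨Y, hY⟩
    have h2 := hq ⟨Y, hY⟩
    rw [← h1] at h2
    refine (hΛ Y).trans ?_
    rw [← Complex.ofReal_ratCast, ← h2]
    rfl
  | zero =>
    have : grMk (P := P) (S := S) (k := k) 0 (Submodule.zero_mem _) = 0 := rfl
    rw [map_zero, this, map_zero, Complex.ofReal_zero]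
  | add X Y hX hY h1 h2 =>
    have : grMk (X + Y) (Submodule.add_mem _ hX hY) = grMk X hX + grMk Y hY := rfl
    rw [map_add, h1, h2, this, map_add, Complex.ofReal_add]
  | smul r X hX h1 =>
    have e : Λ (r • X) = (r : ℂ) * Λ X := by rw [real_smul_eq, map_smul, smul_eq_mul]
    have : grMk (r • X) (Submodule.smul_mem _ r hX) = r • grMk X hX := rfl
    rw [this, e, h1, map_smul, smul_eq_mul, Complex.ofReal_mul]

namespace IsLeviWeight

variable (hL : IsLeviWeight S P L a) {s : Sections S P} (hs : IsSplitting S P L s)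
include hL hs

theorem isGradedPol_sum {p q : ℕ} {w : CoordPair S P n → ∀ j : Fin n, GrR S P (j + 1)}
    (hw : ∀ j : Fin n, IsPol S P p q (fun t => (s j (w t j) : EndC V))) :
    IsGradedPol S P a (p * ·) (q * ·) (fun t => ∑ j : Fin n, (s j (w t j) : EndC V)) := by
  refine ⟨fun t => lieWR_le_wEnd (sum_section_mem _), fun d => ?_⟩
  by_cases hd : ∃ i : Fin n, d = i + 1
  · obtain ⟨i, rfl⟩ := hd
    simp only [hL.degPart_sum_section hs]
    exact (hw i).mono (Nat.le_mul_of_pos_right _ (Nat.succ_pos _))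
      (Nat.le_mul_of_pos_right _ (Nat.succ_pos _))
  · have h0 : ∀ t, degPart S a d (∑ j : Fin n, (s j (w t j) : EndC V)) = 0 := fun t => by
      rw [map_sum]
      exact Finset.sum_eq_zero fun j _ => by
        rw [hL.degPart_section hs, if_neg fun h => hd ⟨j, h⟩]
    simp only [h0]
    exact CoefIn.zero

/-- With x = exp A - 1 and y = exp B - 1, the argument of the logarithm is 1 + x + y + xy.
Subtracting the series for `A` and `B` leaves the mixed terms of its powers. As A and B have no
component of degree -(n+1), nothing is lost in that degree, and the bound there is (n + 1) - 1 = n.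
-/
theorem isPol_degPart_nilLog (n : ℕ) : IsPol S P n n (fun w : CoordPair S P n =>
    degPart S a (n + 1) (nilLog (IsNilpotent.exp (∑ j : Fin n, (s j (w.1 j) : EndC V)) *
      IsNilpotent.exp (∑ j : Fin n, (s j (w.2 j) : EndC V))))) := by
  have hA : IsGradedPol S P a id (fun _ => 0)
      (fun w : CoordPair S P n => ∑ j : Fin n, (s j (w.1 j) : EndC V)) :=
    (hL.isGradedPol_sum hs fun j => hs.isPol_left j).mono (fun d => by simp) (fun d => by simp)
  have hB : IsGradedPol S P a (fun _ => 0) id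
      (fun w : CoordPair S P n => ∑ j : Fin n, (s j (w.2 j) : EndC V)) :=
    (hL.isGradedPol_sum hs fun j => hs.isPol_right j).mono (fun d => by simp) (fun d => by simp)
  have hA0 : ∀ w : ∀ j : Fin n, GrR S P (j + 1),
      degPart S a (n + 1) (∑ j : Fin n, (s j (w j) : EndC V)) = 0 := fun w => by
    rw [map_sum]
    exact Finset.sum_eq_zero fun j _ => by
      rw [hL.degPart_section hs, if_neg (by have := j.2; omega)]
  generalize hAe : (fun w : CoordPair S P n => ∑ j : Fin n, (s j (w.1 j) : EndC V)) = A at hA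
  generalize hBe : (fun w : CoordPair S P n => ∑ j : Fin n, (s j (w.2 j) : EndC V)) = B at hB
  have hAw : ∀ w : CoordPair S P n, ∑ j : Fin n, (s j (w.1 j) : EndC V) = A w := fun w => by
    rw [← hAe]
  have hBw : ∀ w : CoordPair S P n, ∑ j : Fin n, (s j (w.2 j) : EndC V) = B w := fun w => by
    rw [← hBe]
  simp only [hAw, hBw]
  have hx := hA.exp_sub_one hL.elt (fun _ _ => le_rfl) (fun _ _ => le_rfl)
  have hy := hB.exp_sub_one hL.elt (fun _ _ => le_rfl) (fun _ _ => le_rfl)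
  have hlog : ∀ u : EndC V, u - 1 ∈ wEnd S 1 → nilLog u = ∑ r ∈ Finset.range (wLen S),
      ((-1 : ℚ) ^ (r + 1 + 1) / ((r + 1 : ℕ) : ℚ)) • (u - 1) ^ (r + 1) := by
    intro u hu
    have hN : (u - 1) ^ (wLen S + 1) = 0 := by
      have h1 := pow_mem_wEnd hu (wLen S + 1)
      rw [mul_one] at h1
      exact eq_zero_of_mem_wEnd (by omega) h1
    rw [nilLog_eq_sum hN, Finset.sum_range_succ']
    simp
  have hmix : IsGradedPol S P a (· - 1) (· - 1) (fun w => ∑ r ∈ Finset.range (wLen S),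
      ((-1 : ℚ) ^ (r + 1 + 1) / ((r + 1 : ℕ) : ℚ)) •
        ((IsNilpotent.exp (A w) - 1 + (IsNilpotent.exp (B w) - 1) +
          (IsNilpotent.exp (A w) - 1) * (IsNilpotent.exp (B w) - 1)) ^ (r + 1) -
          (IsNilpotent.exp (A w) - 1) ^ (r + 1) - (IsNilpotent.exp (B w) - 1) ^ (r + 1))) :=
    IsGradedPol.sum _ fun r _ => (IsGradedPol.mixed hL.elt hx hy r).smul _
  have hp := hmix.pol (n + 1)
  rw [Nat.add_sub_cancel] at hp
  refine (congrArg (IsPol S P n n) (funext fun w => ?_)).mp hp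
  have e : IsNilpotent.exp (A w) - 1 + (IsNilpotent.exp (B w) - 1) +
      (IsNilpotent.exp (A w) - 1) * (IsNilpotent.exp (B w) - 1) =
      IsNilpotent.exp (A w) * IsNilpotent.exp (B w) - 1 := by noncomm_ring
  simp only [e, smul_sub, Finset.sum_sub_distrib]
  rw [← hlog _ (exp_mul_exp_sub_one_mem (hA.mem w) (hB.mem w)), ← hlog _ (hx.mem w),
    ← hlog _ (hy.mem w), nilLog_exp_of_mem le_rfl (hA.mem w), nilLog_exp_of_mem le_rfl (hB.mem w),
    map_sub, map_sub, ← hAw, ← hBw, hA0, hA0, sub_zero, sub_zero]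

/-- The maps `calb` are polynomial over `ℚ`, of degree at most `n` in each argument. -/
theorem calb_polynomial (n : ℕ) (l : GrR S P (n + 1) →ₗ[ℝ] ℝ)
    (hl : IsRatFunctional S P (n + 1) l) :
    (fun w : CoordPair S P n => l (hL.calb s n w.1 w.2)) ∈ linLeft S P n ^ n * linRight S P n ^ n := by
  obtain ⟨Λ, hΛ, hΛl⟩ := hl.exists_linear
  obtain ⟨f, hf, h⟩ := (hL.isPol_degPart_nilLog hs n).apply Λ hΛ
  refine (congrArg (· ∈ polPair S P n n n) (funext fun w => ?_)).mp hf
  have := (h w).symm.trans (hΛl _ (hL.degPart_lieWR (hL.elt.group.nilLog_exp_mul_exp_mem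
    (sum_section_mem w.1) (sum_section_mem w.2)) (n + 1)))
  exact Complex.ofReal_injective this

theorem isCalb {m : ℕ} (hm : lieW S P (m + 1) = ⊥) : IsCalb S P s m (hL.calb s) where
  polynomial := hL.calb_polynomial hs
  zero := hL.calb_zero s
  groupLaw := hL.expSum_mul_expSum hs hm

end IsLeviWeight

end PolynomialMaps

/-! ### The identity component P(ℝ)⁺. -/

section RealComponent

variable {V : Type*} [AddCommGroup V] [Module ℚ V] {S : HodgeData V} {P : Subgroup (GLC V)}

theorem realPlus_subset : realPlus P ⊆ realPts P :=
  @connectedComponentIn_subset _ (glTopology V) _ _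

theorem one_mem_realPlus : (1 : GLC V) ∈ realPlus P :=
  @mem_connectedComponentIn _ (glTopology V) _ _ (realPts P).one_mem

variable [Module.Finite ℚ V]

theorem continuous_mul_left_glTopology (g : GLC V) :
    @Continuous _ _ (glTopology V) (glTopology V) (fun x => g * x) := by
  let := glTopology V
  have hc : ∀ vl, Continuous fun x : GLC V => coef (x : EndC V) vl := fun vl =>
    (continuous_apply vl).comp (continuous_induced_dom (f := fun g : GLC V => coef (g : EndC V)))
  refine continuous_induced_rng.2 (continuous_pi fun vl => ?_)
  have e : (fun x : GLC V => coef ((g * x : GLC V) : EndC V) vl) = fun x : GLC V =>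
      ∑ i, coef (g : EndC V) (ratBasis V i, vl.2) *
        coef (x : EndC V) (vl.1, (ratBasis V).coord i) :=
    funext fun x => coef_mul _ _ vl.1 vl.2
  change Continuous (fun x : GLC V => coef ((g * x : GLC V) : EndC V) vl)
  rw [e]
  exact continuous_finsetSum _ fun i _ => continuous_const.mul (hc _)

/-- A left translate of the component is connected; if it meets the component in one point, it lies
inside it. Closure under products and inverses both follow from this. -/
theorem mul_image_subset_realPlus {g x : GLC V} (hg : g ∈ realPts P) (hx : x ∈ realPlus P)
    (h : g * x ∈ realPlus P) : (fun y => g * y) '' realPlus P ⊆ realPlus P := by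
  let := glTopology V
  have h1 : IsPreconnected ((fun y => g * y) '' realPlus P) :=
    isPreconnected_connectedComponentIn.image _ (continuous_mul_left_glTopology g).continuousOn
  have h2 : (fun y => g * y) '' realPlus P ⊆ realPts P := by
    rintro _ ⟨y, hy, rfl⟩
    exact mul_mem hg (realPlus_subset hy)
  have h3 := h1.subset_connectedComponentIn ⟨x, hx, rfl⟩ h2
  have h4 : connectedComponentIn (realPts P : Set (GLC V)) (g * x) = realPlus P :=
    (connectedComponentIn_eq h).symm
  rwa [h4] at h3

theorem mul_mem_realPlus {g h : GLC V} (hg : g ∈ realPlus P) (hh : h ∈ realPlus P) :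
    g * h ∈ realPlus P :=
  mul_image_subset_realPlus (realPlus_subset hg) one_mem_realPlus (by rwa [mul_one]) ⟨h, hh, rfl⟩

theorem inv_mem_realPlus {g : GLC V} (hg : g ∈ realPlus P) : g⁻¹ ∈ realPlus P := by
  have h := mul_image_subset_realPlus (inv_mem (realPlus_subset hg)) hg
    (by rw [inv_mul_cancel]; exact one_mem_realPlus) ⟨1, one_mem_realPlus, rfl⟩
  simpa using h

theorem exp_mem_realPts (hP : IsWeightGroup S P) {A : EndC V} (hA : A ∈ lieWR S P 1) {g : GLC V}
    (hg : (g : EndC V) = IsNilpotent.exp A) : g ∈ realPts P := by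
  have hA' := (mem_lieWR.1 hA)
  refine mem_realPts.2 ⟨(hP.exp_mem le_rfl hA'.1 hg).1, ?_⟩
  rw [hg, galE_exp _ (isNilpotent_of_mem_lieWC le_rfl hA'.1), hA'.2]

/-- The path t ↦ exp(tA) is polynomial in `t`, stays in P(ℝ) and joins the element to 1. -/
theorem exp_mem_realPlus (hP : IsWeightGroup S P) {A : EndC V} (hA : A ∈ lieWR S P 1) {g : GLC V}
    (hg : (g : EndC V) = IsNilpotent.exp A) : g ∈ realPlus P := by
  let := glTopology V
  have hA' : ∀ t : ℝ, t • A ∈ lieWR S P 1 := fun t => Submodule.smul_mem _ t hA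
  have hn : ∀ t : ℝ, IsNilpotent (t • A) := fun t =>
    isNilpotent_of_mem_lieWC le_rfl (mem_lieWR.1 (hA' t)).1
  let γ : ℝ → GLC V := fun t => expUnit (t • A) (hn t)
  obtain ⟨N, hN⟩ := isNilpotent_of_mem_lieWC le_rfl (mem_lieWR.1 hA).1
  have hγ : Continuous γ := by
    refine continuous_induced_rng.2 (continuous_pi fun vl => ?_)
    have e : (fun t : ℝ => coef (γ t : EndC V) vl) = fun t : ℝ => (expCurve A N vl).eval (t : ℂ) :=
      funext fun t => by
        rw [eval_expCurve hN, ← real_smul_eq]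
        rfl
    change Continuous (fun t : ℝ => coef (γ t : EndC V) vl)
    rw [e]
    exact (expCurve A N vl).continuous.comp Complex.continuous_ofReal
  have h1 : γ 1 = g := Units.ext (by
    change IsNilpotent.exp ((1 : ℝ) • A) = g
    rw [one_smul, hg])
  have h0 : γ 0 = 1 := Units.ext (by
    change IsNilpotent.exp ((0 : ℝ) • A) = 1
    rw [zero_smul, IsNilpotent.exp_zero])
  have h2 : Set.range γ ⊆ realPts P := by
    rintro _ ⟨t, rfl⟩
    exact exp_mem_realPts hP (hA' t) rfl
  exact (isPreconnected_range hγ).subset_connectedComponentIn ⟨0, h0⟩ h2 ⟨1, h1⟩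

end RealComponent

/-! ### Orbits of filtrations and the split base point. -/

section Orbits

variable {V : Type*} [AddCommGroup V] [Module ℚ V] {S : HodgeData V} {P L : Subgroup (GLC V)}

theorem glc_apply_inv (g : GLC V) (x : Cx V) : (g : EndC V) (((g⁻¹ : GLC V) : EndC V) x) = x :=
  LinearMap.congr_fun g.mul_inv x

theorem glc_inv_apply (g : GLC V) (x : Cx V) : ((g⁻¹ : GLC V) : EndC V) ((g : EndC V) x) = x :=
  LinearMap.congr_fun g.inv_mul x

theorem moveF_mul (g h : GLC V) (F : Filt V) : moveF (g * h) F = moveF g (moveF h F) :=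
  funext fun p => Submodule.map_comp (h : EndC V) (g : EndC V) (F p)

theorem moveF_one (F : Filt V) : moveF 1 F = F := funext fun p => Submodule.map_id (F p)

theorem moveF_inv_moveF (g : GLC V) (F : Filt V) : moveF g⁻¹ (moveF g F) = F := by
  rw [← moveF_mul, inv_mul_cancel, moveF_one]

theorem moveSet_mul (g h : GLC V) (A : Set (Filt V)) :
    moveSet (g * h) A = moveSet g (moveSet h A) := by
  rw [moveSet, moveSet, moveSet, Set.image_image]
  exact Set.image_congr fun F _ => moveF_mul g h F

theorem conjHom_apply (g : GLC V) (h : ℂˣ × ℂˣ →* GLC V) (zw : ℂˣ × ℂˣ) :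
    conjHom g h zw = g * h zw * g⁻¹ := rfl

theorem conjHom_mul (g g' : GLC V) (h : ℂˣ × ℂˣ →* GLC V) :
    conjHom (g * g') h = conjHom g (conjHom g' h) := by
  ext1 zw
  simp only [conjHom_apply, mul_inv_rev, mul_assoc]

theorem wtSpace_conjHom (g : GLC V) (h : ℂˣ × ℂˣ →* GLC V) (p q : ℤ) :
    wtSpace (conjHom g h) p q = (wtSpace h p q).map (g : EndC V) := by
  ext x
  rw [mem_wtSpace, Submodule.mem_map]
  constructor
  · intro hx
    refine ⟨((g⁻¹ : GLC V) : EndC V) x, mem_wtSpace.2 fun zw => ?_, glc_apply_inv g x⟩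
    rw [← map_smul, ← hx zw, conjHom_apply]
    exact (glc_inv_apply g _).symm
  · rintro ⟨y, hy, rfl⟩ zw
    rw [← map_smul, ← mem_wtSpace.1 hy zw, conjHom_apply]
    exact congrArg (fun z => (g : EndC V) ((h zw : EndC V) z)) (glc_inv_apply g y)

theorem hodgeFil_conjHom (g : GLC V) (h : ℂˣ × ℂˣ →* GLC V) :
    hodgeFil (conjHom g h) = moveF g (hodgeFil h) := by
  funext p
  simp only [hodgeFil, moveF, wtSpace_conjHom, Submodule.map_iSup]

theorem moveF_hodgeFil_self (h : ℂˣ × ℂˣ →* GLC V) (zw : ℂˣ × ℂˣ) :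
    moveF (h zw) (hodgeFil h) = hodgeFil h := by
  rw [← hodgeFil_conjHom]
  congr 1
  ext1 zw'
  rw [conjHom_apply, ← map_mul, mul_comm zw, map_mul, mul_inv_cancel_right]

/-- On a lower graded piece of weight n the operator acts as 2^n ≠ 2^k, so an eigenvector with
eigenvalue 2^k falls through all lower weights. -/
theorem IsWeightOp.eq_zero {a : EndC V} (ha : IsWeightOp S a) {k : ℤ} {x : Cx V}
    (hx : a x = (2 : ℂ) ^ k • x) (hxW : x ∈ cxSub (S.W (k - 1))) : x = 0 := by
  have key : ∀ n : ℕ, x ∈ cxSub (S.W (k - 1 - n)) := by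
    intro n
    induction n with
    | zero => simpa using hxW
    | succ n ih =>
      have h1 := ha _ x ih
      rw [hx, ← sub_smul] at h1
      have h2 : (2 : ℂ) ^ k - (2 : ℂ) ^ (k - 1 - n) ≠ 0 := by
        rw [sub_ne_zero]
        intro h
        have h3 : ((2 : ℝ) ^ k : ℝ) = (2 : ℝ) ^ (k - 1 - n) := by
          apply Complex.ofReal_injective
          simpa using h
        have h4 := zpow_right_injective₀ (two_pos : (0 : ℝ) < 2) (by norm_num) h3
        omega
      have h3 := (Submodule.smul_mem_iff _ h2).1 h1
      rwa [show k - 1 - ((n + 1 : ℕ) : ℤ) = k - 1 - n - 1 by push_cast; ring]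
  obtain ⟨b, hb⟩ := S.exists_bot
  have h1 := cxSub_mono (S.mono (show k - 1 - ((k - 1 - b).toNat : ℤ) ≤ b by omega)) (key _)
  rwa [hb, cxSub_bot, Submodule.mem_bot] at h1

/-- The bigrading of `h` is split over `ℝ`, and its weight grading is that of `a`. -/
structure IsSplitHom (S : HodgeData V) (a : GLC V) (h : ℂˣ × ℂˣ →* GLC V) : Prop where
  top : ⨆ pq : ℤ × ℤ, wtSpace h pq.1 pq.2 = ⊤
  weight : ∀ p q : ℤ, wtSpace h p q ≤ cxSub (S.W (p + q))
  value : h ((Units.mk0 2 two_ne_zero)⁻¹, (Units.mk0 2 two_ne_zero)⁻¹) = a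
  conj : ∀ p q : ℤ, ∀ x ∈ wtSpace h p q, conjV V x ∈ wtSpace h q p

theorem apply_half_of_mem {h : ℂˣ × ℂˣ →* GLC V} {p q : ℤ} {x : Cx V} (hx : x ∈ wtSpace h p q) :
    (h ((Units.mk0 2 two_ne_zero)⁻¹, (Units.mk0 2 two_ne_zero)⁻¹) : EndC V) x =
      (2 : ℂ) ^ (p + q) • x := by
  rw [mem_wtSpace.1 hx]
  simp only [inv_zpow', neg_neg, Units.val_mul, Units.val_zpow_eq_zpow_val, Units.val_mk0]
  rw [← zpow_add₀ two_ne_zero]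

/-- The element `u` conjugates the weight element of the bigrading to the real element `a`. After
that, a conjugate vector and its expected partner of opposite type are both 2^{p+q}-eigenvectors of
`a` and differ only in lower weight; `IsWeightOp.eq_zero` turns the congruence into equality. -/
theorem exists_isSplitHom [Module.Finite ℚ V] {x₀ : Filt V} (hF : IsClassified S x₀)
    {h₀ : ℂˣ × ℂˣ →* GLC V} (hh : IsDeligneHom S.W x₀ h₀) {a : GLC V}
    (hL : IsLeviWeight S (mumfordTate S.W x₀) L a) :
    ∃ u ∈ unipSub S (mumfordTate S.W x₀) 1, IsSplitHom S a (conjHom u h₀) := by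
  have hb := hh.isWeightElt hF
  obtain ⟨u, hu, hua⟩ := hL.elt.group.exists_conj hb.mem hL.elt.mem hb.op hL.elt.op
  have hval : conjHom u h₀ ((Units.mk0 2 two_ne_zero)⁻¹, (Units.mk0 2 two_ne_zero)⁻¹) = a :=
    hua.symm
  have huW : ∀ n : ℤ, ∀ x ∈ cxSub (S.W n), (u : EndC V) x ∈ cxSub (S.W n) := fun n x hx => by
    have := hL.elt.group.mem_wEnd u hu.1 n x hx
    simpa using this
  have huW' : ∀ n : ℤ, ∀ x ∈ cxSub (S.W n), (u : EndC V) x - x ∈ cxSub (S.W (n - 1)) :=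
    fun n x hx => by
      have := (hL.elt.group.mem_unipSub.1 hu).2 n x hx
      simpa using this
  refine ⟨u, hu, ?_, fun p q => ?_, hval, fun p q x hx => ?_⟩
  · have h1 := hh.internal.submodule_iSup_eq_top
    simp only [wtSpace_conjHom, ← Submodule.map_iSup]
    rw [h1, Submodule.map_top, LinearMap.range_eq_top]
    exact fun x => ⟨_, glc_apply_inv u x⟩
  · rw [wtSpace_conjHom, Submodule.map_le_iff_le_comap]
    exact fun x hx => huW _ x (hh.wtSpace_le_weight p q hx)
  · have hx2 := apply_half_of_mem hx
    rw [hval] at hx2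
    have hconj : (a : EndC V) (conjV V x) = (2 : ℂ) ^ (q + p) • conjV V x := by
      have h1 := LinearMap.congr_fun (hL.rational conjAut) (conjV V x)
      rw [galE_conjAut_apply, conjV_conjV, hx2, LinearMap.map_smulₛₗ] at h1
      rw [← h1, add_comm, map_zpow₀, Complex.conj_ofNat]
    rw [wtSpace_conjHom] at hx
    obtain ⟨y, hy, rfl⟩ := hx
    have hyc : conjV V y ∈ wtSpace h₀ q p ⊔
        ⨆ (r : ℤ) (s : ℤ) (_ : r < q ∧ s < p), wtSpace h₀ r s := by
      rw [hh.conj q p]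
      refine Submodule.mem_sup_left (mem_conjSub.2 ?_)
      rwa [conjV_conjV]
    obtain ⟨z, hz, w, hw, hzw⟩ := Submodule.mem_sup.1 hyc
    have hwW : w ∈ cxSub (S.W (q + p - 1)) := by
      refine (iSup_le fun r => iSup_le fun s => iSup_le fun hrs => ?_ :
        ⨆ (r : ℤ) (s : ℤ) (_ : r < q ∧ s < p), wtSpace h₀ r s ≤ _) hw
      exact (hh.wtSpace_le_weight r s).trans (cxSub_mono (S.mono (by omega)))
    have hyW := hh.wtSpace_le_weight p q hy
    have huz : (u : EndC V) z ∈ wtSpace (conjHom u h₀) q p := by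
      rw [wtSpace_conjHom]
      exact Submodule.mem_map_of_mem hz
    have huz2 := apply_half_of_mem huz
    rw [hval] at huz2
    suffices conjV V ((u : EndC V) y) - (u : EndC V) z = 0 by
      rw [sub_eq_zero.1 this]; exact huz
    refine hL.elt.op.eq_zero (k := q + p) ?_ ?_
    · rw [map_sub, hconj, huz2, smul_sub]
    · have e : conjV V ((u : EndC V) y) - (u : EndC V) z =
          conjV V ((u : EndC V) y - y) + w - ((u : EndC V) z - z) := by
        rw [map_sub, ← hzw]; abel
      rw [e]
      refine Submodule.sub_mem _ (Submodule.add_mem _ (conjV_mem_cxSub ?_) hwW)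
        (huW' _ z (hh.wtSpace_le_weight q p hz))
      rw [add_comm q p]
      exact huW' _ y hyW

namespace IsSplitHom

variable {a : GLC V} {h : ℂˣ × ℂˣ →* GLC V} (hh : IsSplitHom S a h)
include hh

theorem moveF_weight : moveF a (hodgeFil h) = hodgeFil h := by
  rw [← hh.value]; exact moveF_hodgeFil_self h _

theorem end_ext {f g : EndC V} (hfg : ∀ p q, ∀ x ∈ wtSpace h p q, f x = g x) : f = g := by
  have h1 : (⊤ : Submodule ℂ (Cx V)) ≤ LinearMap.eqLocus f g := by
    rw [← hh.top]
    exact iSup_le fun pq x hx => hfg _ _ x hx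
  exact LinearMap.ext fun x => h1 Submodule.mem_top

theorem real (z w : ℂˣ) : galE conjAut (h (z, w) : EndC V) = h (star w, star z) := by
  refine hh.end_ext fun p q x hx => ?_
  rw [galE_conjAut_apply, mem_wtSpace.1 (hh.conj p q x hx), LinearMap.map_smulₛₗ, conjV_conjV,
    mem_wtSpace.1 hx]
  congr 1
  simp [mul_comm]

end IsSplitHom

end Orbits

/-! ### Real unipotent elements that preserve a split filtration. -/

section Stabilizers

variable {V : Type*} [AddCommGroup V] [Module ℚ V] {S : HodgeData V} {P L : Subgroup (GLC V)}
  {a : GLC V}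

/-- Endomorphisms mapping one `a`-stable filtration to another form a subspace stable under Ad `a`,
so they contain their homogeneous components. -/
theorem degPart_map_mem {F F' : Filt V} (hF : moveF a F = F) (hF' : moveF a F' = F') {T : EndC V}
    (hT : ∀ p, ∀ y ∈ F p, T y ∈ F' p) (k : ℕ) : ∀ p, ∀ y ∈ F p, degPart S a k T y ∈ F' p := by
  intro p
  let N : Submodule ℂ (EndC V) :=
    { carrier := {X | ∀ y ∈ F p, X y ∈ F' p}
      zero_mem' := fun _ _ => Submodule.zero_mem _
      add_mem' := fun hX hY y hy => Submodule.add_mem _ (hX y hy) (hY y hy)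
      smul_mem' := fun c _ hX y hy => Submodule.smul_mem _ c (hX y hy) }
  refine degPart_mem (N := N) (fun X hX y hy => ?_) (hT p) k
  have h1 : ((a⁻¹ : GLC V) : EndC V) y ∈ F p := by
    have h2 : moveF a⁻¹ F = F := by
      have := moveF_inv_moveF a F
      rwa [hF] at this
    rw [← h2]
    exact Submodule.mem_map_of_mem hy
  have h2 := Submodule.mem_map_of_mem (f := (a : EndC V)) (hX _ h1)
  have h3 : (F' p).map (a : EndC V) = F' p := congrFun hF' p
  rw [h3] at h2
  exact h2

/-- In each weight below p + q the filtrations F^p and conj F^q have only zero in common, so the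
vector descends through the weight filtration to zero. -/
theorem HodgeRelations.eq_zero_of_mem {W : ℤ → Submodule ℚ V} {F : Filt V}
    (h : HodgeRelations W F) {p q k : ℤ} (hk : k < p + q) {x : Cx V} (hp : x ∈ F p)
    (hq : conjV V x ∈ F q) (hx : x ∈ cxSub (W k)) : x = 0 := by
  have key : ∀ n : ℕ, x ∈ cxSub (W (k - n)) := by
    intro n
    induction n with
    | zero => simpa using hx
    | succ n ih =>
      have hq' : x ∈ conjSub (F (k - n + 1 - p)) :=
        mem_conjSub.2 (h.anti (show k - n + 1 - p ≤ q by omega) hq)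
      have h1 := h.meet (k - n) p x ⟨hp, ih⟩ x ⟨hq', ih⟩ (by
        rw [sub_self]; exact Submodule.zero_mem _)
      rwa [show k - ((n + 1 : ℕ) : ℤ) = k - n - 1 by push_cast; ring]
  obtain ⟨b, hb⟩ := h.W_bot
  have h1 := cxSub_mono (h.mono (show k - ((k - b).toNat : ℤ) ≤ b by omega)) (key _)
  rwa [hb, cxSub_bot, Submodule.mem_bot] at h1

theorem wtSpace_le_hodgeFil (h : ℂˣ × ℂˣ →* GLC V) (p q : ℤ) : wtSpace h p q ≤ hodgeFil h p :=
  le_iSup_of_le p (le_iSup_of_le q (le_iSup_of_le le_rfl le_rfl))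

namespace IsWeightElt

variable (ha : IsWeightElt S P a)
include ha

theorem degPart_one (k : ℕ) : degPart S a k 1 = if k = 0 then (1 : EndC V) else 0 :=
  ha.degPart_of_eigen one_mem_wEnd (by rw [map_one, adNode, pow_zero, inv_one, one_smul]) k

theorem degPart_zero_of_sub_one {T : EndC V} (hT : T - 1 ∈ wEnd S 1) : degPart S a 0 T = 1 := by
  have h1 := ha.degPart_eq_zero one_pos hT
  rwa [map_sub, ha.degPart_one, if_pos rfl, sub_eq_zero] at h1

theorem degPart_zero_mul {X Y : EndC V} (hX : X ∈ wEnd S 0) (hY : Y ∈ wEnd S 0) :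
    degPart S a 0 (X * Y) = degPart S a 0 X * degPart S a 0 Y := by
  rw [ha.degPart_mul 0 hX hY]
  simp

theorem le_of_map_le {F F' : Filt V} (hF : moveF a F = F) (hF' : moveF a F' = F') {T : EndC V}
    (hT1 : T - 1 ∈ wEnd S 1) (hT : ∀ p, ∀ y ∈ F p, T y ∈ F' p) : F ≤ F' := fun p y hy => by
  have h1 := degPart_map_mem (S := S) hF hF' hT 0 p y hy
  rwa [ha.degPart_zero_of_sub_one hT1] at h1

/-- The degree-0 component of a unipotent element is 1, and it must map the one filtration into the
other; the inverse gives the opposite inclusion. -/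
theorem eq_of_moveF_eq {F F' : Filt V} (hF : moveF a F = F) (hF' : moveF a F' = F') {v : GLC V}
    (hv : v ∈ unipSub S P 1) (h : moveF v F = F') : F = F' := by
  refine le_antisymm (ha.le_of_map_le hF hF' (ha.group.mem_unipSub.1 hv).2 fun p y hy => ?_)
    (ha.le_of_map_le hF' hF (ha.group.mem_unipSub.1 (inv_mem hv)).2 fun p y hy => ?_)
  · rw [← h]
    exact Submodule.mem_map_of_mem hy
  · have h' : moveF v⁻¹ F' = F := by rw [← h, moveF_inv_moveF]
    rw [← h']
    exact Submodule.mem_map_of_mem hy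

theorem sub_one_mem_of_degPart {k : ℕ} {N : EndC V} (hN : N - 1 ∈ wEnd S 1)
    (h : ∀ j, 1 ≤ j → j ≤ k → degPart S a j N = 0) : N - 1 ∈ wEnd S (k + 1) := by
  have h1 := ha.sub_sum_mem_wEnd (k + 1) (mem_wEnd_zero hN)
  rwa [Finset.sum_eq_zero, sub_zero] at h1
  intro i hi
  rw [Finset.mem_range] at hi
  rcases Nat.eq_zero_or_pos i with rfl | hi0
  · exact ha.degPart_eq_zero one_pos hN
  · rw [map_sub, h i hi0 (by omega), ha.degPart_one, if_neg (by omega), sub_zero]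

end IsWeightElt

theorem IsSplitHom.conj_levi {h : ℂˣ × ℂˣ →* GLC V} (hh : IsSplitHom S a h)
    (hL : IsLeviWeight S P L a) {l : GLC V} (hl : l ∈ realPts L) : IsSplitHom S a (conjHom l h) := by
  have hlL := (hL.mem_iff l).1 hl.1
  refine ⟨?_, fun p q => ?_, ?_, fun p q x hx => ?_⟩
  · simp only [wtSpace_conjHom, ← Submodule.map_iSup]
    rw [hh.top, Submodule.map_top, LinearMap.range_eq_top]
    exact fun x => ⟨_, glc_apply_inv l x⟩
  · rw [wtSpace_conjHom, Submodule.map_le_iff_le_comap]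
    intro x hx
    simpa using hL.elt.group.mem_wEnd l hlL.1 _ x (hh.weight p q hx)
  · rw [conjHom_apply, hh.value, hlL.2, mul_inv_cancel_right]
  · rw [wtSpace_conjHom] at hx ⊢
    obtain ⟨y, hy, rfl⟩ := hx
    rw [← hl.2]
    exact Submodule.mem_map_of_mem (hh.conj p q y hy)

/-- In degrees -1, …, -k the components of `T` and `N` agree. So there they preserve the Hodge
filtration and are real, and they carry a vector of type (p, q) into F^p ∩ conj F^q in weight p + q
- j. That intersection is zero. Only `N` has to be real; `T` preserves the filtration. -/
theorem IsSplitHom.sub_one_mem {h : ℂˣ × ℂˣ →* GLC V} (hh : IsSplitHom S a h)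
    (ha : IsWeightElt S P a) (har : galE conjAut (a : EndC V) = a)
    (hF : HodgeRelations S.W (hodgeFil h)) {k : ℕ} {T N : EndC V}
    (hT : ∀ p, ∀ y ∈ hodgeFil h p, T y ∈ hodgeFil h p) (hN : N - 1 ∈ wEnd S 1)
    (hNr : galE conjAut N = N) (hTN : T - N ∈ wEnd S (k + 1)) : N - 1 ∈ wEnd S (k + 1) := by
  have hN0 : N ∈ wEnd S 0 := by
    rw [← sub_add_cancel N 1]
    exact Submodule.add_mem _ (mem_wEnd_zero hN) one_mem_wEnd
  have key : ∀ j, 1 ≤ j → j ≤ k → degPart S a j N = 0 := by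
    intro j hj hjk
    have e : degPart S a j T = degPart S a j N := by
      have := ha.degPart_eq_zero (show j < k + 1 by omega) hTN
      rwa [map_sub, sub_eq_zero] at this
    have hZ := degPart_map_mem (S := S) hh.moveF_weight hh.moveF_weight hT j
    rw [e] at hZ
    have hZr : galE conjAut (degPart S a j N) = degPart S a j N := by
      rw [← degPart_galE har, hNr]
    have hZW := ha.degPart_mem_wEnd j hN0
    refine hh.end_ext fun p q x hx => ?_
    refine hF.eq_zero_of_mem (p := p) (q := q) (k := p + q - j) (by omega)
      (hZ p x (wtSpace_le_hodgeFil h p q hx)) ?_ (hZW _ x (hh.weight p q hx))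
    rw [← (galE_conj_eq_iff _).1 hZr]
    exact hZ q _ (wtSpace_le_hodgeFil h q p (hh.conj p q x hx))
  exact ha.sub_one_mem_of_degPart hN key

end Stabilizers

/-! ### Fibres of the orbit maps to the quotients D_k. -/

section Quotients

variable {V : Type*} [AddCommGroup V] [Module ℚ V] [Module.Finite ℚ V] {S : HodgeData V}
  {P L : Subgroup (GLC V)} {a : GLC V}

namespace IsWeightGroup

variable (hP : IsWeightGroup S P)
include hP

theorem mem_proj {k : ℕ} {x y : Filt V} :
    y ∈ proj S P k x ↔ ∃ u ∈ unipSub S P (k + 1), y = moveF u x := by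
  rw [← hP.wGroup_eq (Nat.succ_pos k)]
  rfl

theorem proj_moveF {k : ℕ} {u : GLC V} (hu : u ∈ unipSub S P (k + 1)) (x : Filt V) :
    proj S P k (moveF u x) = proj S P k x := by
  ext y
  rw [hP.mem_proj, hP.mem_proj]
  constructor
  · rintro ⟨v, hv, rfl⟩
    exact ⟨v * u, mul_mem hv hu, (moveF_mul v u x).symm⟩
  · rintro ⟨v, hv, rfl⟩
    exact ⟨v * u⁻¹, mul_mem hv (inv_mem hu), by rw [← moveF_mul, inv_mul_cancel_right]⟩

theorem proj_eq_iff {k : ℕ} {x y : Filt V} :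
    proj S P k x = proj S P k y ↔ ∃ u ∈ unipSub S P (k + 1), moveF u x = y := by
  constructor
  · intro h
    have hy : y ∈ proj S P k y := hP.mem_proj.2 ⟨1, one_mem _, (moveF_one y).symm⟩
    rw [← h, hP.mem_proj] at hy
    obtain ⟨u, hu, h⟩ := hy
    exact ⟨u, hu, h.symm⟩
  · rintro ⟨u, hu, rfl⟩
    exact (hP.proj_moveF hu x).symm

theorem moveSet_proj {g : GLC V} (hg : g ∈ P) (k : ℕ) (x : Filt V) :
    moveSet g (proj S P k x) = proj S P k (moveF g x) := by
  ext y
  rw [hP.mem_proj, moveSet, Set.mem_image]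
  constructor
  · rintro ⟨z, hz, rfl⟩
    obtain ⟨u, hu, rfl⟩ := hP.mem_proj.1 hz
    exact ⟨g * u * g⁻¹, hP.conj_mem_unipSub hg hu, by
      rw [← moveF_mul, ← moveF_mul, inv_mul_cancel_right]⟩
  · rintro ⟨u, hu, rfl⟩
    refine ⟨moveF (g⁻¹ * u * g) x, hP.mem_proj.2 ⟨g⁻¹ * u * g, ?_, rfl⟩, ?_⟩
    · have := hP.conj_mem_unipSub (P.inv_mem hg) hu
      rwa [inv_inv] at this
    · rw [← moveF_mul, ← moveF_mul]
      simp only [mul_assoc, mul_inv_cancel_left]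

theorem inv_mul_exp_mem_unipSub {k : ℕ} {A B : EndC V} (hA : A ∈ lieWC S P 1)
    (hB : B ∈ lieWC S P 1)
    {u v : GLC V} (hu : (u : EndC V) = IsNilpotent.exp A) (hv : (v : EndC V) = IsNilpotent.exp B) :
    v⁻¹ * u ∈ unipSub S P (k + 1) ↔ A - B ∈ wEnd S (k + 1) := by
  have huP := hP.exp_mem le_rfl hA hu
  have hvP := hP.exp_mem le_rfl hB hv
  have hA1 := lieWC_le_wEnd _ hA
  have hB1 := lieWC_le_wEnd _ hB
  have e : ((v⁻¹ * u : GLC V) : EndC V) - 1 =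
      ((v⁻¹ : GLC V) : EndC V) * ((u : EndC V) - (v : EndC V)) := by
    rw [mul_sub, v.inv_mul, Units.val_mul]
  have e' : (u : EndC V) - (v : EndC V) = (v : EndC V) * (((v⁻¹ * u : GLC V) : EndC V) - 1) := by
    rw [e, ← mul_assoc, v.mul_inv, one_mul]
  rw [hP.mem_unipSub]
  constructor
  · rintro ⟨-, h⟩
    have h1 := mul_mem_wEnd_left (hP.mem_wEnd v hvP.1) h
    rw [← e', hu, hv] at h1
    have h2 := nilLog_sub_nilLog_mem_wEnd (exp_sub_one_mem_wEnd le_rfl hA1)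
      (exp_sub_one_mem_wEnd le_rfl hB1) h1
    rwa [nilLog_exp_of_mem le_rfl hA1, nilLog_exp_of_mem le_rfl hB1] at h2
  · intro h
    refine ⟨P.mul_mem (P.inv_mem hvP.1) huP.1, ?_⟩
    rw [e]
    refine mul_mem_wEnd_left (hP.mem_wEnd _ (P.inv_mem hvP.1)) ?_
    rw [hu, hv]
    exact exp_sub_exp_mem_wEnd hA1 hB1 h

end IsWeightGroup

theorem IsLeviWeight.exists_decomp (hL : IsLeviWeight S P L a) {g : GLC V} (hg : g ∈ realPlus P) :
    ∃ A ∈ lieWR S P 1, ∃ u l : GLC V, (u : EndC V) = IsNilpotent.exp A ∧ u ∈ realPlus P ∧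
      l ∈ realPts L ∧ l ∈ realPlus P ∧ g = u * l := by
  obtain ⟨A, hA, l, hl, e⟩ := hL.exists_exp_mul (realPlus_subset hg)
  let u := expUnit A (isNilpotent_of_mem_lieWC le_rfl (mem_lieWR.1 hA).1)
  have hu : u ∈ realPlus P := exp_mem_realPlus hL.elt.group hA rfl
  have hg' : g = u * l := Units.ext e
  refine ⟨A, hA, u, l, rfl, hu, hl, ?_, hg'⟩
  have : l = u⁻¹ * g := by rw [hg', inv_mul_cancel_left]
  rw [this]
  exact mul_mem_realPlus (inv_mem_realPlus hu) hg

omit [Module.Finite ℚ V] in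
theorem IsLeviWeight.moveF_levi (hL : IsLeviWeight S P L a) {h : ℂˣ × ℂˣ →* GLC V}
    (hh : IsSplitHom S a h) {l : GLC V} (hl : l ∈ L) :
    moveF a (moveF l (hodgeFil h)) = moveF l (hodgeFil h) := by
  rw [← moveF_mul, ← ((hL.mem_iff l).1 hl).2, moveF_mul, hh.moveF_weight]

theorem IsLeviWeight.unipSub_one (hL : IsLeviWeight S P L a) {A : EndC V} (hA : A ∈ lieWR S P 1)
    {u : GLC V} (hu : (u : EndC V) = IsNilpotent.exp A) : u ∈ unipSub S P 1 :=
  hL.elt.group.exp_mem le_rfl (mem_lieWR.1 hA).1 hu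

/-- Two elements of `P(ℝ)⁺` move the split base point to the same point of `D_k` if and only if
they have the same Levi part modulo the stabilizer, and logarithms of the unipotent parts that agree
modulo `W_{-(k+1)}`. -/
theorem IsLeviWeight.proj_moveF_eq_iff (hL : IsLeviWeight S P L a) {h : ℂˣ × ℂˣ →* GLC V}
    (hh : IsSplitHom S a h)
    (hM : ∀ g ∈ realPlus P, HodgeRelations S.W (moveF g (hodgeFil h))) (k : ℕ)
    {A B : EndC V} (hA : A ∈ lieWR S P 1) (hB : B ∈ lieWR S P 1) {u v l r : GLC V}
    (hu : (u : EndC V) = IsNilpotent.exp A) (hv : (v : EndC V) = IsNilpotent.exp B)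
    (hl : l ∈ realPts L) (hr : r ∈ realPts L) (hlP : l ∈ realPlus P) :
    proj S P k (moveF (u * l) (hodgeFil h)) = proj S P k (moveF (v * r) (hodgeFil h)) ↔
      moveF l (hodgeFil h) = moveF r (hodgeFil h) ∧ A - B ∈ wEnd S (k + 1) := by
  have hP := hL.elt.group
  have huP := exp_mem_realPts hP hA hu
  have hvP := exp_mem_realPts hP hB hv
  rw [hP.proj_eq_iff]
  constructor
  -- The unipotent element v⁻¹ t u carries one Levi translate of the base filtration to another;
  -- both are `a`-stable, so they coincide. It then stabilizes that filtration and is congruent to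
  -- the real element v⁻¹ u modulo W_{-(k+1)}.
  · rintro ⟨t, ht, e⟩
    have e2 : moveF (v⁻¹ * t * u) (moveF l (hodgeFil h)) = moveF r (hodgeFil h) := by
      rw [moveF_mul _ r, moveF_mul u l] at e
      rw [moveF_mul, moveF_mul, e, moveF_inv_moveF]
    have ht1 := unipSub_anti (show 1 ≤ k + 1 by omega) ht
    have hT1 : v⁻¹ * t * u ∈ unipSub S P 1 :=
      mul_mem (mul_mem (inv_mem (hL.unipSub_one hB hv)) ht1) (hL.unipSub_one hA hu)
    have e3 := hL.elt.eq_of_moveF_eq (hL.moveF_levi hh hl.1) (hL.moveF_levi hh hr.1) hT1 e2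
    refine ⟨e3, ?_⟩
    rw [← e3, ← hodgeFil_conjHom] at e2
    rw [← hP.inv_mul_exp_mem_unipSub (mem_lieWR.1 hA).1 (mem_lieWR.1 hB).1 hu hv, hP.mem_unipSub]
    refine ⟨P.mul_mem (P.inv_mem hvP.1) huP.1, ?_⟩
    refine (hh.conj_levi hL hl).sub_one_mem hL.elt (hL.rational _)
      (by rw [hodgeFil_conjHom]; exact hM l hlP) (T := ((v⁻¹ * t * u : GLC V) : EndC V))
      (fun p y hy => ?_) ?_ ?_ ?_
    · rw [← congrFun e2 p]
      exact Submodule.mem_map_of_mem hy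
    · exact (hP.mem_unipSub.1 (mul_mem (inv_mem (hL.unipSub_one hB hv))
        (hL.unipSub_one hA hu))).2
    · exact (mem_realPts.1 (mul_mem (inv_mem hvP) huP)).2
    · have e4 : ((v⁻¹ * t * u : GLC V) : EndC V) - ((v⁻¹ * u : GLC V) : EndC V) =
          ((v⁻¹ : GLC V) : EndC V) * ((t : EndC V) - 1) * (u : EndC V) := by
        simp only [Units.val_mul]
        noncomm_ring
      rw [e4]
      exact mul_mem_wEnd_right (mul_mem_wEnd_left (hP.mem_wEnd _ (P.inv_mem hvP.1))
        (hP.mem_unipSub.1 ht).2) (hP.mem_wEnd _ huP.1)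
  · rintro ⟨e, hAB⟩
    have h1 := (hP.inv_mul_exp_mem_unipSub (mem_lieWR.1 hA).1 (mem_lieWR.1 hB).1 hu hv).2 hAB
    refine ⟨v * (v⁻¹ * u)⁻¹ * v⁻¹, hP.conj_mem_unipSub hvP.1 (inv_mem h1), ?_⟩
    rw [moveF_mul v r, ← e, ← moveF_mul, ← moveF_mul]
    congr 1
    group

end Quotients

/-! ### Points split over ℝ and the orbit of the base point. -/

section SplitPoints

variable {V : Type*} [AddCommGroup V] [Module ℚ V] {S : HodgeData V} {P L : Subgroup (GLC V)}
  {a : GLC V}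

theorem isRealMod_iff {N : Subgroup (GLC V)} {h : ℂˣ × ℂˣ →* GLC V} :
    IsRealMod N h ↔ ∀ z w : ℂˣ, ∃ n ∈ N, galG conjAut (h (z, w)) = h (star w, star z) * n := by
  refine forall₂_congr fun z w => exists_congr fun n => and_congr_right fun _ => ?_
  rw [Units.ext_iff, LinearMap.ext_iff]
  exact forall_congr' fun v => by rw [coe_galG, galE_conjAut_apply]

theorem galG_of_mem_realPts {g : GLC V} (hg : g ∈ realPts P) : galG conjAut g = g :=
  Units.ext (mem_realPts.1 hg).2

theorem IsRealMod.mono {N N' : Subgroup (GLC V)} (hN : N ≤ N') {h : ℂˣ × ℂˣ →* GLC V}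
    (hh : IsRealMod N h) : IsRealMod N' h := fun z w => by
  obtain ⟨n, hn, e⟩ := hh z w
  exact ⟨n, hN hn, e⟩

theorem IsSplitHom.isRealMod_conj {h : ℂˣ × ℂˣ →* GLC V} (hh : IsSplitHom S a h)
    (N : Subgroup (GLC V)) {g : GLC V} (hg : g ∈ realPts P) : IsRealMod N (conjHom g h) := by
  refine isRealMod_iff.2 fun z w => ⟨1, one_mem _, ?_⟩
  rw [conjHom_apply, map_mul, map_mul, map_inv, galG_of_mem_realPts hg, mul_one, conjHom_apply]
  congr 2
  exact Units.ext (hh.real z w)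

variable [Module.Finite ℚ V]

-- The relation says that Ad `a` fixes `v` modulo W_{-(k+1)}. A component of degree -j with 1 ≤ j ≤
-- k has eigenvalue 2^{-j} ≠ 1, so it vanishes.
omit [Module.Finite ℚ V] in
theorem IsLeviWeight.sub_one_mem_of_conj (hL : IsLeviWeight S P L a) {k : ℕ} {v n : GLC V}
    (hv : v ∈ unipSub S P 1) (hn : n ∈ unipSub S P (k + 1)) (e : v * a * v⁻¹ = a * n) :
    (v : EndC V) - 1 ∈ wEnd S (k + 1) := by
  have hP := hL.elt.group
  have hv0 := hP.mem_wEnd v hv.1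
  refine hL.elt.sub_one_mem_of_degPart (hP.mem_unipSub.1 hv).2 fun j hj hjk => ?_
  have e1 : v = a * (n * v) * a⁻¹ := by
    rw [← mul_assoc, ← e, inv_mul_cancel_right, mul_inv_cancel_right]
  have e2 : conjE a (v : EndC V) - v =
      - conjE a (((n : EndC V) - 1) * (v : EndC V)) := by
    have e3 : (v : EndC V) = conjE a ((n : EndC V) * (v : EndC V)) := congrArg Units.val e1
    rw [sub_mul, one_mul, map_sub, ← e3, neg_sub]
  have h1 : conjE a (v : EndC V) - v ∈ wEnd S (k + 1) := by
    rw [e2]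
    exact Submodule.neg_mem _ (hP.conjE_mem_wEnd hL.elt.mem
      (mul_mem_wEnd_right (hP.mem_unipSub.1 hn).2 hv0))
  have h2 := hL.elt.degPart_eq_zero (show j < k + 1 by omega) h1
  rw [map_sub, degPart_conjE rfl, hL.elt.conjE_degPart j hv0, rat_smul_eq,
    show ((adNode j : ℚ) : ℂ) • degPart S a j (v : EndC V) - degPart S a j (v : EndC V) =
      (((adNode j : ℚ) : ℂ) - 1) • degPart S a j (v : EndC V) by rw [sub_smul, one_smul],
    smul_eq_zero] at h2
  refine h2.resolve_left ?_
  rw [adNode_cast]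
  exact fun h => two_zpow_neg_ne_one hj (by rw [← neg_sub, h, neg_zero])

/-- The average of log u and its complex conjugate is real and differs from log u by half of their
difference, which lies in W_{-(k+1)} by hypothesis. -/
theorem IsLeviWeight.exists_real_exp (hL : IsLeviWeight S P L a) {k : ℕ} {u : GLC V}
    (hu : u ∈ unipSub S P 1) (h : ((u⁻¹ * galG conjAut u : GLC V) : EndC V) - 1 ∈ wEnd S (k + 1)) :
    ∃ n ∈ realPlus P, n⁻¹ * u ∈ unipSub S P (k + 1) := by
  have hP := hL.elt.group
  have hu1 := (hP.mem_unipSub.1 hu).2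
  have hug : galE conjAut (u : EndC V) - 1 ∈ wEnd S 1 :=
    (hP.mem_unipSub.1 (hP.galG_mem_unipSub hu conjAut)).2
  have hA := nilLog_mem_lieWC le_rfl hu
  set A := nilLog (u : EndC V) with hAdef
  have hAe : (u : EndC V) = IsNilpotent.exp A := (exp_nilLog_of_mem le_rfl hu1).symm
  have hAA : galE conjAut A - A ∈ wEnd S (k + 1) := by
    rw [hAdef, galE_nilLog hu1]
    refine nilLog_sub_nilLog_mem_wEnd hug hu1 ?_
    have := mul_mem_wEnd_left (hP.mem_wEnd u hu.1) h
    rwa [mul_sub, ← Units.val_mul, mul_inv_cancel_left, mul_one] at this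
  let B : EndC V := (2 : ℂ)⁻¹ • (A + galE conjAut A)
  have hB : B ∈ lieWR S P 1 := by
    refine mem_lieWR.2 ⟨Submodule.smul_mem _ _ (Submodule.add_mem _ hA (galE_mem_lieWC hA _)), ?_⟩
    change galE conjAut ((2 : ℂ)⁻¹ • (A + galE conjAut A)) = (2 : ℂ)⁻¹ • (A + galE conjAut A)
    rw [galE_smul, map_add, galE_conj_conj, add_comm, map_inv₀, map_ofNat]
  have hn : IsNilpotent B := isNilpotent_of_mem_lieWC le_rfl (mem_lieWR.1 hB).1
  refine ⟨expUnit B hn, exp_mem_realPlus hP hB rfl,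
    (hP.inv_mul_exp_mem_unipSub hA (mem_lieWR.1 hB).1 hAe rfl).2 ?_⟩
  have e : A - B = (2 : ℂ)⁻¹ • (-(galE conjAut A - A)) := by
    have : A = (2 : ℂ)⁻¹ • (A + A) := by
      rw [← two_smul ℂ A, smul_smul, inv_mul_cancel₀ two_ne_zero, one_smul]
    conv_lhs => rw [this]
    rw [← smul_sub]
    congr 1
    abel
  rw [e]
  exact Submodule.smul_mem _ _ (Submodule.neg_mem _ hAA)

theorem IsWeightGroup.proj_eq_singleton (hP : IsWeightGroup S P) {m : ℕ}
    (hm : lieW S P (m + 1) = ⊥) (x : Filt V) : proj S P m x = {x} := by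
  have h0 : ∀ u ∈ unipSub S P (m + 1), u = 1 := by
    intro u hu
    have h1 := nilLog_mem_lieWC (Nat.succ_pos m) hu
    have h2 := exp_nilLog_of_mem (Nat.succ_pos m) (hP.mem_unipSub.1 hu).2
    rw [lieWC, hm, Submodule.bot_coe, Set.image_singleton] at h1
    have h3 : (cxMap (0 : Module.End ℚ V) : EndC V) = 0 := map_zero (cxHom V)
    rw [h3, Submodule.span_zero_singleton, Submodule.mem_bot] at h1
    rw [h1, IsNilpotent.exp_zero] at h2
    exact Units.ext h2.symm
  ext y
  rw [hP.mem_proj, Set.mem_singleton_iff]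
  constructor
  · rintro ⟨u, hu, rfl⟩
    rw [h0 u hu, moveF_one]
  · rintro rfl
    exact ⟨1, one_mem _, (moveF_one y).symm⟩

variable {D : Set (Filt V)} {x₀ : Filt V} {h₀ : ℂˣ × ℂˣ →* GLC V} {u₀ : GLC V}

section
variable (hF : IsClassified S x₀) (hh : IsDeligneHom S.W x₀ h₀)
  (hL : IsLeviWeight S (mumfordTate S.W x₀) L a) (hu₀ : u₀ ∈ unipSub S (mumfordTate S.W x₀) 1)
  (hs : IsSplitHom S a (conjHom u₀ h₀))

include hh in
omit [Module.Finite ℚ V] in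
theorem IsDeligneHom.hodgeFil_conj (u : GLC V) : hodgeFil (conjHom u h₀) = moveF u x₀ := by
  rw [hodgeFil_conjHom, ← funext hh.hodge]

include hF hh hu₀

theorem conjHom_mem_homClass {p : GLC V} (hp : p ∈ realPlus (mumfordTate S.W x₀)) :
    conjHom p (conjHom u₀ h₀) ∈ homClass S x₀ := by
  refine ⟨p * u₀, ⟨p, hp, u₀, ?_, rfl⟩, h₀, hh, (conjHom_mul _ _ _).symm⟩
  rw [hF.unipotentRadical_eq]
  exact hu₀

theorem hodgeRelations_of_mem_realPlus (hD : IsMumfordTateDomain S D x₀) {p : GLC V}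
    (hp : p ∈ realPlus (mumfordTate S.W x₀)) :
    HodgeRelations S.W (moveF p (hodgeFil (conjHom u₀ h₀))) := by
  have h1 : moveF p (hodgeFil (conjHom u₀ h₀)) ∈ D := by
    rw [hh.hodgeFil_conj, hD.orbit]
    refine ⟨p * u₀, ⟨p, hp, u₀, ?_, rfl⟩, (moveF_mul _ _ _).symm⟩
    rwa [hF.unipotentRadical_eq]
  have h2 : IsClassified S _ := hD.subset h1
  exact h2.mhs.hodgeRelations S.mono S.exists_bot S.exists_top

include hL

/-- Passing to D_0 divides by all of W_{-1}(ℂ). So both the unipotent factor of an orbit element and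
the correction u₀ of the base point disappear, and P(ℝ)⁺ alone is transitive. -/
theorem mem_quotDomain_zero
    (hD : D = {x | ∃ g ∈ orbitGroup (mumfordTate S.W x₀), x = moveF g x₀}) {y : Set (Filt V)} :
    y ∈ quotDomain S (mumfordTate S.W x₀) D 0 ↔ ∃ p ∈ realPlus (mumfordTate S.W x₀),
      y = proj S (mumfordTate S.W x₀) 0 (moveF p (hodgeFil (conjHom u₀ h₀))) := by
  have hP := hL.elt.group
  rw [hh.hodgeFil_conj, hD]
  constructor
  · rintro ⟨x, ⟨g, ⟨p, hp, u, hu, rfl⟩, rfl⟩, rfl⟩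
    rw [hF.unipotentRadical_eq] at hu
    refine ⟨p, hp, ?_⟩
    have hpP := (realPlus_subset hp).1
    rw [moveF_mul, ← hP.moveSet_proj hpP, ← hP.moveSet_proj hpP, hP.proj_moveF hu,
      hP.proj_moveF hu₀]
  · rintro ⟨p, hp, rfl⟩
    refine ⟨moveF p (moveF u₀ x₀), ⟨p * u₀, ⟨p, hp, u₀, ?_, rfl⟩, (moveF_mul _ _ _).symm⟩, rfl⟩
    rwa [hF.unipotentRadical_eq]

include hs

/-- Relative to a split homomorphism, `h` is conjugation by p t with `p` real and `t` unipotent.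
Reality of its weight element modulo W_{-(k+1)} shows that `t` and its conjugate agree modulo that
group, and `t` can be replaced by a real unipotent element without changing the point of D_k. -/
theorem exists_proj_eq_of_isRealMod {k : ℕ} {h : ℂˣ × ℂˣ →* GLC V} (hh' : h ∈ homClass S x₀)
    (hr : IsRealMod (unipSub S (mumfordTate S.W x₀) (k + 1)) h) :
    ∃ p ∈ realPlus (mumfordTate S.W x₀), proj S (mumfordTate S.W x₀) k (hodgeFil h) =
      proj S (mumfordTate S.W x₀) k (moveF p (hodgeFil (conjHom u₀ h₀))) := by
  set P := mumfordTate S.W x₀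
  have hP := hL.elt.group
  obtain ⟨g, ⟨p, hp, u, hu, rfl⟩, h₁, hh₁, rfl⟩ := hh'
  have hpP := realPlus_subset hp
  rw [hF.unipotentRadical_eq] at hu
  obtain ⟨u₁, hu₁, hs₁⟩ := exists_isSplitHom hF hh₁ hL
  -- The class allows any Deligne homomorphism of the base point. No uniqueness is needed: the two
  -- split filtrations are `a`-stable and related by a unipotent element, hence equal.
  have hx : hodgeFil (conjHom u₁ h₁) = hodgeFil (conjHom u₀ h₀) := by
    refine hL.elt.eq_of_moveF_eq hs₁.moveF_weight hs.moveF_weight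
      (mul_mem hu₀ (inv_mem hu₁)) ?_
    rw [hh₁.hodgeFil_conj, hh.hodgeFil_conj, moveF_mul, moveF_inv_moveF]
  have hut := mul_mem hu (inv_mem hu₁)
  set t := u * u₁⁻¹ with ht
  have hpu : p * u = p * t * u₁ := by rw [ht]; group
  rw [hpu, conjHom_mul] at hr ⊢
  rw [hodgeFil_conjHom, hx]
  -- The point (1/2, 1/2) is fixed by (z, w) ↦ (conj w, conj z), so reality of `h` modulo the
  -- subgroup becomes reality of its weight element.
  obtain ⟨n, hn, e⟩ := isRealMod_iff.1 hr (Units.mk0 2 two_ne_zero)⁻¹ (Units.mk0 2 two_ne_zero)⁻¹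
  have hstar : star ((Units.mk0 (2 : ℂ) two_ne_zero)⁻¹) = (Units.mk0 2 two_ne_zero)⁻¹ := by
    ext1
    simp
  have hag : galG conjAut a = a := Units.ext (hL.rational _)
  rw [hstar, conjHom_apply, hs₁.value, map_mul, map_mul, map_inv, map_mul, hag,
    galG_of_mem_realPts hpP] at e
  have htg := hP.galG_mem_unipSub hut conjAut
  obtain ⟨r, hr, hrt⟩ := hL.exists_real_exp (k := k) hut (by
    refine hL.sub_one_mem_of_conj (n := t⁻¹ * (p⁻¹ * n * p) * t) (mul_mem (inv_mem hut) htg)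
      ?_ ?_
    · have h1 := hP.conj_mem_unipSub (P.inv_mem hpP.1) hn
      rw [inv_inv] at h1
      have h2 := hP.conj_mem_unipSub (P.inv_mem hut.1) h1
      rwa [inv_inv] at h2
    · have e2 := congrArg (fun y => t⁻¹ * (p⁻¹ * y * p) * t) e
      simp only [mul_inv_rev, mul_assoc, inv_mul_cancel_left, inv_mul_cancel, mul_one,
        inv_inv] at e2 ⊢
      exact e2)
  have hprP := mul_mem_realPlus hp hr
  refine ⟨p * r, hprP, ?_⟩
  have e3 : p * t = p * r * (r⁻¹ * t) := by group
  rw [e3, moveF_mul _ (r⁻¹ * t), ← hP.moveSet_proj (realPlus_subset hprP).1, hP.proj_moveF hrt,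
    hP.moveSet_proj (realPlus_subset hprP).1]

theorem mem_quotSplitPts {k : ℕ} {y : Set (Filt V)} : y ∈ quotSplitPts S x₀ k ↔
    ∃ p ∈ realPlus (mumfordTate S.W x₀),
      y = proj S (mumfordTate S.W x₀) k (moveF p (hodgeFil (conjHom u₀ h₀))) := by
  constructor
  · rintro ⟨h, hh', hr, rfl⟩
    rw [hL.elt.group.wGroup_eq (Nat.succ_pos k)] at hr
    exact exists_proj_eq_of_isRealMod hF hh hL hu₀ hs hh' hr
  · rintro ⟨p, hp, rfl⟩
    exact ⟨_, conjHom_mem_homClass hF hh hu₀ hp, hs.isRealMod_conj _ (realPlus_subset hp),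
      by rw [hodgeFil_conjHom p]⟩

theorem mem_splitPts {m : ℕ} (hm : lieW S (mumfordTate S.W x₀) (m + 1) = ⊥) {y : Filt V} :
    y ∈ splitPts S x₀ ↔ ∃ p ∈ realPlus (mumfordTate S.W x₀),
      y = moveF p (hodgeFil (conjHom u₀ h₀)) := by
  constructor
  · rintro ⟨h, hh', hr, rfl⟩
    obtain ⟨p, hp, e⟩ := exists_proj_eq_of_isRealMod (k := m) hF hh hL hu₀ hs hh' (hr.mono bot_le)
    rw [hL.elt.group.proj_eq_singleton hm, hL.elt.group.proj_eq_singleton hm,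
      Set.singleton_eq_singleton_iff] at e
    exact ⟨p, hp, e⟩
  · rintro ⟨p, hp, rfl⟩
    exact ⟨_, conjHom_mem_homClass hF hh hu₀ hp, hs.isRealMod_conj _ (realPlus_subset hp),
      (hodgeFil_conjHom p _).symm⟩

end

end SplitPoints

/-! ### Charts from the Levi decomposition and the action formula. -/

section Charts

variable {V : Type*} [AddCommGroup V] [Module ℚ V] {S : HodgeData V} {P L : Subgroup (GLC V)}
  {a : GLC V}

/-- The logarithm of the unipotent part of `g` in the Levi decomposition defined by `a`. -/
def uniLog (S : HodgeData V) (a g : GLC V) : EndC V :=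
  nilLog ((g : EndC V) * degPart S a 0 ((g⁻¹ : GLC V) : EndC V))

namespace IsLeviWeight

variable (hL : IsLeviWeight S P L a)
include hL

theorem degPart_levi {l : GLC V} (hl : l ∈ L) : degPart S a 0 (l : EndC V) = l := by
  have h1 := (hL.mem_iff l).1 hl
  have h2 : conjE a (l : EndC V) = l := by
    have : a * l * a⁻¹ = l := by rw [← h1.2, mul_inv_cancel_right]
    exact congrArg Units.val this
  rw [hL.elt.degPart_of_eigen (hL.elt.group.mem_wEnd l h1.1)
    (by rw [h2, adNode, pow_zero, inv_one, one_smul]), if_pos rfl]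

/-- Taking degree-0 components is multiplicative on W_0 End, equal to 1 on unipotent elements and
the identity on Levi elements. So the Levi factor is a linear function of the matrix, which later
makes it regular. -/
theorem degPart_unip_mul {u l : GLC V} (hu : u ∈ unipSub S P 1) (hl : l ∈ L) :
    degPart S a 0 ((u * l : GLC V) : EndC V) = l := by
  rw [Units.val_mul, hL.elt.degPart_zero_mul (hL.elt.group.mem_wEnd u hu.1)
    (hL.elt.group.mem_wEnd l ((hL.mem_iff l).1 hl).1),
    hL.elt.degPart_zero_of_sub_one (hL.elt.group.mem_unipSub.1 hu).2, hL.degPart_levi hl, one_mul]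

theorem degPart_inv_unip_mul {u l : GLC V} (hu : u ∈ unipSub S P 1) (hl : l ∈ L) :
    degPart S a 0 (((u * l)⁻¹ : GLC V) : EndC V) = (l⁻¹ : GLC V) := by
  have h1 := hL.elt.group.conj_mem_unipSub (P.inv_mem ((hL.mem_iff l).1 hl).1) (inv_mem hu)
  rw [inv_inv] at h1
  have e : (u * l)⁻¹ = l⁻¹ * u⁻¹ * l * l⁻¹ := by group
  rw [e, hL.degPart_unip_mul h1 (inv_mem hl)]

variable [Module.Finite ℚ V]

theorem uniLog_exp_mul {A : EndC V} (hA : A ∈ lieWC S P 1) {u l : GLC V}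
    (hu : (u : EndC V) = IsNilpotent.exp A) (hl : l ∈ L) : uniLog S a (u * l) = A := by
  rw [uniLog, hL.degPart_inv_unip_mul (hL.elt.group.exp_mem le_rfl hA hu) hl, ← Units.val_mul,
    mul_inv_cancel_right, hu, nilLog_exp_of_mem le_rfl (lieWC_le_wEnd _ hA)]

theorem uniLog_mem {g : GLC V} (hg : g ∈ realPlus P) : uniLog S a g ∈ lieWR S P 1 := by
  obtain ⟨A, hA, u, l, hu, -, hl, -, rfl⟩ := hL.exists_decomp hg
  rwa [hL.uniLog_exp_mul (mem_lieWR.1 hA).1 hu hl.1]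

theorem proj_eq_iff_coord {h : ℂˣ × ℂˣ →* GLC V} (hh : IsSplitHom S a h)
    (hM : ∀ g ∈ realPlus P, HodgeRelations S.W (moveF g (hodgeFil h))) (k : ℕ) {g g' : GLC V}
    (hg : g ∈ realPlus P) (hg' : g' ∈ realPlus P) :
    proj S P k (moveF g (hodgeFil h)) = proj S P k (moveF g' (hodgeFil h)) ↔
      proj S P 0 (moveF g (hodgeFil h)) = proj S P 0 (moveF g' (hodgeFil h)) ∧
        ∀ i < k, hL.coord i (uniLog S a g) (hL.uniLog_mem hg) =
          hL.coord i (uniLog S a g') (hL.uniLog_mem hg') := by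
  obtain ⟨A, hA, u, l, hu, -, hl, hlP, e⟩ := hL.exists_decomp hg
  obtain ⟨B, hB, v, r, hv, -, hr, -, e'⟩ := hL.exists_decomp hg'
  have hAu : uniLog S a g = A := by rw [e, hL.uniLog_exp_mul (mem_lieWR.1 hA).1 hu hl.1]
  have hBu : uniLog S a g' = B := by rw [e', hL.uniLog_exp_mul (mem_lieWR.1 hB).1 hv hr.1]
  have hAB : A - B ∈ wEnd S (0 + 1) :=
    Submodule.sub_mem _ (lieWR_le_wEnd hA) (lieWR_le_wEnd hB)
  have hc : (∀ i < k, hL.coord i (uniLog S a g) (hL.uniLog_mem hg) =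
      hL.coord i (uniLog S a g') (hL.uniLog_mem hg')) ↔
      ∀ i < k, hL.coord i A hA = hL.coord i B hB :=
    forall₂_congr fun i _ => by rw [hL.coord_congr i _ hA hAu, hL.coord_congr i _ hB hBu]
  rw [hc, e, e', hL.proj_moveF_eq_iff hh hM k hA hB hu hv hl hr hlP,
    hL.proj_moveF_eq_iff hh hM 0 hA hB hu hv hl hr hlP, and_iff_left hAB]
  exact and_congr_right fun _ => ⟨fun h i hi => hL.coord_eq_of_sub_mem hA hB h hi,
    fun h => hL.sub_mem_of_coord_eq hA hB h⟩

end IsLeviWeight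

/-- `Y` is the orbit of `y₀` under `P(ℝ)⁺`, with the same stabilizer relations as the image of the
orbit of `F` in the quotient by `W_{-(k+1)}`. -/
structure IsOrbitModel {α : Type*} (S : HodgeData V) (P : Subgroup (GLC V)) (F : Filt V)
    (act : GLC V → α → α) (Y : Set α) (y₀ : α) (k : ℕ) : Prop where
  mul : ∀ g ∈ realPlus P, ∀ g' ∈ realPlus P, act (g * g') y₀ = act g (act g' y₀)
  mem : ∀ y, y ∈ Y ↔ ∃ g ∈ realPlus P, y = act g y₀
  eq_iff : ∀ g ∈ realPlus P, ∀ g' ∈ realPlus P,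
    act g y₀ = act g' y₀ ↔ proj S P k (moveF g F) = proj S P k (moveF g' F)

theorem exists_equiv_of_fibres {X A B : Type*} (f : X → A) (g : X → B)
    (hf : Function.Surjective f) (hg : Function.Surjective g) (h : ∀ x y, f x = f y ↔ g x = g y) :
    ∃ Φ : A ≃ B, ∀ x, Φ (f x) = g x := by
  choose f' hf' using hf
  choose g' hg' using hg
  refine ⟨⟨fun a => g (f' a), fun b => f (g' b), fun a => ?_, fun b => ?_⟩, fun x => ?_⟩
  · rw [← hf' a, h, hg', hf']
  · rw [← hg' b, ← h, hf', hg']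
  · exact (h _ _).1 (hf' _)

variable [Module.Finite ℚ V] {α : Type*} {D : Set (Filt V)} {h : ℂˣ × ℂˣ →* GLC V}
  {act : GLC V → α → α} {Y : Set α} {y₀ : α} {k : ℕ}

/-- The product decomposition `Φ` is given by the Levi decomposition in `P(ℝ)⁺`. -/
def IsChart (hL : IsLeviWeight S P L a) (D : Set (Filt V)) (F : Filt V) (act : GLC V → α → α)
    (Y : Set α) (y₀ : α) (Φ : Y ≃ quotDomain S P D 0 × (∀ i : Fin k, GrR S P (i + 1))) : Prop :=
  ∀ (g : GLC V) (hg : g ∈ realPlus P) (y : Y), (y : α) = act g y₀ →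
    ((Φ y).1 : Set (Filt V)) = proj S P 0 (moveF g F) ∧
      ∀ i : Fin k, (Φ y).2 i = hL.coord i (uniLog S a g) (hL.uniLog_mem hg)

/-- Both the orbit map and the coordinate map are surjective from P(ℝ)⁺ with the same fibres, by
`proj_eq_iff_coord`. Surjectivity of the coordinates uses that the unipotent factor can be exchanged
freely: every real exponential lies in P(ℝ)⁺, and D_0 does not see it. -/
theorem IsLeviWeight.exists_isChart (hL : IsLeviWeight S P L a) (hh : IsSplitHom S a h)
    (hM : ∀ g ∈ realPlus P, HodgeRelations S.W (moveF g (hodgeFil h)))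
    {s : Sections S P} (hs : IsSplitting S P L s)
    (hD : ∀ y, y ∈ quotDomain S P D 0 ↔
      ∃ p ∈ realPlus P, y = proj S P 0 (moveF p (hodgeFil h)))
    (hY : IsOrbitModel S P (hodgeFil h) act Y y₀ k) :
    ∃ Φ : Y ≃ quotDomain S P D 0 × (∀ i : Fin k, GrR S P (i + 1)),
      IsChart hL D (hodgeFil h) act Y y₀ Φ := by
  have hP := hL.elt.group
  let f : realPlus P → Y := fun g => ⟨act g y₀, (hY.mem _).2 ⟨g, g.2, rfl⟩⟩
  let c : realPlus P → quotDomain S P D 0 × (∀ i : Fin k, GrR S P (i + 1)) := fun g =>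
    (⟨proj S P 0 (moveF g (hodgeFil h)), (hD _).2 ⟨g, g.2, rfl⟩⟩,
      fun i => hL.coord i (uniLog S a g) (hL.uniLog_mem g.2))
  obtain ⟨Φ, hΦ⟩ := exists_equiv_of_fibres f c
    (fun y => by
      obtain ⟨g, hg, e⟩ := (hY.mem _).1 y.2
      exact ⟨⟨g, hg⟩, Subtype.ext e.symm⟩)
    (fun ⟨d, w⟩ => by
      obtain ⟨p, hp, e⟩ := (hD _).1 d.2
      obtain ⟨A, hA, u, l, hu, -, hl, hlP, rfl⟩ := hL.exists_decomp hp
      have hB := sum_section_mem (s := s) w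
      set B := ∑ j : Fin k, (s j (w j) : EndC V) with hBdef
      let v := expUnit B (isNilpotent_of_mem_lieWC le_rfl (mem_lieWR.1 hB).1)
      have hv : v ∈ realPlus P := exp_mem_realPlus hP hB rfl
      have hvl := mul_mem_realPlus hv hlP
      have hlog : uniLog S a (v * l) = B := hL.uniLog_exp_mul (mem_lieWR.1 hB).1 rfl hl.1
      refine ⟨⟨v * l, hvl⟩, Prod.ext (Subtype.ext ?_) (funext fun i => ?_)⟩
      · change proj S P 0 (moveF (v * l) (hodgeFil h)) = d
        rw [e, moveF_mul, moveF_mul, hP.proj_moveF (hL.unipSub_one hB rfl),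
          hP.proj_moveF (hL.unipSub_one hA hu)]
      · exact (hL.coord_congr _ (hL.uniLog_mem hvl) hB hlog).trans (hL.coord_sum_section hs w i))
    (fun g g' => by
      rw [Subtype.ext_iff, hY.eq_iff g g.2 g' g'.2, hL.proj_eq_iff_coord hh hM k g.2 g'.2,
        Prod.ext_iff, Subtype.ext_iff, funext_iff]
      exact and_congr_right fun _ => ⟨fun H i => H i i.2, fun H i hi => H ⟨i, hi⟩⟩)
  refine ⟨Φ, fun g hg y hy => ?_⟩
  have : y = f ⟨g, hg⟩ := Subtype.ext hy
  rw [this, hΦ]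
  exact ⟨rfl, fun i => rfl⟩

/-- For a point represented by v r, the product u g₀ v r equals u (g₀ v g₀⁻¹) times the Levi element
g₀ r. Its logarithm is that of exp A exp(Ad(g₀) B), whose coordinates `coord_nilLog_mul` computes,
and Ad(g₀) commutes with taking coordinates. -/
theorem IsChart.action {hL : IsLeviWeight S P L a}
    {Φ : Y ≃ quotDomain S P D 0 × (∀ i : Fin k, GrR S P (i + 1))}
    (hΦ : IsChart hL D (hodgeFil h) act Y y₀ Φ)
    {s : Sections S P} (hs : IsSplitting S P L s)
    (hY : IsOrbitModel S P (hodgeFil h) act Y y₀ k) {m : ℕ} (hk : k ≤ m) {g : GLC V}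
    (hg : g ∈ realPlus P) {g₀ : GLC V} (hg₀ : g₀ ∈ realPts L) (w : ∀ i : Fin m, GrR S P (i + 1))
    (e : (g : EndC V) = expSum s w * (g₀ : EndC V)) (y : Y) :
    ∃ hy : act g y ∈ Y, ((Φ ⟨act g y, hy⟩).1 : Set (Filt V)) = moveSet g₀ (Φ y).1 ∧
      ∀ i : Fin k, (Φ ⟨act g y, hy⟩).2 i =
        trunc hk w i + adGr S P g₀ (i + 1) ((Φ y).2 i) +
          hL.calb s i (trunc i.2.le (trunc hk w))
            (fun j : Fin i => adGr S P g₀ (j + 1) (trunc i.2.le (Φ y).2 j)) := by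
  have hP := hL.elt.group
  have hg₀P := hL.realPts_le hg₀
  obtain ⟨g', hg', e'⟩ := (hY.mem _).1 y.2
  have hgg := mul_mem_realPlus hg hg'
  have hact : act g y = act (g * g') y₀ := by rw [e', hY.mul g hg g' hg']
  have hy : act g y ∈ Y := (hY.mem _).2 ⟨_, hgg, hact⟩
  obtain ⟨h1, h2⟩ := hΦ g' hg' y e'
  obtain ⟨h3, h4⟩ := hΦ (g * g') hgg ⟨act g y, hy⟩ hact
  have hA := IsLeviWeight.sum_section_mem (s := s) w
  set A := ∑ j : Fin m, (s j (w j) : EndC V) with hAdef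
  let u := expUnit A (isNilpotent_of_mem_lieWC le_rfl (mem_lieWR.1 hA).1)
  have hue : (u : EndC V) = IsNilpotent.exp A := rfl
  have hgu : g = u * g₀ := Units.ext e
  obtain ⟨B, hB, v, r, hv, -, hr, -, rfl⟩ := hL.exists_decomp hg'
  have hB' := hP.adR_mem le_rfl hg₀P hB
  have hC := hP.nilLog_exp_mul_exp_mem hA hB'
  have hv' : ((g₀ * v * g₀⁻¹ : GLC V) : EndC V) = IsNilpotent.exp (adR g₀ B) := by
    have := conjE_exp g₀ (isNilpotent_of_mem_lieWC le_rfl (mem_lieWR.1 hB).1)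
    rw [← hv] at this
    exact this
  have hlogB : uniLog S a (v * r) = B := hL.uniLog_exp_mul (mem_lieWR.1 hB).1 hv hr.1
  have hlogC : uniLog S a (g * (v * r)) =
      nilLog (IsNilpotent.exp A * IsNilpotent.exp (adR g₀ B)) := by
    have e1 : g * (v * r) = u * (g₀ * v * g₀⁻¹) * (g₀ * r) := by rw [hgu]; group
    rw [e1]
    refine hL.uniLog_exp_mul (mem_lieWR.1 hC).1 ?_ (mul_mem hg₀.1 hr.1)
    rw [exp_nilLog_of_mem le_rfl
      (exp_mul_exp_sub_one_mem (lieWR_le_wEnd hA) (lieWR_le_wEnd hB')), Units.val_mul, hv', hue]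
  refine ⟨hy, ?_, fun i => ?_⟩
  · rw [h3, h1, hgu, mul_assoc, moveF_mul u, hP.proj_moveF (hL.unipSub_one hA hue),
      moveF_mul g₀, hP.moveSet_proj hg₀P.1]
  · have hcA : ∀ j : Fin m, hL.coord j A hA = w j := hL.coord_sum_section hs w
    have hcB : ∀ j : Fin k, adGr S P g₀ (j + 1) ((Φ y).2 j) = hL.coord j (adR g₀ B) hB' :=
      fun j => by rw [h2, hL.coord_congr j _ hB hlogB, hL.adGr_coord j hB hg₀]
    rw [h4, hL.coord_congr i _ hC hlogC, hL.coord_nilLog_mul hs i hA hB', hcB i,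
      hcA ⟨i, i.2.trans_le hk⟩]
    congr 1
    congr 1
    · exact funext fun j => hcA ⟨j, (j.2.trans i.2).trans_le hk⟩
    · exact funext fun j => (hcB ⟨j, j.2.trans i.2⟩).symm

end Charts

/-! ### Interpolation in finite-dimensional function spaces. -/

section FunctionAlgebras

variable {X Y : Type*}

/-- The pullback of real functions. -/
def pullback (φ : Y → X) : (X → ℝ) →ₐ[ℝ] (Y → ℝ) :=
  AlgHom.pi fun y => Pi.evalAlgHom ℝ _ (φ y)

/-- Interpolation in a finite-dimensional space of functions. -/
theorem exists_interpolation (M : Submodule ℝ (X → ℝ)) (hM : M.FG) :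
    ∃ (t : Finset X) (q : X → (X → ℝ)), (∀ x, q x ∈ M) ∧
      ∀ p ∈ M, p = ∑ x ∈ t, p x • q x := by
  classical
  have : Module.Finite ℝ M := Module.Finite.iff_fg.2 hM
  let ev : X → M →ₗ[ℝ] ℝ := fun x => LinearMap.proj x ∘ₗ M.subtype
  -- A minimal finite intersection of kernels of evaluations is contained in every such kernel, so
  -- it is zero; evaluation at the points of `t` is therefore injective on the space.
  obtain ⟨K, ⟨t, rfl⟩, hK⟩ := IsArtinian.set_has_minimal
    (Set.range fun t : Finset X => t.inf fun x => LinearMap.ker (ev x)) ⟨_, ⟨∅, rfl⟩⟩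
  have h0 : ∀ p : M, (∀ x ∈ t, (p : X → ℝ) x = 0) → p = 0 := by
    intro p hp
    have hpt : p ∈ t.inf fun x => LinearMap.ker (ev x) := by
      rw [Submodule.mem_finsetInf]
      exact hp
    refine Subtype.ext (funext fun x => ?_)
    have h1 := hK _ ⟨insert x t, rfl⟩
    simp only [Finset.inf_insert] at h1
    have h2 : LinearMap.ker (ev x) ⊓ (t.inf fun x => LinearMap.ker (ev x)) =
        t.inf fun x => LinearMap.ker (ev x) :=
      eq_of_le_of_not_lt inf_le_right h1
    rw [← h2] at hpt
    exact hpt.1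
  let E : M →ₗ[ℝ] (t → ℝ) := LinearMap.pi fun x => ev x
  obtain ⟨R, hR⟩ := E.exists_leftInverse_of_injective (LinearMap.ker_eq_bot'.2 fun p hp =>
    h0 p fun x hx => congrFun hp ⟨x, hx⟩)
  let q : X → (X → ℝ) := fun x => if hx : x ∈ t then (R (Pi.single ⟨x, hx⟩ 1) : X → ℝ) else 0
  have hq : ∀ x : t, q x = (R (Pi.single x 1) : X → ℝ) := fun x => dif_pos x.2
  refine ⟨t, q, fun x => ?_, fun p hp => ?_⟩
  · by_cases hx : x ∈ t
    · rw [hq ⟨x, hx⟩]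
      exact (R _).2
    · have : q x = 0 := dif_neg hx
      rw [this]
      exact Submodule.zero_mem _
  · have h1 : R (E ⟨p, hp⟩) = ⟨p, hp⟩ := LinearMap.congr_fun hR ⟨p, hp⟩
    have h2 : E ⟨p, hp⟩ = ∑ x : t, p x • (Pi.single x 1 : t → ℝ) := pi_eq_sum_univ' _
    rw [h2, map_sum] at h1
    calc p = ((∑ x : t, R (p x • (Pi.single x 1 : t → ℝ)) : M) : X → ℝ) := by rw [h1]
      _ = ∑ x : t, p x • q x := by
        rw [AddSubmonoidClass.coe_finsetSum]
        exact Finset.sum_congr rfl fun x _ => by rw [map_smul, hq]; rfl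
      _ = ∑ x ∈ t, p x • q x := Finset.sum_coe_sort t fun x => p x • q x

end FunctionAlgebras

/-! ### Regular functions on P(ℝ)⁺. -/

section RegularFunctions

variable {V : Type*} [AddCommGroup V] [Module ℚ V] {S : HodgeData V} {P L : Subgroup (GLC V)}
  {a : GLC V} {X : Type*} {A : Subalgebra ℝ (X → ℝ)} {F G : X → EndC V}

/-- The matrix coefficients of `F x` are real, and as functions of `x` they lie in `A`. -/
abbrev CoefReg (A : Subalgebra ℝ (X → ℝ)) (F : X → EndC V) : Prop :=
  CoefIn ((Subalgebra.toSubmodule A).restrictScalars ℚ) F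

theorem CoefReg.const {T : EndC V} (hT : galE conjAut T = T) : CoefReg A (fun _ => T) :=
  fun vl => ⟨algebraMap ℝ _ (coef T vl).re, A.algebraMap_mem _, fun _ => coef_eq_re hT vl⟩

variable [Module.Finite ℚ V]

theorem CoefReg.mul (hF : CoefReg A F) (hG : CoefReg A G) : CoefReg A (fun x => F x * G x) :=
  CoefIn.mul hF hG fun _ hf _ hg => A.mul_mem hf hg

theorem CoefReg.pow (hF : CoefReg A F) (n : ℕ) : CoefReg A (fun x => F x ^ n) := by
  induction n with
  | zero =>
    simp only [pow_zero]
    exact CoefReg.const (map_one _)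
  | succ n ih =>
    simp only [pow_succ]
    exact ih.mul hF

theorem CoefReg.exp (hF : CoefReg A F) (h : ∀ x, F x ∈ wEnd S 1) :
    CoefReg A (fun x => IsNilpotent.exp (F x)) := by
  have e : ∀ x, IsNilpotent.exp (F x) =
      ∑ i ∈ Finset.range (wLen S), ((i.factorial : ℚ)⁻¹) • F x ^ i := fun x => by
    have h1 := pow_mem_wEnd (h x) (wLen S)
    rw [mul_one] at h1
    exact IsNilpotent.exp_eq_sum (eq_zero_of_mem_wEnd le_rfl h1)
  simp only [e]
  exact CoefIn.sum _ fun i _ => (hF.pow i).smul _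

theorem CoefReg.nilLog (hF : CoefReg A F) (h : ∀ x, F x - 1 ∈ wEnd S 1) :
    CoefReg A (fun x => nilLog (F x)) := by
  have e : ∀ x, _root_.nilLog (F x) =
      ∑ i ∈ Finset.range (wLen S), ((-1 : ℚ) ^ (i + 1) / i) • (F x + (-1 : ℚ) • 1) ^ i := fun x => by
    have h1 := pow_mem_wEnd (h x) (wLen S)
    rw [mul_one] at h1
    rw [nilLog_eq_sum (eq_zero_of_mem_wEnd le_rfl h1), neg_one_smul, ← sub_eq_add_neg]
  simp only [e]
  exact CoefIn.sum _ fun i _ =>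
    (CoefReg.pow (CoefIn.add hF ((CoefReg.const (map_one _)).smul _)) i).smul _

theorem CoefReg.apply_real (hF : CoefReg A F) (Λ : EndC V →ₗ[ℝ] ℝ) : (fun x => Λ (F x)) ∈ A := by
  choose f hf hf' using fun i : Fin (Module.finrank ℚ V) × Fin (Module.finrank ℚ V) =>
    hF (ratBasis V i.2, (ratBasis V).coord i.1)
  have e : (fun x => Λ (F x)) = ∑ i, Λ (endBasis V i) • f i := by
    funext x
    rw [← (endBasis V).sum_repr (F x), map_sum, Finset.sum_apply]
    refine Finset.sum_congr rfl fun i _ => ?_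
    rw [endBasis_repr, hf', ← real_smul_eq, map_smul, Pi.smul_apply, smul_eq_mul, smul_eq_mul,
      mul_comm]
  rw [e]
  exact sum_mem fun i _ => A.smul_mem (hf i) _

omit [Module.Finite ℚ V] in
theorem CoefReg.re_mem (hF : CoefReg A F) (vl : V × Module.Dual ℚ V) :
    (fun x => (coef (F x) vl).re) ∈ A := by
  obtain ⟨f, hf, e⟩ := hF vl
  have : (fun x => (coef (F x) vl).re) = f := funext fun x => by rw [e, Complex.ofReal_re]
  rw [this]
  exact hf

omit [Module.Finite ℚ V] in
-- It is enough to treat the generators of the algebra of regular functions, and these are the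
-- coefficients of the element and of its inverse; hence the two hypotheses.
theorem comp_mem_of_mem_regGL {ψ : X → GLC V} (h : CoefReg A (fun x => (ψ x : EndC V)))
    (h' : CoefReg A (fun x => ((ψ x)⁻¹ : GLC V).1)) {f : GLC V → ℝ} (hf : f ∈ regGL V) :
    (fun x => f (ψ x)) ∈ A := by
  have : regGL V ≤ A.comap (pullback ψ) := by
    refine Algebra.adjoin_le ?_
    rintro _ (⟨vl, rfl⟩ | ⟨vl, rfl⟩)
    · exact h.re_mem vl
    · exact h'.re_mem vl
  exact this hf

theorem re_coef_mul_mem_span {ι : Type*} {F : ι → EndC V} {T : EndC V} (v : V)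
    (l : Module.Dual ℚ V) (hT : galE conjAut T = T) :
    (fun x => (coef (F x * T) (v, l)).re) ∈
      Submodule.span ℝ (Set.range fun i => fun x => (coef (F x) (ratBasis V i, l)).re) := by
  have e : (fun x => (coef (F x * T) (v, l)).re) =
      ∑ i, (coef T (v, (ratBasis V).coord i)).re • fun x => (coef (F x) (ratBasis V i, l)).re := by
    funext x
    rw [coef_mul, Complex.re_sum, Finset.sum_apply]
    refine Finset.sum_congr rfl fun i _ => ?_
    rw [coef_eq_re hT, Complex.re_mul_ofReal, Pi.smul_apply, smul_eq_mul, mul_comm,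
      Complex.ofReal_re]
  rw [e]
  exact Submodule.sum_mem _ fun i _ => Submodule.smul_mem _ _ (Submodule.subset_span ⟨i, rfl⟩)

theorem re_coef_mul_mem_span' {ι : Type*} {F : ι → EndC V} {T : EndC V} (v : V)
    (l : Module.Dual ℚ V) (hT : galE conjAut T = T) :
    (fun x => (coef (T * F x) (v, l)).re) ∈
      Submodule.span ℝ (Set.range fun i => fun x => (coef (F x) (v, (ratBasis V).coord i)).re) := by
  have e : (fun x => (coef (T * F x) (v, l)).re) =
      ∑ i, (coef T (ratBasis V i, l)).re • fun x => (coef (F x) (v, (ratBasis V).coord i)).re := by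
    funext x
    rw [coef_mul, Complex.re_sum, Finset.sum_apply]
    refine Finset.sum_congr rfl fun i _ => ?_
    rw [coef_eq_re hT, Complex.re_ofReal_mul, Pi.smul_apply, smul_eq_mul, Complex.ofReal_re]
  rw [e]
  exact Submodule.sum_mem _ fun i _ => Submodule.smul_mem _ _ (Submodule.subset_span ⟨i, rfl⟩)

/-- The right translates of a regular function, pulled back along `ψ`, span a finite-dimensional
space. -/
theorem exists_fg_of_mem_regGL {ψ : X → GLC V} (h : CoefReg A (fun x => (ψ x : EndC V)))
    (h' : CoefReg A (fun x => ((ψ x)⁻¹ : GLC V).1)) {f : GLC V → ℝ} (hf : f ∈ regGL V) :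
    ∃ M : Submodule ℝ (X → ℝ), M.FG ∧ M ≤ Subalgebra.toSubmodule A ∧
      ∀ l : GLC V, galG conjAut l = l → (fun x => f (ψ x * l)) ∈ M := by
  induction hf using Algebra.adjoin_induction with
  | mem f hf =>
    rcases hf with ⟨⟨v, l⟩, rfl⟩ | ⟨⟨v, l⟩, rfl⟩
    · refine ⟨Submodule.span ℝ (Set.range fun i => fun x =>
        (coef (ψ x : EndC V) (ratBasis V i, l)).re), Submodule.fg_span (Set.finite_range _), ?_,
        fun g hg => re_coef_mul_mem_span v l (congrArg Units.val hg)⟩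
      rw [Submodule.span_le]
      rintro _ ⟨i, rfl⟩
      exact h.re_mem _
    · refine ⟨Submodule.span ℝ (Set.range fun i => fun x =>
        (coef ((ψ x)⁻¹ : GLC V).1 (v, (ratBasis V).coord i)).re),
        Submodule.fg_span (Set.finite_range _), ?_, fun g hg => ?_⟩
      · rw [Submodule.span_le]
        rintro _ ⟨i, rfl⟩
        exact h'.re_mem _
      · simp only [mul_inv_rev, Units.val_mul]
        refine re_coef_mul_mem_span' (F := fun x => ((ψ x)⁻¹ : GLC V).1) v l ?_
        have : galG conjAut g⁻¹ = g⁻¹ := by rw [map_inv, hg]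
        exact congrArg Units.val this
  | algebraMap c =>
    refine ⟨Submodule.span ℝ {1}, Submodule.fg_span (Set.finite_singleton _), ?_, fun g _ => ?_⟩
    · rw [Submodule.span_le, Set.singleton_subset_iff]
      exact A.one_mem
    · exact Submodule.mem_span_singleton.2 ⟨c, by funext x; simp⟩
  | add f g _ _ ihf ihg =>
    obtain ⟨M, hM, hMA, hMf⟩ := ihf
    obtain ⟨N, hN, hNA, hNg⟩ := ihg
    exact ⟨M ⊔ N, hM.sup hN, sup_le hMA hNA, fun l hl =>
      Submodule.add_mem _ (Submodule.mem_sup_left (hMf l hl)) (Submodule.mem_sup_right (hNg l hl))⟩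
  | mul f g _ _ ihf ihg =>
    obtain ⟨M, hM, hMA, hMf⟩ := ihf
    obtain ⟨N, hN, hNA, hNg⟩ := ihg
    exact ⟨M * N, hM.mul hN, Submodule.mul_le.2 fun p hp q hq => A.mul_mem (hMA hp) (hNA hq),
      fun l hl => Submodule.mul_mem_mul (hMf l hl) (hNg l hl)⟩

/-- The restrictions of regular functions to `P(ℝ)⁺`. -/
def regPlus (P : Subgroup (GLC V)) : Subalgebra ℝ (realPlus P → ℝ) :=
  (regGL V).map (pullback Subtype.val)

omit [Module.Finite ℚ V] in
theorem mem_regPlus {f : realPlus P → ℝ} :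
    f ∈ regPlus P ↔ ∃ F ∈ regGL V, ∀ g : realPlus P, f g = F g := by
  refine exists_congr fun F => and_congr_right fun _ => ?_
  rw [funext_iff]
  exact forall_congr' fun g => eq_comm

omit [Module.Finite ℚ V] in
theorem coefReg_val : CoefReg (regPlus P) (fun g : realPlus P => ((g : GLC V) : EndC V)) :=
  fun vl => ⟨fun g => (coef ((g : GLC V) : EndC V) vl).re,
    mem_regPlus.2 ⟨_, Algebra.subset_adjoin (Or.inl ⟨vl, rfl⟩), fun _ => rfl⟩,
    fun g => coef_eq_re (mem_realPts.1 (realPlus_subset g.2)).2 vl⟩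

omit [Module.Finite ℚ V] in
theorem coefReg_inv : CoefReg (regPlus P) (fun g : realPlus P => ((g : GLC V)⁻¹ : GLC V).1) :=
  fun vl => ⟨fun g => (coef ((g : GLC V)⁻¹ : GLC V).1 vl).re,
    mem_regPlus.2 ⟨_, Algebra.subset_adjoin (Or.inr ⟨vl, rfl⟩), fun _ => rfl⟩,
    fun g => coef_eq_re (mem_realPts.1 (inv_mem (realPlus_subset g.2))).2 vl⟩

omit [Module.Finite ℚ V] in
theorem exists_real_functional {k : ℕ} (l : GrR S P k →ₗ[ℝ] ℝ) :
    ∃ Λ : EndC V →ₗ[ℝ] ℝ, ∀ (Z : EndC V) (hZ : Z ∈ lieWR S P k), l (grMk Z hZ) = Λ Z := by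
  obtain ⟨Λ, hΛ⟩ := LinearMap.exists_extend (l ∘ₗ Submodule.mkQ _ : lieWR S P k →ₗ[ℝ] ℝ)
  exact ⟨Λ, fun Z hZ => (LinearMap.congr_fun hΛ ⟨Z, hZ⟩).symm⟩

end RegularFunctions

/-! ### The charts as isomorphisms of real algebraic spaces. -/

section AlgebraicStructure

variable {V : Type*} [AddCommGroup V] [Module ℚ V] [Module.Finite ℚ V] {S : HodgeData V}
  {P L : Subgroup (GLC V)} {a : GLC V}

/-- The polynomial functions on a finite product of real vector spaces. -/
def polAlg {k : ℕ} (E : Fin k → Type*) [∀ i, AddCommGroup (E i)] [∀ i, Module ℝ (E i)] :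
    Subalgebra ℝ ((∀ i, E i) → ℝ) :=
  Algebra.adjoin ℝ {f | ∃ (i : Fin k) (l : E i →ₗ[ℝ] ℝ), f = fun w => l (w i)}

omit [Module.Finite ℚ V] in
theorem coefReg_section {s : Sections S P} {k : ℕ} (i : Fin k) :
    CoefReg (polAlg fun i : Fin k => GrR S P (i + 1))
      (fun w : ∀ i : Fin k, GrR S P (i + 1) => (s i (w i) : EndC V)) := fun vl => by
  refine ⟨_, Algebra.subset_adjoin ⟨i, Complex.reLm ∘ₗ ((coefLin vl).restrictScalars ℝ) ∘ₗ
    (lieWR S P (i + 1)).subtype ∘ₗ s i, rfl⟩, fun w => ?_⟩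
  exact coef_eq_re (mem_lieWR.1 (s i (w i)).2).2 vl

theorem coefReg_exp_section {s : Sections S P} {k : ℕ} :
    CoefReg (polAlg fun i : Fin k => GrR S P (i + 1))
      (fun w : ∀ i : Fin k, GrR S P (i + 1) =>
        IsNilpotent.exp (∑ i : Fin k, (s i (w i) : EndC V))) :=
  CoefReg.exp (CoefIn.sum _ fun i _ => coefReg_section i) fun w =>
    lieWR_le_wEnd (IsLeviWeight.sum_section_mem w)

theorem coefReg_exp_neg_section {s : Sections S P} {k : ℕ} :
    CoefReg (polAlg fun i : Fin k => GrR S P (i + 1))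
      (fun w : ∀ i : Fin k, GrR S P (i + 1) =>
        IsNilpotent.exp (-∑ i : Fin k, (s i (w i) : EndC V))) := by
  refine CoefReg.exp (S := S) ?_ fun w =>
    Submodule.neg_mem _ (lieWR_le_wEnd (IsLeviWeight.sum_section_mem w))
  have h := CoefIn.smul (CoefIn.sum (M := (Subalgebra.toSubmodule
    (polAlg fun i : Fin k => GrR S P (i + 1))).restrictScalars ℚ) Finset.univ
    fun i _ => coefReg_section (s := s) i) (-1)
  simpa only [neg_smul, one_smul] using h

/-- The unipotent element with coordinates `w`. -/
def secUnit (s : Sections S P) {k : ℕ} (w : ∀ i : Fin k, GrR S P (i + 1)) : GLC V :=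
  expUnit (∑ i : Fin k, (s i (w i) : EndC V))
    (isNilpotent_of_mem_lieWC le_rfl (mem_lieWR.1 (IsLeviWeight.sum_section_mem w)).1)

theorem secUnit_val (s : Sections S P) {k : ℕ} (w : ∀ i : Fin k, GrR S P (i + 1)) :
    (secUnit s w : EndC V) = IsNilpotent.exp (∑ i : Fin k, (s i (w i) : EndC V)) := rfl

theorem secUnit_mem (hP : IsWeightGroup S P) (s : Sections S P) {k : ℕ}
    (w : ∀ i : Fin k, GrR S P (i + 1)) : secUnit s w ∈ realPlus P :=
  exp_mem_realPlus hP (IsLeviWeight.sum_section_mem w) rfl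

/-- The Levi factor and its inverse are the degree-0 components of `g` and of its inverse, and the
projector is given by rational linear combinations of matrix coefficients. -/
theorem IsLeviWeight.exists_leviMap (hL : IsLeviWeight S P L a) :
    ∃ π : realPlus P → GLC V, (∀ g, π g ∈ realPlus P ∧ π g ∈ realPts L ∧
      (g : GLC V) * (π g)⁻¹ ∈ unipSub S P 1) ∧
      CoefReg (regPlus P) (fun g => (π g : EndC V)) ∧
      CoefReg (regPlus P) (fun g => ((π g)⁻¹ : GLC V).1) := by
  choose A hA u l hu hu' hl hl' e using fun g : realPlus P => hL.exists_decomp g.2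
  have hU := fun g => hL.unipSub_one (hA g) (hu g)
  have e1 : (fun g => (l g : EndC V)) = fun g : realPlus P =>
      degPart S a 0 ((g : GLC V) : EndC V) := funext fun g => by
    rw [e g, hL.degPart_unip_mul (hU g) (hl g).1]
  have e2 : (fun g => ((l g)⁻¹ : GLC V).1) = fun g : realPlus P =>
      degPart S a 0 ((g : GLC V)⁻¹ : GLC V).1 := funext fun g => by
    rw [e g, hL.degPart_inv_unip_mul (hU g) (hl g).1]
  refine ⟨l, fun g => ⟨hl' g, hl g, ?_⟩, ?_, ?_⟩
  · rw [e g, mul_inv_cancel_right]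
    exact hU g
  · rw [e1]
    exact hL.coefIn_degPart coefReg_val 0
  · rw [e2]
    exact hL.coefIn_degPart coefReg_inv 0

omit [Module.Finite ℚ V] in
theorem coefReg_real {X : Type*} {A : Subalgebra ℝ (X → ℝ)} {g : GLC V} (hg : g ∈ realPlus P) :
    CoefReg A (fun _ => (g : EndC V)) :=
  CoefReg.const (mem_realPts.1 (realPlus_subset hg)).2

theorem IsLeviWeight.coefReg_uniLog (hL : IsLeviWeight S P L a) {g' : GLC V}
    (hg' : g' ∈ realPlus P) :
    CoefReg (regPlus P) (fun g : realPlus P => uniLog S a (g * g')) := by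
  have h1 : CoefReg (regPlus P) (fun g : realPlus P => (((g : GLC V) * g' : GLC V) : EndC V)) :=
    coefReg_val.mul (coefReg_real hg')
  have h2 : CoefReg (regPlus P) (fun g : realPlus P => (((g : GLC V) * g')⁻¹ : GLC V).1) := by
    simp only [mul_inv_rev, Units.val_mul]
    exact (coefReg_real (inv_mem_realPlus hg')).mul coefReg_inv
  refine CoefReg.nilLog (S := S) (h1.mul (hL.coefIn_degPart h2 0)) fun g => ?_
  obtain ⟨A, hA, u, l, hu, -, hl, -, e⟩ := hL.exists_decomp (mul_mem_realPlus g.2 hg')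
  have hU := hL.unipSub_one hA hu
  rw [e, hL.degPart_inv_unip_mul hU hl.1, ← Units.val_mul, mul_inv_cancel_right]
  exact (hL.elt.group.mem_unipSub.1 hU).2

variable {α : Type*} {D : Set (Filt V)} {h : ℂˣ × ℂˣ →* GLC V}
  {act : GLC V → α → α} {Y : Set α} {y₀ : α} {k : ℕ}

section

variable {hL : IsLeviWeight S P L a}
  {Φ : Y ≃ quotDomain S P D 0 × (∀ i : Fin k, GrR S P (i + 1))}
  (hΦ : IsChart hL D (hodgeFil h) act Y y₀ Φ)
  (hY : IsOrbitModel S P (hodgeFil h) act Y y₀ k)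
  (hD : ∀ y, y ∈ quotDomain S P D 0 ↔ ∃ p ∈ realPlus P, y = proj S P 0 (moveF p (hodgeFil h)))
include hΦ hY

/-- The functions whose pullback along an orbit map is regular form an algebra, so only generators
matter: functions on D_0 are regular along orbits by definition, and coordinate functionals are
linear in the regular function `uniLog`. -/
theorem IsChart.mem_regOn {f : quotDomain S P D 0 × (∀ i : Fin k, GrR S P (i + 1)) → ℝ}
    (hf : f ∈ regProd P moveSet (quotDomain S P D 0) (fun i : Fin k => GrR S P (i + 1))) :
    (fun y => f (Φ y)) ∈ regOn P act Y := by
  intro y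
  have hP := hL.elt.group
  obtain ⟨g', hg', e'⟩ := (hY.mem _).1 y.2
  have hact : ∀ g : realPlus P, act g y = act (g * g') y₀ := fun g => by
    rw [e', hY.mul g g.2 g' hg']
  have hmem : ∀ g : realPlus P, act g y ∈ Y := fun g =>
    (hY.mem _).2 ⟨_, mul_mem_realPlus g.2 hg', hact g⟩
  have hΦg := fun g : realPlus P =>
    hΦ (g * g') (mul_mem_realPlus g.2 hg') ⟨act g y, hmem g⟩ (hact g)
  have key : regProd P moveSet (quotDomain S P D 0) (fun i : Fin k => GrR S P (i + 1)) ≤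
      (regPlus P).comap (pullback fun g : realPlus P => Φ ⟨act g y, hmem g⟩) := by
    refine Algebra.adjoin_le ?_
    rintro _ (⟨b, hb, rfl⟩ | ⟨i, l, rfl⟩)
    · obtain ⟨F, hF, hFb⟩ := hb (Φ y).1
      refine mem_regPlus.2 ⟨F, hF, fun g => ?_⟩
      have e : ((Φ ⟨act g y, hmem g⟩).1 : Set (Filt V)) = moveSet g (Φ y).1 := by
        rw [(hΦg g).1, (hΦ g' hg' y e').1, hP.moveSet_proj (realPlus_subset g.2).1, moveF_mul]
      have hm : moveSet g (Φ y).1 ∈ quotDomain S P D 0 := e ▸ (Φ ⟨act g y, hmem g⟩).1.2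
      rw [← hFb g g.2 hm]
      exact congrArg b (Subtype.ext e)
    · obtain ⟨Λ, hΛ⟩ := exists_real_functional l
      have h1 := CoefReg.apply_real (hL.coefIn_degPart (hL.coefReg_uniLog hg') (i + 1)) Λ
      refine (congrArg (· ∈ regPlus P) (funext fun g => ?_)).mp h1
      change _ = l ((Φ ⟨act g y, hmem g⟩).2 i)
      rw [(hΦg g).2 i]
      exact (hΛ _ _).symm
  obtain ⟨F, hF, hFe⟩ := mem_regPlus.1 (key hf)
  exact ⟨F, hF, fun g hg hgy => hFe ⟨g, hg⟩⟩

include hD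

/-- A function regular along the orbit map is f(d, w) = F(exp(Σ s(w)) l), where the Levi element `l`
represents `d`. For fixed `w` it is regular in `d`, for fixed `d` it is polynomial in `w`; a bound
uniform in `d` is needed to write it as a finite sum of products. -/
theorem IsChart.mem_regProd {s : Sections S P} (hs : IsSplitting S P L s)
    {f : quotDomain S P D 0 × (∀ i : Fin k, GrR S P (i + 1)) → ℝ}
    (hf : (fun y => f (Φ y)) ∈ regOn P act Y)
    (hy₀ : act 1 y₀ = y₀) :
    f ∈ regProd P moveSet (quotDomain S P D 0) (fun i : Fin k => GrR S P (i + 1)) := by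
  have hP := hL.elt.group
  have hy₀Y : y₀ ∈ Y := (hY.mem _).2 ⟨1, one_mem_realPlus, hy₀.symm⟩
  obtain ⟨F, hF, hFf⟩ := hf ⟨y₀, hy₀Y⟩
  have key : ∀ (d : quotDomain S P D 0) (w : ∀ i : Fin k, GrR S P (i + 1)) (l : GLC V),
      l ∈ realPlus P → l ∈ realPts L → (d : Set (Filt V)) = proj S P 0 (moveF l (hodgeFil h)) →
      f (d, w) = F (secUnit s w * l) := by
    intro d w l hlP hl hd
    have hg := mul_mem_realPlus (secUnit_mem hP s w) hlP
    have hgY : act (secUnit s w * l) y₀ ∈ Y := (hY.mem _).2 ⟨_, hg, rfl⟩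
    have hB := IsLeviWeight.sum_section_mem (s := s) w
    obtain ⟨h1, h2⟩ := hΦ _ hg ⟨_, hgY⟩ rfl
    rw [← hFf _ hg hgY]
    refine congrArg f (Prod.ext (Subtype.ext ?_) (funext fun i => ?_))
    · rw [h1, hd, moveF_mul, hP.proj_moveF (hL.unipSub_one hB (secUnit_val s w))]
    · rw [h2, hL.coord_congr i _ hB
        (hL.uniLog_exp_mul (mem_lieWR.1 hB).1 (secUnit_val s w) hl.1)]
      exact (hL.coord_sum_section hs w i).symm
  have hlevi : ∀ d : quotDomain S P D 0, ∃ l ∈ realPlus P, l ∈ realPts L ∧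
      (d : Set (Filt V)) = proj S P 0 (moveF l (hodgeFil h)) := by
    intro d
    obtain ⟨p, hp, hd⟩ := (hD _).1 d.2
    obtain ⟨A, hA, u, l, hu, -, hl, hlP, rfl⟩ := hL.exists_decomp hp
    exact ⟨l, hlP, hl, by rw [hd, moveF_mul, hP.proj_moveF (hL.unipSub_one hA hu)]⟩
  have hreg : ∀ w, (fun d => f (d, w)) ∈ regOn P moveSet (quotDomain S P D 0) := by
    intro w d
    obtain ⟨l, hlP, hl, hd⟩ := hlevi d
    obtain ⟨π, hπ, hπr, hπi⟩ := hL.exists_leviMap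
    have h1 : CoefReg (regPlus P) (fun g => ((secUnit s w * (π g * l) : GLC V) : EndC V)) :=
      (coefReg_real (secUnit_mem hP s w)).mul (hπr.mul (coefReg_real hlP))
    have h2 : CoefReg (regPlus P) (fun g => ((secUnit s w * (π g * l))⁻¹ : GLC V).1) := by
      simp only [mul_inv_rev, Units.val_mul]
      exact ((coefReg_real (inv_mem_realPlus hlP)).mul hπi).mul
        (coefReg_real (inv_mem_realPlus (secUnit_mem hP s w)))
    obtain ⟨F', hF', e⟩ := mem_regPlus.1 (comp_mem_of_mem_regGL h1 h2 hF)
    refine ⟨F', hF', fun g hg hgd => ?_⟩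
    obtain ⟨hπP, hπL, hπU⟩ := hπ ⟨g, hg⟩
    refine (key ⟨_, hgd⟩ w (π ⟨g, hg⟩ * l) (mul_mem_realPlus hπP hlP) (mul_mem hπL hl) ?_).trans
      (e ⟨g, hg⟩)
    change moveSet g (d : Set (Filt V)) = _
    rw [hd, hP.moveSet_proj (realPlus_subset hg).1, ← moveF_mul]
    have : g * l = g * (π ⟨g, hg⟩)⁻¹ * (π ⟨g, hg⟩ * l) := by group
    rw [this, moveF_mul (g * (π ⟨g, hg⟩)⁻¹), hP.proj_moveF hπU]
  -- The uniform bound: right translation by real `l` keeps the functions of `w` in one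
  -- finite-dimensional space of polynomials, whatever `d` is.
  obtain ⟨M, hM, hMA, hMF⟩ := exists_fg_of_mem_regGL
    (A := polAlg fun i : Fin k => GrR S P (i + 1)) (ψ := fun w => secUnit s w)
    coefReg_exp_section coefReg_exp_neg_section hF
  obtain ⟨t, q, hq, hqM⟩ := exists_interpolation M hM
  have hfM : ∀ d, (fun w => f (d, w)) ∈ M := by
    intro d
    obtain ⟨l, hlP, hl, hd⟩ := hlevi d
    have : (fun w => f (d, w)) = fun w => F (secUnit s w * l) :=
      funext fun w => key d w l hlP hl hd
    rw [this]
    exact hMF l (galG_of_mem_realPts hl)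
  have hsnd : polAlg (fun i : Fin k => GrR S P (i + 1)) ≤
      (regProd P moveSet (quotDomain S P D 0) (fun i : Fin k => GrR S P (i + 1))).comap
        (pullback Prod.snd) := by
    refine Algebra.adjoin_le ?_
    rintro _ ⟨i, l, rfl⟩
    exact Algebra.subset_adjoin (Or.inr ⟨i, l, rfl⟩)
  -- Interpolation at the finitely many points of `t` separates the variables: the values at these
  -- points are regular on D_0 and the interpolating functions are polynomial in the coordinates.
  have e : f = ∑ w ∈ t, (fun y => f (y.1, w)) * pullback Prod.snd (q w) := by
    funext ⟨d, w⟩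
    have h1 := congrFun (hqM _ (hfM d)) w
    rw [Finset.sum_apply] at h1 ⊢
    exact h1
  rw [e]
  refine sum_mem fun w _ => mul_mem (Algebra.subset_adjoin (Or.inl ⟨_, hreg w, rfl⟩)) ?_
  exact hsnd (hMA (hq w))

theorem IsChart.isProductStructure {s : Sections S P} (hs : IsSplitting S P L s)
    (hy₀ : act 1 y₀ = y₀) {m : ℕ} (hk : k ≤ m) :
    IsProductStructure S P L D s (hL.calb s) act Y hk Φ where
  algebraic _ := ⟨fun hf => hΦ.mem_regOn hY hf, fun hf => hΦ.mem_regProd hY hD hs hf hy₀⟩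
  action _ hg _ hg₀ w e y := hΦ.action hs hY hk hg hg₀ w e y

end

end AlgebraicStructure

end MixedHodge
end

/-! ### The product decomposition. -/

open MixedHodge in
theorem mainTheorem11 {V : Type*} [AddCommGroup V] [Module ℚ V] [Module.Finite ℚ V]
    (S : HodgeData V) (D : Set (Filt V)) (x₀ : Filt V) (hD : IsMumfordTateDomain S D x₀)
    (P : Subgroup (GLC V)) (hP : P = mumfordTate S.W x₀)
    (m : ℕ) (hm : lieW S P (m + 1) = ⊥) :
    (∃ L, IsLevi P L) ∧
    ∀ L : Subgroup (GLC V), IsLevi P L →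
      (∃ s : Sections S P, IsSplitting S P L s) ∧
      ∀ s : Sections S P, IsSplitting S P L s →
        (∀ g ∈ realPlus P, ∃! a : GLC V × (∀ i : Fin m, GrR S P (i + 1)),
          a.1 ∈ realPts L ∧ (g : EndC V) = expSum s a.2 * (a.1 : EndC V)) ∧
        ∃ (calb : Calb S P)
          (Φ : splitPts S x₀ ≃ quotDomain S P D 0 × (∀ i : Fin m, GrR S P (i + 1)))
          (Ψ : ∀ k : ℕ, quotSplitPts S x₀ k ≃
            quotDomain S P D 0 × (∀ i : Fin k, GrR S P (i + 1))),
          IsCalb S P s m calb ∧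
          IsProductStructure S P L D s calb moveF (splitPts S x₀) le_rfl Φ ∧
          (∀ y, ((Ψ 0 y).1 : Set (Filt V)) = y) ∧
          ∀ (k : ℕ) (hk : k < m),
            IsProductStructure S P L D s calb moveSet (quotSplitPts S x₀ k) hk.le (Ψ k) ∧
            ∀ x : splitPts S x₀, ∃ hx : proj S P k x ∈ quotSplitPts S x₀ k,
              Ψ k ⟨proj S P k x, hx⟩ = ((Φ x).1, trunc hk.le (Φ x).2) := by
  subst hP
  have hF : IsClassified S x₀ := hD.subset hD.mem
  have hR := hF.unipotentRadical_eq
  obtain ⟨h₀, hh₀⟩ :=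
    (hF.mhs.hodgeRelations S.mono S.exists_bot S.exists_top).exists_isDeligneHom
  have hb := hh₀.isWeightElt hF
  refine ⟨?_, fun L hLevi => ?_⟩
  · obtain ⟨L, b, hL⟩ := exists_isLeviWeight_of_isWeightElt hb
    exact ⟨L, hL.isLevi hR⟩
  obtain ⟨a, hL⟩ := hLevi.exists_isLeviWeight hR hb
  refine ⟨hL.exists_isSplitting, fun s hs => ⟨fun g hg =>
    hL.existsUnique_decomp hs hm (realPlus_subset hg), ?_⟩⟩
  obtain ⟨u₀, hu₀, hh⟩ := exists_isSplitHom hF hh₀ hL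
  have hP := hL.elt.group
  have hM := fun g hg => hodgeRelations_of_mem_realPlus hF hh₀ hu₀ hD (p := g) hg
  have hD0 := fun y => mem_quotDomain_zero hF hh₀ hL hu₀ hD.orbit (y := y)
  -- D_ℝ is treated as the case k = m of the quotients: W_{-(m+1)} is trivial, so the projection to
  -- D_m is injective and the orbit of filtrations serves as a model.
  have hY : IsOrbitModel S _ (hodgeFil (conjHom u₀ h₀)) moveF (splitPts S x₀)
      (hodgeFil (conjHom u₀ h₀)) m :=
    { mul := fun g _ g' _ => moveF_mul g g' _
      mem := fun y => mem_splitPts hF hh₀ hL hu₀ hh hm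
      eq_iff := fun g _ g' _ => by
        rw [hP.proj_eq_singleton hm, hP.proj_eq_singleton hm, Set.singleton_eq_singleton_iff] }
  have hact : ∀ k, ∀ g ∈ realPlus (mumfordTate S.W x₀),
      moveSet g (proj S (mumfordTate S.W x₀) k (hodgeFil (conjHom u₀ h₀))) =
        proj S (mumfordTate S.W x₀) k (moveF g (hodgeFil (conjHom u₀ h₀))) :=
    fun k g hg => hP.moveSet_proj (realPlus_subset hg).1 k _
  have hYk : ∀ k, IsOrbitModel S _ (hodgeFil (conjHom u₀ h₀)) moveSet (quotSplitPts S x₀ k)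
      (proj S (mumfordTate S.W x₀) k (hodgeFil (conjHom u₀ h₀))) k := fun k =>
    { mul := fun g _ g' _ => moveSet_mul g g' _
      mem := fun y => (mem_quotSplitPts hF hh₀ hL hu₀ hh).trans
        (exists_congr fun g => and_congr_right fun hg => by rw [hact k g hg])
      eq_iff := fun g hg g' hg' => by rw [hact k g hg, hact k g' hg'] }
  obtain ⟨Φ, hΦ⟩ := hL.exists_isChart hh hM hs hD0 hY
  -- All charts use the same base point and the same Levi decomposition, so they share one family
  -- `calb`, and the projections between them merely omit coordinates.
  choose Ψ hΨ using fun k => hL.exists_isChart hh hM hs hD0 (hYk k)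
  refine ⟨hL.calb s, Φ, Ψ, hL.isCalb hs hm,
    hΦ.isProductStructure hY hD0 hs (moveF_one _) le_rfl, fun y => ?_, fun k hk =>
    ⟨(hΨ k).isProductStructure (hYk k) hD0 hs
      (by rw [hact k 1 one_mem_realPlus, moveF_one]) hk.le, fun y => ?_⟩⟩
  · obtain ⟨g, hg, e⟩ := ((hYk 0).mem _).1 y.2
    rw [(hΨ 0 g hg y e).1, e, hact 0 g hg]
  · obtain ⟨g, hg, e⟩ := (hY.mem _).1 y.2
    have e' : proj S (mumfordTate S.W x₀) k y =
        moveSet g (proj S (mumfordTate S.W x₀) k (hodgeFil (conjHom u₀ h₀))) := by rw [e, hact k g hg]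
    have hy := ((hYk k).mem _).2 ⟨g, hg, e'⟩
    obtain ⟨h1, h2⟩ := hΦ g hg y e
    obtain ⟨h3, h4⟩ := hΨ k g hg ⟨_, hy⟩ e'
    exact ⟨hy, Prod.ext (Subtype.ext (h3.trans h1.symm))
      (funext fun i => (h4 i).trans (h2 ⟨i, i.2.trans hk⟩).symm)⟩
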